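/- A triangulation $G$ of the closed disk is a finite simplicial complex of dimension $2$ whose underlying space is homeomorphic to the closed disk; an edge is a boundary edge if it lies in exactly one face, a vertex is a boundary vertex if it is an end of a boundary edge, all other vertices and edges are inner, and $\partial G$ is the cycle of boundary edges. Let $\mathcal F_\circ^2(4)$ be the class of all triangulations of the disk in which every vertex has degree at least $3$ and every inner vertex has degree at least $4$. Every $G\in\mathcal F_\circ^2(4)$ can be obtained from a flag (the wheel with four spokes) or from an octahedron component (the surface of the octahedron without one face) by a finite sequence of the following operations, each leading from a member $G'$ of $\mathcal F_\circ^2(4)$ to a member $G$ of $\mathcal F_\circ^2(4)$. An edge $uv$ of $G$ is contractible if the identification of $u$ and $v$ (multiple edges and faces being merged) gives again a triangulation $G/uv$ of the disk. 1. 3-splitting of triodes: $G'=G/uv$, where $uv$ is contractible and every vertex of degree $3$ produced by the contraction (if any), i.e. the new vertex or a vertex whose degree has changed, is a triode, i.e. a boundary vertex of degree $3$. 2. 4-splitting: $G'=G/uv$, where $uv$ is contractible and $u$ and $v$ have degree at least $4$ in $G$. 3. Addition of a flag along a boundary edge $x_1x_2$ of $G'$: $G'=G-\{a,b,x\}$,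 where $x$ is an inner vertex of $G$ of degree $4$ without neighbours of degree $4$, the link of $x$ is the 4-cycle $x_1abx_2$, the edges $x_1a,ab,bx_2$ are boundary edges of $G$, $x_1x_2$ is an inner edge of $G$, and $\deg(a)=\deg(b)=3$. 4. Addition of an octahedron: $G'=G-\{v_1,v_2,v_3\}$ or, along a boundary edge $a_ia_k$ of $G'$, $G'=G-\{a_j,v_1,v_2,v_3\}$, where $\{i,j,k\}=\{1,2,3\}$ and $G$ has an octahedron component with center $v_1v_2v_3$ and remaining vertices $a_1,a_2,a_3$; in the second case the edges $a_ia_j$ and $a_ja_k$ are required to be boundary edges of $G$. Here an octahedron component consists of six distinct vertices $v_1,v_2,v_3,a_1,a_2,a_3$ of $G$ such that $v_1v_2v_3$ and $a_1a_2a_3$ are 3-cycles of $G$, $\deg(v_i)=4$ for all $i$, $a_i$ is adjacent to $v_j$ for all $i\ne j$, and either no $v_i$ is a boundary vertex, or $\partial G$ is a 3-cycle $v_ia_ja_k$, $v_iv_ja_k$ (with $i,j,k$ distinct) or $v_1v_2v_3$. In $G-\{v_1,v_2,v_3\}$ the cycle $a_1a_2a_3$ is a face if no $v_i$ is a boundary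 vertex of $G$, and the boundary otherwise. -/

import Mathlib

/-- A finite two-dimensional simplicial complex on vertices of type `V`, given by its triangles.
Its edges and vertices are those of the triangles (a complex whose underlying space is a surface
is always of this kind). -/
@[ext]
structure TriComplex (V : Type*) where
  faces : Finset (Finset V)
  card_eq : ∀ t ∈ faces, t.card = 3

namespace TriComplex

variable {V : Type*}

/-! ### The complex, its graph and its underlying space -/

/-- The graph (1-skeleton) of the complex. -/
def graph (G : TriComplex V) : SimpleGraph V where
  Adj u v := u ≠ v ∧ ∃ t ∈ G.faces, u ∈ t ∧ v ∈ t
  symm := ⟨fun _ _ h => ⟨h.1.symm, h.2.imp fun _ ht => ⟨ht.1, ht.2.2, ht.2.1⟩⟩⟩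
  loopless := ⟨fun _ h => h.1 rfl⟩

/-- `v` is a vertex of the complex. -/
def IsVertex (G : TriComplex V) (v : V) : Prop :=
  ∃ t ∈ G.faces, v ∈ t

/-- The degree of a vertex in the graph of the complex (a finite number). -/
noncomputable def deg (G : TriComplex V) (v : V) : ℕ :=
  (G.graph.neighborSet v).ncard

/-- The underlying space (geometric realization) of the complex in barycentric coordinates, a
subspace of `V → ℝ`. -/
def space (G : TriComplex V) : Set (V → ℝ) :=
  {x | (∀ v, 0 ≤ x v) ∧ ∃ t ∈ G.faces, (∀ v, v ∉ t → x v = 0) ∧ ∑ v ∈ t, x v = 1}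

/-- The complex is a triangulation of the disk: its underlying space is homeomorphic to the closed
unit disk of the Euclidean plane. -/
def IsDisk (G : TriComplex V) : Prop :=
  Nonempty (G.space ≃ₜ Metric.closedBall (0 : EuclideanSpace ℝ (Fin 2)) 1)

/-- `uv` is a boundary edge: an edge that lies in exactly one triangle. -/
def BoundaryEdge (G : TriComplex V) (u v : V) : Prop :=
  u ≠ v ∧ ∃! t, t ∈ G.faces ∧ u ∈ t ∧ v ∈ t

/-- `v` is a boundary vertex: an end of a boundary edge. -/
def BoundaryVertex (G : TriComplex V) (v : V) : Prop :=
  ∃ w, G.BoundaryEdge v w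

/-- The boundary of the complex is the 3-cycle `pqr`. -/
def BoundaryIs (G : TriComplex V) (p q r : V) : Prop :=
  ∀ x y, G.BoundaryEdge x y ↔
    x ≠ y ∧ (x = p ∨ x = q ∨ x = r) ∧ (y = p ∨ y = q ∨ y = r)

/-- The class `F∘²(4)` for the disk: triangulations of the disk with all degrees at least 3, and at
least 4 at the vertices that are not on the boundary. -/
def InFCirc4 (G : TriComplex V) : Prop :=
  G.IsDisk ∧ ∀ v, G.IsVertex v → 3 ≤ G.deg v ∧ (¬ G.BoundaryVertex v → 4 ≤ G.deg v)

/-! ### Contraction and splitting -/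

section Operations

variable [DecidableEq V]

/-- `G / uv`: the vertices `u` and `v` are identified (the new vertex is called `u`); triangles
that contain both collapse to edges, and multiple edges and triangles are merged. -/
def contract (G : TriComplex V) (u v : V) : TriComplex V where
  faces := {t ∈ G.faces.image (Finset.image fun w => if w = v then u else w) | t.card = 3}
  card_eq := fun _ ht => (Finset.mem_filter.mp ht).2

/-- The edge `uv` is contractible: the result of its contraction is still a triangulation of the
disk. -/
def Contractible (G : TriComplex V) (u v : V) : Prop :=
  G.graph.Adj u v ∧ (G.contract u v).IsDisk

/-- `w` is a vertex of degree 3 of `G / uv` that is produced by the contraction: it is the new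
vertex, or its degree was changed. -/
def ProducedDegThree (G : TriComplex V) (u v w : V) : Prop :=
  (G.contract u v).IsVertex w ∧ (G.contract u v).deg w = 3 ∧ (w = u ∨ G.deg w ≠ 3)

/-- A triode: a boundary vertex of degree 3. -/
def Triode (G : TriComplex V) (w : V) : Prop :=
  G.BoundaryVertex w ∧ G.deg w = 3

/-- A triode detecting edge: a contractible edge such that the vertices of degree 3 produced by its
contraction are triodes. -/
def TriodeDetecting (G : TriComplex V) (u v : V) : Prop :=
  G.Contractible u v ∧ ∀ w, G.ProducedDegThree u v w → (G.contract u v).Triode w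

/-- `G` is obtained from `G'` by a 3-splitting of triodes, the inverse of the contraction of a
triode detecting edge. -/
def TriodeSplitting (G' G : TriComplex V) : Prop :=
  ∃ u v, G.TriodeDetecting u v ∧ G' = G.contract u v

/-- `G` is obtained from `G'` by a 4-splitting: the inverse of the contraction of a contractible
edge, such that both ends of that edge have degree at least 4 after the splitting. -/
def FourSplitting (G' G : TriComplex V) : Prop :=
  ∃ u v, G.Contractible u v ∧ 4 ≤ G.deg u ∧ 4 ≤ G.deg v ∧ G' = G.contract u v

/-! ### Flags -/

/-- Deletion of a set of vertices, with all the triangles that meet it. -/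
def deleteVertices (G : TriComplex V) (S : Finset V) : TriComplex V where
  faces := {t ∈ G.faces | Disjoint t S}
  card_eq := fun t ht => G.card_eq t (Finset.mem_filter.mp ht).1

/-- A flag centered at `x`: an inner vertex of degree 4 without neighbours of degree 4, whose link
is the 4-cycle `x₁ a b x₂`, where `x₁a`, `ab`, `bx₂` are boundary edges, `x₁x₂` is not one, and `a`
and `b` have degree 3. -/
structure IsFlagAt (G : TriComplex V) (x x₁ a b x₂ : V) : Prop where
  nodup : [x, x₁, a, b, x₂].Nodup
  inner : ¬ G.BoundaryVertex x
  deg_eq : G.deg x = 4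
  independent : ∀ y, G.graph.Adj x y → G.deg y ≠ 4
  link₁ : {x, x₁, a} ∈ G.faces
  link₂ : {x, a, b} ∈ G.faces
  link₃ : {x, b, x₂} ∈ G.faces
  link₄ : {x, x₂, x₁} ∈ G.faces
  boundary₁ : G.BoundaryEdge x₁ a
  boundary₂ : G.BoundaryEdge a b
  boundary₃ : G.BoundaryEdge b x₂
  not_boundary : ¬ G.BoundaryEdge x₁ x₂
  deg_a : G.deg a = 3
  deg_b : G.deg b = 3

/-- `G` is obtained from `G'` by adding a flag along a boundary edge `x₁x₂` of `G'`. -/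
def FlagAddition (G' G : TriComplex V) : Prop :=
  ∃ x x₁ a b x₂, G.IsFlagAt x x₁ a b x₂ ∧ G' = G.deleteVertices {a, b, x}

/-! ### Octahedra -/

/-- An octahedron component centered at the 3-cycle `v₀v₁v₂` with remaining vertices `a₀, a₁, a₂`:
the `vᵢ` have degree 4, `aᵢ` is adjacent to the two `vⱼ` with `j ≠ i` (by the degrees there are no
other common neighbours outside the 3-cycle), the cycle `a₀a₁a₂` exists, and one of four conditions
holds for the position of the `vᵢ` with respect to the boundary. -/
structure IsOctahedronAt (G : TriComplex V) (v a : Fin 3 → V) : Prop where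
  v_injective : Function.Injective v
  a_injective : Function.Injective a
  v_ne_a : ∀ i j, v i ≠ a j
  deg_v : ∀ i, G.deg (v i) = 4
  adj_v : ∀ i j, i ≠ j → G.graph.Adj (v i) (v j)
  adj_av : ∀ i j, i ≠ j → G.graph.Adj (a i) (v j)
  adj_a : ∀ i j, i ≠ j → G.graph.Adj (a i) (a j)
  position :
    (∀ i, ¬ G.BoundaryVertex (v i)) ∨
    (∃ i j k, i ≠ j ∧ i ≠ k ∧ j ≠ k ∧ G.BoundaryIs (v i) (a j) (a k)) ∨
    (∃ i j k, i ≠ j ∧ i ≠ k ∧ j ≠ k ∧ G.BoundaryIs (v i) (v j) (a k)) ∨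
    G.BoundaryIs (v 0) (v 1) (v 2)

/-- `G` is obtained from `G'` by adding an octahedron, that is, `G'` is the graph
`G - {v₀, v₁, v₂}`. If the `vᵢ` are inner vertices then `a₀a₁a₂` is a face of `G'`, and the
octahedron is added inside it; otherwise `a₀a₁a₂` is the boundary of `G'`. -/
def OctahedronAddition (G' G : TriComplex V) : Prop :=
  ∃ v a : Fin 3 → V, G.IsOctahedronAt v a ∧
    (((∀ i, ¬ G.BoundaryVertex (v i)) ∧
        G'.faces = insert {a 0, a 1, a 2} (G.deleteVertices {v 0, v 1, v 2}).faces) ∨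
      ((∃ i, G.BoundaryVertex (v i)) ∧ G' = G.deleteVertices {v 0, v 1, v 2}))

/-- `G` is obtained from `G'` by adding an octahedron along a boundary edge of `G'`: the octahedron
component of `G` is external, that is, the edges from `aⱼ` to the other two `aᵢ` are boundary edges,
and `G'` is `G - {aⱼ, v₀, v₁, v₂}`. -/
def ExternalOctahedronAddition (G' G : TriComplex V) : Prop :=
  ∃ (v a : Fin 3 → V) (j : Fin 3), G.IsOctahedronAt v a ∧
    (∀ i, i ≠ j → G.BoundaryEdge (a j) (a i)) ∧
    G' = G.deleteVertices {a j, v 0, v 1, v 2}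

/-! ### Generation -/

/-- `G` is obtained from `G'` by one of the operations, inside the class `F∘²(4)`. -/
def Step (G' G : TriComplex V) : Prop :=
  G'.InFCirc4 ∧ G.InFCirc4 ∧
    (TriodeSplitting G' G ∨ FlagAddition G' G ∨ FourSplitting G' G ∨
      OctahedronAddition G' G ∨ ExternalOctahedronAddition G' G)

/-- The complex is just a flag: the wheel with four spokes `xcᵢ`. -/
def IsFlag (G : TriComplex V) : Prop :=
  ∃ x c₀ c₁ c₂ c₃ : V, [x, c₀, c₁, c₂, c₃].Nodup ∧
    G.faces = {{x, c₀, c₁}, {x, c₁, c₂}, {x, c₂, c₃}, {x, c₃, c₀}}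

/-- The complex is just an octahedron component: the surface of the octahedron without the
face `a₀a₁a₂`. -/
def IsOctahedron (G : TriComplex V) : Prop :=
  ∃ v₀ v₁ v₂ a₀ a₁ a₂ : V, [v₀, v₁, v₂, a₀, a₁, a₂].Nodup ∧
    G.faces = {{v₀, v₁, v₂}, {v₀, v₁, a₂}, {v₀, a₁, v₂}, {a₀, v₁, v₂},
      {v₀, a₁, a₂}, {a₀, v₁, a₂}, {a₀, a₁, v₂}}

end Operations

end TriComplex

/-! The proof is a descent on the number of faces: a member of the class that is neither a flag nor
an octahedron component arises by one of the operations from a member with fewer faces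
(`InFCirc4.exists_step`). An inner vertex of degree 4 or a boundary vertex of degree 3 is called
critical. Apart from the new vertex, the contraction of an edge lowers only the degrees of the third
vertices of the faces at that edge, and these by one. Hence an edge can be contracted inside the
class if the common neighbours of its ends come from faces, it is not a chord, and no face at it has
a critical third vertex (`InFCirc4.step_contract`). Such a contraction is always inverse to a
3-splitting of triodes, so 4-splittings are never needed.

A complex without such edges is reduced: at every edge with the first two properties some third
vertex is critical. If one of two third vertices is not critical, the other one is, and this spreads
criticality from face to face. Three cases remain. If some 3-cycle is not a face, one with the
smallest inside is the outer cycle of an octahedron (`IsReduced.exists_isOctahedronPart`), which is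
removed inside a face or along a boundary edge unless it is the whole complex. If all 3-cycles are
faces and there is a chord, a smallest region cut off by a chord contains a flag
(`IsReduced.exists_isFlagAt`). If there is no chord either, the complex is a flag
(`IsReduced.isFlag`).

Topology enters in two ways. The combinatorial properties of `IsCombDisk` are extracted from the
homeomorphism with the disk by means of locally additive cochains modulo 2: on a disk they have
primitives, around an inner point they have one period, around a point of the circle none.
Conversely, contractions and deletions must produce disks again; all of these follow from one
piecewise linear homeomorphism, which replaces the star of a vertex by a fan
(`nonempty_space_homeomorph_of_fan`). The inside of a 3-cycle and the sides of a chord come from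
homology modulo 2 instead of the Jordan curve theorem. -/

open Topology Filter Set

/-! ### Locally additive cochains modulo 2 and the local topology of the disk. -/

/-- A cochain with values in `ZMod 2` that is additive near each point of `S`. -/
def LocallyAdditiveOn {X : Type*} [TopologicalSpace X] (c : X → X → ZMod 2) (S : Set X) : Prop :=
  ∀ x ∈ S, ∃ N ∈ 𝓝[S] x, ∀ y ∈ N, ∀ z ∈ N, ∀ w ∈ N, c y z + c z w = c y w

/-- `g` is a primitive of the cochain `c` on `S`. -/
def IsPrimitiveOn {X : Type*} [TopologicalSpace X] (c : X → X → ZMod 2) (g : X → ZMod 2)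
    (S : Set X) : Prop :=
  ∀ x ∈ S, ∀ᶠ y in 𝓝[S] x, c x y = g x + g y

theorem LocallyAdditiveOn.comp {X Y : Type*} [TopologicalSpace X] [TopologicalSpace Y]
    {c : Y → Y → ZMod 2} {S : Set Y} (hc : LocallyAdditiveOn c S) {e : X → Y} {T : Set X}
    (he : ContinuousOn e T) (hm : MapsTo e T S) :
    LocallyAdditiveOn (fun x y => c (e x) (e y)) T := by
  intro x hx
  obtain ⟨N, hN, h⟩ := hc (e x) (hm hx)
  refine ⟨e ⁻¹' N, ?_, fun y hy z hz w hw => h _ hy _ hz _ hw⟩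
  exact ((he x hx).tendsto_nhdsWithin hm) hN

theorem LocallyAdditiveOn.mono {X : Type*} [TopologicalSpace X]
    {c : X → X → ZMod 2} {S T : Set X} (hc : LocallyAdditiveOn c S) (h : T ⊆ S) :
    LocallyAdditiveOn c T :=
  hc.comp continuousOn_id h

theorem IsPrimitiveOn.comp {X Y : Type*} [TopologicalSpace X] [TopologicalSpace Y]
    {c : Y → Y → ZMod 2} {g : Y → ZMod 2} {S : Set Y} (hc : IsPrimitiveOn c g S) {e : X → Y}
    {T : Set X} (he : ContinuousOn e T) (hm : MapsTo e T S) :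
    IsPrimitiveOn (fun x y => c (e x) (e y)) (fun x => g (e x)) T := by
  intro x hx
  exact ((he x hx).tendsto_nhdsWithin hm).eventually (hc (e x) (hm hx))

theorem IsPrimitiveOn.mono {X : Type*} [TopologicalSpace X]
    {c : X → X → ZMod 2} {g : X → ZMod 2} {S T : Set X} (hc : IsPrimitiveOn c g S) (h : T ⊆ S) :
    IsPrimitiveOn c g T :=
  hc.comp continuousOn_id h

/-- A function that is locally constant on a preconnected set is constant on it. -/
theorem IsPreconnected.eq_of_eventually_eq {X Y : Type*} [TopologicalSpace X]
    {S : Set X} (hS : IsPreconnected S) {g : X → Y} (hg : ∀ x ∈ S, ∀ᶠ y in 𝓝[S] x, g y = g x)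
    {a b : X} (ha : a ∈ S) (hb : b ∈ S) : g a = g b := by
  let _ : TopologicalSpace Y := ⊥
  have : DiscreteTopology Y := ⟨rfl⟩
  refine hS.constant (f := g) (fun x hx => ?_) ha hb
  rw [ContinuousWithinAt, nhds_discrete, tendsto_pure]
  exact hg x hx

/-- Every locally additive cochain on a compact convex set has a primitive. -/
theorem LocallyAdditiveOn.exists_primitive {E : Type*} [NormedAddCommGroup E] [NormedSpace ℝ E]
    {c : E → E → ZMod 2} {K : Set E} (hK : IsCompact K) (hconv : Convex ℝ K)
    (hc : LocallyAdditiveOn c K) : ∃ g, IsPrimitiveOn c g K := by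
  rcases K.eq_empty_or_nonempty with rfl | ⟨o, ho⟩
  · exact ⟨0, fun x hx => hx.elim⟩
  choose! N hN h using hc
  have hO : ∀ x ∈ K, ∃ ε > 0, Metric.ball x ε ∩ K ⊆ N x := fun x hx =>
    Metric.mem_nhdsWithin_iff.mp (hN x hx)
  choose! ε hε hεN using hO
  -- The Lebesgue number makes the additivity uniform: it holds for any three points in a common
  -- ball of radius `δ`.
  obtain ⟨δ, hδ, hleb⟩ := lebesgue_number_lemma_of_metric (c := fun x : K =>
      Metric.ball (x : E) (ε x))
    hK (fun _ => Metric.isOpen_ball)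
    (fun x hx => mem_iUnion.mpr ⟨⟨x, hx⟩, Metric.mem_ball_self (hε x hx)⟩)
  have hadd : ∀ x ∈ K, ∀ y ∈ K, ∀ z ∈ K, ∀ w ∈ K, dist y x < δ → dist z x < δ → dist w x < δ →
      c y z + c z w = c y w := by
    intro x hx y hy z hz w hw h1 h2 h3
    obtain ⟨⟨i, hi⟩, hsub⟩ := hleb x hx
    exact h i hi y (hεN i hi ⟨hsub h1, hy⟩) z (hεN i hi ⟨hsub h2, hz⟩) w (hεN i hi ⟨hsub h3, hw⟩)
  obtain ⟨R, hR⟩ := hK.isBounded.exists_norm_le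
  have hR0 : 0 ≤ R := (norm_nonneg o).trans (hR o ho)
  -- The segments from `o` have length at most `2 * R`, so `n` equal steps are shorter than `δ / 2`.
  obtain ⟨n, hn⟩ := exists_nat_gt ((2 * R + 1) / (δ / 2))
  have hn0 : (0 : ℝ) < n := lt_of_le_of_lt (by positivity) hn
  rw [div_lt_iff₀ (by positivity)] at hn
  let γ : E → ℕ → E := fun x i => o + ((i : ℝ) / n) • (x - o)
  have hγK : ∀ x ∈ K, ∀ i ≤ n, γ x i ∈ K := by
    intro x hx i hi
    refine hconv.add_smul_sub_mem ho hx ⟨by positivity, ?_⟩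
    rw [div_le_one hn0]
    exact_mod_cast hi
  have hγ0 : ∀ x, γ x 0 = o := fun x => by simp [γ]
  have hγn : ∀ x, γ x n = x := fun x => by simp [γ, div_self hn0.ne']
  have hstep : ∀ x ∈ K, ∀ i, dist (γ x (i + 1)) (γ x i) < δ / 2 := by
    intro x hx i
    have : γ x (i + 1) - γ x i = (1 / (n : ℝ)) • (x - o) := by
      simp only [γ, Nat.cast_add, Nat.cast_one, add_sub_add_left_eq_sub, ← sub_smul]
      congr 1
      ring
    rw [dist_eq_norm, this, norm_smul, Real.norm_of_nonneg (by positivity)]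
    have : ‖x - o‖ ≤ 2 * R := (norm_sub_le _ _).trans (by linarith [hR x hx, hR o ho])
    rw [div_mul_eq_mul_div, one_mul, div_lt_iff₀ hn0]
    linarith
  have hclose : ∀ x y, ∀ i ≤ n, dist (γ x i) (γ y i) ≤ dist x y := by
    intro x y i hi
    have : γ x i - γ y i = ((i : ℝ) / n) • (x - y) := by
      simp only [γ, add_sub_add_left_eq_sub, ← smul_sub]
      congr 1
      abel
    rw [dist_eq_norm, this, norm_smul, Real.norm_of_nonneg (by positivity), dist_eq_norm]
    refine mul_le_of_le_one_left (norm_nonneg _) ?_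
    rw [div_le_one hn0]
    exact_mod_cast hi
  -- The primitive is the discrete integral of `c` along the segment from `o` to `x`.
  refine ⟨fun x => ∑ i ∈ Finset.range n, c (γ x i) (γ x (i + 1)), fun x hx => ?_⟩
  have hev : ∀ᶠ y in 𝓝[K] x, y ∈ K ∧ dist y x < δ / 2 :=
    inter_mem self_mem_nhdsWithin (mem_nhdsWithin_of_mem_nhds
      (Metric.ball_mem_nhds x (half_pos hδ)))
  filter_upwards [hev] with y hy
  -- Discrete homotopy between the segments to `x` and to `y`: each square of the ladder lies in a
  -- `δ`-ball around `γ x m`, so additivity pushes the rung from `m` to `m + 1`.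
  have key : ∀ m ≤ n, ∑ i ∈ Finset.range m, c (γ x i) (γ x (i + 1)) + c (γ x m) (γ y m) =
      ∑ i ∈ Finset.range m, c (γ y i) (γ y (i + 1)) := by
    intro m
    induction m with
    | zero =>
      intro _
      have := hadd o ho o ho o ho o ho (by simpa) (by simpa) (by simpa)
      simpa [hγ0] using this
    | succ m ih =>
      intro hm
      rw [Finset.sum_range_succ, Finset.sum_range_succ, ← ih (by omega)]
      have a1 := hstep x hx m
      have a2 := hstep y hy.1 m
      have a3 : dist (γ y m) (γ x m) < δ / 2 := by
        refine lt_of_le_of_lt (hclose y x m (by omega)) hy.2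
      have kx := hγK x hx m (by omega)
      have kx' := hγK x hx (m + 1) hm
      have ky := hγK y hy.1 m (by omega)
      have ky' := hγK y hy.1 (m + 1) hm
      have a4 : dist (γ y (m + 1)) (γ x m) < δ :=
        lt_of_le_of_lt (dist_triangle _ (γ y m) _) (by linarith)
      have a0 : dist (γ x m) (γ x m) < δ := by simpa
      have b1 := hadd _ kx _ kx _ kx' _ ky' a0 (by linarith) a4
      have b2 := hadd _ kx _ kx _ ky _ ky' a0 (by linarith) a4
      rw [add_assoc, b1, ← b2, add_assoc]
  have := key n le_rfl
  rw [hγn, hγn] at this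
  rw [← this, ← add_assoc, CharTwo.add_self_eq_zero, zero_add]

/-- Near a point of the unit circle, locally additive cochains on the punctured unit disk have
primitives on compact sets. -/
theorem LocallyAdditiveOn.exists_primitive_of_norm_eq_one {p : ℂ} (hp : ‖p‖ = 1) {r : ℝ}
    {c : ℂ → ℂ → ZMod 2}
    (hc : LocallyAdditiveOn c ((Metric.closedBall p r ∩ Metric.closedBall 0 1) \ {p})) {L : Set ℂ}
    (hL : IsCompact L) (hLs : L ⊆ (Metric.closedBall p r ∩ Metric.closedBall 0 1) \ {p}) :
    ∃ g, IsPrimitiveOn c g L := by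
  rcases L.eq_empty_or_nonempty with rfl | hne
  · exact ⟨0, fun x hx => hx.elim⟩
  have hcont : Continuous fun z : ℂ => inner ℝ p z := continuous_const.inner continuous_id
  obtain ⟨w, hw, hmax⟩ := hL.exists_isMaxOn hne hcont.continuousOn
  have hlt : ∀ z ∈ Metric.closedBall (0 : ℂ) 1, z ≠ p → inner ℝ p z < 1 := by
    intro z hz hzp
    by_contra! h
    have h1 := norm_sub_sq_real p z
    have h2 : ‖z‖ ≤ 1 := by simpa using hz
    have h3 : ‖z‖ ^ 2 ≤ 1 := by nlinarith [norm_nonneg z]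
    have h4 : ‖p - z‖ ^ 2 ≤ 0 := by rw [h1, hp]; linarith
    have h5 : ‖p - z‖ = 0 := by nlinarith [norm_nonneg (p - z)]
    exact hzp (sub_eq_zero.mp (norm_eq_zero.mp h5)).symm
  -- By strict convexity the linear functional `inner ℝ p` is below 1 on the disk away from `p`.
  -- Cutting at its maximum over `L` leaves a compact convex set that contains `L` and misses `p`.
  let K : Set ℂ := (Metric.closedBall p r ∩ Metric.closedBall 0 1) ∩ {z | inner ℝ p z ≤ inner ℝ p w}
  have hK : IsCompact K :=
    ((isCompact_closedBall p r).inter (isCompact_closedBall 0 1)).inter_right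
      (isClosed_le hcont continuous_const)
  have hconv : Convex ℝ K :=
    ((convex_closedBall p r).inter (convex_closedBall 0 1)).inter
      (convex_halfSpace_le (IsLinearMap.mk (fun x y => inner_add_right _ _ _)
        (fun a x => by rw [inner_smul_right]; rfl)) _)
  have hKs : K ⊆ (Metric.closedBall p r ∩ Metric.closedBall 0 1) \ {p} := by
    rintro z ⟨hz, hz'⟩
    refine ⟨hz, ?_⟩
    rintro rfl
    have h1 := hlt w (hLs hw).1.2 (hLs hw).2
    have h2 : inner ℝ z z = (1 : ℝ) := by rw [real_inner_self_eq_norm_sq, hp]; norm_num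
    have h3 : inner ℝ z z ≤ (inner ℝ z w : ℝ) := hz'
    linarith
  obtain ⟨g, hg⟩ := (hc.mono hKs).exists_primitive hK hconv
  exact ⟨g, hg.mono fun z hz => ⟨(hLs hz).1, hmax hz⟩⟩

/-- In a punctured disk around a point, two locally additive cochains are linearly dependent, up to
cochains with a primitive. -/
theorem exists_combination_primitive_of_punctured_ball {p : ℂ} {r : ℝ} {c d : ℂ → ℂ → ZMod 2}
    (hc : LocallyAdditiveOn c (Metric.closedBall p r \ {p}))
    (hd : LocallyAdditiveOn d (Metric.closedBall p r \ {p}))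
    {L : Set ℂ} (hL : IsCompact L) (hLs : L ⊆ Metric.closedBall p r \ {p}) :
    ∃ a b : ZMod 2, ¬(a = 0 ∧ b = 0) ∧
      ∃ g, IsPrimitiveOn (fun x y => a * c x y + b * d x y) g L := by
  rcases L.eq_empty_or_nonempty with rfl | hne
  · exact ⟨1, 0, by simp, 0, fun x hx => hx.elim⟩
  obtain ⟨w₀, hw₀, hmin⟩ := hL.exists_isMinOn hne
    (continuous_id.dist continuous_const : Continuous fun z : ℂ => dist z p).continuousOn
  set r₁ := dist w₀ p with hr₁
  have hr₁0 : 0 < r₁ := dist_pos.mpr (hLs hw₀).2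
  have hr0 : 0 < r := lt_of_lt_of_le hr₁0 (hLs hw₀).1
  -- Logarithmic polar coordinates: rectangles cover the annulus and are convex, so pulled back
  -- cochains have primitives there.
  let e : ℂ → ℂ := fun z => p + Complex.exp z
  have he : Continuous e := continuous_const.add Complex.continuous_exp
  let box (s t : ℝ) : Set ℂ := Icc (Real.log r₁) (Real.log r) ×ℂ Icc s t
  have hbox : ∀ s t, IsCompact (box s t) := fun s t => isCompact_Icc.reProdIm isCompact_Icc
  have hboxc : ∀ s t, Convex ℝ (box s t) := fun s t =>
    ((convex_Icc _ _).linear_preimage Complex.reLm).inter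
      ((convex_Icc _ _).linear_preimage Complex.imLm)
  have hem : ∀ s t, MapsTo e (box s t) (Metric.closedBall p r \ {p}) := by
    intro s t z hz
    have hz1 : Real.log r₁ ≤ z.re ∧ z.re ≤ Real.log r := (Complex.mem_reProdIm.mp hz).1
    refine ⟨?_, ?_⟩
    · have : Real.exp z.re ≤ r := by
        rw [← Real.exp_log hr0]; exact Real.exp_le_exp.mpr hz1.2
      simpa [e, Complex.norm_exp] using this
    · simp [e, Complex.exp_ne_zero]
  -- The heights leave room for a translation by one period, from `R` into `K`, and for local lifts
  -- with imaginary part up to `2π` in absolute value.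
  let K := box (-(4 * Real.pi)) (4 * Real.pi)
  let R := box (-(4 * Real.pi)) (2 * Real.pi)
  have hpi := Real.pi_pos
  set T : ℂ := 2 * Real.pi * Complex.I with hT
  have hTre : T.re = 0 := by simp [hT]
  have hTim : T.im = 2 * Real.pi := by simp [hT]
  have heT : ∀ z, e (z + T) = e z := fun z => by simp [e, hT, Complex.exp_periodic z]
  have hRK : ∀ z ∈ R, z ∈ K ∧ z + T ∈ K := by
    intro z hz
    obtain ⟨h1, h2⟩ := Complex.mem_reProdIm.mp hz
    simp only [mem_Icc] at h1 h2
    constructor <;> refine Complex.mem_reProdIm.mpr ⟨?_, ?_⟩ <;>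
      simp only [mem_Icc, Complex.add_re, Complex.add_im, hTre, hTim] <;>
      constructor <;> linarith
  -- The primitive changes by a constant `m` under one turn around `p`; this period is the only
  -- obstruction to its descent to the annulus.
  have main : ∀ f : ℂ → ℂ → ZMod 2, LocallyAdditiveOn f (Metric.closedBall p r \ {p}) →
      ∃ (g : ℂ → ZMod 2) (m : ZMod 2), IsPrimitiveOn (fun x y => f (e x) (e y)) g K ∧
        ∀ z ∈ R, g (z + T) = g z + m := by
    intro f hf
    obtain ⟨g, hg⟩ := (hf.comp he.continuousOn (hem _ _)).exists_primitive
      (hbox (-(4 * Real.pi)) (4 * Real.pi)) (hboxc _ _)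
    have hconst : ∀ z ∈ R, ∀ z' ∈ R, g (z + T) + g z = g (z' + T) + g z' := by
      intro z hz z' hz'
      refine (hboxc (-(4 * Real.pi)) (2 * Real.pi)).isPreconnected.eq_of_eventually_eq
        (g := fun z => g (z + T) + g z) ?_ hz hz'
      intro x hx
      have hRKm : MapsTo (fun y => y + T) R K := fun y hy => (hRK y hy).2
      have h1 := (hg.mono fun y hy => (hRK y hy).1) x hx
      have h2 := (hg.comp (e := fun y => y + T) (T := R)
        (continuous_id.add continuous_const).continuousOn hRKm) x hx
      filter_upwards [h1, h2] with y hy1 hy2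
      simp only [heT] at hy2
      have := hy1.symm.trans hy2
      generalize g x = a₁ at *
      generalize g y = a₂ at *
      generalize g (x + T) = a₃ at *
      generalize g (y + T) = a₄ at *
      clear * - this
      revert a₁ a₂ a₃ a₄
      decide
    by_cases hRe : R.Nonempty
    · obtain ⟨z₀, hz₀⟩ := hRe
      refine ⟨g, g (z₀ + T) + g z₀, hg, fun z hz => ?_⟩
      rw [← hconst z hz z₀ hz₀, add_comm (g (z + T)), ← add_assoc, CharTwo.add_self_eq_zero,
        zero_add]
    · exact ⟨g, 0, hg, fun z hz => (hRe ⟨z, hz⟩).elim⟩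
  obtain ⟨g₁, m₁, hg₁, hm₁⟩ := main c hc
  obtain ⟨g₂, m₂, hg₂, hm₂⟩ := main d hd
  -- Two periods in `ZMod 2` are linearly dependent; the corresponding combination of the cochains
  -- has period zero.
  obtain ⟨a, b, hab, hm⟩ : ∃ a b : ZMod 2, ¬(a = 0 ∧ b = 0) ∧ a * m₁ + b * m₂ = 0 := by
    clear * -
    revert m₁ m₂; decide
  refine ⟨a, b, hab, fun w => a * g₁ (Complex.log (w - p)) + b * g₂ (Complex.log (w - p)), ?_⟩
  set g : ℂ → ZMod 2 := fun z => a * g₁ z + b * g₂ z with hgdef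
  have hgT : ∀ z ∈ R, g (z + T) = g z := by
    intro z hz
    simp only [hgdef, hm₁ z hz, hm₂ z hz]
    linear_combination hm
  have hgK : ∀ z ∈ K, ∀ᶠ y in 𝓝[K] z, a * c (e z) (e y) + b * d (e z) (e y) = g z + g y := by
    intro z hz
    filter_upwards [hg₁ z hz, hg₂ z hz] with y h1 h2
    rw [h1, h2, hgdef]
    ring
  have hLre : ∀ w ∈ L, Real.log r₁ ≤ Real.log ‖w - p‖ ∧ Real.log ‖w - p‖ ≤ Real.log r := by
    intro w hw
    have h1 : r₁ ≤ ‖w - p‖ := by rw [← dist_eq_norm]; exact hmin hw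
    have h2 : ‖w - p‖ ≤ r := by rw [← dist_eq_norm]; exact (hLs hw).1
    exact ⟨Real.log_le_log hr₁0 h1, Real.log_le_log (hr₁0.trans_le h1) h2⟩
  intro w hw
  have hwp : w - p ≠ 0 := sub_ne_zero.mpr (hLs hw).2
  set z := Complex.log (w - p) with hz
  -- The principal logarithm jumps across its cut. `s` is a logarithm of `y - p` that is continuous
  -- at `w`, and it differs from the principal one by at most one period.
  let s : ℂ → ℂ := fun y => z + Complex.log ((y - p) / (w - p))
  have hexp : ∀ y ∈ L, Complex.exp (s y) = y - p := by
    intro y hy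
    have hyp : y - p ≠ 0 := sub_ne_zero.mpr (hLs hy).2
    rw [Complex.exp_add, Complex.exp_log hwp, Complex.exp_log (div_ne_zero hyp hwp)]
    field_simp
  have hre : ∀ y ∈ L, (s y).re = Real.log ‖y - p‖ := by
    intro y hy
    have := congrArg (fun t => Real.log ‖t‖) (hexp y hy)
    simpa [Complex.norm_exp] using this
  have him : ∀ y, |(s y).im| ≤ 2 * Real.pi := by
    intro y
    have h1 := Complex.abs_arg_le_pi (w - p)
    have h2 := Complex.abs_arg_le_pi ((y - p) / (w - p))
    simp only [s, Complex.add_im, hz, Complex.log_im]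
    exact (abs_add_le _ _).trans (by linarith)
  have hsK : ∀ y ∈ L, s y ∈ K := by
    intro y hy
    have h1 := hLre y hy
    have h2 := abs_le.mp (him y)
    refine Complex.mem_reProdIm.mpr ⟨?_, ?_⟩
    · rw [hre y hy]; exact h1
    · exact ⟨by linarith, by linarith⟩
  have hs0 : s w = z := by simp [s, div_self hwp]
  have hscont : ContinuousAt s w := by
    refine continuousAt_const.add (ContinuousAt.clog ?_ ?_)
    · exact (continuousAt_id.sub continuousAt_const).div_const _
    · simp [div_self hwp]
  have htend : Tendsto s (𝓝[L] w) (𝓝[K] z) := by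
    rw [← hs0]
    refine tendsto_nhdsWithin_iff.mpr ⟨hscont.tendsto.mono_left nhdsWithin_le_nhds, ?_⟩
    filter_upwards [self_mem_nhdsWithin] with y hy using hsK y hy
  have hzK : z ∈ K := hs0 ▸ hsK w hw
  filter_upwards [htend.eventually (hgK z hzK), self_mem_nhdsWithin] with y hy hyL
  have e1 : e z = w := by simp [e, ← hs0, hexp w hw]
  have e2 : e (s y) = y := by simp [e, hexp y hyL]
  rw [e1, e2] at hy
  rw [hy]
  change g z + g (s y) = g z + g (Complex.log (y - p))
  congr 1
  have hyp : y - p ≠ 0 := sub_ne_zero.mpr (hLs hyL).2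
  obtain ⟨n, hn⟩ := Complex.exp_eq_exp_iff_exists_int.mp
    ((hexp y hyL).trans (Complex.exp_log hyp).symm)
  have hnT : s y = Complex.log (y - p) + n * T := by rw [hn]
  have h1 := abs_le.mp (him y)
  have h2 := abs_le.mp (Complex.abs_arg_le_pi (y - p))
  have h3 : (s y).im = (y - p).arg + n * (2 * Real.pi) := by
    rw [hnT]; simp [hTim, hTre, Complex.log_im]
  have hn1 : n < 2 := by
    by_contra! h
    have : (2 : ℝ) ≤ n := by exact_mod_cast h
    nlinarith
  have hn2 : -2 < n := by
    by_contra! h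
    have : (n : ℝ) ≤ -2 := by exact_mod_cast h
    nlinarith
  have hlog : Complex.log (y - p) ∈ R := by
    refine Complex.mem_reProdIm.mpr ⟨?_, ?_⟩
    · rw [Complex.log_re]; exact hLre y hyL
    · rw [Complex.log_im]; exact ⟨by linarith, by linarith⟩
  interval_cases n
  · have h4 : s y ∈ R := by
      refine Complex.mem_reProdIm.mpr ⟨?_, ?_⟩
      · rw [hre y hyL]; exact hLre y hyL
      · exact ⟨by linarith, by linarith⟩
    have := hgT _ h4
    rw [← this, hnT]
    congr 1
    push_cast
    ring
  · rw [hnT]; simp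
  · rw [hnT]
    simpa using hgT _ hlog

/-- At an inner point a small punctured ball fits into the disk, and there is one period to kill. At
a point of the circle the punctured neighbourhood carries no period at all, so already the first
cochain has a primitive. -/
theorem exists_combination_primitive {p : ℂ} (hp : p ∈ Metric.closedBall (0 : ℂ) 1) {U : Set ℂ}
    (hU : U ∈ 𝓝[Metric.closedBall (0 : ℂ) 1] p) {c d : ℂ → ℂ → ZMod 2}
    (hc : LocallyAdditiveOn c ((U ∩ Metric.closedBall (0 : ℂ) 1) \ {p}))
    (hd : LocallyAdditiveOn d ((U ∩ Metric.closedBall (0 : ℂ) 1) \ {p})) :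
    ∃ r > 0, ∀ L, IsCompact L → L ⊆ (Metric.closedBall p r ∩ Metric.closedBall 0 1) \ {p} →
      ∃ a b : ZMod 2, ¬(a = 0 ∧ b = 0) ∧
        ∃ g, IsPrimitiveOn (fun x y => a * c x y + b * d x y) g L := by
  obtain ⟨ε, hε, hεU⟩ := Metric.mem_nhdsWithin_iff.mp hU
  rcases (show ‖p‖ ≤ 1 by simpa using hp).lt_or_eq with h | h
  · refine ⟨min (ε / 2) (1 - ‖p‖), lt_min (half_pos hε) (by linarith), fun L hL hLs => ?_⟩
    have hsub : Metric.closedBall p (min (ε / 2) (1 - ‖p‖)) \ {p} ⊆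
        (U ∩ Metric.closedBall (0 : ℂ) 1) \ {p} := by
      rintro z ⟨hz, hzp⟩
      rw [Metric.mem_closedBall, le_min_iff] at hz
      have h1 : z ∈ Metric.closedBall (0 : ℂ) 1 := by
        have : ‖z‖ ≤ ‖z - p‖ + ‖p‖ := by simpa using norm_add_le (z - p) p
        rw [← dist_eq_norm] at this
        simp only [Metric.mem_closedBall, dist_zero_right]
        linarith [hz.2]
      exact ⟨⟨hεU ⟨Metric.mem_ball.mpr (by linarith [hz.1]), h1⟩, h1⟩, hzp⟩
    exact exists_combination_primitive_of_punctured_ball (hc.mono hsub) (hd.mono hsub) hL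
      fun z hz => ⟨(hLs hz).1.1, (hLs hz).2⟩
  · refine ⟨ε / 2, half_pos hε, fun L hL hLs => ⟨1, 0, by simp, ?_⟩⟩
    have hsub : (Metric.closedBall p (ε / 2) ∩ Metric.closedBall 0 1) \ {p} ⊆
        (U ∩ Metric.closedBall (0 : ℂ) 1) \ {p} := by
      rintro z ⟨⟨hz, hz1⟩, hzp⟩
      refine ⟨⟨hεU ⟨?_, hz1⟩, hz1⟩, hzp⟩
      exact Metric.mem_ball.mpr (lt_of_le_of_lt hz (by linarith))
    obtain ⟨g, hg⟩ := (hc.mono hsub).exists_primitive_of_norm_eq_one h hL hLs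
    exact ⟨g, by simpa using hg⟩

/-- The unit disk is not locally disconnected by the removal of a point. -/
theorem exists_ball_inter_diff_isPreconnected {p : ℂ} (hp : p ∈ Metric.closedBall (0 : ℂ) 1)
    {ε : ℝ} (hε : 0 < ε) : ∃ r > 0, r ≤ ε ∧
      IsPreconnected ((Metric.ball p r ∩ Metric.closedBall 0 1) \ {p}) := by
  rcases (show ‖p‖ ≤ 1 by simpa using hp).lt_or_eq with h | h
  · refine ⟨min ε (1 - ‖p‖), lt_min hε (by linarith), min_le_left _ _, ?_⟩
    set r := min ε (1 - ‖p‖) with hr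
    have hr0 : 0 < r := lt_min hε (by linarith)
    -- Inside the disk the punctured ball is the image of a half-plane under the exponential map.
    have : (Metric.ball p r ∩ Metric.closedBall 0 1) \ {p} =
        (fun z => p + Complex.exp z) '' {z | z.re < Real.log r} := by
      ext z
      constructor
      · rintro ⟨⟨hz, -⟩, hzp⟩
        have hzp' : z - p ≠ 0 := sub_ne_zero.mpr hzp
        refine ⟨Complex.log (z - p), ?_, by simp [Complex.exp_log hzp']⟩
        simp only [mem_ofPred_eq, Complex.log_re]
        refine Real.log_lt_log (norm_pos_iff.mpr hzp') ?_
        rwa [← dist_eq_norm]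
      · rintro ⟨w, hw, rfl⟩
        have h1 : Real.exp w.re < r := by
          rw [← Real.exp_log hr0]; exact Real.exp_lt_exp.mpr hw
        refine ⟨⟨by simpa [Complex.norm_exp] using h1, ?_⟩, by simp [Complex.exp_ne_zero]⟩
        have h2 : r ≤ 1 - ‖p‖ := min_le_right _ _
        have h3 := norm_add_le p (Complex.exp w)
        rw [Complex.norm_exp] at h3
        simp only [Metric.mem_closedBall, dist_zero_right]
        linarith
    rw [this]
    exact (convex_halfSpace_re_lt _).isPreconnected.image _
      (continuous_const.add Complex.continuous_exp).continuousOn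
  · refine ⟨ε, hε, le_rfl, ?_⟩
    -- A point of the circle is an extreme point of the disk, so its removal leaves a convex set.
    have h1 : p ∈ extremePoints ℝ (Metric.closedBall (0 : ℂ) 1) :=
      StrictConvexSpace.sphere_subset_extremePoints_closedBall _ (by norm_num) (by simpa using h)
    have h2 := ((convex_closedBall (0 : ℂ) 1).mem_extremePoints_iff_convex_sdiff.mp h1).2
    rw [inter_sdiff_assoc]
    exact ((convex_ball p ε).inter h2).isPreconnected

set_option linter.unusedSectionVars false

/-! ### From the homeomorphism to combinatorics: connectedness and vanishing first cohomology. -/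

namespace TriComplex
variable {V : Type*} [DecidableEq V]

/-- `abc` is a triangle of the complex. -/
def IsTri (G : TriComplex V) (a b c : V) : Prop := ({a, b, c} : Finset V) ∈ G.faces

/-- The combinatorial properties of the triangulations of the disk: edges lie in at most two
triangles, links are connected, the graph is connected, the first cohomology group with coefficients
`ZMod 2` vanishes, and the boundary is not empty. -/
structure IsCombDisk (G : TriComplex V) : Prop where
  two : ∀ {a b c₁ c₂ c₃ : V}, G.IsTri a b c₁ → G.IsTri a b c₂ → G.IsTri a b c₃ →
    c₁ = c₂ ∨ c₁ = c₃ ∨ c₂ = c₃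
  link : ∀ {v : V} {S : Set V} {a : V}, G.graph.Adj v a → a ∈ S →
    (∀ a b, G.IsTri v a b → a ∈ S → b ∈ S) → ∀ b, G.graph.Adj v b → b ∈ S
  conn : ∀ {S : Set V}, (∀ a b, G.graph.Adj a b → a ∈ S → b ∈ S) →
    ∀ a b, G.IsVertex a → G.IsVertex b → a ∈ S → b ∈ S
  h1 : ∀ φ : V → V → ZMod 2, (∀ a b, φ a b = φ b a) →
    (∀ a b c, G.IsTri a b c → φ a b + φ b c = φ a c) →
    ∃ g : V → ZMod 2, ∀ a b, G.graph.Adj a b → φ a b = g a + g b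
  bdry : ∃ a b, G.BoundaryEdge a b

/-! ### Triangles -/

variable {G : TriComplex V} {a b c d : V}

theorem IsTri.swap₁₂ (h : G.IsTri a b c) : G.IsTri b a c := by
  unfold IsTri at *; rwa [Finset.insert_comm]

theorem IsTri.swap₂₃ (h : G.IsTri a b c) : G.IsTri a c b := by
  unfold IsTri at *; rwa [Finset.pair_comm]

theorem IsTri.swap₁₃ (h : G.IsTri a b c) : G.IsTri c b a := h.swap₁₂.swap₂₃.swap₁₂

theorem IsTri.rotate (h : G.IsTri a b c) : G.IsTri b c a := h.swap₁₂.swap₂₃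

theorem IsTri.ne₁₂ (h : G.IsTri a b c) : a ≠ b := by
  rintro rfl
  have := G.card_eq _ h
  have h2 : ({a, a, c} : Finset V).card ≤ 2 := by
    rw [Finset.insert_eq_of_mem (Finset.mem_insert_self _ _)]; exact Finset.card_le_two
  omega

theorem IsTri.ne₂₃ (h : G.IsTri a b c) : b ≠ c := h.rotate.ne₁₂

theorem IsTri.ne₁₃ (h : G.IsTri a b c) : a ≠ c := h.swap₂₃.ne₁₂

theorem IsTri.adj₁₂ (h : G.IsTri a b c) : G.graph.Adj a b :=
  ⟨h.ne₁₂, _, h, by simp, by simp⟩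

theorem IsTri.adj₂₃ (h : G.IsTri a b c) : G.graph.Adj b c := h.rotate.adj₁₂

theorem IsTri.adj₁₃ (h : G.IsTri a b c) : G.graph.Adj a c := h.swap₂₃.adj₁₂

theorem exists_eq_of_mem_face {t : Finset V} (ht : t ∈ G.faces) (ha : a ∈ t) :
    ∃ b c, t = {a, b, c} ∧ G.IsTri a b c := by
  obtain ⟨b, c, hbc, h⟩ := Finset.card_eq_two.mp
    (show (t.erase a).card = 2 by rw [Finset.card_erase_of_mem ha, G.card_eq t ht])
  have : t = {a, b, c} := by rw [← h, Finset.insert_erase ha]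
  exact ⟨b, c, this, by rw [IsTri, ← this]; exact ht⟩

theorem exists_eq_of_mem_face₂ {t : Finset V} (ht : t ∈ G.faces) (ha : a ∈ t) (hb : b ∈ t)
    (hab : a ≠ b) : ∃ c, t = {a, b, c} ∧ G.IsTri a b c := by
  obtain ⟨p, q, h, htri⟩ := exists_eq_of_mem_face ht ha
  rw [h] at hb
  simp only [Finset.mem_insert, Finset.mem_singleton] at hb
  rcases hb with rfl | rfl | rfl
  · exact (hab rfl).elim
  · exact ⟨q, h, htri⟩
  · exact ⟨p, h.trans (by rw [Finset.pair_comm]), htri.swap₂₃⟩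

theorem adj_iff : G.graph.Adj a b ↔ ∃ c, G.IsTri a b c := by
  constructor
  · rintro ⟨hab, t, ht, ha, hb⟩
    obtain ⟨c, -, h⟩ := exists_eq_of_mem_face₂ ht ha hb hab
    exact ⟨c, h⟩
  · rintro ⟨c, h⟩
    exact h.adj₁₂

theorem isVertex_iff : G.IsVertex a ↔ ∃ b, G.graph.Adj a b := by
  constructor
  · rintro ⟨t, ht, ha⟩
    obtain ⟨b, c, -, h⟩ := exists_eq_of_mem_face ht ha
    exact ⟨b, h.adj₁₂⟩
  · rintro ⟨b, -, t, ht, ha, -⟩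
    exact ⟨t, ht, ha⟩

theorem boundaryEdge_iff : G.BoundaryEdge a b ↔
    ∃ c, G.IsTri a b c ∧ ∀ d, G.IsTri a b d → d = c := by
  constructor
  · rintro ⟨hab, t, ⟨ht, ha, hb⟩, huniq⟩
    obtain ⟨c, rfl, h⟩ := exists_eq_of_mem_face₂ ht ha hb hab
    refine ⟨c, h, fun d hd => ?_⟩
    have := huniq {a, b, d} ⟨hd, by simp, by simp⟩
    have hd' : d ∈ ({a, b, c} : Finset V) := this ▸ (by simp)
    simp only [Finset.mem_insert, Finset.mem_singleton] at hd'
    rcases hd' with h' | h' | h'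
    · exact (hd.ne₁₃ h'.symm).elim
    · exact (hd.ne₂₃ h'.symm).elim
    · exact h'
  · rintro ⟨c, h, huniq⟩
    refine ⟨h.ne₁₂, {a, b, c}, ⟨h, by simp, by simp⟩, ?_⟩
    rintro t ⟨ht, ha, hb⟩
    obtain ⟨d, rfl, hd⟩ := exists_eq_of_mem_face₂ ht ha hb h.ne₁₂
    rw [huniq d hd]

theorem BoundaryEdge.symm (h : G.BoundaryEdge a b) : G.BoundaryEdge b a := by
  obtain ⟨c, h1, h2⟩ := boundaryEdge_iff.mp h
  exact boundaryEdge_iff.mpr ⟨c, h1.swap₁₂, fun d hd => h2 d hd.swap₁₂⟩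

theorem BoundaryEdge.adj (h : G.BoundaryEdge a b) : G.graph.Adj a b := by
  obtain ⟨c, h1, -⟩ := boundaryEdge_iff.mp h
  exact h1.adj₁₂

/-! ### Points of the underlying space -/

theorem face_of_pos {x : V → ℝ} (hx : x ∈ G.space) :
    ∃ t ∈ G.faces, (∀ v, x v ≠ 0 → v ∈ t) ∧ ∑ v ∈ t, x v = 1 := by
  obtain ⟨-, t, ht, h0, h1⟩ := hx
  exact ⟨t, ht, fun v hv => by_contra fun h => hv (h0 v h), h1⟩

theorem exists_large_coord {x : V → ℝ} (hx : x ∈ G.space) : ∃ v, 1 / 3 ≤ x v := by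
  obtain ⟨t, ht, -, h1⟩ := face_of_pos hx
  by_contra! h
  have : ∑ v ∈ t, x v < ∑ v ∈ t, (1 / 3 : ℝ) := by
    refine Finset.sum_lt_sum_of_nonempty ?_ fun v _ => h v
    rw [← Finset.card_pos, G.card_eq t ht]; norm_num
  rw [h1, Finset.sum_const, G.card_eq t ht] at this
  norm_num at this

open Classical in
/-- A vertex of large weight. -/
noncomputable def nearVertex (x : V → ℝ) (a₀ : V) : V :=
  if h : ∃ v, 1 / 3 ≤ x v then h.choose else a₀

theorem nearVertex_spec {x : V → ℝ} (hx : x ∈ G.space) (a₀ : V) : 1 / 3 ≤ x (nearVertex x a₀) := by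
  rw [nearVertex, dif_pos (exists_large_coord hx)]
  exact (exists_large_coord hx).choose_spec

/-- A discontinuous substitute for simplicial approximation. The finitely many coordinates that
vanish at `x` stay below 1/3 nearby, so the chosen vertices of all nearby points lie in one face,
the one that carries `x`. -/
theorem eventually_nearVertex {x : V → ℝ} (_hx : x ∈ G.space) (a₀ : V) :
    ∀ᶠ y in 𝓝[G.space] x, x (nearVertex y a₀) ≠ 0 := by
  have h1 : ∀ᶠ y in 𝓝 x, ∀ v ∈ G.faces.biUnion id, x v = 0 → y v < 1 / 3 := by
    rw [eventually_all_finset]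
    intro v _
    by_cases h : x v = 0
    · have : ∀ᶠ y in 𝓝 x, y v < 1 / 3 :=
        (continuous_apply v).continuousAt.eventually
          (gt_mem_nhds (show x v < 1 / 3 by rw [h]; norm_num))
      filter_upwards [this] with y hy _ using hy
    · simp [h]
  filter_upwards [mem_nhdsWithin_of_mem_nhds h1, self_mem_nhdsWithin] with y hy hyG h0
  have h2 := nearVertex_spec hyG a₀
  obtain ⟨t, ht, hpos, -⟩ := face_of_pos hyG
  have h3 : nearVertex y a₀ ∈ G.faces.biUnion id :=
    Finset.mem_biUnion.mpr ⟨t, ht, hpos _ (by linarith)⟩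
  have := hy _ h3 h0
  linarith

theorem mem_space_of_tri (h : G.IsTri a b c) {x : V → ℝ} (h0 : ∀ v, 0 ≤ x v)
    (hs : ∀ v, v ≠ a → v ≠ b → v ≠ c → x v = 0) (h1 : x a + x b + x c = 1) : x ∈ G.space := by
  refine ⟨h0, {a, b, c}, h, fun v hv => ?_, ?_⟩
  · simp only [Finset.mem_insert, Finset.mem_singleton, not_or] at hv
    exact hs v hv.1 hv.2.1 hv.2.2
  · rw [Finset.sum_insert, Finset.sum_pair h.ne₂₃, ← h1, add_assoc]
    simp [h.ne₁₂, h.ne₁₃]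

theorem edge_mem_space (h : G.graph.Adj a b) {τ : ℝ} (hτ : τ ∈ Icc (0 : ℝ) 1) :
    (Pi.single a (1 - τ) + Pi.single b τ : V → ℝ) ∈ G.space := by
  obtain ⟨c, hc⟩ := adj_iff.mp h
  refine mem_space_of_tri hc (fun v => ?_) (fun v h1 h2 h3 => ?_) ?_
  · simp only [Pi.add_apply, Pi.single_apply]
    have := hτ.1; have := hτ.2
    split_ifs <;> linarith
  · simp [h1, h2]
  · have h12 := hc.ne₁₂; have h13 := hc.ne₁₃; have h23 := hc.ne₂₃
    simp [h12, h12.symm, h13.symm, h23.symm]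

/-- A parametrization of the underlying space by the unit disk of the complex plane. -/
theorem IsDisk.exists_param (hG : G.IsDisk) : ∃ (e : ℂ → V → ℝ) (f : (V → ℝ) → ℂ),
    ContinuousOn e (Metric.closedBall 0 1) ∧ MapsTo e (Metric.closedBall 0 1) G.space ∧
    ContinuousOn f G.space ∧ MapsTo f G.space (Metric.closedBall 0 1) ∧
    (∀ x ∈ G.space, e (f x) = x) ∧ ∀ z ∈ Metric.closedBall (0 : ℂ) 1, f (e z) = z := by
  obtain ⟨h⟩ := hG
  let i : ℂ ≃ₗᵢ[ℝ] EuclideanSpace ℝ (Fin 2) := Complex.orthonormalBasisOneI.repr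
  have him : ∀ z ∈ Metric.closedBall (0 : ℂ) 1,
      i z ∈ Metric.closedBall (0 : EuclideanSpace ℝ (Fin 2)) 1 := by
    intro z hz; simpa using hz
  have hjm : ∀ z ∈ Metric.closedBall (0 : EuclideanSpace ℝ (Fin 2)) 1,
      i.symm z ∈ Metric.closedBall (0 : ℂ) 1 := by
    intro z hz; simpa using hz
  classical
  let e : ℂ → V → ℝ := fun z =>
    if hz : z ∈ Metric.closedBall (0 : ℂ) 1 then h.symm ⟨i z, him z hz⟩ else 0
  let f : (V → ℝ) → ℂ := fun x => if hx : x ∈ G.space then i.symm (h ⟨x, hx⟩) else 0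
  have he : ∀ z (hz : z ∈ Metric.closedBall (0 : ℂ) 1), e z = h.symm ⟨i z, him z hz⟩ :=
    fun z hz => dif_pos hz
  have hf : ∀ x (hx : x ∈ G.space), f x = i.symm (h ⟨x, hx⟩) := fun z hz => dif_pos hz
  refine ⟨e, f, ?_, ?_, ?_, ?_, ?_, ?_⟩
  · rw [continuousOn_iff_continuous_domRestrict]
    have : (Metric.closedBall (0 : ℂ) 1).domRestrict e =
        fun z : Metric.closedBall (0 : ℂ) 1 => (h.symm ⟨i z, him z z.2⟩ : V → ℝ) := by
      funext z; exact he z z.2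
    rw [this]
    fun_prop
  · intro z hz; rw [he z hz]; exact Subtype.coe_prop _
  · rw [continuousOn_iff_continuous_domRestrict]
    have : G.space.domRestrict f = fun x => i.symm (h x) := by
      funext x; exact hf x x.2
    rw [this]
    fun_prop
  · intro x hx; rw [hf x hx]; exact hjm _ (Subtype.coe_prop _)
  · intro x hx
    have h1 : f x ∈ Metric.closedBall (0 : ℂ) 1 := by
      rw [hf x hx]; exact hjm _ (Subtype.coe_prop _)
    rw [he _ h1]
    simp [hf x hx]
  · intro z hz
    have h1 : e z ∈ G.space := by rw [he z hz]; exact Subtype.coe_prop _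
    rw [hf _ h1]
    simp [he z hz]

theorem IsDisk.isPreconnected (hG : G.IsDisk) : IsPreconnected G.space := by
  obtain ⟨e, f, he, hem, -, hfm, hef, -⟩ := hG.exists_param
  have : G.space = e '' Metric.closedBall 0 1 := by
    ext x
    exact ⟨fun hx => ⟨f x, hfm hx, hef x hx⟩, fun ⟨z, hz, h⟩ => h ▸ hem hz⟩
  rw [this]
  exact (convex_closedBall 0 1).isPreconnected.image _ he

theorem nearVertex_single (a a₀ : V) : nearVertex (Pi.single a (1 : ℝ)) a₀ = a := by
  have h : ∃ v, 1 / 3 ≤ (Pi.single a (1 : ℝ) : V → ℝ) v := ⟨a, by simp; norm_num⟩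
  rw [nearVertex, dif_pos h]
  by_contra hne
  have := h.choose_spec
  rw [Pi.single_eq_of_ne hne] at this
  norm_num at this

theorem single_mem_space (h : G.IsVertex a) : (Pi.single a 1 : V → ℝ) ∈ G.space := by
  obtain ⟨b, hb⟩ := isVertex_iff.mp h
  simpa using edge_mem_space hb (τ := 0) (by simp)

/-- Whether the chosen vertex of a point lies in `S` is locally constant on the connected underlying
space. -/
theorem IsDisk.conn (hG : G.IsDisk) {S : Set V} (hS : ∀ a b, G.graph.Adj a b → a ∈ S → b ∈ S)
    (a b : V) (ha : G.IsVertex a) (hb : G.IsVertex b) (haS : a ∈ S) : b ∈ S := by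
  have := hG.isPreconnected.eq_of_eventually_eq (g := fun x => nearVertex x a ∈ S) ?_
    (single_mem_space ha) (single_mem_space hb)
  · rw [nearVertex_single, nearVertex_single] at this
    exact this.mp haS
  · intro x hx
    filter_upwards [eventually_nearVertex hx a] with y hy
    obtain ⟨t, ht, hpos, -⟩ := face_of_pos hx
    have h1 : nearVertex x a ∈ t := hpos _ (by linarith [nearVertex_spec hx a])
    have h2 : nearVertex y a ∈ t := hpos _ hy
    by_cases h : nearVertex x a = nearVertex y a
    · rw [h]
    · exact propext ⟨hS _ _ ⟨Ne.symm h, t, ht, h2, h1⟩, hS _ _ ⟨h, t, ht, h1, h2⟩⟩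

/-- A simplicial cocycle becomes a locally additive cochain by evaluation at the chosen vertices.
Its primitive on the disk, read at the vertices of the complex, is the potential. -/
theorem IsDisk.h1 (hG : G.IsDisk) (φ : V → V → ZMod 2) (hsymm : ∀ a b, φ a b = φ b a)
    (hφ : ∀ a b c, G.IsTri a b c → φ a b + φ b c = φ a c) :
    ∃ g : V → ZMod 2, ∀ a b, G.graph.Adj a b → φ a b = g a + g b := by
  rcases isEmpty_or_nonempty V with hV | ⟨⟨a₀⟩⟩
  · exact ⟨0, fun a => hV.elim a⟩
  -- The values of `φ` on the diagonal are arbitrary, whereas additivity on a face forces zero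
  -- there.
  let ψ : V → V → ZMod 2 := fun a b => if a = b then 0 else φ a b
  have hψ : ∀ t ∈ G.faces, ∀ a ∈ t, ∀ b ∈ t, ∀ c ∈ t, ψ a b + ψ b c = ψ a c := by
    intro t ht a ha b hb c hc
    by_cases hab : a = b
    · simp [ψ, hab]
    by_cases hbc : b = c
    · simp [ψ, hbc]
    by_cases hac : a = c
    · subst hac
      simp only [ψ, if_neg hab, if_neg hbc, hsymm b a, if_true]
      exact CharTwo.add_self_eq_zero _
    obtain ⟨d, rfl, hd⟩ := exists_eq_of_mem_face₂ ht ha hb hab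
    have : c = d := by
      simp only [Finset.mem_insert, Finset.mem_singleton] at hc
      rcases hc with h | h | h
      · exact (hac h.symm).elim
      · exact (hbc h.symm).elim
      · exact h
    subst this
    simp only [ψ, if_neg hab, if_neg hbc, if_neg hac]
    exact hφ _ _ _ hd
  let ν : (V → ℝ) → V := fun x => nearVertex x a₀
  have hadd : LocallyAdditiveOn (fun x y => ψ (ν x) (ν y)) G.space := by
    intro x hx
    obtain ⟨t, ht, hpos, -⟩ := face_of_pos hx
    exact ⟨_, eventually_nearVertex hx a₀, fun y hy z hz w hw =>
      hψ t ht _ (hpos _ hy) _ (hpos _ hz) _ (hpos _ hw)⟩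
  obtain ⟨e, f, he, hem, hf, hfm, hef, -⟩ := hG.exists_param
  obtain ⟨g, hg⟩ := (hadd.comp he hem).exists_primitive (isCompact_closedBall 0 1)
    (convex_closedBall 0 1)
  refine ⟨fun a => g (f (Pi.single a 1)), fun a b hab => ?_⟩
  -- Along an edge the primitive and the cocycle based at `a` change together, so their sum is
  -- constant; comparison of the two ends gives the value of `φ`.
  have key := (convex_Icc (0 : ℝ) 1).isPreconnected.eq_of_eventually_eq
    (g := fun τ => g (f (Pi.single a (1 - τ) + Pi.single b τ)) +
      ψ a (ν (Pi.single a (1 - τ) + Pi.single b τ))) ?_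
    (left_mem_Icc.mpr zero_le_one) (right_mem_Icc.mpr zero_le_one)
  · simp only [sub_zero, Pi.single_zero, add_zero, sub_self, zero_add, ν, nearVertex_single] at key
    simp only [ψ, if_true, if_neg hab.1, add_zero] at key
    beta_reduce
    rw [key, add_right_comm, CharTwo.add_self_eq_zero, zero_add]
  · intro τ hτ
    have hx := edge_mem_space hab hτ
    have hcont : Continuous fun τ : ℝ => (Pi.single a (1 - τ) + Pi.single b τ : V → ℝ) := by
      refine Continuous.add ?_ ?_
      · exact (continuous_single (A := fun _ : V => ℝ) a).comp (continuous_const.sub continuous_id)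
      · exact continuous_single (A := fun _ : V => ℝ) b
    have hm : MapsTo (fun τ : ℝ => (Pi.single a (1 - τ) + Pi.single b τ : V → ℝ)) (Icc 0 1)
        G.space := fun τ hτ => edge_mem_space hab hτ
    have h2 := ((hg.comp hf hfm).comp hcont.continuousOn hm) τ hτ
    filter_upwards [h2, self_mem_nhdsWithin] with σ hσ hσI
    simp only [hef _ hx, hef _ (edge_mem_space hab hσI)] at hσ
    have hν : ∀ τ ∈ Icc (0 : ℝ) 1, ν (Pi.single a (1 - τ) + Pi.single b τ) = a ∨
        ν (Pi.single a (1 - τ) + Pi.single b τ) = b := by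
      intro τ hτ
      have h3 := nearVertex_spec (edge_mem_space hab hτ) a₀
      by_contra! h4
      rw [Pi.add_apply, Pi.single_eq_of_ne h4.1, Pi.single_eq_of_ne h4.2] at h3
      norm_num at h3
    obtain ⟨t, ht, hat, hbt⟩ := hab.2
    have h5 : ∀ τ ∈ Icc (0 : ℝ) 1, ν (Pi.single a (1 - τ) + Pi.single b τ) ∈ t := by
      intro τ hτ
      rcases hν τ hτ with h | h <;> rw [h] <;> assumption
    have h6 := hψ t ht a hat _ (h5 τ hτ) _ (h5 σ hσI)
    rw [← h6, hσ]
    generalize g _ = p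
    generalize g _ = q
    generalize ψ _ _ = r
    clear * -
    revert p q r
    decide

end TriComplex

/-! ### Crossing cochains and paths around a point of an edge or of a triangle. -/

namespace TriComplex
variable {V : Type*} [DecidableEq V] {G : TriComplex V} {a b c d : V}

/-- The cochain that counts the changes of `S` on the set where `H` holds. -/
noncomputable def crossing {X : Type*} (S : X → ZMod 2) (H : X → Prop) (x y : X) : ZMod 2 :=
  open Classical in if H x ∧ H y then S x + S y else 0

theorem crossing_eq_zero {X : Type*} {S : X → ZMod 2} {H : X → Prop} {x y : X} (h : S x = S y) :
    crossing S H x y = 0 := by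
  unfold crossing
  split_ifs
  · rw [h]; exact CharTwo.add_self_eq_zero _
  · rfl

/-- Where `S` is locally constant the cochain vanishes; where `H` is locally constant it is zero or
the coboundary of `S`. Additivity can fail only where both change, and in the applications this
happens at `x₀` alone, which is removed. -/
theorem locallyAdditiveOn_crossing {X : Type*} [TopologicalSpace X] {S : X → ZMod 2}
    {H : X → Prop} {N : Set X}
    (h : ∀ x ∈ N, (∀ᶠ y in 𝓝[N] x, S y = S x) ∨ ∀ᶠ y in 𝓝[N] x, (H y ↔ H x)) :
    LocallyAdditiveOn (crossing S H) N := by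
  intro x hx
  rcases h x hx with h | h
  · refine ⟨_, h, fun y hy z hz w hw => ?_⟩
    rw [crossing_eq_zero (hy.trans hz.symm), crossing_eq_zero (hz.trans hw.symm),
      crossing_eq_zero (hy.trans hw.symm), add_zero]
  · refine ⟨_, h, fun y hy z hz w hw => ?_⟩
    replace hy : H y ↔ H x := hy
    replace hz : H z ↔ H x := hz
    replace hw : H w ↔ H x := hw
    unfold crossing
    by_cases hH : H x
    · rw [if_pos ⟨hy.mpr hH, hz.mpr hH⟩, if_pos ⟨hz.mpr hH, hw.mpr hH⟩,
        if_pos ⟨hy.mpr hH, hw.mpr hH⟩, add_assoc, ← add_assoc (S z), CharTwo.add_self_eq_zero,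
        zero_add]
    · rw [if_neg fun h' => hH (hy.mp h'.1), if_neg fun h' => hH (hz.mp h'.1),
        if_neg fun h' => hH (hy.mp h'.1), add_zero]

/-- Whether a point lies on the side of `a` of the line through `x₀` and the vertex opposite
to `ab`. -/
noncomputable def side (x₀ : V → ℝ) (a b : V) (x : V → ℝ) : ZMod 2 :=
  if x b * x₀ a < x a * x₀ b then 1 else 0

theorem eventually_side_eq {x₀ x : V → ℝ} (h : x a * x₀ b ≠ x b * x₀ a) :
    ∀ᶠ y in 𝓝 x, side x₀ a b y = side x₀ a b x := by
  have ca : Continuous fun y : V → ℝ => y a * x₀ b := (continuous_apply a).mul continuous_const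
  have cb : Continuous fun y : V → ℝ => y b * x₀ a := (continuous_apply b).mul continuous_const
  rcases h.lt_or_gt with h | h
  · filter_upwards [ca.continuousAt.eventually_lt cb.continuousAt h] with y hy
    rw [side, side, if_neg (not_lt.mpr hy.le), if_neg (not_lt.mpr h.le)]
  · filter_upwards [cb.continuousAt.eventually_lt ca.continuousAt h] with y hy
    rw [side, side, if_pos hy, if_pos h]

/-- Paths around `x₀` in the triangle `abc`. -/
noncomputable def detour (x₀ : V → ℝ) (a b c : V) (κ t σ : ℝ) : V → ℝ :=
  x₀ + t • (σ • (Pi.single a 1 - Pi.single b 1) + (κ * (1 - |σ|)) •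
    ((x₀ a + x₀ b) • Pi.single c 1 - x₀ a • Pi.single a 1 - x₀ b • Pi.single b 1))

section Detour
variable {x₀ : V → ℝ} {κ t σ : ℝ}

theorem continuous_detour : Continuous fun q : ℝ × ℝ => detour x₀ a b c κ q.1 q.2 := by
  unfold detour; fun_prop

theorem detour_zero : detour x₀ a b c κ 0 σ = x₀ := by simp [detour]

theorem detour_a (hab : a ≠ b) (hac : a ≠ c) :
    detour x₀ a b c κ t σ a = x₀ a + t * (σ - κ * (1 - |σ|) * x₀ a) := by
  simp [detour, hab, hac]; ring

theorem detour_b (hab : a ≠ b) (hbc : b ≠ c) :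
    detour x₀ a b c κ t σ b = x₀ b + t * (-σ - κ * (1 - |σ|) * x₀ b) := by
  simp [detour, hab.symm, hbc]; ring

theorem detour_c (hac : a ≠ c) (hbc : b ≠ c) :
    detour x₀ a b c κ t σ c = x₀ c + t * (κ * (1 - |σ|) * (x₀ a + x₀ b)) := by
  simp [detour, hac.symm, hbc.symm]

theorem detour_other {v : V} (hva : v ≠ a) (hvb : v ≠ b) (hvc : v ≠ c) :
    detour x₀ a b c κ t σ v = x₀ v := by
  simp [detour, hva, hvb, hvc]

/-- All detours start and end at the same two points, on either side of `x₀` along the direction of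
`ab`. So detours through different triangles, or on different sides of `x₀`, close up to loops
around `x₀`. -/
theorem detour_end {c' : V} {κ' : ℝ} (hσ : |σ| = 1) :
    detour x₀ a b c κ t σ = detour x₀ a b c' κ' t σ := by
  simp [detour, hσ]

/-- The displacement towards `c` keeps the ratio of the weights of `a` and `b`, so the line that
`side` tests is crossed exactly at `σ = 0`. -/
theorem side_detour (hab : a ≠ b) (hac : a ≠ c) (hbc : b ≠ c) (ha : 0 < x₀ a) (hb : 0 < x₀ b)
    (ht : 0 < t) : side x₀ a b (detour x₀ a b c κ t σ) = if 0 < σ then 1 else 0 := by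
  rw [side, detour_a hab hac, detour_b hab hbc]
  congr 1
  rw [← sub_pos]
  have : (x₀ a + t * (σ - κ * (1 - |σ|) * x₀ a)) * x₀ b -
    (x₀ b + t * (-σ - κ * (1 - |σ|) * x₀ b)) * x₀ a = (t * (x₀ a + x₀ b)) * σ := by ring
  rw [this, mul_pos_iff_of_pos_left (by positivity)]

theorem detour_ne (hab : a ≠ b) (hac : a ≠ c) (hbc : b ≠ c) (ha : 0 < x₀ a) (hb : 0 < x₀ b)
    (hκ : κ ≠ 0) (ht : 0 < t) : detour x₀ a b c κ t σ ≠ x₀ := by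
  intro h
  have h1 := congrFun h a
  have h2 := congrFun h b
  have h3 := congrFun h c
  rw [detour_a hab hac] at h1
  rw [detour_b hab hbc] at h2
  rw [detour_c hac hbc] at h3
  have h4 : t * (σ - κ * (1 - |σ|) * x₀ a) = 0 := by linarith
  have h5 : t * (-σ - κ * (1 - |σ|) * x₀ b) = 0 := by linarith
  have h6 : t * (κ * (1 - |σ|) * (x₀ a + x₀ b)) = 0 := by linarith
  have h7 : κ * (1 - |σ|) * (x₀ a + x₀ b) = 0 := (mul_eq_zero.mp h6).resolve_left ht.ne'
  have h8 : κ * (1 - |σ|) = 0 := (mul_eq_zero.mp h7).resolve_right (by positivity)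
  rw [h8] at h4
  have h9 : σ = 0 := by
    have := (mul_eq_zero.mp h4).resolve_left ht.ne'
    linarith
  rw [h9] at h8
  simp [hκ] at h8

/-- With `κ = 1` the path bulges towards `c`, with `κ = -1` away from it; the latter stays in the
triangle only if `x₀` has positive weight at `c`. -/
theorem detour_mem (h : G.IsTri a b c) (h0 : ∀ v, 0 ≤ x₀ v)
    (hs : ∀ v, v ≠ a → v ≠ b → v ≠ c → x₀ v = 0) (h1 : x₀ a + x₀ b + x₀ c = 1)
    (ha : 0 < x₀ a) (hb : 0 < x₀ b) (hκ : κ = 1 ∨ κ = -1 ∧ 0 < x₀ c) :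
    ∀ᶠ t in 𝓝[>] (0 : ℝ), ∀ σ ∈ Icc (-1 : ℝ) 1, detour x₀ a b c κ t σ ∈ G.space \ {x₀} := by
  have hc := h0 c
  have e1 : ∀ᶠ t in 𝓝[>] (0 : ℝ), t < x₀ a := mem_nhdsWithin_of_mem_nhds (gt_mem_nhds ha)
  have e2 : ∀ᶠ t in 𝓝[>] (0 : ℝ), t < x₀ b := mem_nhdsWithin_of_mem_nhds (gt_mem_nhds hb)
  have e3 : ∀ᶠ t in 𝓝[>] (0 : ℝ), κ = -1 → t < x₀ c := by
    by_cases h : κ = -1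
    · have : 0 < x₀ c := by
        rcases hκ with h' | h'
        · rw [h] at h'; norm_num at h'
        · exact h'.2
      filter_upwards [mem_nhdsWithin_of_mem_nhds (gt_mem_nhds this)] with t ht _ using ht
    · simp [h]
  filter_upwards [e1, e2, e3, self_mem_nhdsWithin] with t ht1 ht2 ht3 ht0 σ hσ
  replace ht0 : 0 < t := ht0
  refine ⟨?_, detour_ne h.ne₁₂ h.ne₁₃ h.ne₂₃ ha hb (by rcases hκ with h | h <;> simp [h]) ht0⟩
  have hσ1 : |σ| ≤ 1 := abs_le.mpr hσ
  have hσ0 := abs_nonneg σ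
  have hs1 := neg_abs_le σ
  have hs2 := le_abs_self σ
  refine mem_space_of_tri h (fun v => ?_) (fun v hva hvb hvc => ?_) ?_
  · by_cases hva : v = a
    · subst hva
      rw [detour_a h.ne₁₂ h.ne₁₃]
      have : -1 ≤ σ - κ * (1 - |σ|) * x₀ v := by
        rcases hκ with rfl | ⟨rfl, -⟩ <;> nlinarith
      nlinarith
    by_cases hvb : v = b
    · subst hvb
      rw [detour_b h.ne₁₂ h.ne₂₃]
      have : -1 ≤ -σ - κ * (1 - |σ|) * x₀ v := by
        rcases hκ with rfl | ⟨rfl, -⟩ <;> nlinarith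
      nlinarith
    by_cases hvc : v = c
    · subst hvc
      rw [detour_c h.ne₁₃ h.ne₂₃]
      rcases hκ with rfl | ⟨rfl, -⟩
      · have : 0 ≤ (1 - |σ|) * (x₀ a + x₀ b) := mul_nonneg (by linarith) (by linarith)
        nlinarith
      · have h3 := ht3 rfl
        have : (1 - |σ|) * (x₀ a + x₀ b) ≤ 1 := by nlinarith
        nlinarith
    rw [detour_other hva hvb hvc]
    exact h0 v
  · rw [detour_other hva hvb hvc, hs v hva hvb hvc]
  · rw [detour_a h.ne₁₂ h.ne₁₃, detour_b h.ne₁₂ h.ne₂₃, detour_c h.ne₁₃ h.ne₂₃]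
    linear_combination h1

end Detour

/-- A family of small paths around `x₀` in the range of a parametrization. -/
theorem exists_small_paths {X : Set (V → ℝ)} {f : (V → ℝ) → ℂ} (hf : ContinuousOn f X)
    {x₀ : V → ℝ} (hx₀ : x₀ ∈ X) {J : Type*} [Finite J] (γ : J → ℝ → ℝ → V → ℝ)
    (hγ : ∀ j, Continuous fun q : ℝ × ℝ => γ j q.1 q.2) (hγ0 : ∀ j σ, γ j 0 σ = x₀)
    (hmem : ∀ j, ∀ᶠ t in 𝓝[>] (0 : ℝ), ∀ σ ∈ Icc (-1 : ℝ) 1, γ j t σ ∈ X \ {x₀}) {r : ℝ}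
    (hr : 0 < r) : ∃ t > 0, ∀ j, ∀ σ ∈ Icc (-1 : ℝ) 1, γ j t σ ∈ X \ {x₀} ∧
      f (γ j t σ) ∈ Metric.closedBall (f x₀) r := by
  have hU : f ⁻¹' Metric.closedBall (f x₀) r ∈ 𝓝[X] x₀ :=
    (hf x₀ hx₀) (Metric.closedBall_mem_nhds _ hr)
  obtain ⟨O, hO, hx₀O, hOX⟩ := mem_nhdsWithin.mp hU
  have key : ∀ j, ∀ᶠ t in 𝓝 (0 : ℝ), ∀ σ ∈ Icc (-1 : ℝ) 1, γ j t σ ∈ O := by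
    intro j
    refine isCompact_Icc.eventually_forall_of_forall_eventually (fun σ _ => ?_)
    have h1 := (hγ j).continuousAt (x := ((0 : ℝ), σ))
    have h2 : O ∈ 𝓝 (γ j 0 σ) := by rw [hγ0]; exact hO.mem_nhds hx₀O
    exact h1 h2
  have h3 : ∀ᶠ t in 𝓝[>] (0 : ℝ), 0 < t ∧ ∀ j, ∀ σ ∈ Icc (-1 : ℝ) 1,
      γ j t σ ∈ X \ {x₀} ∧ γ j t σ ∈ O := by
    filter_upwards [self_mem_nhdsWithin, eventually_all.mpr hmem,
      eventually_all.mpr fun j => (key j).filter_mono nhdsWithin_le_nhds] with t h1 h2 h3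
    exact ⟨h1, fun j σ hσ => ⟨h2 j σ hσ, h3 j σ hσ⟩⟩
  obtain ⟨t, ht, h⟩ := h3.exists
  exact ⟨t, ht, fun j σ hσ => ⟨(h j σ hσ).1, hOX ⟨(h j σ hσ).2, (h j σ hσ).1.1⟩⟩⟩

/-- The change of a primitive along a path. -/
theorem primitive_change {C : (V → ℝ) → (V → ℝ) → ZMod 2} {g : (V → ℝ) → ZMod 2}
    {L : Set (V → ℝ)} (hg : IsPrimitiveOn C g L) {γ : ℝ → V → ℝ} (hγ : Continuous γ)
    (hm : MapsTo γ (Icc (-1) 1) L) {ε : ZMod 2} (hzero : ∀ σ τ : ℝ, (0 < σ ↔ 0 < τ) →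
      C (γ σ) (γ τ) = 0)
    (hcross : ∀ σ τ : ℝ, |σ| < 1 → |τ| < 1 → 0 < τ → ¬ 0 < σ → C (γ σ) (γ τ) = ε) :
    g (γ (-1)) + g (γ 1) = ε := by
  -- Adding `ε` on the positive half compensates the single jump at `σ = 0`, so the sum is locally
  -- constant.
  have := (convex_Icc (-1 : ℝ) 1).isPreconnected.eq_of_eventually_eq
    (g := fun σ => g (γ σ) + if 0 < σ then ε else 0) ?_
    (left_mem_Icc.mpr (by norm_num)) (right_mem_Icc.mpr (by norm_num))
  · simp only [Left.neg_pos_iff, zero_lt_one, if_true] at this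
    rw [if_neg (by norm_num)] at this
    rw [add_zero] at this
    rw [this, add_right_comm, CharTwo.add_self_eq_zero, zero_add]
  · intro σ hσ
    have h1 := (hg.comp hγ.continuousOn hm) σ hσ
    have h2 : ∀ᶠ τ in 𝓝[Icc (-1) 1] σ, (0 < σ ↔ 0 < τ) ∨ |σ| < 1 ∧ |τ| < 1 ∧ 0 < τ ∧ ¬ 0 < σ := by
      refine mem_nhdsWithin_of_mem_nhds ?_
      rcases lt_trichotomy σ 0 with h | h | h
      · filter_upwards [gt_mem_nhds h] with τ hτ
        left; constructor <;> intro <;> linarith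
      · subst h
        have : ∀ᶠ τ in 𝓝 (0 : ℝ), |τ| < 1 :=
          continuous_abs.continuousAt.eventually (gt_mem_nhds (by norm_num))
        filter_upwards [this] with τ hτ
        by_cases h : 0 < τ
        · right; simp [hτ, h]
        · left; simp [h]
      · filter_upwards [lt_mem_nhds h] with τ hτ
        left; exact ⟨fun _ => hτ, fun _ => h⟩
    filter_upwards [h1, h2] with τ hτ1 hτ2
    rcases hτ2 with h | ⟨h1, h2, h3, h4⟩
    · rw [hzero σ τ h] at hτ1
      rw [if_congr h rfl rfl]
      congr 1
      generalize g (γ σ) = p at *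
      generalize g (γ τ) = q at *
      clear * - hτ1
      revert p q
      decide
    · rw [hcross σ τ h1 h2 h3 h4] at hτ1
      rw [if_pos h3, if_neg h4, hτ1]
      generalize g (γ σ) = p at *
      generalize g (γ τ) = q at *
      clear * -
      revert p q
      decide

theorem crossing_detour_zero {x₀ : V → ℝ} {κ t σ τ : ℝ} {H : (V → ℝ) → Prop} (h : G.IsTri a b c)
    (ha : 0 < x₀ a) (hb : 0 < x₀ b) (ht : 0 < t) (hστ : 0 < σ ↔ 0 < τ) :
    crossing (side x₀ a b) H (detour x₀ a b c κ t σ) (detour x₀ a b c κ t τ) = 0 := by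
  apply crossing_eq_zero
  rw [side_detour h.ne₁₂ h.ne₁₃ h.ne₂₃ ha hb ht, side_detour h.ne₁₂ h.ne₁₃ h.ne₂₃ ha hb ht]
  exact if_congr hστ rfl rfl

theorem crossing_detour_of_true {x₀ : V → ℝ} {κ t σ τ : ℝ} {H : (V → ℝ) → Prop} (h : G.IsTri a b c)
    (ha : 0 < x₀ a) (hb : 0 < x₀ b) (ht : 0 < t) (hτ : 0 < τ) (hσ : ¬ 0 < σ)
    (h1 : H (detour x₀ a b c κ t σ)) (h2 : H (detour x₀ a b c κ t τ)) :
    crossing (side x₀ a b) H (detour x₀ a b c κ t σ) (detour x₀ a b c κ t τ) = 1 := by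
  rw [crossing, if_pos ⟨h1, h2⟩, side_detour h.ne₁₂ h.ne₁₃ h.ne₂₃ ha hb ht,
    side_detour h.ne₁₂ h.ne₁₃ h.ne₂₃ ha hb ht, if_pos hτ, if_neg hσ, zero_add]

theorem crossing_of_false {X : Type*} {S : X → ZMod 2} {H : X → Prop} {x y : X} (h : ¬ H x) :
    crossing S H x y = 0 := by
  rw [crossing, if_neg fun h' => h h'.1]

/-- The pull-back of the neighborhoods under a parametrization. -/
theorem locallyAdditiveOn_param {X : Set (V → ℝ)} {e : ℂ → V → ℝ} {f : (V → ℝ) → ℂ}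
    (he : ContinuousOn e (Metric.closedBall 0 1)) (hem : MapsTo e (Metric.closedBall 0 1) X)
    (hfe : ∀ z ∈ Metric.closedBall (0 : ℂ) 1, f (e z) = z) {x₀ : V → ℝ} {N : Set (V → ℝ)}
    {C : (V → ℝ) → (V → ℝ) → ZMod 2} (hC : LocallyAdditiveOn C ((N ∩ X) \ {x₀})) :
    LocallyAdditiveOn (fun z w => C (e z) (e w)) ((e ⁻¹' N ∩ Metric.closedBall 0 1) \ {f x₀}) := by
  refine hC.comp (he.mono fun z hz => hz.1.2) ?_
  rintro z ⟨⟨hzN, hz⟩, hne⟩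
  refine ⟨⟨hzN, hem hz⟩, fun h => hne ?_⟩
  rw [mem_singleton_iff] at h ⊢
  rw [← h, hfe z hz]

/-- The crossing cochains at a point in the interior of an edge are locally additive. -/
theorem locallyAdditiveOn_crossing_edge {x₀ : V → ℝ} (hab : a ≠ b)
    (h1 : x₀ a + x₀ b = 1) (hs : ∀ v, v ≠ a → v ≠ b → x₀ v = 0) (c : V) (hca : c ≠ a)
    (hcb : c ≠ b) :
    LocallyAdditiveOn (crossing (side x₀ a b) fun x => 0 < x c)
      (({x | 0 < x a} ∩ {x | 0 < x b} ∩ G.space) \ {x₀}) := by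
  apply locallyAdditiveOn_crossing
  rintro x ⟨⟨⟨hxa, hxb⟩, hx⟩, hxx₀⟩
  -- Off the line `side` is locally constant. On the line a point other than `x₀` lies in the
  -- interior of one triangle `abd`, and nearby the weight of `c` is positive exactly if `c = d`.
  by_cases hside : x a * x₀ b = x b * x₀ a
  · right
    obtain ⟨h0, t, ht, hxt, hsum⟩ := hx
    have hat : a ∈ t := by_contra fun h => (ne_of_gt hxa) (hxt a h)
    have hbt : b ∈ t := by_contra fun h => (ne_of_gt hxb) (hxt b h)
    obtain ⟨d, rfl, hd⟩ := exists_eq_of_mem_face₂ ht hat hbt hab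
    have hsum' : x a + x b + x d = 1 := by
      rw [← hsum, Finset.sum_insert (by simp [hd.ne₁₂, hd.ne₁₃]), Finset.sum_pair hd.ne₂₃,
        add_assoc]
    have hxd : 0 < x d := by
      refine lt_of_le_of_ne (h0 d) fun hd0 => hxx₀ ?_
      have ha : x a = x₀ a := by linear_combination x₀ a * hsum' + hside - x a * h1 + x₀ a * hd0
      have hb : x b = x₀ b := by linarith
      rw [mem_singleton_iff]
      funext v
      by_cases hva : v = a
      · rw [hva, ha]
      by_cases hvb : v = b
      · rw [hvb, hb]
      rw [hs v hva hvb]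
      by_cases hvd : v = d
      · rw [hvd, ← hd0]
      exact hxt v (by simp [hva, hvb, hvd])
    have hev : ∀ᶠ y in 𝓝[({x | 0 < x a} ∩ {x | 0 < x b} ∩ G.space) \ {x₀}] x, 0 < y d :=
      mem_nhdsWithin_of_mem_nhds ((continuous_apply d).continuousAt.eventually (lt_mem_nhds hxd))
    have hiff : ∀ y ∈ ({x | 0 < x a} ∩ {x | 0 < x b} ∩ G.space) \ {x₀}, 0 < y d →
        (0 < y c ↔ c = d) := by
      rintro y ⟨⟨⟨hya, hyb⟩, ⟨hy0, s, hs, hys, -⟩⟩, -⟩ hyd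
      constructor
      · intro hyc
        have has : a ∈ s := by_contra fun h => (ne_of_gt hya) (hys a h)
        have hbs : b ∈ s := by_contra fun h => (ne_of_gt hyb) (hys b h)
        have hds : d ∈ s := by_contra fun h => (ne_of_gt hyd) (hys d h)
        have hcs : c ∈ s := by_contra fun h => (ne_of_gt hyc) (hys c h)
        obtain ⟨p, rfl, hp⟩ := exists_eq_of_mem_face₂ hs has hbs hab
        simp only [Finset.mem_insert, Finset.mem_singleton] at hds hcs
        have h1 := hd.ne₁₃
        have h2 := hd.ne₂₃
        grind
      · rintro rfl; exact hyd
    filter_upwards [hev, self_mem_nhdsWithin] with y hy hyN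
    rw [hiff y hyN hy, hiff x ⟨⟨⟨hxa, hxb⟩, ⟨h0, _, ht, hxt, hsum⟩⟩, hxx₀⟩ hxd]
  · left
    exact (eventually_side_eq hside).filter_mono nhdsWithin_le_nhds

/-- The crossing cochain at a point in the interior of a triangle is locally additive. -/
theorem locallyAdditiveOn_crossing_triangle {x₀ : V → ℝ} (h : G.IsTri a b c)
    (h1 : x₀ a + x₀ b + x₀ c = 1) (ha : 0 < x₀ a) (hb : 0 < x₀ b)
    (hs : ∀ v, v ≠ a → v ≠ b → v ≠ c → x₀ v = 0) :
    LocallyAdditiveOn (crossing (side x₀ a b) fun x => x₀ c < x c)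
      (({x | 0 < x a} ∩ {x | 0 < x b} ∩ {x | 0 < x c} ∩ G.space) \ {x₀}) := by
  apply locallyAdditiveOn_crossing
  rintro x ⟨⟨⟨⟨hxa, hxb⟩, hxc⟩, hx⟩, hxx₀⟩
  by_cases hside : x a * x₀ b = x b * x₀ a
  · right
    obtain ⟨h0, t, ht, hxt, hsum⟩ := hx
    have hat : a ∈ t := by_contra fun h => (ne_of_gt hxa) (hxt a h)
    have hbt : b ∈ t := by_contra fun h => (ne_of_gt hxb) (hxt b h)
    have hct : c ∈ t := by_contra fun h => (ne_of_gt hxc) (hxt c h)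
    obtain ⟨d, rfl, hd⟩ := exists_eq_of_mem_face₂ ht hat hbt h.ne₁₂
    obtain rfl : c = d := by
      simp only [Finset.mem_insert, Finset.mem_singleton] at hct
      have h1 := h.ne₁₃
      have h2 := h.ne₂₃
      grind
    have hsum' : x a + x b + x c = 1 := by
      rw [← hsum, Finset.sum_insert (by simp [hd.ne₁₂, hd.ne₁₃]), Finset.sum_pair hd.ne₂₃,
        add_assoc]
    -- On the line the point is determined by its weight at `c`, so away from `x₀` this weight stays
    -- strictly on one side of `x₀ c`.
    have hne : x c ≠ x₀ c := by
      intro hc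
      apply hxx₀
      have ha' : x a * (x₀ a + x₀ b) = x₀ a * (x₀ a + x₀ b) := by
        linear_combination hside + x₀ a * (hsum' - h1 - hc)
      have ha'' : x a = x₀ a := mul_right_cancel₀ (by positivity) ha'
      rw [mem_singleton_iff]
      funext v
      by_cases hva : v = a
      · rw [hva, ha'']
      by_cases hvb : v = b
      · rw [hvb]; linarith
      by_cases hvc : v = c
      · rw [hvc, hc]
      rw [hs v hva hvb hvc, hxt v (by simp [hva, hvb, hvc])]
    refine Eventually.filter_mono nhdsWithin_le_nhds ?_
    have hcont := (continuous_apply (A := fun _ : V => ℝ) c).continuousAt (x := x)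
    rcases hne.lt_or_gt with h' | h'
    · filter_upwards [hcont.eventually (gt_mem_nhds h')] with y hy
      constructor <;> intro h'' <;> [exact absurd h'' (not_lt.mpr hy.le);
        exact absurd h'' (not_lt.mpr h'.le)]
    · filter_upwards [hcont.eventually (lt_mem_nhds h')] with y hy
      exact ⟨fun _ => h', fun _ => hy⟩
  · left
    exact (eventually_side_eq hside).filter_mono nhdsWithin_le_nhds

end TriComplex

/-! ### From the homeomorphism to combinatorics: edges, boundary and links. -/

namespace TriComplex
variable {V : Type*} [DecidableEq V] {G : TriComplex V} {a b c d : V}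

theorem not_pos_detour {x₀ : V → ℝ} {κ t σ : ℝ} {v : V} (hva : v ≠ a) (hvb : v ≠ b) (hvc : v ≠ c)
    (h : x₀ v = 0) : ¬ 0 < detour x₀ a b c κ t σ v := by
  rw [detour_other hva hvb hvc, h]; exact lt_irrefl _

/-- An edge of a triangulation of the disk lies in at most two triangles. -/
theorem IsDisk.two (hG : G.IsDisk) {c₁ c₂ c₃ : V} (h₁ : G.IsTri a b c₁) (h₂ : G.IsTri a b c₂)
    (h₃ : G.IsTri a b c₃) : c₁ = c₂ ∨ c₁ = c₃ ∨ c₂ = c₃ := by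
  by_contra! hne
  obtain ⟨hn12, hn13, hn23⟩ := hne
  obtain ⟨e, f, he, hem, hf, hfm, hef, hfe⟩ := hG.exists_param
  have hab := h₁.ne₁₂
  let x₀ : V → ℝ := Pi.single a (1 - 1 / 2) + Pi.single b (1 / 2)
  have hx₀ : x₀ ∈ G.space := edge_mem_space h₁.adj₁₂ (by constructor <;> norm_num)
  have hxa : x₀ a = 1 / 2 := by simp [x₀, hab]; norm_num
  have hxb : x₀ b = 1 / 2 := by simp [x₀, hab.symm]
  have hxs : ∀ v, v ≠ a → v ≠ b → x₀ v = 0 := fun v h1 h2 => by simp [x₀, h1, h2]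
  have ha : 0 < x₀ a := by rw [hxa]; norm_num
  have hb : 0 < x₀ b := by rw [hxb]; norm_num
  have h0 : ∀ v, 0 ≤ x₀ v := hx₀.1
  let N : Set (V → ℝ) := {x | 0 < x a} ∩ {x | 0 < x b}
  have hN : IsOpen N := (isOpen_lt continuous_const (continuous_apply a)).inter
    (isOpen_lt continuous_const (continuous_apply b))
  have hsum : x₀ a + x₀ b = 1 := by rw [hxa, hxb]; norm_num
  have hadd : ∀ c, c ≠ a → c ≠ b → LocallyAdditiveOn _ _ := fun c hca hcb =>
    locallyAdditiveOn_param he hem hfe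
      (locallyAdditiveOn_crossing_edge (G := G) hab hsum hxs c hca hcb)
  have hU : e ⁻¹' N ∈ 𝓝[Metric.closedBall 0 1] (f x₀) :=
    he _ (hfm hx₀) (hN.mem_nhds (by rw [hef _ hx₀]; exact ⟨ha, hb⟩))
  -- Three sheets at an edge would give the punctured neighbourhood of its midpoint two independent
  -- periods, while the disk allows one. The two cochains count crossings in the first and in the
  -- second sheet.
  obtain ⟨r, hr, hcomb⟩ := exists_combination_primitive (hfm hx₀) hU
    (hadd c₁ h₁.ne₁₃.symm h₁.ne₂₃.symm) (hadd c₂ h₂.ne₁₃.symm h₂.ne₂₃.symm)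
  let cs : Fin 3 → V := ![c₁, c₂, c₃]
  have hcs : ∀ j, G.IsTri a b (cs j) := by
    intro j; fin_cases j <;> assumption
  obtain ⟨t, ht, hpath⟩ := exists_small_paths hf hx₀ (fun (j : Fin 3) t σ =>
      detour x₀ a b (cs j) 1 t σ)
    (fun j => continuous_detour) (fun j σ => detour_zero)
    (fun j => detour_mem (hcs j) h0 (fun v h1 h2 _ => hxs v h1 h2)
      (by rw [hxs _ (hcs j).ne₁₃.symm (hcs j).ne₂₃.symm, hxa, hxb]; norm_num) ha hb (Or.inl rfl)) hr
  let γ : Fin 3 → ℝ → V → ℝ := fun j σ => detour x₀ a b (cs j) 1 t σ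
  have hγc : ∀ j, Continuous (γ j) := fun j =>
    continuous_detour.comp (continuous_const.prodMk continuous_id)
  have hγX : ∀ j, MapsTo (γ j) (Icc (-1) 1) G.space := fun j σ hσ => (hpath j σ hσ).1.1
  let L : Set ℂ := ⋃ j, (fun σ => f (γ j σ)) '' Icc (-1) 1
  have hL : IsCompact L := isCompact_iUnion fun j =>
    isCompact_Icc.image_of_continuousOn (hf.comp (hγc j).continuousOn (hγX j))
  have hLs : L ⊆ (Metric.closedBall (f x₀) r ∩ Metric.closedBall 0 1) \ {f x₀} := by
    rintro z hz
    obtain ⟨j, σ, hσ, rfl⟩ := mem_iUnion.mp hz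
    refine ⟨⟨(hpath j σ hσ).2, hfm (hγX j hσ)⟩, fun h => (hpath j σ hσ).1.2 ?_⟩
    rw [mem_singleton_iff] at h ⊢
    have := congrArg e h
    rwa [hef _ (hγX j hσ), hef _ hx₀] at this
  obtain ⟨p, q, hpq, g, hg⟩ := hcomb L hL hLs
  have hgX : ∀ j, IsPrimitiveOn (fun x y => p * crossing (side x₀ a b) (fun x => 0 < x c₁) x y +
      q * crossing (side x₀ a b) (fun x => 0 < x c₂) x y)
        (fun x => g (f x)) (γ j '' Icc (-1) 1) := by
    intro j
    have hsub : γ j '' Icc (-1) 1 ⊆ G.space := (hγX j).image_subset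
    have h1 := hg.comp (e := f) (T := γ j '' Icc (-1) 1) (hf.mono hsub) (by
      rintro x ⟨σ, hσ, rfl⟩
      exact mem_iUnion.mpr ⟨j, σ, hσ, rfl⟩)
    intro x hx
    filter_upwards [h1 x hx, self_mem_nhdsWithin] with y hy hyX
    simpa only [hef _ (hsub hx), hef _ (hsub hyX)] using hy
  have hpos : ∀ j σ, |σ| < 1 → 0 < γ j σ (cs j) := by
    intro j σ hσ
    simp only [γ]
    rw [detour_c (hcs j).ne₁₃ (hcs j).ne₂₃, hxs _ (hcs j).ne₁₃.symm (hcs j).ne₂₃.symm]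
    have : 0 < 1 - |σ| := by linarith
    positivity
  have hchange : ∀ (j : Fin 3) (ε : ZMod 2),
      (∀ σ τ : ℝ, |σ| < 1 → |τ| < 1 → 0 < τ → ¬ 0 < σ →
        p * crossing (side x₀ a b) (fun x => 0 < x c₁) (γ j σ) (γ j τ) +
          q * crossing (side x₀ a b) (fun x => 0 < x c₂) (γ j σ) (γ j τ) = ε) →
      g (f (γ j (-1))) + g (f (γ j 1)) = ε := by
    intro j ε hε
    refine primitive_change (hgX j) (hγc j) (mapsTo_image _ _) (fun σ τ hστ => ?_) hε
    rw [crossing_detour_zero (hcs j) ha hb ht hστ, crossing_detour_zero (hcs j) ha hb ht hστ]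
    ring
  have hT : ∀ j c, cs j = c → ∀ σ τ : ℝ, |σ| < 1 → |τ| < 1 → 0 < τ → ¬ 0 < σ →
      crossing (side x₀ a b) (fun x => 0 < x c) (γ j σ) (γ j τ) = 1 := by
    rintro j c rfl σ τ hσ hτ hτ0 hσ0
    exact crossing_detour_of_true (hcs j) ha hb ht hτ0 hσ0 (hpos j σ hσ) (hpos j τ hτ)
  have hF : ∀ j c, G.IsTri a b c → c ≠ cs j → ∀ σ τ : ℝ,
      crossing (side x₀ a b) (fun x => 0 < x c) (γ j σ) (γ j τ) = 0 := by
    intro j c hc hne σ τ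
    exact crossing_of_false (not_pos_detour hc.ne₁₃.symm hc.ne₂₃.symm hne
      (hxs _ hc.ne₁₃.symm hc.ne₂₃.symm))
  -- The three paths have common ends, so the primitive changes equally along them. The changes are
  -- `p`, `q` and 0, and the combination would be trivial.
  have k0 := hchange 0 p fun σ τ hσ hτ hτ0 hσ0 => by
    rw [hT 0 c₁ rfl σ τ hσ hτ hτ0 hσ0, hF 0 c₂ h₂ hn12.symm]; ring
  have k1 := hchange 1 q fun σ τ hσ hτ hτ0 hσ0 => by
    rw [hT 1 c₂ rfl σ τ hσ hτ hτ0 hσ0, hF 1 c₁ h₁ hn12]; ring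
  have k2 := hchange 2 0 fun σ τ hσ hτ hτ0 hσ0 => by
    rw [hF 2 c₂ h₂ hn23, hF 2 c₁ h₁ hn13]; ring
  have e1 : ∀ j, γ j 1 = γ 0 1 := fun j => detour_end (by simp)
  have e2 : ∀ j, γ j (-1) = γ 0 (-1) := fun j => detour_end (by simp)
  rw [e1, e2] at k1 k2
  exact hpq ⟨k0.symm.trans k2, k1.symm.trans k2⟩

/-- At a point of the unit circle, no two paths around a point are separated by a cochain. -/
theorem no_crossing_on_circle {e : ℂ → V → ℝ} {f : (V → ℝ) → ℂ}
    (he : ContinuousOn e (Metric.closedBall 0 1)) (hem : MapsTo e (Metric.closedBall 0 1) G.space)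
    (hf : ContinuousOn f G.space) (hfm : MapsTo f G.space (Metric.closedBall 0 1))
    (hef : ∀ x ∈ G.space, e (f x) = x) (hfe : ∀ z ∈ Metric.closedBall (0 : ℂ) 1, f (e z) = z)
    {x₀ : V → ℝ} (hx₀ : x₀ ∈ G.space) (hnorm : ‖f x₀‖ = 1) {N : Set (V → ℝ)} (hN : IsOpen N)
    (hx₀N : x₀ ∈ N) {H : (V → ℝ) → Prop}
    (hadd : LocallyAdditiveOn (crossing (side x₀ a b) H) ((N ∩ G.space) \ {x₀}))
    (ha : 0 < x₀ a) (hb : 0 < x₀ b) {c₁ c₂ : V} {κ₁ κ₂ : ℝ} (h₁ : G.IsTri a b c₁)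
    (h₂ : G.IsTri a b c₂)
    (hm₁ : ∀ᶠ t in 𝓝[>] (0 : ℝ), ∀ σ ∈ Icc (-1 : ℝ) 1, detour x₀ a b c₁ κ₁ t σ ∈ G.space \ {x₀})
    (hm₂ : ∀ᶠ t in 𝓝[>] (0 : ℝ), ∀ σ ∈ Icc (-1 : ℝ) 1, detour x₀ a b c₂ κ₂ t σ ∈ G.space \ {x₀})
    (hH₁ : ∀ t σ : ℝ, 0 < t → |σ| < 1 → H (detour x₀ a b c₁ κ₁ t σ))
    (hH₂ : ∀ t σ : ℝ, 0 < t → |σ| < 1 → ¬ H (detour x₀ a b c₂ κ₂ t σ)) : False := by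
  have hU : e ⁻¹' N ∈ 𝓝[Metric.closedBall 0 1] (f x₀) :=
    he _ (hfm hx₀) (hN.mem_nhds (by rw [hef _ hx₀]; exact hx₀N))
  obtain ⟨ε, hε, hεU⟩ := Metric.mem_nhdsWithin_iff.mp hU
  let cs : Fin 2 → V := ![c₁, c₂]
  let κs : Fin 2 → ℝ := ![κ₁, κ₂]
  have hcs : ∀ j, G.IsTri a b (cs j) := by
    intro j; fin_cases j <;> assumption
  obtain ⟨t, ht, hpath⟩ := exists_small_paths hf hx₀
    (fun (j : Fin 2) t σ => detour x₀ a b (cs j) (κs j) t σ)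
    (fun j => continuous_detour) (fun j σ => detour_zero)
    (fun j => by fin_cases j <;> assumption) (half_pos hε)
  let γ : Fin 2 → ℝ → V → ℝ := fun j σ => detour x₀ a b (cs j) (κs j) t σ
  have hγc : ∀ j, Continuous (γ j) := fun j =>
    continuous_detour.comp (continuous_const.prodMk continuous_id)
  have hγX : ∀ j, MapsTo (γ j) (Icc (-1) 1) G.space := fun j σ hσ => (hpath j σ hσ).1.1
  let L : Set ℂ := ⋃ j, (fun σ => f (γ j σ)) '' Icc (-1) 1
  have hL : IsCompact L := isCompact_iUnion fun j =>
    isCompact_Icc.image_of_continuousOn (hf.comp (hγc j).continuousOn (hγX j))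
  have hLs : L ⊆ (Metric.closedBall (f x₀) (ε / 2) ∩ Metric.closedBall 0 1) \ {f x₀} := by
    rintro z hz
    obtain ⟨j, σ, hσ, rfl⟩ := mem_iUnion.mp hz
    refine ⟨⟨(hpath j σ hσ).2, hfm (hγX j hσ)⟩, fun h => (hpath j σ hσ).1.2 ?_⟩
    rw [mem_singleton_iff] at h ⊢
    have := congrArg e h
    rwa [hef _ (hγX j hσ), hef _ hx₀] at this
  have hadd' := (locallyAdditiveOn_param he hem hfe hadd).mono
    (T := (Metric.closedBall (f x₀) (ε / 2) ∩ Metric.closedBall 0 1) \ {f x₀}) (by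
      rintro z ⟨⟨hz, hz1⟩, hzp⟩
      refine ⟨⟨hεU ⟨?_, hz1⟩, hz1⟩, hzp⟩
      exact Metric.mem_ball.mpr (lt_of_le_of_lt hz (by linarith)))
  obtain ⟨g, hg⟩ := hadd'.exists_primitive_of_norm_eq_one hnorm hL hLs
  have hgX : ∀ j, IsPrimitiveOn (crossing (side x₀ a b) H) (fun x => g (f x))
      (γ j '' Icc (-1) 1) := by
    intro j
    have hsub : γ j '' Icc (-1) 1 ⊆ G.space := (hγX j).image_subset
    have h1 := hg.comp (e := f) (T := γ j '' Icc (-1) 1) (hf.mono hsub) (by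
      rintro x ⟨σ, hσ, rfl⟩
      exact mem_iUnion.mpr ⟨j, σ, hσ, rfl⟩)
    intro x hx
    filter_upwards [h1 x hx, self_mem_nhdsWithin] with y hy hyX
    simpa only [hef _ (hsub hx), hef _ (hsub hyX)] using hy
  have k0 := primitive_change (hgX 0) (hγc 0) (mapsTo_image _ _) (ε := 1)
    (fun σ τ hστ => crossing_detour_zero (hcs 0) ha hb ht hστ)
    (fun σ τ hσ hτ hτ0 hσ0 => crossing_detour_of_true (hcs 0) ha hb ht hτ0 hσ0
      (hH₁ t σ ht hσ) (hH₁ t τ ht hτ))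
  have k1 := primitive_change (hgX 1) (hγc 1) (mapsTo_image _ _) (ε := 0)
    (fun σ τ hστ => crossing_detour_zero (hcs 1) ha hb ht hστ)
    (fun σ τ hσ hτ hτ0 hσ0 => crossing_of_false (hH₂ t σ ht hσ))
  have e1 : γ 1 1 = γ 0 1 := detour_end (by simp)
  have e2 : γ 1 (-1) = γ 0 (-1) := detour_end (by simp)
  rw [e1, e2, k0] at k1
  exact one_ne_zero k1

/-- A triangulation of the disk has a boundary edge. -/
theorem IsDisk.bdry (hG : G.IsDisk) : ∃ a b, G.BoundaryEdge a b := by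
  by_contra! hbd
  obtain ⟨e, f, he, hem, hf, hfm, hef, hfe⟩ := hG.exists_param
  -- The circle is infinite and the vertices are finitely many, so some point of the circle lies in
  -- the interior of an edge or of a triangle.
  have hinf : (Metric.sphere (0 : ℂ) 1).Infinite := by
    refine infinite_of_injective_forall_mem (f := fun n : ℕ =>
      Complex.exp ((1 / (n + 1) : ℝ) * Complex.I)) ?_ ?_
    · intro m n hmn
      have h1 : ∀ n : ℕ, (0 : ℝ) < 1 / (n + 1) := fun n => by positivity
      have h2 : ∀ n : ℕ, (1 : ℝ) / (n + 1) ≤ 1 := fun n => by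
        rw [div_le_one (by positivity)]; linarith [(Nat.cast_nonneg n : (0 : ℝ) ≤ n)]
      have := Real.pi_gt_three
      have h3 : ∀ n : ℕ, (Complex.exp ((1 / (n + 1) : ℝ) * Complex.I)).arg = 1 / (n + 1) := by
        intro n
        rw [Complex.exp_mul_I]
        exact Complex.arg_cos_add_sin_mul_I ⟨by linarith [h1 n], by linarith [h2 n]⟩
      have h4 := (h3 m).symm.trans ((congrArg Complex.arg hmn).trans (h3 n))
      field_simp at h4
      have h5 : (m : ℝ) = n := by linarith
      exact_mod_cast h5
    · intro n
      simp only [mem_sphere_zero_iff_norm]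
      exact Complex.norm_exp_ofReal_mul_I _
  obtain ⟨p, hp, hpv⟩ := hinf.exists_notMem_finset
    ((G.faces.biUnion id).image fun v => f (Pi.single v 1))
  have hp1 : ‖p‖ = 1 := by simpa using hp
  have hpD : p ∈ Metric.closedBall (0 : ℂ) 1 := Metric.sphere_subset_closedBall hp
  set x₀ := e p with hx₀def
  have hx₀ : x₀ ∈ G.space := hem hpD
  have hfx : f x₀ = p := hfe p hpD
  have hnorm : ‖f x₀‖ = 1 := by rw [hfx, hp1]
  have hx₀' := hx₀
  obtain ⟨h0, t, ht, hxt, hsum⟩ := hx₀'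
  obtain ⟨a, ha⟩ := exists_large_coord hx₀
  replace ha : 0 < x₀ a := by linarith
  have hat : a ∈ t := by_contra fun h => ha.ne' (hxt a h)
  obtain ⟨b, hb, hba⟩ : ∃ b, 0 < x₀ b ∧ b ≠ a := by
    by_contra! h
    have hz : ∀ v, v ≠ a → x₀ v = 0 := fun v hv => by
      by_contra hne
      exact hv (h v (lt_of_le_of_ne (h0 v) (Ne.symm hne)))
    have h1 : x₀ a = 1 := by
      rw [← hsum]
      exact (Finset.sum_eq_single a (fun v _ hv => hz v hv) (fun h => (h hat).elim)).symm
    have h2 : x₀ = Pi.single a 1 := by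
      funext v
      by_cases hv : v = a
      · subst hv; simp [h1]
      · simp [hv, hz v hv]
    refine hpv (Finset.mem_image.mpr ⟨a, Finset.mem_biUnion.mpr ⟨t, ht, hat⟩, ?_⟩)
    rw [← h2, hfx]
  have hbt : b ∈ t := by_contra fun h => hb.ne' (hxt b h)
  obtain ⟨c, rfl, hc⟩ := exists_eq_of_mem_face₂ ht hat hbt hba.symm
  have hsum' : x₀ a + x₀ b + x₀ c = 1 := by
    rw [← hsum, Finset.sum_insert (by simp [hc.ne₁₂, hc.ne₁₃]), Finset.sum_pair hc.ne₂₃, add_assoc]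
  have hs : ∀ v, v ≠ a → v ≠ b → v ≠ c → x₀ v = 0 := fun v h1 h2 h3 => hxt v (by simp [h1, h2, h3])
  have oa : ∀ v : V, IsOpen {x : V → ℝ | 0 < x v} := fun v =>
    isOpen_lt continuous_const (continuous_apply v)
  -- In a triangle, or on an edge with two triangles, the two detours form a loop that a crossing
  -- cochain detects; no cochain detects a loop around a point of the circle.
  rcases (h0 c).lt_or_eq with hxc | hxc
  · refine no_crossing_on_circle he hem hf hfm hef hfe hx₀ hnorm
      (((oa a).inter (oa b)).inter (oa c)) ⟨⟨ha, hb⟩, hxc⟩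
      (locallyAdditiveOn_crossing_triangle hc hsum' ha hb hs) ha hb hc hc
      (detour_mem hc h0 hs hsum' ha hb (Or.inl rfl))
      (detour_mem hc h0 hs hsum' ha hb (Or.inr ⟨rfl, hxc⟩)) ?_ ?_
    · intro t σ ht hσ
      rw [detour_c hc.ne₁₃ hc.ne₂₃]
      have : 0 < 1 - |σ| := by linarith
      have : 0 < t * (1 * (1 - |σ|) * (x₀ a + x₀ b)) := by positivity
      linarith
    · intro t σ ht hσ
      rw [detour_c hc.ne₁₃ hc.ne₂₃]
      have : 0 < 1 - |σ| := by linarith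
      have : 0 < t * (1 * (1 - |σ|) * (x₀ a + x₀ b)) := by positivity
      nlinarith
  · have hs' : ∀ v, v ≠ a → v ≠ b → x₀ v = 0 := by
      intro v h1 h2
      by_cases h3 : v = c
      · rw [h3, ← hxc]
      · exact hs v h1 h2 h3
    have hnb := hbd a b
    rw [boundaryEdge_iff] at hnb
    push Not at hnb
    obtain ⟨d, hd, hdc⟩ := hnb c hc
    have hsum2 : x₀ a + x₀ b = 1 := by linarith
    refine no_crossing_on_circle he hem hf hfm hef hfe hx₀ hnorm ((oa a).inter (oa b)) ⟨ha, hb⟩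
      (locallyAdditiveOn_crossing_edge hba.symm hsum2 hs' c hc.ne₁₃.symm hc.ne₂₃.symm)
      ha hb hc hd (detour_mem hc h0 hs hsum' ha hb (Or.inl rfl))
      (detour_mem hd h0 (fun v h1 h2 _ => hs' v h1 h2)
        (by rw [hs' d hd.ne₁₃.symm hd.ne₂₃.symm, hsum2, add_zero]) ha hb (Or.inl rfl)) ?_ ?_
    · intro t σ ht hσ
      rw [detour_c hc.ne₁₃ hc.ne₂₃]
      have : 0 < 1 - |σ| := by linarith
      have : 0 < t * (1 * (1 - |σ|) * (x₀ a + x₀ b)) := by positivity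
      linarith
    · intro t σ ht hσ
      exact not_pos_detour hc.ne₁₃.symm hc.ne₂₃.symm hdc.symm hxc.symm

/-- The links of the vertices of a triangulation of the disk are connected. -/
theorem IsDisk.link (hG : G.IsDisk) {v : V} {S : Set V} (hva : G.graph.Adj v a) (haS : a ∈ S)
    (hS : ∀ a b, G.IsTri v a b → a ∈ S → b ∈ S) (b : V) (hvb : G.graph.Adj v b) : b ∈ S := by
  obtain ⟨e, f, he, hem, hf, hfm, hef, hfe⟩ := hG.exists_param
  let x₀ : V → ℝ := Pi.single v 1
  have hx₀ : x₀ ∈ G.space := single_mem_space (isVertex_iff.mpr ⟨a, hva⟩)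
  have hev : ∀ᶠ z in 𝓝[Metric.closedBall 0 1] (f x₀), 0 < e z v := by
    have h1 := he _ (hfm hx₀)
    rw [ContinuousWithinAt, hef _ hx₀] at h1
    have h2 : ∀ᶠ y in 𝓝 x₀, 0 < y v :=
      (continuous_apply v).continuousAt.eventually (lt_mem_nhds (by simp [x₀]))
    exact h1.eventually h2
  obtain ⟨ε, hε, hεU⟩ := Metric.mem_nhdsWithin_iff.mp hev
  obtain ⟨r, hr, hrε, hconn⟩ := exists_ball_inter_diff_isPreconnected (hfm hx₀) hε
  have hpath : ∀ w, G.graph.Adj v w → ∃ τ : ℝ, 0 < τ ∧ τ ≤ 1 ∧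
      f (Pi.single v (1 - τ) + Pi.single w τ) ∈ (Metric.ball (f x₀) r ∩ Metric.closedBall 0 1) \
        {f x₀} := by
    intro w hw
    have hcont : ContinuousOn (fun τ : ℝ => f (Pi.single v (1 - τ) + Pi.single w τ)) (Icc 0 1) := by
      refine hf.comp (Continuous.continuousOn ?_) fun τ hτ => edge_mem_space hw hτ
      refine Continuous.add ?_ ?_
      · exact (continuous_single (A := fun _ : V => ℝ) v).comp (continuous_const.sub continuous_id)
      · exact continuous_single (A := fun _ : V => ℝ) w
    have h1 := hcont 0 (by simp)
    have h2 : (fun τ : ℝ => f (Pi.single v (1 - τ) + Pi.single w τ)) ⁻¹' Metric.ball (f x₀) r ∈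
        𝓝[Icc 0 1] (0 : ℝ) := by
      refine h1 ?_
      simp only [sub_zero, Pi.single_zero, add_zero]
      exact Metric.ball_mem_nhds _ hr
    obtain ⟨δ, hδ, hδs⟩ := Metric.mem_nhdsWithin_iff.mp h2
    have hτ1 : min (δ / 2) 1 ≤ 1 := min_le_right _ _
    have hτ0 : 0 < min (δ / 2) 1 := lt_min (half_pos hδ) one_pos
    have hτδ : min (δ / 2) 1 < δ := lt_of_le_of_lt (min_le_left _ _) (by linarith)
    refine ⟨min (δ / 2) 1, hτ0, hτ1, ?_⟩
    generalize min (δ / 2) 1 = τ at *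
    have hX := edge_mem_space hw ⟨hτ0.le, hτ1⟩
    refine ⟨⟨hδs ⟨?_, ⟨hτ0.le, hτ1⟩⟩, hfm hX⟩, fun h => ?_⟩
    · rw [Metric.mem_ball, dist_zero_right, Real.norm_of_nonneg hτ0.le]; exact hτδ
    · rw [mem_singleton_iff] at h
      have h3 := congrArg e h
      rw [hef _ hX, hef _ hx₀] at h3
      have h4 := congrFun h3 w
      simp [x₀, hw.ne'] at h4
      exact hτ0.ne' h4
  have hSname : ∀ w τ : ℝ, ∀ u, G.graph.Adj v u → 0 < τ →
      ((∃ w ∈ S, w ≠ v ∧ 0 < (Pi.single v (1 - τ) + Pi.single u τ : V → ℝ) w) ↔ u ∈ S) := by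
    intro _ τ u hu hτ
    constructor
    · rintro ⟨w, hw, hwv, hpos⟩
      by_cases h : w = u
      · rwa [← h]
      · simp [hwv, h] at hpos
    · intro hu'
      exact ⟨u, hu', hu.ne', by simp [hu.ne', hτ]⟩
  obtain ⟨τ, hτ0, hτ1, hτ⟩ := hpath a hva
  obtain ⟨τ', hτ0', hτ1', hτ'⟩ := hpath b hvb
  -- On the punctured neighbourhood of `v`, which is connected, it is locally constant whether the
  -- point has positive weight at an element of `S` other than `v`.
  have key := hconn.eq_of_eventually_eq (g := fun z => ∃ w ∈ S, w ≠ v ∧ 0 < e z w) ?_ hτ hτ'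
  · beta_reduce at key
    rw [hef _ (edge_mem_space hva ⟨hτ0.le, hτ1⟩), hef _ (edge_mem_space hvb ⟨hτ0'.le, hτ1'⟩)] at key
    rw [hSname 0 τ a hva hτ0, hSname 0 τ' b hvb hτ0'] at key
    exact key.mp haS
  · rintro z ⟨⟨hz, hz1⟩, hzp⟩
    have hzv : 0 < e z v := hεU ⟨Metric.ball_subset_ball hrε hz, hz1⟩
    have hne : e z ≠ x₀ := fun h => hzp (by rw [mem_singleton_iff, ← h, hfe z hz1])
    obtain ⟨h0, t, ht, hxt, hsum⟩ := hem hz1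
    have hvt : v ∈ t := by_contra fun h => hzv.ne' (hxt v h)
    obtain ⟨u, hu, huv⟩ : ∃ u, 0 < e z u ∧ u ≠ v := by
      by_contra! h
      have hz : ∀ w, w ≠ v → e z w = 0 := fun w hw => by
        by_contra hne
        exact hw (h w (lt_of_le_of_ne (h0 w) (Ne.symm hne)))
      have h1 : e z v = 1 := by
        rw [← hsum]
        exact (Finset.sum_eq_single v (fun w _ hw => hz w hw) (fun h => (h hvt).elim)).symm
      refine hne (funext fun w => ?_)
      by_cases hw : w = v
      · subst hw; simp [h1, x₀]
      · simp [hw, hz w hw, x₀]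
    have hiff : ∀ z ∈ Metric.closedBall (0 : ℂ) 1, 0 < e z v → 0 < e z u →
        ((∃ w ∈ S, w ≠ v ∧ 0 < e z w) ↔ u ∈ S) := by
      intro z hz hzv hu
      constructor
      · rintro ⟨w, hw, hwv, hpos⟩
        by_cases hwu : w = u
        · rwa [← hwu]
        obtain ⟨-, s, hs, hxs, -⟩ := hem hz
        have hvs : v ∈ s := by_contra fun h => hzv.ne' (hxs v h)
        have hus : u ∈ s := by_contra fun h => hu.ne' (hxs u h)
        have hws : w ∈ s := by_contra fun h => hpos.ne' (hxs w h)
        obtain ⟨d, rfl, hd⟩ := exists_eq_of_mem_face₂ hs hvs hws hwv.symm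
        have : u = d := by
          simp only [Finset.mem_insert, Finset.mem_singleton] at hus
          grind
        subst this
        exact hS _ _ hd hw
      · intro h
        exact ⟨u, h, huv, hu⟩
    have hcont : ContinuousWithinAt (fun z => e z u)
        ((Metric.ball (f x₀) r ∩ Metric.closedBall 0 1) \ {f x₀}) z :=
      ((continuous_apply u).continuousAt.comp_continuousWithinAt (he z hz1)).mono fun w hw => hw.1.2
    filter_upwards [hcont.eventually (lt_mem_nhds hu), self_mem_nhdsWithin] with w hw hwm
    refine propext ?_
    rw [hiff z hz1 hzv hu, hiff w hwm.1.2 (hεU ⟨Metric.ball_subset_ball hrε hwm.1.1, hwm.1.2⟩) hw]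

theorem IsDisk.isCombDisk (hG : G.IsDisk) : G.IsCombDisk where
  two := hG.two
  link := hG.link
  conn := hG.conn
  h1 := hG.h1
  bdry := hG.bdry

end TriComplex

/-! ### Homeomorphisms by gluing compact pieces. -/

/-- The correspondence between `K ∪ S` and `K ∪ F` that is the identity on `K` and is given by the
coincidence of `LS` and `LF` on `S` and `F`. -/
def gluingRel {E Z : Type*} (K S F : Set E) (LS LF : E → Z) : Set (E × E) :=
  (fun x => (x, x)) '' K ∪ {q ∈ S ×ˢ F | LS q.1 = LF q.2}

theorem isCompact_gluingRel {E Z : Type*} [TopologicalSpace E] [T2Space E] [TopologicalSpace Z]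
    [T2Space Z] {K S F : Set E} (hK : IsCompact K) (hS : IsCompact S) (hF : IsCompact F)
    {LS LF : E → Z} (cS : Continuous LS) (cF : Continuous LF) :
    IsCompact (gluingRel K S F LS LF) := by
  refine (hK.image (continuous_id.prodMk continuous_id)).union ?_
  have : IsClosed {q : E × E | LS q.1 = LF q.2} :=
    isClosed_eq (cS.comp continuous_fst) (cF.comp continuous_snd)
  exact (hS.prod hF).inter_right this

/-- The first projection is a continuous bijection from a compact space to a Hausdorff space.
Working with the relation avoids the construction of the map from `S` to `F` and the proof that it
is continuous. -/
theorem nonempty_gluingRel_homeomorph {E Z : Type*} [TopologicalSpace E] [T2Space E]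
    [TopologicalSpace Z] [T2Space Z] {K S F : Set E} (hK : IsCompact K) (hS : IsCompact S)
    (hF : IsCompact F) {LS LF : E → Z} (cS : Continuous LS) (cF : Continuous LF)
    (iF : InjOn LF F) (himg : LS '' S ⊆ LF '' F) (hKS : K ∩ S ⊆ K ∩ F)
    (hag : ∀ x ∈ K ∩ S, LS x = LF x) :
    Nonempty (gluingRel K S F LS LF ≃ₜ ↥(K ∪ S)) := by
  have hm : ∀ q ∈ gluingRel K S F LS LF, q.1 ∈ K ∪ S := by
    rintro q (⟨x, hx, rfl⟩ | ⟨hq, -⟩)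
    · exact Or.inl hx
    · exact Or.inr hq.1
  let φ : gluingRel K S F LS LF → ↥(K ∪ S) := fun q => ⟨q.1.1, hm q.1 q.2⟩
  have hφ : Continuous φ := by fun_prop
  have hbij : Function.Bijective φ := by
    constructor
    · rintro ⟨⟨x, y⟩, hq⟩ ⟨⟨x', y'⟩, hq'⟩ h
      obtain rfl : x = x' := congrArg Subtype.val h
      have hmix : ∀ y, x ∈ K → (x, y) ∈ S ×ˢ F → LS x = LF y → y = x := by
        intro y hxK hxy h
        exact iF hxy.2 (hKS ⟨hxK, hxy.1⟩).2 (h.symm.trans (hag x ⟨hxK, hxy.1⟩))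
      have : y = y' := by
        rcases hq with ⟨w, hw, hw'⟩ | ⟨h1, h2⟩ <;> rcases hq' with ⟨z, hz, hz'⟩ | ⟨h3, h4⟩
        · simp only [Prod.mk.injEq] at hw' hz'
          rw [← hw'.2, ← hz'.2, hw'.1, hz'.1]
        · simp only [Prod.mk.injEq] at hw'
          rw [hmix y' (hw'.1 ▸ hw) h3 h4, ← hw'.2, hw'.1]
        · simp only [Prod.mk.injEq] at hz'
          rw [hmix y (hz'.1 ▸ hz) h1 h2, ← hz'.2, hz'.1]
        · exact iF h1.2 h3.2 (h2.symm.trans h4)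
      subst this
      rfl
    · rintro ⟨x, hx | hx⟩
      · exact ⟨⟨(x, x), Or.inl ⟨x, hx, rfl⟩⟩, rfl⟩
      · obtain ⟨y, hy, h⟩ := himg ⟨x, hx, rfl⟩
        exact ⟨⟨(x, y), Or.inr ⟨⟨hx, hy⟩, h.symm⟩⟩, rfl⟩
  have : CompactSpace (gluingRel K S F LS LF) :=
    isCompact_iff_compactSpace.mp (isCompact_gluingRel hK hS hF cS cF)
  exact ⟨Continuous.homeoOfEquivCompactToT2 (f := Equiv.ofBijective φ hbij) hφ⟩

/-- Two compact sets are homeomorphic if they arise by gluing to a common part two pieces that are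
identified by injective maps into a common space. -/
theorem nonempty_homeomorph_of_gluing {E Z : Type*} [TopologicalSpace E] [T2Space E]
    [TopologicalSpace Z] [T2Space Z] {K S F : Set E} (hK : IsCompact K) (hS : IsCompact S)
    (hF : IsCompact F) {LS LF : E → Z} (cS : Continuous LS) (cF : Continuous LF)
    (iS : InjOn LS S) (iF : InjOn LF F) (himg : LS '' S = LF '' F) (hKS : K ∩ S = K ∩ F)
    (hag : ∀ x ∈ K ∩ S, LS x = LF x) : Nonempty (↥(K ∪ S) ≃ₜ ↥(K ∪ F)) := by
  obtain ⟨h₁⟩ := nonempty_gluingRel_homeomorph hK hS hF cS cF iF himg.subset hKS.subset hag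
  obtain ⟨h₂⟩ := nonempty_gluingRel_homeomorph hK hF hS cF cS iS himg.symm.subset hKS.symm.subset
    (fun x hx => (hag x (hKS ▸ hx)).symm)
  refine ⟨h₁.symm.trans (Homeomorph.trans ?_ h₂)⟩
  refine (Homeomorph.prodComm E E).subtype fun q => ?_
  constructor
  · rintro (⟨x, hx, rfl⟩ | ⟨h, h'⟩)
    · exact Or.inl ⟨x, hx, rfl⟩
    · exact Or.inr ⟨⟨h.2, h.1⟩, h'.symm⟩
  · rintro (⟨x, hx, hq⟩ | ⟨h, h'⟩)
    · refine Or.inl ⟨x, hx, ?_⟩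
      have h1 := congrArg Prod.fst hq
      have h2 := congrArg Prod.snd hq
      exact Prod.ext h2 h1
    · exact Or.inr ⟨⟨h.2, h.1⟩, h'.symm⟩

/-- The underlying space of a family of simplices. -/
def realization {V : Type*} (A : Finset (Finset V)) : Set (V → ℝ) :=
  {x | (∀ v, 0 ≤ x v) ∧ ∃ t ∈ A, (∀ v, v ∉ t → x v = 0) ∧ ∑ v ∈ t, x v = 1}

theorem isCompact_realization {V : Type*} (A : Finset (Finset V)) : IsCompact (realization A) := by
  have : realization A = ⋃ t ∈ A, (univ.pi (fun _ => Icc (0 : ℝ) 1) ∩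
      ({x | ∀ v, v ∉ t → x v = 0} ∩ {x | ∑ v ∈ t, x v = 1})) := by
    ext x
    simp only [realization, mem_ofPred_eq, mem_iUnion, mem_inter_iff, mem_univ_pi, mem_Icc,
      exists_prop]
    constructor
    · rintro ⟨h0, t, ht, h1, h2⟩
      refine ⟨t, ht, fun v => ⟨h0 v, ?_⟩, h1, h2⟩
      by_cases hv : v ∈ t
      · rw [← h2]; exact Finset.single_le_sum (fun w _ => h0 w) hv
      · rw [h1 v hv]; exact zero_le_one
    · rintro ⟨t, ht, h0, h1, h2⟩
      exact ⟨fun v => (h0 v).1, t, ht, h1, h2⟩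
  rw [this]
  refine A.isCompact_biUnion fun t _ => (isCompact_univ_pi fun _ => isCompact_Icc).inter_right ?_
  refine IsClosed.inter ?_ (isClosed_eq (continuous_finsetSum _ fun v _ => continuous_apply v)
    continuous_const)
  have : {x : V → ℝ | ∀ v, v ∉ t → x v = 0} = ⋂ v, ⋂ (_ : v ∉ t), {x | x v = 0} := by
    ext x; simp
  rw [this]
  exact isClosed_iInter fun v => isClosed_iInter fun _ =>
    isClosed_eq (continuous_apply v) continuous_const

theorem realization_union {V : Type*} [DecidableEq V] (A B : Finset (Finset V)) :
    realization (A ∪ B) = realization A ∪ realization B := by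
  ext x
  simp only [realization, Finset.mem_union, mem_ofPred_eq, mem_union]
  constructor
  · rintro ⟨h, t, ht | ht, h'⟩
    · exact Or.inl ⟨h, t, ht, h'⟩
    · exact Or.inr ⟨h, t, ht, h'⟩
  · rintro (⟨h, t, ht, h'⟩ | ⟨h, t, ht, h'⟩)
    · exact ⟨h, t, Or.inl ht, h'⟩
    · exact ⟨h, t, Or.inr ht, h'⟩

theorem sum_eq_of_support {V : Type*} [DecidableEq V] {x : V → ℝ} {s t : Finset V}
    (hs : ∀ v, v ∉ s → x v = 0) (ht : ∀ v, v ∉ t → x v = 0) : ∑ v ∈ s, x v = ∑ v ∈ t, x v := by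
  rw [Finset.sum_subset (Finset.subset_union_left (s₂ := t)) fun v _ h => hs v h,
    Finset.sum_subset (Finset.subset_union_right (s₁ := s)) fun v _ h => ht v h]

theorem mem_realization_of_support {V : Type*} [DecidableEq V] {A B : Finset (Finset V)}
    {x : V → ℝ} (hx : x ∈ realization A) {t : Finset V} (ht : t ∈ B)
    (h : ∀ v, v ∉ t → x v = 0) : x ∈ realization B := by
  obtain ⟨h0, s, -, hs, h1⟩ := hx
  exact ⟨h0, t, ht, h, by rw [← h1, sum_eq_of_support h hs]⟩

/-! ### Sequences supported at two consecutive places -/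

theorem sum_of_consecutive {z : ℕ → ℝ} {k i : ℕ} (hi : i < k)
    (hz : ∀ j ≤ k, j ≠ i → j ≠ i + 1 → z j = 0) (w : ℕ → ℝ) :
    ∑ j ∈ Finset.range (k + 1), w j * z j = w i * z i + w (i + 1) * z (i + 1) := by
  rw [← Finset.sum_pair (f := fun j => w j * z j) (Nat.ne_of_lt (Nat.lt_succ_self i))]
  symm
  refine Finset.sum_subset (fun j hj => ?_) fun j hj hj' => ?_
  · simp only [Finset.mem_insert, Finset.mem_singleton] at hj
    exact Finset.mem_range.mpr (by omega)
  · simp only [Finset.mem_insert, Finset.mem_singleton, not_or] at hj'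
    rw [hz j (by have := Finset.mem_range.mp hj; omega) hj'.1 hj'.2, mul_zero]

/-- Total mass and first moment determine such a sequence: if `i < i'`, the moment of `z` is at most
`i + 1` times the mass, that of `z'` at least `i'` times the mass, and equality puts all mass at a
common place. -/
theorem consecutive_unique {z z' : ℕ → ℝ} {k i i' : ℕ} (hi : i < k) (hi' : i' < k)
    (h0 : ∀ j, 0 ≤ z j) (h0' : ∀ j, 0 ≤ z' j)
    (hz : ∀ j ≤ k, j ≠ i → j ≠ i + 1 → z j = 0) (hz' : ∀ j ≤ k, j ≠ i' → j ≠ i' + 1 → z' j = 0)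
    (hT : z i + z (i + 1) = z' i' + z' (i' + 1))
    (hM : i * z i + (i + 1) * z (i + 1) = i' * z' i' + (i' + 1) * z' (i' + 1)) (j : ℕ)
      (hj : j ≤ k) :
    z j = z' j := by
  wlog h : i ≤ i' generalizing z z' i i'
  · exact (this hi' hi h0' h0 hz' hz hT.symm hM.symm (le_of_not_ge h)).symm
  have a1 := h0 i; have a2 := h0 (i + 1); have a3 := h0' i'; have a4 := h0' (i' + 1)
  rcases h.lt_or_eq with h | rfl
  · have h' : (i : ℝ) + 1 ≤ i' := by exact_mod_cast h
    have b1 : z i = 0 ∧ z' (i' + 1) = 0 := by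
      constructor <;> nlinarith
    have b3 : z (i + 1) = z' i' := by linarith [b1.1, b1.2]
    by_cases hT0 : z' i' = 0
    · have h1 : z j = 0 := by
        by_cases e1 : j = i
        · rw [e1, b1.1]
        by_cases e2 : j = i + 1
        · rw [e2, b3, hT0]
        exact hz j hj e1 e2
      have h2 : z' j = 0 := by
        by_cases e1 : j = i'
        · rw [e1, hT0]
        by_cases e2 : j = i' + 1
        · rw [e2, b1.2]
        exact hz' j hj e1 e2
      rw [h1, h2]
    · have h3 : 0 < z' i' := lt_of_le_of_ne a3 (Ne.symm hT0)
      rw [b1.1, b1.2, b3] at hM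
      have h4 : ((i : ℝ) + 1 - i') * z' i' = 0 := by linarith
      have h5 : (i : ℝ) + 1 = i' := by
        have := (mul_eq_zero.mp h4).resolve_right hT0
        linarith
      obtain rfl : i + 1 = i' := by exact_mod_cast h5
      by_cases e2 : j = i + 1
      · rw [e2, b3]
      have h1 : z j = 0 := by
        by_cases e1 : j = i
        · rw [e1, b1.1]
        exact hz j hj e1 e2
      have h2 : z' j = 0 := by
        by_cases e3 : j = i + 1 + 1
        · rw [e3, b1.2]
        exact hz' j hj e2 e3
      rw [h1, h2]
  · have b1 : z (i + 1) = z' (i + 1) := by linear_combination hM - i * hT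
    have b2 : z i = z' i := by linarith
    by_cases e1 : j = i
    · rw [e1, b2]
    by_cases e2 : j = i + 1
    · rw [e2, b1]
    rw [hz j hj e1 e2, hz' j hj e1 e2]

/-- Take the least `i` with `M ≤ (i + 1) * T`; mass and moment then determine the two weights `(i +
1) * T - M` and `M - i * T`. -/
theorem exists_consecutive {k : ℕ} (hk : 1 ≤ k) {T M : ℝ} (hM0 : 0 ≤ M) (hM : M ≤ k * T) :
    ∃ i < k, ∃ y y' : ℝ, 0 ≤ y ∧ 0 ≤ y' ∧ y + y' = T ∧ i * y + (i + 1) * y' = M := by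
  have hex : ∃ i : ℕ, M ≤ (i + 1) * T := ⟨k - 1, by rw [Nat.cast_sub hk]; push_cast; linarith⟩
  classical
  have h1 := Nat.find_spec hex
  have h2 : Nat.find hex ≤ k - 1 := Nat.find_min' hex (by
    rw [Nat.cast_sub hk]; push_cast; linarith)
  refine ⟨Nat.find hex, by omega, (Nat.find hex + 1) * T - M, M - Nat.find hex * T, by linarith,
    ?_, by ring, by ring⟩
  by_cases h0 : Nat.find hex = 0
  · rw [h0]; simpa using hM0
  · have := Nat.find_min hex (m := Nat.find hex - 1) (by omega)
    rw [Nat.cast_sub (by omega)] at this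
    push_cast at this
    linarith

theorem mem_realization_triple {V : Type*} [DecidableEq V] {A : Finset (Finset V)} {x : V → ℝ}
    {a b c : V} (hA : {a, b, c} ∈ A) (hab : a ≠ b) (hac : a ≠ c) (hbc : b ≠ c) (h0 : ∀ v, 0 ≤ x v)
    (hs : ∀ v, v ≠ a → v ≠ b → v ≠ c → x v = 0) (h1 : x a + x b + x c = 1) :
    x ∈ realization A := by
  refine ⟨h0, _, hA, fun v hv => ?_, ?_⟩
  · simp only [Finset.mem_insert, Finset.mem_singleton, not_or] at hv
    exact hs v hv.1 hv.2.1 hv.2.2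
  · rw [Finset.sum_insert (by simp [hab, hac]), Finset.sum_pair hbc, ← h1, add_assoc]

theorem sum_triple_of_support {V : Type*} [DecidableEq V] {x : V → ℝ} {a b c : V} (hab : a ≠ b)
    (hac : a ≠ c) (hbc : b ≠ c) (h1 : ∑ v ∈ ({a, b, c} : Finset V), x v = 1) :
    x a + x b + x c = 1 := by
  rw [Finset.sum_insert (by simp [hab, hac]), Finset.sum_pair hbc, ← add_assoc] at h1
  exact h1

/-! ### Star and fan as two subdivisions of one triangle. -/

/-- A path `p 0, ..., p k` in a complex, together with two vertices `u` and `v` off the path. -/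
structure ConePath {V : Type*} (u v : V) (p : ℕ → V) (k : ℕ) : Prop where
  ne : u ≠ v
  pos : 1 ≤ k
  inj : InjOn p (Iic k)
  ne_u : ∀ j ≤ k, p j ≠ u
  ne_v : ∀ j ≤ k, p j ≠ v

namespace ConePath
variable {V : Type*} [DecidableEq V] {u v : V} {p : ℕ → V} {k : ℕ}

/-- The triangles of the cone from `u` over the path. -/
def fan (u : V) (p : ℕ → V) (k : ℕ) : Finset (Finset V) :=
  (Finset.range k).image fun i => {u, p i, p (i + 1)}

theorem ne_succ (h : ConePath u v p k) {i : ℕ} (hi : i < k) : p i ≠ p (i + 1) := fun he => by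
  have := h.inj (by simp; omega : i ∈ Iic k) (by simp; omega : i + 1 ∈ Iic k) he
  omega

theorem eq_iff (h : ConePath u v p k) {i j : ℕ} (hi : i ≤ k) (hj : j ≤ k) : p i = p j ↔ i = j :=
  ⟨fun he => h.inj hi hj he, fun he => he ▸ rfl⟩

theorem mem_realization_fan (h : ConePath u v p k) {x : V → ℝ} : x ∈ realization (fan u p k) ↔
    (∀ w, 0 ≤ x w) ∧ ∃ i < k, (∀ w, w ≠ u → w ≠ p i → w ≠ p (i + 1) → x w = 0) ∧
      x u + x (p i) + x (p (i + 1)) = 1 := by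
  constructor
  · rintro ⟨h0, t, ht, hs, h1⟩
    obtain ⟨i, hi, rfl⟩ := Finset.mem_image.mp ht
    have hi := Finset.mem_range.mp hi
    refine ⟨h0, i, hi, fun w a b c => hs w (by simp [a, b, c]), ?_⟩
    exact sum_triple_of_support (h.ne_u i hi.le).symm (h.ne_u _ hi).symm (h.ne_succ hi) h1
  · rintro ⟨h0, i, hi, hs, h1⟩
    exact mem_realization_triple (Finset.mem_image_of_mem _ (Finset.mem_range.mpr hi))
      (h.ne_u i hi.le).symm (h.ne_u _ hi).symm (h.ne_succ hi) h0 hs h1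

/-- The star of `v`: the cone from `v` over the path `u, p 0, ..., p k`, which is closed to a cycle
if `inner` holds. -/
def IsStar (u v : V) (p : ℕ → V) (k : ℕ) (inner : Prop) (A : Finset (Finset V)) : Prop :=
  ∀ t, t ∈ A ↔ (∃ i < k, t = {v, p i, p (i + 1)}) ∨ t = {v, u, p 0} ∨ (inner ∧ t = {v, u, p k})

/-- In terms of the weight of `u`, the mass `T` and the moment `M` of the path, the fan is the
triangle `0 ≤ M ≤ k * T`. The star is the cone from `v` over those sides of this triangle that do
not contain `v`, so one of the inequalities must be an equality once the weight of `v` is split off.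
-/
theorem mem_realization_star (h : ConePath u v p k) {inner : Prop} {A : Finset (Finset V)}
    (hA : IsStar u v p k inner A) {x : V → ℝ} : x ∈ realization A ↔
    (∀ w, 0 ≤ x w) ∧ ∃ i < k, (∀ w, w ≠ v → w ≠ u → w ≠ p i → w ≠ p (i + 1) → x w = 0) ∧
      x v + x u + (x (p i) + x (p (i + 1))) = 1 ∧ (x u = 0 ∨
        i * x (p i) + (i + 1) * x (p (i + 1)) = 0 ∨
        (inner ∧ i * x (p i) + (i + 1) * x (p (i + 1)) = k * (x (p i) + x (p (i + 1))))) := by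
  have hk := h.pos
  constructor
  · rintro ⟨h0, t, ht, hs, h1⟩
    refine ⟨h0, ?_⟩
    rcases (hA t).mp ht with ⟨i, hi, rfl⟩ | rfl | ⟨hin, rfl⟩
    · refine ⟨i, hi, fun w a _ c d => hs w (by simp [a, c, d]), ?_, Or.inl ?_⟩
      · have hu : x u = 0 := hs u (by
          simp [h.ne, (h.ne_u i hi.le).symm, (h.ne_u _ hi).symm])
        have := sum_triple_of_support (h.ne_v i hi.le).symm (h.ne_v _ hi).symm (h.ne_succ hi) h1
        linarith
      · exact hs u (by simp [h.ne, (h.ne_u i hi.le).symm, (h.ne_u _ hi).symm])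
    · have h2 : x (p 1) = 0 := hs _ (by
        simp [h.ne_v 1 hk, h.ne_u 1 hk, h.eq_iff hk (Nat.zero_le k)])
      refine ⟨0, hk, fun w a b c _ => hs w (by simp [a, b, c]), ?_, Or.inr (Or.inl ?_)⟩
      · have := sum_triple_of_support h.ne.symm (h.ne_v 0 (by omega)).symm
          (h.ne_u 0 (by omega)).symm h1
        simp only [zero_add, h2]
        linarith
      · simp [h2]
    · have hk1 : k - 1 + 1 = k := by omega
      have h2 : x (p (k - 1)) = 0 := by
        have e : p (k - 1) ≠ p k := fun he => by
          have := (h.eq_iff (by omega) le_rfl).mp he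
          omega
        exact hs _ (by simp [h.ne_v (k - 1) (by omega), h.ne_u (k - 1) (by omega), e])
      refine ⟨k - 1, by omega, fun w a b _ c => hs w (by rw [hk1] at c; simp [a, b, c]), ?_,
        Or.inr (Or.inr ⟨hin, ?_⟩)⟩
      · have := sum_triple_of_support h.ne.symm (h.ne_v k le_rfl).symm
          (h.ne_u k le_rfl).symm h1
        rw [hk1, h2]
        linarith
      · rw [hk1, h2, Nat.cast_sub hk]
        push_cast
        ring
  · rintro ⟨h0, i, hi, hs, h1, hcase⟩
    have p0 := h0 (p i)
    have p1 := h0 (p (i + 1))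
    have hi' : (i : ℝ) + 1 ≤ k := by exact_mod_cast hi
    have hi0 : (0 : ℝ) ≤ i := Nat.cast_nonneg i
    have hvu : x (p i) = 0 → x (p (i + 1)) = 0 → x ∈ realization A := by
      intro e1 e2
      refine mem_realization_triple ((hA _).mpr (Or.inr (Or.inl rfl))) h.ne.symm
        (h.ne_v 0 (by omega)).symm (h.ne_u 0 (by omega)).symm h0 (fun w a b c => ?_) ?_
      · by_cases e3 : w = p i
        · rw [e3, e1]
        by_cases e4 : w = p (i + 1)
        · rw [e4, e2]
        exact hs w a b e3 e4
      · have : x (p 0) = 0 := by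
          by_cases e3 : p 0 = p i
          · rw [e3, e1]
          by_cases e4 : p 0 = p (i + 1)
          · rw [e4, e2]
          exact hs _ (h.ne_v 0 (by omega)) (h.ne_u 0 (by omega)) e3 e4
        linarith
    rcases hcase with hu | hM | ⟨hin, hM⟩
    · refine mem_realization_triple ((hA _).mpr (Or.inl ⟨i, hi, rfl⟩))
        (h.ne_v i hi.le).symm (h.ne_v _ hi).symm (h.ne_succ hi) h0 (fun w a b c => ?_) (by linarith)
      by_cases e : w = u
      · rw [e, hu]
      · exact hs w a e b c
    · have e2 : x (p (i + 1)) = 0 := by nlinarith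
      by_cases hi1 : i = 0
      · subst hi1
        refine mem_realization_triple ((hA _).mpr (Or.inr (Or.inl rfl))) h.ne.symm
          (h.ne_v 0 (by omega)).symm (h.ne_u 0 (by omega)).symm h0 (fun w a b c => ?_)
          (by linarith)
        by_cases e : w = p (0 + 1)
        · rw [e, e2]
        · exact hs w a b c e
      · have : (1 : ℝ) ≤ i := by exact_mod_cast Nat.one_le_iff_ne_zero.mpr hi1
        exact hvu (by nlinarith) e2
    · have e1 : x (p i) = 0 := by nlinarith
      by_cases hi1 : i + 1 = k
      · rw [hi1] at hs h1
        refine mem_realization_triple ((hA _).mpr (Or.inr (Or.inr ⟨hin, rfl⟩))) h.ne.symm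
          (h.ne_v k le_rfl).symm (h.ne_u k le_rfl).symm h0 (fun w a b c => ?_)
          (by linarith)
        by_cases e : w = p i
        · rw [e, e1]
        · exact hs w a b e c
      · have : (i : ℝ) + 1 + 1 ≤ k := by exact_mod_cast (show i + 1 + 1 ≤ k by omega)
        rw [e1] at hM
        exact hvu e1 (by nlinarith)

/-- The coordinates in which the star of `v` and the cone from `u` are identified. -/
noncomputable def coords (u v : V) (p : ℕ → V) (k : ℕ) (α τ μ : ℝ) (x : V → ℝ) : ℝ × ℝ × ℝ :=
  (x u + α * x v, ∑ j ∈ Finset.range (k + 1), 1 * x (p j) + τ * x v,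
    ∑ j ∈ Finset.range (k + 1), (j : ℝ) * x (p j) + μ * x v)

theorem coords_eq {α τ μ : ℝ} {x : V → ℝ} {i : ℕ} (hi : i < k)
    (hs : ∀ j ≤ k, j ≠ i → j ≠ i + 1 → x (p j) = 0) : coords u v p k α τ μ x =
    (x u + α * x v, (x (p i) + x (p (i + 1))) + τ * x v,
      (i * x (p i) + (i + 1) * x (p (i + 1))) + μ * x v) := by
  rw [coords, sum_of_consecutive (z := fun j => x (p j)) hi hs (fun _ => 1),
    sum_of_consecutive (z := fun j => x (p j)) hi hs (fun j => (j : ℝ))]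
  push_cast
  simp only [one_mul]

theorem support_path (h : ConePath u v p k) {x : V → ℝ} {i : ℕ} (hi : i < k)
    (hs : ∀ w, w ≠ v → w ≠ u → w ≠ p i → w ≠ p (i + 1) → x w = 0) :
    ∀ j ≤ k, j ≠ i → j ≠ i + 1 → x (p j) = 0 := by
  intro j hj h1 h2
  exact hs _ (h.ne_v j hj) (h.ne_u j hj) (fun e => h1 ((h.eq_iff hj hi.le).mp e))
    (fun e => h2 ((h.eq_iff hj hi).mp e))

theorem ext_of_coords (h : ConePath u v p k) {x x' : V → ℝ} {i i' : ℕ} (hi : i < k) (hi' : i' < k)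
    (h0 : ∀ w, 0 ≤ x w) (h0' : ∀ w, 0 ≤ x' w)
    (hs : ∀ w, w ≠ v → w ≠ u → w ≠ p i → w ≠ p (i + 1) → x w = 0)
    (hs' : ∀ w, w ≠ v → w ≠ u → w ≠ p i' → w ≠ p (i' + 1) → x' w = 0) (hv : x v = x' v)
    (hu : x u = x' u) (hT : x (p i) + x (p (i + 1)) = x' (p i') + x' (p (i' + 1)))
    (hM : i * x (p i) + (i + 1) * x (p (i + 1)) = i' * x' (p i') + (i' + 1) * x' (p (i' + 1))) :
    x = x' := by
  have key := consecutive_unique (z := fun j => x (p j)) (z' := fun j => x' (p j)) hi hi'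
    (fun j => h0 _) (fun j => h0' _) (h.support_path hi hs) (h.support_path hi' hs') hT hM
  funext w
  by_cases e1 : w = v
  · rw [e1, hv]
  by_cases e2 : w = u
  · rw [e2, hu]
  by_cases e3 : ∃ j ≤ k, w = p j
  · obtain ⟨j, hj, rfl⟩ := e3
    exact key j hj
  · push Not at e3
    rw [hs w e1 e2 (e3 i hi.le) (e3 _ hi), hs' w e1 e2 (e3 i' hi'.le) (e3 _ hi')]

/-- The vector with given weights at `u`, `v` and at two consecutive vertices of the path. -/
noncomputable def weights (u v : V) (p : ℕ → V) (i : ℕ) (c m y y' : ℝ) : V → ℝ :=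
  Pi.single u c + Pi.single v m + Pi.single (p i) y + Pi.single (p (i + 1)) y'

theorem weights_spec (h : ConePath u v p k) {i : ℕ} (hi : i < k) {c m y y' : ℝ} (hc : 0 ≤ c)
    (hm : 0 ≤ m) (hy : 0 ≤ y) (hy' : 0 ≤ y') :
    (∀ w, 0 ≤ weights u v p i c m y y' w) ∧ weights u v p i c m y y' u = c ∧
    weights u v p i c m y y' v = m ∧ weights u v p i c m y y' (p i) = y ∧
    weights u v p i c m y y' (p (i + 1)) = y' ∧
    ∀ w, w ≠ v → w ≠ u → w ≠ p i → w ≠ p (i + 1) → weights u v p i c m y y' w = 0 := by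
  have h1 := h.ne
  have h2 := h.ne_u i hi.le
  have h3 := h.ne_u _ hi
  have h4 := h.ne_v i hi.le
  have h5 := h.ne_v _ hi
  have h6 := h.ne_succ hi
  refine ⟨fun w => ?_, ?_, ?_, ?_, ?_, fun w a b c d => ?_⟩
  · simp only [weights, Pi.add_apply, Pi.single_apply]
    split_ifs <;> linarith
  · simp [weights, h1, h2.symm, h3.symm]
  · simp [weights, h1.symm, h4.symm, h5.symm]
  · simp [weights, h2, h4, h6]
  · simp [weights, h3, h5, h6.symm]
  · simp [weights, a, b, c, d]

/-- A point of the triangle is pushed away from the position `(α, τ, μ)` of `v`: weight is moved to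
`v` until the first side is reached. If `v` lies on the side `M = κ * T`, that side moves along and
imposes no bound. -/
theorem exists_tight {inner : Prop} {κ α τ μ c T M : ℝ} (hα : 0 < α) (hμ : 0 < μ)
    (hin : inner → μ < κ * τ) (hout : ¬ inner → μ = κ * τ)
    (hc : 0 ≤ c) (hM : 0 ≤ M) (hMT : M ≤ κ * T) :
    ∃ m, 0 ≤ m ∧ 0 ≤ c - α * m ∧ 0 ≤ M - μ * m ∧ M - μ * m ≤ κ * (T - τ * m) ∧
      (c - α * m = 0 ∨ M - μ * m = 0 ∨ inner ∧ M - μ * m = κ * (T - τ * m)) := by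
  have e1 : α * (c / α) = c := by field_simp
  have e2 : μ * (M / μ) = M := by field_simp
  by_cases h : inner
  · have h3 : 0 < κ * τ - μ := by linarith [hin h]
    have e3 : (κ * τ - μ) * ((κ * T - M) / (κ * τ - μ)) = κ * T - M := by field_simp
    set m := min (min (c / α) (M / μ)) ((κ * T - M) / (κ * τ - μ)) with hm
    have m1 : m ≤ c / α := (min_le_left _ _).trans (min_le_left _ _)
    have m2 : m ≤ M / μ := (min_le_left _ _).trans (min_le_right _ _)
    have m3 : m ≤ (κ * T - M) / (κ * τ - μ) := min_le_right _ _
    have b1 := mul_le_mul_of_nonneg_left m1 hα.le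
    have b2 := mul_le_mul_of_nonneg_left m2 hμ.le
    have b3 := mul_le_mul_of_nonneg_left m3 h3.le
    refine ⟨m, le_min (le_min (by positivity) (by positivity)) (div_nonneg (by linarith) h3.le),
      by linarith, by linarith, by linarith, ?_⟩
    rcases min_choice (min (c / α) (M / μ)) ((κ * T - M) / (κ * τ - μ)) with h' | h'
    · rcases min_choice (c / α) (M / μ) with h'' | h''
      · left; rw [hm, h', h'', e1, sub_self]
      · right; left; rw [hm, h', h'', e2, sub_self]
    · right; right
      refine ⟨h, ?_⟩
      have : (κ * τ - μ) * m = κ * T - M := by rw [hm, h', e3]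
      linarith
  · have h3 := hout h
    set m := min (c / α) (M / μ) with hm
    have m1 : m ≤ c / α := min_le_left _ _
    have m2 : m ≤ M / μ := min_le_right _ _
    have b1 := mul_le_mul_of_nonneg_left m1 hα.le
    have b2 := mul_le_mul_of_nonneg_left m2 hμ.le
    refine ⟨m, le_min (by positivity) (by positivity),
      by linarith, by linarith, by rw [h3]; linarith, ?_⟩
    rcases min_choice (c / α) (M / μ) with h'' | h''
    · left; rw [hm, h'', e1, sub_self]
    · right; left; rw [hm, h'', e2, sub_self]

section Coordinates
variable {inner : Prop} {A : Finset (Finset V)} {α τ μ : ℝ}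

/-- If two points with equal coordinates had different weights at `v`, the one with the smaller
weight would satisfy all inequalities strictly, and so could not lie in the star. -/
theorem injOn_star (h : ConePath u v p k) (hA : IsStar u v p k inner A) (hα : 0 < α) (hμ : 0 < μ)
    (hin : inner → μ < k * τ) :
    InjOn (coords u v p k α τ μ) (realization A) := by
  have hlt : ∀ x ∈ realization A, ∀ x' ∈ realization A,
      coords u v p k α τ μ x = coords u v p k α τ μ x' → ¬ x v < x' v := by
    intro x hx x' hx' he hv
    obtain ⟨h0, i, hi, hs, h1, hcase⟩ := (h.mem_realization_star hA).mp hx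
    obtain ⟨h0', i', hi', hs', h1', -⟩ := (h.mem_realization_star hA).mp hx'
    rw [coords_eq hi (h.support_path hi hs), coords_eq hi' (h.support_path hi' hs')] at he
    simp only [Prod.mk.injEq] at he
    obtain ⟨he1, he2, he3⟩ := he
    have q0 := h0' (p i')
    have q1 := h0' (p (i' + 1))
    have hi'' : (i' : ℝ) + 1 ≤ k := by exact_mod_cast hi'
    have hi0 : (0 : ℝ) ≤ i' := Nat.cast_nonneg i'
    have hd : 0 < x' v - x v := by linarith
    have k1 : 0 < x u := by
      have := mul_pos hα hd
      linarith [h0' u]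
    have hM' : 0 ≤ i' * x' (p i') + (i' + 1) * x' (p (i' + 1)) := by positivity
    have hMT' : i' * x' (p i') + (i' + 1) * x' (p (i' + 1)) ≤
        k * (x' (p i') + x' (p (i' + 1))) := by nlinarith
    rcases hcase with hu | hM | ⟨hinn, hM⟩
    · linarith
    · have := mul_pos hμ hd
      linarith
    · have h2 := mul_pos (sub_pos.mpr (hin hinn)) hd
      have h3 : x (p i) + x (p (i + 1)) = x' (p i') + x' (p (i' + 1)) + τ * (x' v - x v) := by
        linarith
      rw [h3] at hM
      nlinarith
  intro x hx x' hx' he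
  have hv : x v = x' v := le_antisymm (not_lt.mp (hlt x' hx' x hx he.symm))
    (not_lt.mp (hlt x hx x' hx' he))
  obtain ⟨h0, i, hi, hs, h1, -⟩ := (h.mem_realization_star hA).mp hx
  obtain ⟨h0', i', hi', hs', h1', -⟩ := (h.mem_realization_star hA).mp hx'
  rw [coords_eq hi (h.support_path hi hs), coords_eq hi' (h.support_path hi' hs')] at he
  simp only [Prod.mk.injEq] at he
  obtain ⟨he1, he2, he3⟩ := he
  rw [hv] at he1 he2 he3
  exact h.ext_of_coords hi hi' h0 h0' hs hs' hv (by linarith) (by linarith) (by linarith)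

theorem injOn_fan (h : ConePath u v p k) :
    InjOn (coords u v p k 0 0 0) (realization (fan u p k)) := by
  intro x hx x' hx' he
  obtain ⟨h0, i, hi, hs, h1⟩ := h.mem_realization_fan.mp hx
  obtain ⟨h0', i', hi', hs', h1'⟩ := h.mem_realization_fan.mp hx'
  have hv : x v = 0 := hs v h.ne.symm (h.ne_v i hi.le).symm (h.ne_v _ hi).symm
  have hv' : x' v = 0 := hs' v h.ne.symm (h.ne_v i' hi'.le).symm (h.ne_v _ hi').symm
  have hs2 : ∀ w, w ≠ v → w ≠ u → w ≠ p i → w ≠ p (i + 1) → x w = 0 := fun w _ => hs w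
  have hs2' : ∀ w, w ≠ v → w ≠ u → w ≠ p i' → w ≠ p (i' + 1) → x' w = 0 := fun w _ => hs' w
  rw [coords_eq hi (h.support_path hi hs2), coords_eq hi' (h.support_path hi' hs2')] at he
  simp only [Prod.mk.injEq, zero_mul, add_zero] at he
  exact h.ext_of_coords hi hi' h0 h0' hs2 hs2' (hv.trans hv'.symm) he.1 he.2.1 he.2.2

/-- Both images are the same triangle: `exists_consecutive` supplies a point of the fan with given
coordinates, and after `exists_tight` also one of the star. -/
theorem image_star_eq (h : ConePath u v p k) (hA : IsStar u v p k inner A) (hα : 0 < α) (hμ : 0 < μ)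
    (hατ : α + τ = 1) (hμτ : μ ≤ k * τ) (hin : inner → μ < k * τ) (hout : ¬ inner → μ = k * τ) :
    coords u v p k α τ μ '' realization A = coords u v p k 0 0 0 '' realization (fan u p k) := by
  have hk := h.pos
  apply Subset.antisymm
  · rintro _ ⟨x, hx, rfl⟩
    obtain ⟨h0, i, hi, hs, h1, -⟩ := (h.mem_realization_star hA).mp hx
    rw [coords_eq hi (h.support_path hi hs)]
    have q0 := h0 (p i)
    have q1 := h0 (p (i + 1))
    have qv := h0 v
    have hi' : (i : ℝ) + 1 ≤ k := by exact_mod_cast hi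
    have hi0 : (0 : ℝ) ≤ i := Nat.cast_nonneg i
    obtain ⟨j, hj, y, y', hy, hy', hT, hM⟩ := exists_consecutive hk
      (T := (x (p i) + x (p (i + 1))) + τ * x v)
      (M := (i * x (p i) + (i + 1) * x (p (i + 1))) + μ * x v) (by positivity)
      (by nlinarith [mul_le_mul_of_nonneg_right hμτ qv])
    obtain ⟨w0, wu, wv, wi, wi', ws⟩ := h.weights_spec hj (c := x u + α * x v) (m := 0)
      (by have := h0 u; positivity) le_rfl hy hy'
    refine ⟨_, h.mem_realization_fan.mpr ⟨w0, j, hj, fun w a b c => ?_, ?_⟩, ?_⟩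
    · by_cases e : w = v
      · rw [e, wv]
      · exact ws w e a b c
    · rw [wu, wi, wi', add_assoc, hT]
      linear_combination h1 + x v * hατ
    · rw [coords_eq hj (h.support_path hj ws), wu, wi, wi', wv, hT, hM]
      simp
  · rintro _ ⟨x, hx, rfl⟩
    obtain ⟨h0, i, hi, hs, h1⟩ := h.mem_realization_fan.mp hx
    have hv : x v = 0 := hs v h.ne.symm (h.ne_v i hi.le).symm (h.ne_v _ hi).symm
    have hs2 : ∀ w, w ≠ v → w ≠ u → w ≠ p i → w ≠ p (i + 1) → x w = 0 := fun w _ => hs w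
    rw [coords_eq hi (h.support_path hi hs2), hv]
    have q0 := h0 (p i)
    have q1 := h0 (p (i + 1))
    have hi' : (i : ℝ) + 1 ≤ k := by exact_mod_cast hi
    have hi0 : (0 : ℝ) ≤ i := Nat.cast_nonneg i
    obtain ⟨m, hm, hc', hM', hMT', htight⟩ := exists_tight (inner := inner) (κ := k) (α := α)
      (τ := τ) (μ := μ) (c := x u) (T := x (p i) + x (p (i + 1)))
      (M := i * x (p i) + (i + 1) * x (p (i + 1))) hα hμ hin hout (h0 u) (by positivity)
      (by nlinarith)
    obtain ⟨j, hj, y, y', hy, hy', hT, hM⟩ := exists_consecutive hk hM' hMT'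
    obtain ⟨w0, wu, wv, wi, wi', ws⟩ := h.weights_spec hj hc' hm hy hy'
    refine ⟨_, (h.mem_realization_star hA).mpr ⟨w0, j, hj, ws, ?_, ?_⟩, ?_⟩
    · rw [wu, wi, wi', wv, hT]
      linear_combination h1 - m * hατ
    · rw [wu, wi, wi', hM, hT]
      exact htight
    · rw [coords_eq hj (h.support_path hj ws), wu, wi, wi', wv, hT, hM]
      simp

theorem continuous_coords : Continuous (coords u v p k α τ μ) := by
  unfold coords; fun_prop

end Coordinates

end ConePath

namespace TriComplex
variable {V : Type*} [DecidableEq V] {G : TriComplex V}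

/-- The star of `v` may be replaced by a cone from a vertex `u` of its link. -/
theorem nonempty_space_homeomorph_of_fan {u v : V} {p : ℕ → V} {k : ℕ} (h : ConePath u v p k)
    {inner : Prop}
    (hS : ∀ t, t ∈ G.faces ∧ v ∈ t ↔
      (∃ i < k, t = {v, p i, p (i + 1)}) ∨ t = {v, u, p 0} ∨ (inner ∧ t = {v, u, p k}))
    (hK : ∀ t ∈ G.faces, v ∉ t → u ∈ t → ∀ j ≤ k, p j ∈ t → j = 0 ∨ (inner ∧ j = k))
    (hK' : ∀ i < k, ¬ G.IsTri u (p i) (p (i + 1))) {G' : TriComplex V}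
    (hG' : G'.faces = {t ∈ G.faces | v ∉ t} ∪ ConePath.fan u p k) :
    Nonempty (G.space ≃ₜ G'.space) := by
  have hk := h.pos
  set A : Finset (Finset V) := {t ∈ G.faces | v ∈ t} with hAdef
  set K : Finset (Finset V) := {t ∈ G.faces | v ∉ t} with hKdef
  have hA : ConePath.IsStar u v p k inner A := by
    intro t
    rw [hAdef, Finset.mem_filter]
    exact hS t
  have e1 : G.space = realization K ∪ realization A := by
    rw [← realization_union, Finset.union_comm, hAdef, hKdef, Finset.filter_union_filter_not_eq]
    rfl
  have e2 : G'.space = realization K ∪ realization (ConePath.fan u p k) := by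
    rw [← realization_union, ← hG']
    rfl
  have hKv : ∀ x ∈ realization K, x v = 0 := by
    rintro x ⟨-, t, ht, hs, -⟩
    exact hs v (Finset.mem_filter.mp ht).2
  -- The fan must not meet the rest of the complex in anything new. By `hK` and `hK'` the rest meets
  -- it only in the part of its boundary that the star shares.
  have hKA : realization K ∩ realization A = realization K ∩ realization (ConePath.fan u p k) := by
    ext x
    refine and_congr_right fun hxK => ?_
    have hxv := hKv x hxK
    have hfan : ∀ i < k, ({u, p i, p (i + 1)} : Finset V) ∈ ConePath.fan u p k := fun i hi =>
      Finset.mem_image_of_mem _ (Finset.mem_range.mpr hi)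
    constructor
    · rintro ⟨-, t, ht, hs, -⟩
      rcases (hA t).mp ht with ⟨i, hi, rfl⟩ | rfl | ⟨-, rfl⟩
      · refine mem_realization_of_support hxK (hfan i hi) fun w hw => ?_
        by_cases e : w = v
        · rw [e, hxv]
        · exact hs w (by simp only [Finset.mem_insert, Finset.mem_singleton] at hw ⊢; tauto)
      · refine mem_realization_of_support hxK (hfan 0 hk) fun w hw => ?_
        by_cases e : w = v
        · rw [e, hxv]
        · exact hs w (by simp only [Finset.mem_insert, Finset.mem_singleton] at hw ⊢; tauto)
      · refine mem_realization_of_support hxK (hfan (k - 1) (by omega)) fun w hw => ?_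
        rw [Nat.sub_add_cancel hk] at hw
        by_cases e : w = v
        · rw [e, hxv]
        · exact hs w (by simp only [Finset.mem_insert, Finset.mem_singleton] at hw ⊢; tauto)
    · intro hxF
      obtain ⟨h0, i, hi, hs, h1⟩ := h.mem_realization_fan.mp hxF
      obtain ⟨-, t, ht, hst, -⟩ := hxK
      rw [hKdef, Finset.mem_filter] at ht
      have hmem : ∀ w, x w ≠ 0 → w ∈ t := fun w hw => by_contra fun h => hw (hst w h)
      refine (h.mem_realization_star hA).mpr ⟨h0, i, hi, fun w _ => hs w, by linarith, ?_⟩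
      by_cases hu : x u = 0
      · exact Or.inl hu
      right
      have hut := hmem u hu
      have hj : ∀ j ≤ k, x (p j) ≠ 0 → j = 0 ∨ (inner ∧ j = k) := fun j hj hx =>
        hK t ht.1 ht.2 hut j hj (hmem _ hx)
      by_cases f1 : x (p i) = 0
      · by_cases f2 : x (p (i + 1)) = 0
        · left; rw [f1, f2]; ring
        · rcases hj (i + 1) hi f2 with h' | ⟨hin, h'⟩
          · omega
          · right
            refine ⟨hin, ?_⟩
            rw [f1, ← h']
            push_cast
            ring
      · by_cases f2 : x (p (i + 1)) = 0
        · rcases hj i hi.le f1 with h' | ⟨hin, h'⟩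
          · left; rw [f2, h']; simp
          · omega
        · exfalso
          refine hK' i hi ?_
          have : ({u, p i, p (i + 1)} : Finset V) = t := by
            refine Finset.eq_of_subset_of_card_le ?_ ?_
            · intro w hw
              simp only [Finset.mem_insert, Finset.mem_singleton] at hw
              rcases hw with rfl | rfl | rfl
              · exact hut
              · exact hmem _ f1
              · exact hmem _ f2
            · rw [G.card_eq t ht.1, Finset.card_eq_three.mpr ⟨u, p i, p (i + 1),
                (h.ne_u i hi.le).symm, (h.ne_u _ hi).symm, h.ne_succ hi, rfl⟩]
          rw [IsTri, this]
          exact ht.1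
  have hkr : (1 : ℝ) ≤ k := by exact_mod_cast hk
  -- The vertex `v` is placed at the centroid of `u`, `p 0`, `p k` if it is inner, and at the
  -- midpoint of `u` and `p k` otherwise.
  obtain ⟨α, τ, μ, hα, hμ, hατ, hin, hout⟩ : ∃ α τ μ : ℝ, 0 < α ∧ 0 < μ ∧ α + τ = 1 ∧
      (inner → μ < k * τ) ∧ (¬ inner → μ = k * τ) := by
    by_cases hin : inner
    · refine ⟨1 / 3, 2 / 3, k / 3, by norm_num, by positivity, by norm_num, fun _ => by linarith,
        fun h => (h hin).elim⟩
    · exact ⟨1 / 2, 1 / 2, k / 2, by norm_num, by positivity, by norm_num, fun h => (hin h).elim,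
        fun _ => by ring⟩
  have hμτ : μ ≤ k * τ := by
    by_cases hi : inner
    · exact (hin hi).le
    · exact (hout hi).le
  rw [e1, e2]
  refine nonempty_homeomorph_of_gluing (isCompact_realization _) (isCompact_realization _)
    (isCompact_realization _) (ConePath.continuous_coords (α := α) (τ := τ) (μ := μ))
    ConePath.continuous_coords (h.injOn_star hA hα hμ hin) h.injOn_fan
    (h.image_star_eq hA hα hμ hατ hμτ hin hout) hKA ?_
  intro x hx
  simp [ConePath.coords, hKv x hx.1]

end TriComplex

/-! ### Links, closed subcomplexes, and contraction of edges of a disk. -/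

namespace TriComplex
variable {V : Type*} [DecidableEq V] {G : TriComplex V} {a b c d u v : V}

/-- A family of triangles that is closed under adjacency contains no or all triangles. -/
theorem IsCombDisk.forall_face (hG : G.IsCombDisk) {P : Finset V → Prop}
    (hP : ∀ a b c d, G.IsTri a b c → G.IsTri a b d → P {a, b, c} → P {a, b, d})
    {t s : Finset V} (ht : t ∈ G.faces) (h : P t) (hs : s ∈ G.faces) : P s := by
  have key : ∀ v a b, G.IsTri v a b → P {v, a, b} → ∀ a b, G.IsTri v a b → P {v, a, b} := by
    intro v a b hv hp x y hxy
    have hx : x ∈ {a | ∃ b, G.IsTri v a b ∧ P {v, a, b}} := by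
      refine hG.link (S := {a | ∃ b, G.IsTri v a b ∧ P {v, a, b}}) hv.adj₁₂ ⟨b, hv, hp⟩ ?_ x
        hxy.adj₁₂
      rintro p q hpq ⟨r, hr, hpr⟩
      refine ⟨p, hpq.swap₂₃, ?_⟩
      rw [Finset.pair_comm q p]
      exact hP v p r q hr hpq hpr
    obtain ⟨r, hr, hpr⟩ := hx
    exact hP v x r y hr hxy hpr
  obtain ⟨a, b, c, -, -, -, rfl⟩ := Finset.card_eq_three.mp (G.card_eq t ht)
  obtain ⟨x, y, z, -, -, -, rfl⟩ := Finset.card_eq_three.mp (G.card_eq s hs)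
  have habc : G.IsTri a b c := ht
  have hxyz : G.IsTri x y z := hs
  have hx : x ∈ {v | ∀ a b, G.IsTri v a b → P {v, a, b}} := by
    refine hG.conn (a := a) (b := x) ?_ (isVertex_iff.mpr ⟨b, habc.adj₁₂⟩)
      (isVertex_iff.mpr ⟨y, hxyz.adj₁₂⟩) (key a b c habc h)
    intro p q hpq hp
    obtain ⟨r, hr⟩ := adj_iff.mp hpq
    refine key q p r hr.swap₁₂ ?_
    rw [Finset.insert_comm]
    exact hp q r hr
  exact hx y z hxyz

theorem not_boundaryEdge_iff (h : G.IsTri a b c) :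
    ¬ G.BoundaryEdge a b ↔ ∃ d, d ≠ c ∧ G.IsTri a b d := by
  rw [boundaryEdge_iff]
  constructor
  · intro h'
    push Not at h'
    obtain ⟨d, hd, hne⟩ := h' c h
    exact ⟨d, hne, hd⟩
  · rintro ⟨d, hne, hd⟩ ⟨e, -, he⟩
    exact hne ((he d hd).trans (he c h).symm)

theorem exists_other (hv : ¬ G.BoundaryVertex v) (h : G.IsTri v a b) :
    ∃ d, d ≠ b ∧ G.IsTri v a d :=
  (not_boundaryEdge_iff h).mp fun hb => hv ⟨a, hb⟩

/-- A family of triangles such that neighbours across inner edges exist within it, is everything. -/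
theorem IsCombDisk.forall_face_of_exists (hG : G.IsCombDisk) {P : Finset V → Prop}
    (hP : ∀ a b c, G.IsTri a b c → P {a, b, c} →
      G.BoundaryEdge a b ∨ ∃ d, d ≠ c ∧ G.IsTri a b d ∧ P {a, b, d})
    {t s : Finset V} (ht : t ∈ G.faces) (h : P t) (hs : s ∈ G.faces) : P s := by
  refine hG.forall_face ?_ ht h hs
  intro a b c d hc hd hp
  rcases hP a b c hc hp with hb | ⟨e, hne, he, hpe⟩
  · obtain ⟨e, -, he⟩ := boundaryEdge_iff.mp hb
    rwa [he d hd, ← he c hc]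
  · rcases hG.two hc hd he with h | h | h
    · rwa [← h]
    · exact (hne h.symm).elim
    · rwa [h]

/-- There is no closed subcomplex. -/
theorem IsCombDisk.false_of_closed (hG : G.IsCombDisk) {P : Finset V → Prop}
    (hP : ∀ a b c, G.IsTri a b c → P {a, b, c} → ∃ d, d ≠ c ∧ G.IsTri a b d ∧ P {a, b, d})
    {t : Finset V} (ht : t ∈ G.faces) (h : P t) : False := by
  obtain ⟨x, y, hxy⟩ := hG.bdry
  obtain ⟨z, hz, hz'⟩ := boundaryEdge_iff.mp hxy
  obtain ⟨d, hd, hd', -⟩ := hP x y z hz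
    (hG.forall_face_of_exists (fun a b c h hp => Or.inr (hP a b c h hp)) ht h hz)
  exact hd (hz' d hd')

/-- The four triangles form a closed surface. They are the sets `W.erase w`, and exchanging the
omitted vertex leads to the neighbour across an edge. -/
theorem IsCombDisk.false_of_tetrahedron (hG : G.IsCombDisk) (h₁ : G.IsTri a b c)
    (h₂ : G.IsTri a b d) (h₃ : G.IsTri a c d) (h₄ : G.IsTri b c d) : False := by
  have n1 := h₁.ne₁₂; have n2 := h₁.ne₁₃; have n3 := h₁.ne₂₃
  have n4 := h₂.ne₁₃; have n5 := h₂.ne₂₃; have n6 := h₃.ne₂₃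
  have hW : ∀ w ∈ ({a, b, c, d} : Finset V), ({a, b, c, d} : Finset V).erase w ∈ G.faces := by
    intro w hw
    simp only [Finset.mem_insert, Finset.mem_singleton] at hw
    have : ({a, b, c, d} : Finset V).erase w = {b, c, d} ∧ w = a ∨
        ({a, b, c, d} : Finset V).erase w = {a, c, d} ∧ w = b ∨
        ({a, b, c, d} : Finset V).erase w = {a, b, d} ∧ w = c ∨
        ({a, b, c, d} : Finset V).erase w = {a, b, c} ∧ w = d := by
      rcases hw with rfl | rfl | rfl | rfl
      · left; refine ⟨?_, rfl⟩; ext z; simp; grind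
      · right; left; refine ⟨?_, rfl⟩; ext z; simp; grind
      · right; right; left; refine ⟨?_, rfl⟩; ext z; simp; grind
      · right; right; right; refine ⟨?_, rfl⟩; ext z; simp; grind
    rcases this with ⟨h, -⟩ | ⟨h, -⟩ | ⟨h, -⟩ | ⟨h, -⟩ <;> rw [h] <;> assumption
  have hmem : ({b, c, d} : Finset V) = ({a, b, c, d} : Finset V).erase a := by
    ext z; simp; grind
  have hWa : a ∈ ({a, b, c, d} : Finset V) := by simp
  generalize ({a, b, c, d} : Finset V) = W at hW hmem hWa
  refine hG.false_of_closed (P := fun t => ∃ w ∈ W, t = W.erase w) ?_ h₄ ⟨a, hWa, hmem⟩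
  rintro x y z hxyz ⟨w, hw, hwt⟩
  have hz : z ∈ W := Finset.mem_of_mem_erase (a := w) (hwt ▸ (by simp))
  have hwn : w ∉ ({x, y, z} : Finset V) := by rw [hwt]; simp
  have e : ({x, y, w} : Finset V) = W.erase z := by
    rw [← Finset.insert_erase hw, ← hwt]
    have := hxyz.ne₁₃
    have := hxyz.ne₂₃
    ext p
    simp only [Finset.mem_insert, Finset.mem_singleton, Finset.mem_erase] at hwn ⊢
    grind
  refine ⟨w, fun h => hwn (by simp [h]), ?_, z, hz, e⟩
  rw [IsTri, e]
  exact hW z hz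

/-- The vertices of the link of `v` on a path from `u`. -/
def IsLinkPath (G : TriComplex V) (v u : V) (n : ℕ) (q : ℕ → V) : Prop :=
  q 0 = u ∧ InjOn q (Iic n) ∧ ∀ i < n, G.IsTri v (q i) (q (i + 1))

theorem IsLinkPath.le_card {n : ℕ} {q : ℕ → V} (h : IsLinkPath G v u n q) :
    n ≤ (G.faces.biUnion id).card := by
  obtain ⟨-, hinj, htri⟩ := h
  have : ((Finset.range n).image q).card = n := by
    rw [Finset.card_image_of_injOn (hinj.mono fun i hi => by
      simp only [Finset.coe_range, mem_Iio, mem_Iic] at hi ⊢; omega), Finset.card_range]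
  rw [← this]
  refine Finset.card_le_card fun w hw => ?_
  obtain ⟨i, hi, rfl⟩ := Finset.mem_image.mp hw
  exact Finset.mem_biUnion.mpr ⟨_, htri i (Finset.mem_range.mp hi), by simp⟩

/-- The link of a vertex is a path or a cycle. -/
theorem IsCombDisk.exists_linkPath (hG : G.IsCombDisk) (hvu : G.graph.Adj v u)
    (hb : ¬ G.BoundaryVertex v ∨ G.BoundaryEdge v u) :
    ∃ n q, IsLinkPath G v u n q ∧ 1 ≤ n ∧ (¬ G.BoundaryVertex v → 2 ≤ n) ∧
      (∀ w, G.graph.Adj v w → ∃ j ≤ n, w = q j) ∧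
      ∀ i j, i < j → j ≤ n → (G.IsTri v (q i) (q j) ↔
        j = i + 1 ∨ (¬ G.BoundaryVertex v ∧ i = 0 ∧ j = n)) := by
  classical
  have hex : ∃ n q, IsLinkPath G v u n q := ⟨0, fun _ => u, rfl, by
    intro i hi j hj _
    simp only [mem_Iic, Nat.le_zero] at hi hj
    rw [hi, hj], fun i hi => by omega⟩
  -- A longest path in the link that starts at `u`; its length is bounded by the number of vertices.
  obtain ⟨n, ⟨q, hq⟩, hmax⟩ : ∃ n, (∃ q, IsLinkPath G v u n q) ∧
      ¬ ∃ q, IsLinkPath G v u (n + 1) q := by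
    obtain ⟨n, hn⟩ := hex
    by_contra! h
    have : ∀ m, ∃ q, IsLinkPath G v u (n + m) q := by
      intro m
      induction m with
      | zero => exact hn
      | succ m ih => exact h _ ih
    obtain ⟨q, hq⟩ := this ((G.faces.biUnion id).card + 1)
    have := hq.le_card
    omega
  have hq' := hq
  obtain ⟨h0, hinj, htri⟩ := hq
  have heq : ∀ i j, i ≤ n → j ≤ n → q i = q j → i = j := fun i j hi hj h => hinj hi hj h
  have hend : ∀ z, G.IsTri v (q n) z → ∃ j ≤ n, z = q j := by
    intro z hz
    by_contra! h
    refine hmax ⟨Function.update q (n + 1) z, ?_, ?_, ?_⟩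
    · rw [Function.update_of_ne (by omega), h0]
    · intro i hi j hj hij
      simp only [mem_Iic] at hi hj
      by_cases h1 : i = n + 1 <;> by_cases h2 : j = n + 1
      · omega
      · subst h1
        rw [Function.update_self, Function.update_of_ne h2] at hij
        exact (h j (by omega) hij).elim
      · subst h2
        rw [Function.update_self, Function.update_of_ne h1] at hij
        exact (h i (by omega) hij.symm).elim
      · rw [Function.update_of_ne h1, Function.update_of_ne h2] at hij
        exact heq i j (by omega) (by omega) hij
    · intro i hi
      rw [Function.update_of_ne (by omega)]
      by_cases h1 : i = n
      · subst h1; rw [Function.update_self]; exact hz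
      · rw [Function.update_of_ne (by omega)]; exact htri i (by omega)
  have hmid : ∀ i, 0 < i → i < n → ∀ z, G.IsTri v (q i) z → z = q (i - 1) ∨ z = q (i + 1) := by
    intro i h1 h2 z hz
    have e1 := htri (i - 1) (by omega)
    rw [Nat.sub_add_cancel h1] at e1
    rcases hG.two e1.swap₂₃ (htri i h2) hz with h | h | h
    · have := heq _ _ (by omega) (by omega) h; omega
    · exact Or.inl h.symm
    · exact Or.inr h.symm
  have hn1 : 1 ≤ n := by
    by_contra hn
    obtain rfl : n = 0 := by omega
    obtain ⟨c, hc⟩ := adj_iff.mp hvu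
    obtain ⟨j, hj, rfl⟩ := hend c (by rw [h0]; exact hc)
    obtain rfl : j = 0 := by omega
    exact hc.ne₂₃ h0.symm
  -- At an inner vertex the end of the path has a second neighbour in the link. By maximality it
  -- lies on the path, and inner vertices of the path are saturated, so it is the start.
  have hinner : ¬ G.BoundaryVertex v → 2 ≤ n ∧ G.IsTri v (q 0) (q n) := by
    intro hv
    have e1 := htri (n - 1) (by omega)
    rw [Nat.sub_add_cancel hn1] at e1
    obtain ⟨z, hz, hztri⟩ := exists_other hv e1.swap₂₃
    obtain ⟨j, hj, rfl⟩ := hend z hztri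
    have hjn : j ≠ n := fun h => hztri.ne₂₃ (by rw [h])
    have hjn1 : j ≠ n - 1 := fun h => hz (by rw [h])
    by_cases hj0 : j = 0
    · subst hj0
      exact ⟨by omega, hztri.swap₂₃⟩
    · rcases hmid j (by omega) (by omega) _ hztri.swap₂₃ with h | h
      · have := heq _ _ (by omega) (by omega) h; omega
      · have := heq _ _ (by omega) (by omega) h; omega
  have hzero : ∀ z, G.IsTri v (q 0) z → z = q 1 ∨ (¬ G.BoundaryVertex v ∧ z = q n) := by
    intro z hz
    have e1 := htri 0 hn1
    rcases hb with hv | hv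
    · obtain ⟨hn2, hn⟩ := hinner hv
      rcases hG.two e1 hn hz with h | h | h
      · have := heq _ _ (by omega) le_rfl h; omega
      · exact Or.inl h.symm
      · exact Or.inr ⟨hv, h.symm⟩
    · obtain ⟨c, hc, hcu⟩ := boundaryEdge_iff.mp hv
      rw [← h0] at hcu
      exact Or.inl ((hcu z hz).trans (hcu _ e1).symm)
  refine ⟨n, q, hq', hn1, fun hv => (hinner hv).1, ?_, ?_⟩
  · intro w hw
    have := hG.link (S := {w | ∃ j ≤ n, w = q j}) hvu ⟨0, Nat.zero_le _, h0.symm⟩ ?_ w hw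
    · exact this
    · rintro a b hab ⟨j, hj, rfl⟩
      by_cases hj0 : j = 0
      · subst hj0
        rcases hzero b hab with h | ⟨-, h⟩
        · exact ⟨1, hn1, h⟩
        · exact ⟨n, le_rfl, h⟩
      by_cases hjn : j = n
      · subst hjn; exact hend b hab
      rcases hmid j (by omega) (by omega) b hab with h | h
      · exact ⟨_, by omega, h⟩
      · exact ⟨_, by omega, h⟩
  · intro i j hij hj
    constructor
    · intro h
      by_cases hi0 : i = 0
      · subst hi0
        rcases hzero _ h with h' | ⟨hv, h'⟩
        · left; exact heq _ _ hj hn1 h'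
        · right; exact ⟨hv, rfl, heq _ _ hj le_rfl h'⟩
      · rcases hmid i (by omega) (by omega) _ h with h' | h'
        · have := heq _ _ hj (by omega) h'; omega
        · left; exact heq _ _ hj (by omega) h'
    · rintro (rfl | ⟨hv, rfl, rfl⟩)
      · exact htri i (by omega)
      · exact (hinner hv).2

/-! ### Contraction of edges -/

theorem image_contract_of_notMem {t : Finset V} (h : v ∉ t) :
    t.image (fun w => if w = v then u else w) = t := by
  conv_rhs => rw [← Finset.image_id (s := t)]
  refine Finset.image_congr fun w hw => if_neg ?_
  rintro rfl
  exact h hw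

theorem image_contract_triple (ha : a ≠ v) (hb : b ≠ v) :
    ({v, a, b} : Finset V).image (fun w => if w = v then u else w) = {u, a, b} := by
  simp [Finset.image_insert, ha, hb]

theorem mem_contract_iff (huv : u ≠ v) {t : Finset V} : t ∈ (G.contract u v).faces ↔
    (t ∈ G.faces ∧ v ∉ t) ∨ ∃ a b, t = {u, a, b} ∧ a ≠ u ∧ b ≠ u ∧ G.IsTri v a b := by
  simp only [contract, Finset.mem_filter, Finset.mem_image]
  constructor
  · rintro ⟨⟨s, hs, rfl⟩, hcard⟩
    by_cases hv : v ∈ s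
    · obtain ⟨a, b, rfl, h⟩ := exists_eq_of_mem_face hs hv
      rw [image_contract_triple h.ne₁₂.symm h.ne₁₃.symm] at hcard ⊢
      refine Or.inr ⟨a, b, rfl, ?_, ?_, h⟩
      · rintro rfl
        have : ({a, a, b} : Finset V).card ≤ 2 := by
          rw [Finset.insert_eq_of_mem (by simp)]; exact Finset.card_le_two
        omega
      · rintro rfl
        have : ({b, a, b} : Finset V).card ≤ 2 := by
          rw [Finset.insert_eq_of_mem (by simp)]; exact Finset.card_le_two
        omega
    · rw [image_contract_of_notMem hv]
      exact Or.inl ⟨hs, hv⟩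
  · rintro (⟨ht, hv⟩ | ⟨a, b, rfl, ha, hb, h⟩)
    · exact ⟨⟨t, ht, image_contract_of_notMem hv⟩, G.card_eq t ht⟩
    · exact ⟨⟨_, h, image_contract_triple h.ne₁₂.symm h.ne₁₃.symm⟩,
        Finset.card_eq_three.mpr ⟨u, a, b, ha.symm, hb.symm, h.ne₂₃, rfl⟩⟩

theorem nonempty_homeomorph_of_relabel {G' : TriComplex V} (e : Equiv.Perm V)
    (h : G'.faces = G.faces.image (Finset.image e)) : Nonempty (G.space ≃ₜ G'.space) := by
  have key : ∀ x : V → ℝ, x ∈ G.space ↔ x ∘ e.symm ∈ G'.space := by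
    intro x
    have hsum : ∀ t : Finset V, ∑ v ∈ t.image e, (x ∘ e.symm) v = ∑ v ∈ t, x v := by
      intro t
      rw [Finset.sum_image e.injective.injOn]
      simp
    constructor
    · rintro ⟨h0, t, ht, hs, h1⟩
      refine ⟨fun v => h0 _, t.image e, by rw [h]; exact Finset.mem_image_of_mem _ ht,
        fun v hv => hs _ fun h' => hv (Finset.mem_image.mpr ⟨_, h', by simp⟩), by rw [hsum, h1]⟩
    · rintro ⟨h0, t, ht, hs, h1⟩
      rw [h] at ht
      obtain ⟨s, hs', rfl⟩ := Finset.mem_image.mp ht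
      refine ⟨fun v => by simpa using h0 (e v), s, hs', fun v hv => ?_, by rw [← hsum, h1]⟩
      have := hs (e v) (by simpa using hv)
      simpa using this
  refine ⟨Homeomorph.subtype (Homeomorph.piCongrLeft (Y := fun _ => ℝ) e) fun x => ?_⟩
  rw [key x]
  have : (Homeomorph.piCongrLeft (Y := fun _ => ℝ) e) x = x ∘ e.symm := by
    funext v
    obtain ⟨w, rfl⟩ := e.surjective v
    change (Equiv.piCongrLeft (fun _ => ℝ) e) x (e w) = _
    rw [Equiv.piCongrLeft_apply_apply]
    simp
  rw [this]

/-- The name of the new vertex breaks the symmetry between `u` and `v`; the transposition restores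
it. -/
theorem nonempty_homeomorph_contract_swap (huv : u ≠ v) :
    Nonempty ((G.contract u v).space ≃ₜ (G.contract v u).space) := by
  refine nonempty_homeomorph_of_relabel (Equiv.swap u v) ?_
  have hcomp : (fun w => if w = u then v else w) =
      Equiv.swap u v ∘ fun w => if w = v then u else w := by
    funext w
    simp only [Function.comp]
    by_cases h1 : w = v
    · subst h1; simp [huv.symm]
    · by_cases h2 : w = u
      · subst h2; simp [huv]
      · simp [h1, h2, Equiv.swap_apply_of_ne_of_ne h2 h1]
  ext t
  simp only [contract, Finset.mem_filter, Finset.mem_image]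
  constructor
  · rintro ⟨⟨s, hs, rfl⟩, hcard⟩
    rw [hcomp, ← Finset.image_image] at hcard ⊢
    rw [Finset.card_image_of_injective _ (Equiv.injective _)] at hcard
    exact ⟨_, ⟨⟨s, hs, rfl⟩, hcard⟩, rfl⟩
  · rintro ⟨_, ⟨⟨s, hs, rfl⟩, hcard⟩, rfl⟩
    refine ⟨⟨s, hs, ?_⟩, ?_⟩
    · rw [hcomp, ← Finset.image_image]
    · rwa [Finset.card_image_of_injective _ (Equiv.injective _)]

/-- Contraction replaces the star of `v` by the fan from `u` over the rest of the link of `v`. By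
`hfac` this identifies nothing but edges of collapsed faces. On the boundary, `v` needs a face that
avoids `u`, since otherwise the fan is empty. -/
theorem IsCombDisk.nonempty_homeomorph_contract_aux (hG : G.IsCombDisk) (huv : G.graph.Adj u v)
    (hfac : ∀ w, G.graph.Adj u w → G.graph.Adj v w → G.IsTri u v w)
    (hb : ¬ G.BoundaryVertex v ∨ (G.BoundaryEdge v u ∧ ∃ a b, G.IsTri v a b ∧ a ≠ u ∧ b ≠ u)) :
    Nonempty (G.space ≃ₜ (G.contract u v).space) := by
  obtain ⟨n, q, ⟨h0, hinj, htri⟩, hn1, hn2, hall, hchar⟩ :=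
    hG.exists_linkPath huv.symm (hb.imp_right And.left)
  have heq : ∀ i j, i ≤ n → j ≤ n → q i = q j → i = j := fun i j hi hj h => hinj hi hj h
  have hadj : ∀ j ≤ n, G.graph.Adj v (q j) := by
    intro j hj
    by_cases h : j = n
    · have := htri (n - 1) (by omega)
      rw [Nat.sub_add_cancel hn1] at this
      rw [h]; exact this.adj₁₃
    · exact (htri j (by omega)).adj₁₂
  have hchar' : ∀ a b, G.IsTri v a b → (∃ i < n, (a = q i ∧ b = q (i + 1)) ∨
      (b = q i ∧ a = q (i + 1))) ∨
      (¬ G.BoundaryVertex v ∧ ((a = q 0 ∧ b = q n) ∨ (a = q n ∧ b = q 0))) := by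
    intro a b hab
    obtain ⟨i, hi, rfl⟩ := hall a hab.adj₁₂
    obtain ⟨j, hj, rfl⟩ := hall b hab.adj₁₃
    rcases lt_trichotomy i j with h | h | h
    · rcases (hchar i j h hj).mp hab with rfl | ⟨hv, rfl, rfl⟩
      · exact Or.inl ⟨i, by omega, Or.inl ⟨rfl, rfl⟩⟩
      · exact Or.inr ⟨hv, Or.inl ⟨rfl, rfl⟩⟩
    · subst h; exact (hab.ne₂₃ rfl).elim
    · rcases (hchar j i h hi).mp hab.swap₂₃ with rfl | ⟨hv, rfl, rfl⟩
      · exact Or.inl ⟨j, by omega, Or.inr ⟨rfl, rfl⟩⟩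
      · exact Or.inr ⟨hv, Or.inr ⟨rfl, rfl⟩⟩
  have hn : 2 ≤ n := by
    rcases hb with hv | ⟨hvu, a, b, hab, ha, hb⟩
    · exact hn2 hv
    · by_contra hn
      obtain rfl : n = 1 := by omega
      rw [← h0] at ha hb
      rcases hchar' a b hab with ⟨i, hi, h⟩ | ⟨hv, -⟩
      · obtain rfl : i = 0 := by omega
        rcases h with h | h
        · exact ha h.1
        · exact hb h.1
      · exact hv ⟨u, hvu⟩
  -- The path is the link with its first vertex `u` removed, hence the shift by one.
  have hpath : ConePath u v (fun i => q (i + 1)) (n - 1) := by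
    refine ⟨huv.1, by omega, ?_, ?_, ?_⟩
    · intro i hi j hj h
      simp only [mem_Iic] at hi hj
      have := heq _ _ (by omega) (by omega) h
      omega
    · intro j hj h
      rw [← h0] at h
      have := heq _ _ (by omega) (by omega) h
      omega
    · intro j hj h
      exact (hadj (j + 1) (by omega)).1 h.symm
  have hnn : n - 1 + 1 = n := by omega
  have hcommon : ∀ j ≤ n - 1, G.graph.Adj u (q (j + 1)) →
      j = 0 ∨ (¬ G.BoundaryVertex v ∧ j = n - 1) := by
    intro j hj h
    have h1 := (hfac _ h (hadj _ (by omega))).swap₁₂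
    rw [← h0] at h1
    rcases (hchar 0 (j + 1) (by omega) (by omega)).mp h1 with h' | ⟨hv, -, h'⟩
    · left; omega
    · right; exact ⟨hv, by omega⟩
  refine nonempty_space_homeomorph_of_fan hpath (inner := ¬ G.BoundaryVertex v) ?_ ?_ ?_ ?_
  · intro t
    constructor
    · rintro ⟨ht, hv⟩
      obtain ⟨a, b, rfl, hab⟩ := exists_eq_of_mem_face ht hv
      have main : ∀ i < n, (∃ j < n - 1, ({v, q i, q (i + 1)} : Finset V) =
          {v, q (j + 1), q (j + 1 + 1)}) ∨ ({v, q i, q (i + 1)} : Finset V) = {v, u, q (0 + 1)} ∨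
          (¬ G.BoundaryVertex v ∧
            ({v, q i, q (i + 1)} : Finset V) = {v, u, q (n - 1 + 1)}) := by
        intro i hi
        by_cases hi0 : i = 0
        · subst hi0
          exact Or.inr (Or.inl (by rw [h0]))
        · refine Or.inl ⟨i - 1, by omega, ?_⟩
          rw [Nat.sub_add_cancel (by omega)]
      rcases hchar' a b hab with ⟨i, hi, ⟨rfl, rfl⟩ | ⟨rfl, rfl⟩⟩ | ⟨hv', ⟨rfl, rfl⟩ | ⟨rfl, rfl⟩⟩
      · exact main i hi
      · rw [Finset.pair_comm]; exact main i hi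
      · exact Or.inr (Or.inr ⟨hv', by simp only [hnn]; rw [h0]⟩)
      · exact Or.inr (Or.inr ⟨hv', by simp only [hnn]; rw [h0, Finset.pair_comm]⟩)
    · rintro (⟨i, hi, rfl⟩ | rfl | ⟨hv, rfl⟩)
      · exact ⟨htri (i + 1) (by omega), by simp⟩
      · have := htri 0 (by omega)
        rw [h0] at this
        exact ⟨this, by simp⟩
      · have := (hchar 0 n (by omega) le_rfl).mpr (Or.inr ⟨hv, rfl, rfl⟩)
        rw [h0] at this
        simp only [hnn]
        exact ⟨this, by simp⟩
  · intro t ht hv hu j hj hjt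
    exact hcommon j hj ⟨(hpath.ne_u j hj).symm, t, ht, hu, hjt⟩
  -- If a triangle of the fan were already a face, both its path vertices would be common neighbours
  -- of `u` and `v`. Then the link of `v` is a 3-cycle and the four faces form a tetrahedron.
  · intro i hi h
    have c1 := hcommon i hi.le h.adj₁₂
    have c2 := hcommon (i + 1) hi h.adj₁₃
    have hi0 : i = 0 := by omega
    have hv : ¬ G.BoundaryVertex v := by
      rcases c2 with h' | h'
      · omega
      · exact h'.1
    have hn' : n = 2 := by omega
    subst hi0 hn'
    have t01 := htri 0 (by omega)
    have t12 := htri 1 (by omega)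
    have t02 := (hchar 0 2 (by omega) le_rfl).mpr (Or.inr ⟨hv, rfl, rfl⟩)
    rw [h0] at t01 t02
    simp only [zero_add, Nat.reduceAdd] at h t01 t12
    exact hG.false_of_tetrahedron t01 t02 t12 h
  · ext t
    rw [mem_contract_iff huv.1, Finset.mem_union, Finset.mem_filter]
    refine or_congr Iff.rfl ?_
    rw [ConePath.fan, Finset.mem_image]
    constructor
    · rintro ⟨a, b, rfl, ha, hb, hab⟩
      rcases hchar' a b hab with ⟨i, hi, h⟩ | ⟨hv, h⟩
      · have hi0 : i ≠ 0 := by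
          rintro rfl
          rw [h0] at h
          rcases h with h | h
          · exact ha h.1
          · exact hb h.1
        refine ⟨i - 1, Finset.mem_range.mpr (by omega), ?_⟩
        rw [Nat.sub_add_cancel (by omega)]
        rcases h with ⟨rfl, rfl⟩ | ⟨rfl, rfl⟩
        · rfl
        · rw [Finset.pair_comm]
      · rw [h0] at h
        rcases h with h | h
        · exact (ha h.1).elim
        · exact (hb h.2).elim
    · rintro ⟨i, hi, rfl⟩
      have hi := Finset.mem_range.mp hi
      exact ⟨_, _, rfl, hpath.ne_u i hi.le, hpath.ne_u (i + 1) hi, htri (i + 1) (by omega)⟩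

/-- An inner end may be absorbed into the other one. For a boundary edge it suffices that one end
has a face without the other; if neither has, connectedness leaves a single face. -/
theorem IsDisk.contract (hG : G.IsDisk) (huv : G.graph.Adj u v)
    (hfac : ∀ w, G.graph.Adj u w → G.graph.Adj v w → G.IsTri u v w)
    (hb : G.BoundaryEdge u v ∨ ¬ G.BoundaryVertex u ∨ ¬ G.BoundaryVertex v)
    (hcard : 2 ≤ G.faces.card) : (G.contract u v).IsDisk := by
  have hC := hG.isCombDisk
  obtain ⟨e⟩ := hG
  have h1 : ¬ G.BoundaryVertex v ∨ (G.BoundaryEdge v u ∧ ∃ a b, G.IsTri v a b ∧ a ≠ u ∧ b ≠ u) →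
      (G.contract u v).IsDisk := fun h =>
    let ⟨f⟩ := hC.nonempty_homeomorph_contract_aux huv hfac h
    ⟨f.symm.trans e⟩
  have h2 : ¬ G.BoundaryVertex u ∨ (G.BoundaryEdge u v ∧ ∃ a b, G.IsTri u a b ∧ a ≠ v ∧ b ≠ v) →
      (G.contract u v).IsDisk := fun h =>
    let ⟨f⟩ := hC.nonempty_homeomorph_contract_aux huv.symm
      (fun w h h' => (hfac w h' h).swap₁₂) h
    let ⟨g⟩ := nonempty_homeomorph_contract_swap (G := G) huv.1.symm
    ⟨(f.trans g).symm.trans e⟩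
  rcases hb with hb | hb | hb
  · by_contra hcon
    obtain ⟨w, hw, huniq⟩ := boundaryEdge_iff.mp hb
    have k1 : ∀ a b, G.IsTri v a b → a = u ∨ b = u := by
      intro a b hab
      by_contra! h
      exact hcon (h1 (Or.inr ⟨hb.symm, a, b, hab, h.1, h.2⟩))
    have k2 : ∀ a b, G.IsTri u a b → a = v ∨ b = v := by
      intro a b hab
      by_contra! h
      exact hcon (h2 (Or.inr ⟨hb, a, b, hab, h.1, h.2⟩))
    have k3 : ∀ t ∈ G.faces, u ∈ t ∨ v ∈ t → t = {u, v, w} := by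
      intro t ht h
      have : u ∈ t ∧ v ∈ t := by
        rcases h with h | h <;> obtain ⟨a, b, rfl, hab⟩ := exists_eq_of_mem_face ht h
        · rcases k2 a b hab with h | h <;> simp [h]
        · rcases k1 a b hab with h | h <;> simp [h]
      obtain ⟨c, rfl, hc⟩ := exists_eq_of_mem_face₂ ht this.1 this.2 huv.1
      rw [huniq c hc]
    have k4 : ∀ t ∈ G.faces, t = {u, v, w} := by
      intro t ht
      refine hC.forall_face (P := fun t => t = {u, v, w}) ?_ hw rfl ht
      intro a b c d hc hd h
      refine k3 _ hd ?_
      have ha : a ∈ ({u, v, w} : Finset V) := h ▸ (by simp)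
      have hb : b ∈ ({u, v, w} : Finset V) := h ▸ (by simp)
      have := hc.ne₁₂
      simp only [Finset.mem_insert, Finset.mem_singleton] at ha hb ⊢
      grind
    have := Finset.card_le_one.mpr fun a ha b hb => (k4 a ha).trans (k4 b hb).symm
    omega
  · exact h2 (Or.inl hb)
  · exact h1 (Or.inl hb)

/-- Deletion of a vertex that lies in only one face. -/
theorem IsDisk.deleteVertices_of_ear (hG : G.IsDisk) (hb : G.IsTri b a c)
    (huniq : ∀ t ∈ G.faces, b ∈ t → t = {b, a, c}) (hcard : 2 ≤ G.faces.card) :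
    (G.deleteVertices {b}).IsDisk := by
  have hadj : ∀ w, G.graph.Adj b w → w = a ∨ w = c := by
    rintro w ⟨hne, t, ht, hbt, hwt⟩
    rw [huniq t ht hbt] at hwt
    simp only [Finset.mem_insert, Finset.mem_singleton] at hwt
    exact hwt.resolve_left hne.symm
  have hbe : G.BoundaryEdge a b := by
    refine ⟨hb.ne₁₂.symm, _, ⟨hb, by simp, by simp⟩, fun t ht => huniq t ht.1 ht.2.2⟩
  -- Contraction of a boundary edge of the ear has the same effect as deletion of `b`.
  have h := hG.contract hb.adj₁₂.symm ?_ (Or.inl hbe) hcard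
  · convert h using 1
    ext t
    rw [mem_contract_iff hb.ne₁₂.symm, deleteVertices, Finset.mem_filter,
      Finset.disjoint_singleton_right]
    refine ⟨Or.inl, fun h => h.resolve_right ?_⟩
    rintro ⟨p, q, rfl, hp, hq, hpq⟩
    have h1 := (hadj p hpq.adj₁₂).resolve_left hp
    have h2 := (hadj q hpq.adj₁₃).resolve_left hq
    exact hpq.ne₂₃ (h1.trans h2.symm)
  · intro w h1 h2
    rcases hadj w h2 with rfl | rfl
    · exact (h1.1 rfl).elim
    · exact hb.swap₁₂

end TriComplex

/-! ### Contractions that stay inside the class. -/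

namespace TriComplex
variable {V : Type*} [DecidableEq V] {G : TriComplex V} {a b c d u v w x : V}

/-! ### Degrees -/

theorem finite_neighborSet (G : TriComplex V) (v : V) : (G.graph.neighborSet v).Finite := by
  refine (Finset.finite_toSet (G.faces.biUnion id)).subset fun w hw => ?_
  obtain ⟨-, t, ht, -, hwt⟩ := hw
  exact Finset.mem_coe.mpr (Finset.mem_biUnion.mpr ⟨t, ht, hwt⟩)

theorem deg_le_card {s : Finset V} (h : ∀ w, G.graph.Adj v w → w ∈ s) : G.deg v ≤ s.card := by
  rw [deg, ← Set.ncard_coe_finset]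
  exact Set.ncard_le_ncard h s.finite_toSet

theorem card_le_deg {s : Finset V} (h : ∀ w ∈ s, G.graph.Adj v w) : s.card ≤ G.deg v := by
  rw [deg, ← Set.ncard_coe_finset]
  exact Set.ncard_le_ncard h (finite_neighborSet G v)

theorem mem_of_deg_le_card {s : Finset V} (h : ∀ w ∈ s, G.graph.Adj v w) (hd : G.deg v ≤ s.card)
    (hw : G.graph.Adj v w) : w ∈ s := by
  have := Set.eq_of_subset_of_ncard_le (s := (s : Set V)) (t := G.graph.neighborSet v) h
    (by rwa [Set.ncard_coe_finset]) (finite_neighborSet G v)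
  rw [← Finset.mem_coe, this]
  exact hw

theorem exists_finset_neighbors (G : TriComplex V) (v : V) :
    ∃ s : Finset V, s.card = G.deg v ∧ ∀ w, w ∈ s ↔ G.graph.Adj v w := by
  refine ⟨(finite_neighborSet G v).toFinset, ?_, fun w => ?_⟩
  · rw [deg, Set.ncard_eq_toFinset_card _ (finite_neighborSet G v)]
  · simp

/-- Otherwise the link of `x`, being connected, would have only the vertices `u` and `v`. The face
found here survives the contraction of `uv` and keeps `x` adjacent to the new vertex. -/
theorem IsCombDisk.exists_third (hG : G.IsCombDisk) (hx : 3 ≤ G.deg x)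
    (h : G.graph.Adj x u ∨ G.graph.Adj x v) :
    ∃ d, d ≠ u ∧ d ≠ v ∧ (G.IsTri u x d ∨ G.IsTri v x d) := by
  by_contra! hcon
  have key : ∀ w, G.graph.Adj x w → w ∈ ({u, v} : Set V) := by
    have hcl : ∀ a b, G.IsTri x a b → a ∈ ({u, v} : Set V) → b ∈ ({u, v} : Set V) := by
      rintro a b hab ha
      simp only [Set.mem_insert_iff, Set.mem_singleton_iff] at ha ⊢
      by_contra! hb
      rcases ha with rfl | rfl
      · exact (hcon b hb.1 hb.2).1 hab.swap₁₂
      · exact (hcon b hb.1 hb.2).2 hab.swap₁₂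
    rcases h with h | h
    · exact hG.link h (by simp) hcl
    · exact hG.link h (by simp) hcl
  have := deg_le_card (s := {u, v}) (fun w hw => by simpa using key w hw)
  have := Finset.card_le_two (a := u) (b := v)
  omega

/-! ### The class and the contractions inside it -/

/-- An inner vertex of degree 4 or a boundary vertex of degree 3. -/
def Critical (G : TriComplex V) (v : V) : Prop :=
  (¬ G.BoundaryVertex v ∧ G.deg v = 4) ∨ (G.BoundaryVertex v ∧ G.deg v = 3)

theorem InFCirc4.isCombDisk (hG : G.InFCirc4) : G.IsCombDisk := hG.1.isCombDisk

theorem InFCirc4.three_le (hG : G.InFCirc4) (h : G.graph.Adj v w) : 3 ≤ G.deg v :=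
  (hG.2 v (isVertex_iff.mpr ⟨w, h⟩)).1

theorem InFCirc4.four_le (hG : G.InFCirc4) (h : G.graph.Adj v w) (hv : ¬ G.BoundaryVertex v) :
    4 ≤ G.deg v :=
  (hG.2 v (isVertex_iff.mpr ⟨w, h⟩)).2 hv

theorem isTri_contract_iff (huv : u ≠ v) (ha : a ≠ u) (ha' : a ≠ v) (hb : b ≠ u) (hb' : b ≠ v)
    (hc : c ≠ u) (hc' : c ≠ v) : (G.contract u v).IsTri a b c ↔ G.IsTri a b c := by
  rw [IsTri, mem_contract_iff huv]
  constructor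
  · rintro (h | ⟨p, q, h, -⟩)
    · exact h.1
    · have : u ∈ ({a, b, c} : Finset V) := h ▸ (by simp)
      simp [ha.symm, hb.symm, hc.symm] at this
  · intro h
    exact Or.inl ⟨h, by simp [ha'.symm, hb'.symm, hc'.symm]⟩

theorem isTri_contract_left (huv : u ≠ v) (hb : b ≠ u) (hb' : b ≠ v) (hc : c ≠ u) (hc' : c ≠ v) :
    (G.contract u v).IsTri u b c ↔ G.IsTri u b c ∨ G.IsTri v b c := by
  rw [IsTri, mem_contract_iff huv]
  constructor
  · rintro (h | ⟨p, q, h, hp, hq, ht⟩)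
    · exact Or.inl h.1
    · right
      have e := congrArg (fun t => insert v (Finset.erase t u)) h
      beta_reduce at e
      rw [Finset.erase_insert (by simp [hb.symm, hc.symm]),
        Finset.erase_insert (by simp [hp.symm, hq.symm])] at e
      rw [IsTri, e]
      exact ht
  · rintro (h | h)
    · exact Or.inl ⟨h, by simp [huv.symm, hb'.symm, hc'.symm]⟩
    · exact Or.inr ⟨b, c, rfl, hb, hc, h⟩

theorem not_adj_contract (huv : u ≠ v) : ¬ (G.contract u v).graph.Adj a v := by
  rintro ⟨-, t, ht, -, hv⟩
  rcases (mem_contract_iff huv).mp ht with h | ⟨p, q, rfl, -, -, h⟩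
  · exact h.2 hv
  · simp [huv.symm, h.ne₁₂, h.ne₁₃] at hv

theorem card_faces_contract_lt (huv : G.graph.Adj u v) :
    (G.contract u v).faces.card < G.faces.card := by
  obtain ⟨w, hw⟩ := adj_iff.mp huv
  refine lt_of_lt_of_le (Finset.card_lt_card (t := G.faces.image
    (Finset.image fun w => if w = v then u else w)) ?_) Finset.card_image_le
  refine Finset.filter_ssubset.mpr ⟨_, Finset.mem_image_of_mem _ hw, fun h => ?_⟩
  have : ({u, v, w} : Finset V).image (fun z => if z = v then u else z) ⊆ {u, w} := by
    intro z hz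
    simp only [Finset.mem_image, Finset.mem_insert, Finset.mem_singleton] at hz ⊢
    obtain ⟨y, hy, rfl⟩ := hz
    split_ifs with h
    · exact Or.inl rfl
    · tauto
  have := Finset.card_le_card this
  have := Finset.card_le_two (a := u) (b := w)
  omega

theorem adj_contract (huv : G.graph.Adj u v) (ha : a ≠ u) (ha' : a ≠ v) (hb : b ≠ u) (hb' : b ≠ v)
    (h : G.graph.Adj a b) : (G.contract u v).graph.Adj a b := by
  obtain ⟨c, hc⟩ := adj_iff.mp h
  by_cases hcu : c = u
  · subst hcu
    exact ((isTri_contract_left huv.1 ha ha' hb hb').mpr (Or.inl hc.rotate.rotate)).adj₂₃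
  · by_cases hcv : c = v
    · subst hcv
      exact ((isTri_contract_left huv.1 ha ha' hb hb').mpr (Or.inr hc.rotate.rotate)).adj₂₃
    · exact ((isTri_contract_iff huv.1 ha ha' hb hb' hcu hcv).mpr hc).adj₁₂

theorem boundaryEdge_contract_of_ne (huv : G.graph.Adj u v) (ha : a ≠ u) (ha' : a ≠ v) (hb : b ≠ u)
    (hb' : b ≠ v)
    (h : G.BoundaryEdge a b) : (G.contract u v).BoundaryEdge a b := by
  obtain ⟨d, hd⟩ := adj_iff.mp (adj_contract huv ha ha' hb hb' h.adj)
  refine boundaryEdge_iff.mpr ⟨d, hd, fun e he => ?_⟩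
  obtain ⟨c, hc, hc'⟩ := boundaryEdge_iff.mp h
  have key : ∀ e, (G.contract u v).IsTri a b e → e = if c = v then u else c := by
    intro e he
    have hev : e ≠ v := by
      rintro rfl
      exact not_adj_contract huv.1 he.adj₁₃
    by_cases heu : e = u
    · subst heu
      rcases (isTri_contract_left huv.1 ha ha' hb hb').mp he.rotate.rotate with h | h
      · rw [← hc' _ h.rotate, if_neg huv.1]
      · rw [← hc' _ h.rotate, if_pos rfl]
    · rw [← hc' _ ((isTri_contract_iff huv.1 ha ha' hb hb' heu hev).mp he), if_neg hev]
  rw [key e he, key d hd]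

theorem IsCombDisk.adj_contract_left (hG : G.IsCombDisk) (huv : G.graph.Adj u v) (hb : b ≠ u)
    (hb' : b ≠ v) (hd : 3 ≤ G.deg b)
    (h : G.graph.Adj b u ∨ G.graph.Adj b v) : (G.contract u v).graph.Adj u b := by
  obtain ⟨d, hdu, hdv, h⟩ := hG.exists_third hd h
  exact ((isTri_contract_left huv.1 hb hb' hdu hdv).mpr h).adj₁₂

/-- If the only face at the boundary edge contains the other end of `uv`, the merged edge inherits
the single remaining face of its partner. If not, `hfac` shows that there is no partner. -/
theorem IsCombDisk.boundaryEdge_contract_left (hG : G.IsCombDisk) (huv : G.graph.Adj u v)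
    (hfac : ∀ w, G.graph.Adj u w → G.graph.Adj v w → G.IsTri u v w) (hb : b ≠ u) (hb' : b ≠ v)
      (hd : 3 ≤ G.deg b)
    (h : G.BoundaryEdge b u ∨ G.BoundaryEdge b v) : (G.contract u v).BoundaryEdge u b := by
  obtain ⟨d, hdu, hdv, hd⟩ := hG.exists_third hd (h.imp (·.adj) (·.adj))
  refine boundaryEdge_iff.mpr ⟨d, (isTri_contract_left huv.1 hb hb' hdu hdv).mpr hd, fun e he => ?_⟩
  have hev : e ≠ v := by
    rintro rfl
    exact not_adj_contract huv.1 he.adj₁₃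
  have heu : e ≠ u := he.ne₁₃.symm
  have he := (isTri_contract_left huv.1 hb hb' heu hev).mp he
  have key : ∀ p q, G.BoundaryEdge b p → (∀ w, G.graph.Adj p w → G.graph.Adj q w → G.IsTri p q w) →
      d ≠ q → d ≠ p → e ≠ q → e ≠ p →
      G.IsTri p b d ∨ G.IsTri q b d → G.IsTri p b e ∨ G.IsTri q b e → e = d := by
    intro p q hp hpq hdq hdp heq hep hd he
    obtain ⟨c, hc, hc'⟩ := boundaryEdge_iff.mp hp
    have hq : ∀ x, G.IsTri q b x → c = q :=
      fun x hx => (hc' q (hpq b hp.adj.symm hx.adj₁₂).swap₂₃.swap₁₂).symm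
    rcases hd with hd | hd
    · have h1 := hc' d hd.swap₁₂
      rcases he with he | he
      · rw [hc' e he.swap₁₂, h1]
      · exact (hdq (h1.trans (hq e he))).elim
    · obtain rfl := hq d hd
      rcases he with he | he
      · exact (heq (hc' e he.swap₁₂)).elim
      · rcases hG.two hc.swap₂₃ hd.swap₁₂ he.swap₁₂ with h | h | h
        · exact (hdp h.symm).elim
        · exact (hep h.symm).elim
        · exact h.symm
  rcases h with h | h
  · exact key u v h hfac hdv hdu hev heu hd he
  · exact key v u h (fun w h1 h2 => (hfac w h2 h1).swap₁₂) hdu hdv heu hev hd.symm he.symm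

/-- The other end of the link, which is a path. It keeps the new vertex on the boundary when a
boundary edge is contracted. -/
theorem IsCombDisk.exists_boundaryEdge_ne (hG : G.IsCombDisk) (h : G.BoundaryEdge v u) :
    ∃ x, x ≠ u ∧ G.BoundaryEdge v x := by
  obtain ⟨n, q, ⟨h0, hinj, htri⟩, hn1, -, hall, hchar⟩ := hG.exists_linkPath h.adj (Or.inr h)
  have hbv : G.BoundaryVertex v := ⟨u, h⟩
  refine ⟨q n, ?_, boundaryEdge_iff.mpr ⟨q (n - 1), ?_, fun d hd => ?_⟩⟩
  · rw [← h0]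
    intro h
    have := hinj (show n ∈ Iic n by simp) (show 0 ∈ Iic n by simp) h
    omega
  · have := htri (n - 1) (by omega)
    rw [Nat.sub_add_cancel hn1] at this
    exact this.swap₂₃
  · obtain ⟨j, hj, rfl⟩ := hall d hd.adj₁₃
    have hjn : j ≠ n := by
      rintro rfl
      exact hd.ne₂₃ rfl
    rcases (hchar j n (by omega) le_rfl).mp hd.swap₂₃ with h | ⟨h, -⟩
    · congr 1; omega
    · exact (h hbv).elim

/-- Boundary vertices stay on the boundary, and only third vertices of faces at `uv` lose a
neighbour. Not being critical, they can afford this. -/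
theorem InFCirc4.step_contract (hG : G.InFCirc4) (huv : G.graph.Adj u v)
    (hfac : ∀ w, G.graph.Adj u w → G.graph.Adj v w → G.IsTri u v w)
    (hb : G.BoundaryEdge u v ∨ ¬ G.BoundaryVertex u ∨ ¬ G.BoundaryVertex v)
    (hnc : ∀ w, G.IsTri u v w → ¬ G.Critical w) : Step (G.contract u v) G := by
  have hC := hG.isCombDisk
  have h3 : ∀ {a b}, G.graph.Adj a b → 3 ≤ G.deg a := fun h => hG.three_le h
  have hcard : 2 ≤ G.faces.card := by
    obtain ⟨d, hdu, hdv, hd⟩ := hC.exists_third (h3 huv) (u := v) (v := v) (Or.inl huv)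
    obtain ⟨w, hw⟩ := adj_iff.mp huv
    by_contra hlt
    have h1 := Finset.card_le_one.mp (show G.faces.card ≤ 1 by omega)
    have hsub : ∀ y, G.graph.Adj u y → y ∈ ({v, w} : Finset V) := by
      rintro y ⟨hne, t, ht, hut, hyt⟩
      rw [h1 t ht _ hw] at hyt
      simp only [Finset.mem_insert, Finset.mem_singleton] at hyt ⊢
      exact hyt.resolve_left hne.symm
    have := deg_le_card hsub
    have := Finset.card_le_two (a := v) (b := w)
    have := h3 huv
    omega
  have hdisk := hG.1.contract huv hfac hb hcard
  have hbd : ∀ w, w ≠ u → w ≠ v → G.BoundaryVertex w → (G.contract u v).BoundaryVertex w := by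
    rintro w hwu hwv ⟨x, hx⟩
    by_cases hxu : x = u
    · subst hxu
      exact ⟨x, (hC.boundaryEdge_contract_left huv hfac hwu hwv (h3 hx.adj) (Or.inl hx)).symm⟩
    · by_cases hxv : x = v
      · subst hxv
        exact ⟨u, (hC.boundaryEdge_contract_left huv hfac hwu hwv (h3 hx.adj) (Or.inr hx)).symm⟩
      · exact ⟨x, boundaryEdge_contract_of_ne huv hwu hwv hxu hxv hx⟩
  have hbdu : G.BoundaryVertex u ∨ G.BoundaryVertex v → (G.contract u v).BoundaryVertex u := by
    rintro (⟨x, hx⟩ | ⟨x, hx⟩)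
    · obtain ⟨y, hy, hyv⟩ : ∃ y, y ≠ v ∧ G.BoundaryEdge u y := by
        by_cases h : x = v
        · subst h
          exact hC.exists_boundaryEdge_ne hx
        · exact ⟨x, h, hx⟩
      exact ⟨y, hC.boundaryEdge_contract_left huv hfac hyv.adj.1.symm hy (h3 hyv.adj.symm)
        (Or.inl hyv.symm)⟩
    · obtain ⟨y, hy, hyv⟩ : ∃ y, y ≠ u ∧ G.BoundaryEdge v y := by
        by_cases h : x = u
        · subst h
          exact hC.exists_boundaryEdge_ne hx
        · exact ⟨x, h, hx⟩
      exact ⟨y, hC.boundaryEdge_contract_left huv hfac hy hyv.adj.1.symm (h3 hyv.adj.symm)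
        (Or.inr hyv.symm)⟩
  -- The new vertex keeps all neighbours of `u` and `v` but `u` and `v`, and the `c` common ones are
  -- merged in pairs. A boundary edge gives at least 3 + 3 - 2 - 1, an inner end 4 + 3 - 2 - 2, and
  -- two inner ends 4 + 4 - 2 - 2.
  have hcommon : ∃ c : ℕ, (G.BoundaryEdge u v → c ≤ 1) ∧ c ≤ 2 ∧
      G.deg u + G.deg v ≤ (G.contract u v).deg u + 2 + c := by
    obtain ⟨s, hs, hs'⟩ := exists_finset_neighbors G u
    obtain ⟨t, ht, ht'⟩ := exists_finset_neighbors G v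
    refine ⟨(s ∩ t).card, fun hbe => ?_, ?_, ?_⟩
    · obtain ⟨c, -, hc⟩ := boundaryEdge_iff.mp hbe
      refine Finset.card_le_one.mpr fun x hx y hy => ?_
      simp only [Finset.mem_inter, hs', ht'] at hx hy
      rw [hc x (hfac x hx.1 hx.2), hc y (hfac y hy.1 hy.2)]
    · by_contra! hlt
      obtain ⟨x, hx, y, hy, z, hz, h1, h2, h3⟩ := Finset.two_lt_card.mp hlt
      simp only [Finset.mem_inter, hs', ht'] at hx hy hz
      rcases hC.two (hfac x hx.1 hx.2) (hfac y hy.1 hy.2) (hfac z hz.1 hz.2) with h | h | h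
      · exact h1 h
      · exact h2 h
      · exact h3 h
    · have hsub : ∀ y ∈ (s ∪ t) \ {u, v}, (G.contract u v).graph.Adj u y := by
        intro y hy
        simp only [Finset.mem_sdiff, Finset.mem_union, Finset.mem_insert, Finset.mem_singleton,
          not_or, hs', ht'] at hy
        have hy1 := hy.1.imp (·.symm) (·.symm)
        exact hC.adj_contract_left huv hy.2.1 hy.2.2 (hy1.elim (h3 ·) (h3 ·)) hy1
      have h1 := card_le_deg hsub
      have h2 := Finset.le_card_sdiff {u, v} (s ∪ t)
      have h3 := Finset.card_union_add_card_inter s t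
      have h4 := Finset.card_le_two (a := u) (b := v)
      omega
  have hdeg : ∀ w, w ≠ u → w ≠ v → (∃ y, G.graph.Adj w y) → G.deg w ≤ (G.contract u v).deg w + 1 ∧
      (¬ G.IsTri u v w → G.deg w ≤ (G.contract u v).deg w) := by
    rintro w hwu hwv ⟨y, hy⟩
    have hw3 := h3 hy
    obtain ⟨s, hs, hs'⟩ := exists_finset_neighbors G w
    have hsub : ∀ y ∈ s.erase v, (G.contract u v).graph.Adj w y := by
      intro y hy
      rw [Finset.mem_erase, hs'] at hy
      by_cases hyu : y = u
      · subst hyu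
        exact (hC.adj_contract_left huv hwu hwv hw3 (Or.inl hy.2)).symm
      · exact adj_contract huv hwu hwv hyu hy.1 hy.2
    refine ⟨?_, fun hnt => ?_⟩
    · have := card_le_deg hsub
      have := Finset.pred_card_le_card_erase (s := s) (a := v)
      omega
    · by_cases hv : v ∈ s
      · have hu : u ∉ s := fun hu => hnt (hfac w ((hs' _).mp hu).symm ((hs' _).mp hv).symm)
        have hsub' : ∀ y ∈ insert u (s.erase v), (G.contract u v).graph.Adj w y := by
          intro y hy
          rcases Finset.mem_insert.mp hy with rfl | hy
          · exact (hC.adj_contract_left huv hwu hwv hw3 (Or.inr ((hs' _).mp hv))).symm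
          · exact hsub y hy
        have := card_le_deg hsub'
        rw [Finset.card_insert_of_notMem (fun h => hu (Finset.mem_of_mem_erase h)),
          Finset.card_erase_of_mem hv] at this
        omega
      · have := card_le_deg hsub
        rw [Finset.erase_eq_of_notMem hv] at this
        omega
  have hclass : (G.contract u v).InFCirc4 := by
    refine ⟨hdisk, fun w hw => ?_⟩
    obtain ⟨y, hwy⟩ := isVertex_iff.mp hw
    have hwv : w ≠ v := by
      rintro rfl
      exact not_adj_contract huv.1 hwy.symm
    by_cases hwu : w = u
    · subst hwu
      obtain ⟨c, hc1, hc2, hc⟩ := hcommon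
      have hw3 := h3 huv
      have hv3 := h3 huv.symm
      have hw4 := hG.four_le huv
      have hv4 := hG.four_le huv.symm
      refine ⟨?_, fun hn => ?_⟩
      · rcases hb with hb | hb | hb
        · have := hc1 hb; omega
        · have := hw4 hb; omega
        · have := hv4 hb; omega
      · have := hw4 fun h => hn (hbdu (Or.inl h))
        have := hv4 fun h => hn (hbdu (Or.inr h))
        omega
    · have hadj : ∃ y, G.graph.Adj w y := by
        obtain ⟨t, ht, hwt⟩ := hw
        rcases (mem_contract_iff huv.1).mp ht with h | ⟨p, q, rfl, -, -, h⟩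
        · exact isVertex_iff.mp ⟨t, h.1, hwt⟩
        · simp only [Finset.mem_insert, Finset.mem_singleton, hwu, false_or] at hwt
          rcases hwt with rfl | rfl
          · exact ⟨_, h.adj₁₂.symm⟩
          · exact ⟨_, h.adj₁₃.symm⟩
      obtain ⟨h1, h2⟩ := hdeg w hwu hwv hadj
      obtain ⟨y, hy⟩ := hadj
      have hw3 := h3 hy
      have hw4 := hG.four_le hy
      have hwb := hbd w hwu hwv
      by_cases ht : G.IsTri u v w
      · have := hnc w ht
        simp only [Critical, not_or, not_and] at this
        by_cases hbw : G.BoundaryVertex w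
        · have := this.2 hbw
          exact ⟨by omega, fun h => (h (hwb hbw)).elim⟩
        · have := this.1 hbw
          have := hw4 hbw
          exact ⟨by omega, fun h => by omega⟩
      · have := h2 ht
        refine ⟨by omega, fun h => ?_⟩
        have := hw4 fun h' => h (hwb h')
        omega
  -- Members of the class have vertices of degree 3 only on the boundary, so the triode condition is
  -- automatic.
  refine ⟨hclass, hG, Or.inl ⟨u, v, ⟨⟨huv, hdisk⟩, ?_⟩, rfl⟩⟩
  rintro w ⟨hw, hw3, -⟩
  refine ⟨?_, hw3⟩
  by_contra hn
  have := (hclass.2 w hw).2 hn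
  omega

end TriComplex

/-! ### Reduced complexes without chords and nonfacial 3-cycles. -/

namespace TriComplex
variable {V : Type*} [DecidableEq V] {G : TriComplex V} {a b c d u v w x y z p q : V}

/-! ### Links of small degree -/

theorem not_boundaryEdge_of_ne (h₁ : G.IsTri a b c) (h₂ : G.IsTri a b d) (h : c ≠ d) :
    ¬ G.BoundaryEdge a b :=
  (not_boundaryEdge_iff h₁).mpr ⟨d, h.symm, h₂⟩

theorem BoundaryEdge.unique (h : G.BoundaryEdge a b) (h₁ : G.IsTri a b c) (h₂ : G.IsTri a b d) :
    c = d := by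
  by_contra hne
  exact not_boundaryEdge_of_ne h₁ h₂ hne h

theorem IsCombDisk.eq_of_ne (hG : G.IsCombDisk) (h₁ : G.IsTri a b c) (h₂ : G.IsTri a b d)
    (h₃ : G.IsTri a b x) (h : c ≠ d) (h' : c ≠ x) : d = x := by
  rcases hG.two h₁ h₂ h₃ with e | e | e
  · exact (h e).elim
  · exact (h' e).elim
  · exact e

theorem IsCombDisk.eq_or_eq (hG : G.IsCombDisk) (h₁ : G.IsTri a b c) (h₂ : G.IsTri a b d)
    (h : c ≠ d) (h₃ : G.IsTri a b x) : x = c ∨ x = d := by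
  rcases hG.two h₁ h₂ h₃ with e | e | e
  · exact (h e).elim
  · exact Or.inl e.symm
  · exact Or.inr e.symm

/-- Every edge at `v` would lie in two faces and `v` would have at most three neighbours: an inner
vertex of degree below 4. -/
theorem InFCirc4.false_of_link₃ (hG : G.InFCirc4) (h₁ : G.IsTri v a b) (h₂ : G.IsTri v b c)
    (h₃ : G.IsTri v c a) : False := by
  have hC := hG.isCombDisk
  have hN : ∀ w, G.graph.Adj v w → w ∈ ({a, b, c} : Set V) := by
    refine hC.link h₁.adj₁₂ (by simp) ?_
    rintro p q hpq (rfl | rfl | rfl)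
    · rcases hC.eq_or_eq h₁ h₃.swap₂₃ h₂.ne₂₃ hpq with rfl | rfl <;> simp
    · rcases hC.eq_or_eq h₁.swap₂₃ h₂ h₃.ne₂₃.symm hpq with rfl | rfl <;> simp
    · rcases hC.eq_or_eq h₂.swap₂₃ h₃ h₁.ne₂₃.symm hpq with rfl | rfl <;> simp
  have hv : ¬ G.BoundaryVertex v := by
    rintro ⟨w, hw⟩
    rcases hN w hw.adj with rfl | rfl | rfl
    · exact not_boundaryEdge_of_ne h₁ h₃.swap₂₃ h₂.ne₂₃ hw
    · exact not_boundaryEdge_of_ne h₁.swap₂₃ h₂ h₃.ne₂₃.symm hw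
    · exact not_boundaryEdge_of_ne h₂.swap₂₃ h₃ h₁.ne₂₃.symm hw
  have h4 := hG.four_le h₁.adj₁₂ hv
  have h5 := deg_le_card (s := {a, b, c}) fun w hw => by simpa using hN w hw
  have := Finset.card_le_three (a := a) (b := b) (c := c)
  omega

/-- The face would be the only one at `v`, which would have degree 2. -/
theorem InFCirc4.false_of_link₂ (hG : G.InFCirc4) (h : G.IsTri v a b) (ha : G.BoundaryEdge v a)
    (hb : G.BoundaryEdge v b) : False := by
  have hN : ∀ w, G.graph.Adj v w → w ∈ ({a, b} : Set V) := by
    refine hG.isCombDisk.link h.adj₁₂ (by simp) ?_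
    rintro p q hpq (rfl | rfl)
    · simp [ha.unique hpq h]
    · simp [hb.unique hpq h.swap₂₃]
  have h3 := hG.three_le h.adj₁₂
  have h5 := deg_le_card (s := {a, b}) fun w hw => by simpa using hN w hw
  have := Finset.card_le_two (a := a) (b := b)
  omega

theorem InFCirc4.exists_link₄ (hG : G.InFCirc4) (hv : ¬ G.BoundaryVertex v) (hd : G.deg v = 4)
    (h : G.IsTri v a b) : ∃ c d, G.IsTri v b c ∧ G.IsTri v c d ∧ G.IsTri v d a ∧ a ≠ c ∧ b ≠ d ∧
      ∀ w, G.graph.Adj v w → w = a ∨ w = b ∨ w = c ∨ w = d := by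
  have hC := hG.isCombDisk
  obtain ⟨d, hdb, hd'⟩ := exists_other hv h
  obtain ⟨c, hca, hc⟩ := exists_other hv h.swap₂₃
  have hcd : c ≠ d := by
    rintro rfl
    exact hG.false_of_link₃ h hc hd'.swap₂₃
  have hN : ∀ w, G.graph.Adj v w → w ∈ ({a, b, c, d} : Finset V) := by
    intro w
    refine mem_of_deg_le_card ?_ ?_
    · intro w hw
      simp only [Finset.mem_insert, Finset.mem_singleton] at hw
      rcases hw with rfl | rfl | rfl | rfl
      exacts [h.adj₁₂, h.adj₁₃, hc.adj₁₃, hd'.adj₁₃]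
    · rw [hd, Finset.card_insert_of_notMem, Finset.card_insert_of_notMem, Finset.card_pair hcd]
      · simp [hc.ne₂₃, hdb.symm]
      · simp [h.ne₂₃, hca.symm, hd'.ne₂₃]
  simp only [Finset.mem_insert, Finset.mem_singleton] at hN
  obtain ⟨e, heb, he⟩ := exists_other hv hc.swap₂₃
  refine ⟨c, d, hc, ?_, hd'.swap₂₃, hca.symm, hdb.symm, hN⟩
  rcases hN e he.adj₁₃ with rfl | rfl | rfl | rfl
  · rcases hC.eq_or_eq h hd' hdb.symm he.swap₂₃ with h' | h'
    · exact (hc.ne₂₃ h'.symm).elim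
    · exact (hcd h').elim
  · exact (heb rfl).elim
  · exact (he.ne₂₃ rfl).elim
  · exact he

theorem IsCombDisk.link₄ (hG : G.IsCombDisk) (h₁ : G.IsTri v a b) (h₂ : G.IsTri v b c)
    (h₃ : G.IsTri v c d) (h₄ : G.IsTri v d a) (hac : a ≠ c) (hbd : b ≠ d) :
    ¬ G.BoundaryVertex v ∧ G.deg v = 4 ∧
      ∀ w, G.graph.Adj v w → w = a ∨ w = b ∨ w = c ∨ w = d := by
  have hN : ∀ w, G.graph.Adj v w → w ∈ ({a, b, c, d} : Set V) := by
    refine hG.link h₁.adj₁₂ (by simp) ?_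
    rintro p q hpq (rfl | rfl | rfl | rfl)
    · rcases hG.eq_or_eq h₁ h₄.swap₂₃ hbd hpq with rfl | rfl <;> simp
    · rcases hG.eq_or_eq h₁.swap₂₃ h₂ hac hpq with rfl | rfl <;> simp
    · rcases hG.eq_or_eq h₂.swap₂₃ h₃ hbd hpq with rfl | rfl <;> simp
    · rcases hG.eq_or_eq h₃.swap₂₃ h₄ hac.symm hpq with rfl | rfl <;> simp
  refine ⟨?_, ?_, hN⟩
  · rintro ⟨w, hw⟩
    rcases hN w hw.adj with rfl | rfl | rfl | rfl
    · exact not_boundaryEdge_of_ne h₁ h₄.swap₂₃ hbd hw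
    · exact not_boundaryEdge_of_ne h₁.swap₂₃ h₂ hac hw
    · exact not_boundaryEdge_of_ne h₂.swap₂₃ h₃ hbd hw
    · exact not_boundaryEdge_of_ne h₃.swap₂₃ h₄ hac.symm hw
  · have hcard : ({a, b, c, d} : Finset V).card = 4 := by
      rw [Finset.card_insert_of_notMem, Finset.card_insert_of_notMem, Finset.card_pair h₃.ne₂₃]
      · simp [h₂.ne₂₃, hbd]
      · simp [h₁.ne₂₃, hac, h₄.ne₂₃.symm]
    rw [← hcard]
    refine le_antisymm (deg_le_card fun w hw => by simpa using hN w hw) (card_le_deg fun w hw => ?_)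
    simp only [Finset.mem_insert, Finset.mem_singleton] at hw
    rcases hw with rfl | rfl | rfl | rfl
    exacts [h₁.adj₁₂, h₂.adj₁₂, h₃.adj₁₂, h₄.adj₁₂]

theorem IsCombDisk.isTri_of_link₄ (hG : G.IsCombDisk) (h₁ : G.IsTri v a b) (h₂ : G.IsTri v b c)
    (h₃ : G.IsTri v c d) (h₄ : G.IsTri v d a) (hac : a ≠ c) (hbd : b ≠ d) (h : G.IsTri v p q) :
    (p = a ∧ q = b ∨ p = b ∧ q = a) ∨ (p = b ∧ q = c ∨ p = c ∧ q = b) ∨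
      (p = c ∧ q = d ∨ p = d ∧ q = c) ∨ (p = d ∧ q = a ∨ p = a ∧ q = d) := by
  obtain ⟨-, -, hN⟩ := hG.link₄ h₁ h₂ h₃ h₄ hac hbd
  rcases hN p h.adj₁₂ with rfl | rfl | rfl | rfl
  · rcases hG.eq_or_eq h₁ h₄.swap₂₃ hbd h with rfl | rfl <;> simp
  · rcases hG.eq_or_eq h₁.swap₂₃ h₂ hac h with rfl | rfl <;> simp
  · rcases hG.eq_or_eq h₂.swap₂₃ h₃ hbd h with rfl | rfl <;> simp
  · rcases hG.eq_or_eq h₃.swap₂₃ h₄ hac.symm h with rfl | rfl <;> simp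

/-- Two consecutive inner neighbours of degree 4 of a vertex of degree 4 determine a second apex. -/
theorem InFCirc4.exists_apex (hG : G.InFCirc4) (h₁ : G.IsTri x b z) (h₂ : G.IsTri x z y)
    (h₃ : G.IsTri x y a) (haz : a ≠ z) (hby : b ≠ y) (hz : ¬ G.BoundaryVertex z)
    (hz4 : G.deg z = 4) (hy : ¬ G.BoundaryVertex y) (hy4 : G.deg y = 4) :
    ∃ q, q ≠ x ∧ G.IsTri z b q ∧ G.IsTri z y q ∧ G.IsTri y a q := by
  have hC := hG.isCombDisk
  obtain ⟨c, d, k1, k2, k3, k4, k5, -⟩ := hG.exists_link₄ hz hz4 h₁.swap₁₃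
  obtain ⟨c', d', l1, l2, l3, l4, l5, -⟩ := hG.exists_link₄ hy hy4 h₂.swap₁₃
  obtain rfl := hC.eq_of_ne h₁.rotate.rotate k1 h₂.swap₁₂ k4 hby
  obtain rfl := hC.eq_of_ne h₂.rotate.rotate l1 h₃.swap₁₂ l4 haz.symm
  obtain rfl := hC.eq_of_ne h₂.swap₁₃ l3.swap₂₃ k2.swap₁₂ l5 k5
  exact ⟨d', k5.symm, k3.swap₂₃, k2, l2⟩

/-- A member of the class without contractions inside the class. -/
structure IsReduced (G : TriComplex V) : Prop where
  inFCirc4 : G.InFCirc4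
  exists_critical : ∀ {u v}, G.graph.Adj u v →
    (∀ w, G.graph.Adj u w → G.graph.Adj v w → G.IsTri u v w) →
    (G.BoundaryEdge u v ∨ ¬ G.BoundaryVertex u ∨ ¬ G.BoundaryVertex v) →
    ∃ w, G.IsTri u v w ∧ G.Critical w

/-- The rule by which criticality spreads from face to face. -/
theorem IsReduced.critical_of_ne (hG : G.IsReduced) (h₁ : G.IsTri u v w) (h₂ : G.IsTri u v x)
    (hne : w ≠ x) (hfac : ∀ w, G.graph.Adj u w → G.graph.Adj v w → G.IsTri u v w)
    (hb : ¬ G.BoundaryVertex u ∨ ¬ G.BoundaryVertex v) (hw : ¬ G.Critical w) : G.Critical x := by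
  obtain ⟨y, hy, hyc⟩ := hG.exists_critical h₁.adj₁₂ hfac (Or.inr hb)
  rcases hG.inFCirc4.isCombDisk.eq_or_eq h₁ h₂ hne hy with rfl | rfl
  · exact (hw hyc).elim
  · exact hyc

theorem IsReduced.critical_of_boundaryEdge (hG : G.IsReduced) (h : G.IsTri u v w)
    (hb : G.BoundaryEdge u v) (hfac : ∀ w, G.graph.Adj u w → G.graph.Adj v w → G.IsTri u v w) :
    G.Critical w := by
  obtain ⟨y, hy, hyc⟩ := hG.exists_critical h.adj₁₂ hfac (Or.inl hb)
  rwa [hb.unique h hy]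

theorem Critical.deg_of_inner (h : G.Critical v) (hv : ¬ G.BoundaryVertex v) : G.deg v = 4 :=
  h.elim (·.2) fun h => (hv h.1).elim

theorem Critical.deg_of_boundary (h : G.Critical v) (hv : G.BoundaryVertex v) : G.deg v = 3 :=
  h.elim (fun h => (h.1 hv).elim) (·.2)

theorem four_le_deg (ha : G.graph.Adj v a) (hb : G.graph.Adj v b) (hc : G.graph.Adj v c)
    (hd : G.graph.Adj v d) (hab : a ≠ b) (hac : a ≠ c) (had : a ≠ d) (hbc : b ≠ c) (hbd : b ≠ d)
    (hcd : c ≠ d) : 4 ≤ G.deg v := by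
  have hcard : ({a, b, c, d} : Finset V).card = 4 := by
    rw [Finset.card_insert_of_notMem, Finset.card_insert_of_notMem, Finset.card_pair hcd]
    · simp [hbc, hbd]
    · simp [hab, hac, had]
  rw [← hcard]
  refine card_le_deg fun w hw => ?_
  simp only [Finset.mem_insert, Finset.mem_singleton] at hw
  rcases hw with rfl | rfl | rfl | rfl <;> assumption

theorem not_critical_of_four_le (hv : G.BoundaryVertex v) (h : 4 ≤ G.deg v) : ¬ G.Critical v :=
  fun hc => by
    have := hc.deg_of_boundary hv
    omega

/-- A reduced complex without chords whose 3-cycles are faces is a flag. -/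
theorem IsReduced.isFlag (hG : G.IsReduced)
    (hfac : ∀ a b c, G.graph.Adj a b → G.graph.Adj a c → G.graph.Adj b c → G.IsTri a b c)
    (hno : ∀ a b, G.graph.Adj a b → G.BoundaryVertex a → G.BoundaryVertex b → G.BoundaryEdge a b) :
    G.IsFlag := by
  have hF := hG.inFCirc4
  have hC := hF.isCombDisk
  obtain ⟨u, v, huv⟩ := hC.bdry
  obtain ⟨x, hx, -⟩ := boundaryEdge_iff.mp huv
  have hbu : G.BoundaryVertex u := ⟨v, huv⟩
  have hbv : G.BoundaryVertex v := ⟨u, huv.symm⟩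
  have hxi : ¬ G.BoundaryVertex x := fun hxb =>
    hF.false_of_link₂ hx.rotate.rotate (hno _ _ hx.adj₁₃.symm hxb hbu)
      (hno _ _ hx.adj₂₃.symm hxb hbv)
  -- The face `uvx` is the only one at `uv`, so `x` is critical.
  have hx4 := (hG.critical_of_boundaryEdge hx huv fun w h h' =>
      hfac _ _ _ hx.adj₁₂ h h').deg_of_inner hxi
  have t1 : G.IsTri x u v := hx.rotate.rotate
  obtain ⟨b, a, t2, t3, t4, hub, hva, hN⟩ := hF.exists_link₄ hxi hx4 t1
  -- If `b` were inner, `a` would have degree at least 4 and not be critical. Then the edge `xu`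
  -- makes `v` critical, but `v` has four neighbours as well.
  have key : ∀ u v a b, G.BoundaryEdge u v → G.IsTri x u v → G.IsTri x v b → G.IsTri x b a →
      G.IsTri x a u → u ≠ b → v ≠ a → G.BoundaryVertex a → G.BoundaryVertex b := by
    intro u v a b huv t1 t2 t3 t4 hub hva ha
    by_contra hb
    have hbu : G.BoundaryVertex u := ⟨v, huv⟩
    have hbv : G.BoundaryVertex v := ⟨u, huv.symm⟩
    have hau := hno a u t4.adj₂₃ ha hbu
    obtain ⟨d, hdx, hd⟩ := exists_other hb t3.rotate
    have hdu : d ≠ u := by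
      rintro rfl
      exact t3.ne₁₂ (hau.unique t4.rotate hd.rotate)
    have ha4 := four_le_deg t4.adj₂₃ t4.adj₁₂.symm t3.adj₂₃.symm hd.adj₂₃ t4.ne₁₃.symm hub hdu.symm
      t3.ne₁₂ hdx.symm hd.ne₁₃
    have hvc : G.Critical v := hG.critical_of_ne t4.swap₂₃ t1 hva.symm
      (fun w h h' => hfac _ _ _ t1.adj₁₂ h h') (Or.inl hxi) (not_critical_of_four_le ha ha4)
    obtain ⟨e, hex, he⟩ := exists_other hb t2.swap₁₃
    have heu : e ≠ u := by
      rintro rfl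
      exact t2.ne₁₃ (huv.unique t1.rotate he.swap₁₃)
    have := four_le_deg huv.adj.symm t1.adj₁₃.symm t2.adj₂₃ he.adj₂₃ t1.ne₁₂.symm hub heu.symm
      t2.ne₁₃ hex.symm he.ne₁₃
    have := hvc.deg_of_boundary hbv
    omega
  -- A further face at the inner vertex `a` gives `u` a fourth neighbour.
  have nc : ∀ u v a, G.BoundaryEdge u v → G.IsTri x u v → G.IsTri x a u → v ≠ a →
      ¬ G.BoundaryVertex a → ¬ G.Critical u := by
    intro u v a huv t1 t4 hva ha
    obtain ⟨d, hdx, hd⟩ := exists_other ha t4.rotate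
    have hdv : d ≠ v := by
      rintro rfl
      exact t4.ne₁₂ (huv.unique t1.rotate hd.rotate)
    exact not_critical_of_four_le ⟨v, huv⟩ (four_le_deg huv.adj t1.adj₁₂.symm t4.adj₂₃.symm hd.adj₂₃
      t1.ne₁₃.symm hva hdv.symm t4.ne₁₂ hdx.symm hd.ne₁₃)
  by_cases ha : G.BoundaryVertex a
  · have hb := key u v a b huv t1 t2 t3 t4 hub hva ha
    have hlink : ∀ p q, G.IsTri x p q → G.BoundaryEdge p q := by
      intro p q h
      refine hno p q h.adj₂₃ ?_ ?_ <;>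
        rcases hC.isTri_of_link₄ t1 t2 t3 t4 hub hva h with (h | h) | (h | h) | (h | h) |
          (h | h) <;>
        rcases h with ⟨rfl, rfl⟩ <;> assumption
    have hall : ∀ t ∈ G.faces, x ∈ t := by
      intro t ht
      refine hC.forall_face (P := fun t => x ∈ t) ?_ t1 (by simp) ht
      intro p q r s hr hs h
      simp only [Finset.mem_insert, Finset.mem_singleton] at h ⊢
      rcases h with rfl | rfl | rfl
      · simp
      · simp
      · exact Or.inr (Or.inr ((hlink p q hr.rotate.rotate).unique hr hs))
    refine ⟨x, u, v, b, a, ?_, ?_⟩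
    · simp [t1.ne₁₂, t1.ne₁₃, t2.ne₁₃, t3.ne₁₃, t1.ne₂₃, hub, t4.ne₂₃.symm, t2.ne₂₃, hva, t3.ne₂₃]
    · ext t
      simp only [Finset.mem_insert, Finset.mem_singleton]
      constructor
      · intro ht
        obtain ⟨p, q, rfl, h⟩ := exists_eq_of_mem_face ht (hall t ht)
        rcases hC.isTri_of_link₄ t1 t2 t3 t4 hub hva h with (h | h) | (h | h) | (h | h) |
          (h | h) <;>
          rcases h with ⟨rfl, rfl⟩
        · simp
        · simp [Finset.pair_comm p q]
        · simp
        · simp [Finset.pair_comm p q]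
        · simp
        · simp [Finset.pair_comm p q]
        · simp
        · simp [Finset.pair_comm p q]
      · rintro (rfl | rfl | rfl | rfl) <;> assumption
  -- If `a` and `b` are inner, both are critical and have degree 4. Their second apex `q` is a
  -- common neighbour of `u` and `v`, and gives a second face at the boundary edge `uv`.
  · have hb : ¬ G.BoundaryVertex b := fun hb =>
      ha (key v u b a huv.symm t1.swap₂₃ t4.swap₂₃ t3.swap₂₃ t2.swap₂₃ hva hub hb)
    have ha4 : G.deg a = 4 := (hG.critical_of_ne t1 t4.swap₂₃ hva
      (fun w h h' => hfac _ _ _ t1.adj₁₂ h h') (Or.inl hxi)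
      (nc v u b huv.symm t1.swap₂₃ t2.swap₂₃ hub hb)).deg_of_inner ha
    have hb4 : G.deg b = 4 := (hG.critical_of_ne t1.swap₂₃ t2 hub
      (fun w h h' => hfac _ _ _ t1.adj₁₃ h h') (Or.inl hxi)
      (nc u v a huv t1 t4 hva ha)).deg_of_inner hb
    obtain ⟨q, hqx, q1, -, q3⟩ := hF.exists_apex t2 t3 t4 hub hva hb hb4 ha ha4
    exact (hqx (huv.unique (hfac u v q huv.adj q3.adj₂₃ q1.adj₂₃) t1.rotate)).elim

end TriComplex

/-! ### Homology modulo 2 as a substitute for the Jordan curve theorem. -/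

namespace TriComplex
variable {V : Type*} [DecidableEq V] {G : TriComplex V} {a b c d u v w x y z p q : V}
  {P Q : Finset (Finset V)} {e : Sym2 V}

/-! ### Chains modulo 2 -/

open Classical in
/-- The chain of the edges of a set of vertices. -/
noncomputable def edgeChain (t : Finset V) (e : Sym2 V) : ZMod 2 :=
  if ¬ e.IsDiag ∧ ∀ x ∈ e, x ∈ t then 1 else 0

/-- The boundary of a set of triangles. -/
noncomputable def boundary (P : Finset (Finset V)) (e : Sym2 V) : ZMod 2 := ∑ t ∈ P, edgeChain t e

/-- The edges of the complex. -/
def edges (G : TriComplex V) : Finset (Sym2 V) := G.faces.biUnion fun t => {e ∈ t.sym2 | ¬ e.IsDiag}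

theorem edgeChain_mk (t : Finset V) (a b : V) :
    edgeChain t s(a, b) = if a ≠ b ∧ a ∈ t ∧ b ∈ t then 1 else 0 := by
  unfold edgeChain
  congr 1
  simp

theorem mem_edges : s(a, b) ∈ G.edges ↔ G.graph.Adj a b := by
  simp only [edges, Finset.mem_biUnion, Finset.mem_filter, Finset.mk_mem_sym2_iff,
    Sym2.mk_isDiag_iff]
  constructor
  · rintro ⟨t, ht, ⟨ha, hb⟩, hab⟩
    exact ⟨hab, t, ht, ha, hb⟩
  · rintro ⟨hab, t, ht, ha, hb⟩
    exact ⟨t, ht, ⟨ha, hb⟩, hab⟩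

theorem edgeChain_triple (hab : a ≠ b) (hac : a ≠ c) (hbc : b ≠ c) :
    edgeChain {a, b, c} = Pi.single s(a, b) 1 + Pi.single s(b, c) 1 + Pi.single s(a, c) 1 := by
  funext e
  induction e with | _ p q
  rw [edgeChain_mk]
  simp only [Pi.add_apply, Pi.single_apply, Finset.mem_insert, Finset.mem_singleton, Sym2.eq_iff]
  by_cases h1 : p = a
  · subst h1
    by_cases h2 : q = b
    · subst h2; simp [hab, hac, hbc, hab.symm]
    · by_cases h3 : q = c
      · subst h3; simp [hab, hac, hbc.symm]
      · simp [h2, h3, hab, hac]; grind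
  · by_cases h2 : p = b
    · subst h2
      by_cases h3 : q = a
      · subst h3; simp [hab.symm, hbc]; grind
      · by_cases h4 : q = c
        · subst h4; simp [hab.symm, hbc, hac.symm]
        · simp [h3, h4, hab.symm, hbc]; grind
    · by_cases h3 : p = c
      · subst h3
        by_cases h4 : q = a
        · subst h4; simp [hac.symm, hab, hbc.symm]
        · by_cases h5 : q = b
          · subst h5; simp [hac.symm, hbc.symm]; grind
          · simp [h4, h5, hac.symm, hbc.symm]; grind
      · simp [h1, h2, h3]

theorem sum_edgeChain (h₁ : G.graph.Adj a b) (h₂ : G.graph.Adj a c) (h₃ : G.graph.Adj b c) (x : V) :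
    ∑ e ∈ G.edges with x ∈ e, edgeChain {a, b, c} e = 0 := by
  rw [edgeChain_triple h₁.1 h₂.1 h₃.1]
  simp only [Pi.add_apply, Pi.single_apply, Finset.sum_add_distrib, Finset.sum_ite_eq',
    Finset.mem_filter, mem_edges, h₁, h₂, h₃, Sym2.mem_iff, true_and]
  have h12 := h₁.1
  have h13 := h₂.1
  have h23 := h₃.1
  by_cases h1 : x = a
  · subst h1; simp [h12, h13]; decide
  · by_cases h2 : x = b
    · subst h2; simp [h1, h23]; decide
    · by_cases h3 : x = c
      · subst h3; simp [h1, h2]; decide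
      · simp [h1, h2, h3]

theorem sum_boundary (hP : P ⊆ G.faces) (x : V) : ∑ e ∈ G.edges with x ∈ e, boundary P e = 0 := by
  simp only [boundary]
  rw [Finset.sum_comm]
  refine Finset.sum_eq_zero fun t ht => ?_
  obtain ⟨a, b, c, -, -, -, rfl⟩ := Finset.card_eq_three.mp (G.card_eq t (hP ht))
  have h : G.IsTri a b c := hP ht
  exact sum_edgeChain h.adj₁₂ h.adj₁₃ h.adj₂₃ x

theorem boundary_mk (hab : a ≠ b) :
    boundary P s(a, b) = (({t ∈ P | a ∈ t ∧ b ∈ t}.card : ℕ) : ZMod 2) := by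
  simp only [boundary, edgeChain_mk, Finset.sum_boole]
  simp [hab]

theorem boundary_congr (h : ∀ t, a ∈ t → b ∈ t → (t ∈ P ↔ t ∈ Q)) :
    boundary P s(a, b) = boundary Q s(a, b) := by
  by_cases hab : a = b
  · simp [boundary, edgeChain_mk, hab]
  · rw [boundary_mk hab, boundary_mk hab]
    congr 2
    ext t
    simp only [Finset.mem_filter]
    constructor
    · rintro ⟨h1, h2⟩; exact ⟨(h t h2.1 h2.2).mp h1, h2⟩
    · rintro ⟨h1, h2⟩; exact ⟨(h t h2.1 h2.2).mpr h1, h2⟩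

theorem boundary_empty : boundary (∅ : Finset (Finset V)) e = 0 := rfl

theorem boundary_add_boundary_sdiff (h : P ⊆ Q) :
    boundary (Q \ P) e + boundary P e = boundary Q e :=
  Finset.sum_sdiff h

theorem boundary_eq_zero_of_not_adj (hP : P ⊆ G.faces) (h : ¬ G.graph.Adj a b) :
    boundary P s(a, b) = 0 := by
  refine Finset.sum_eq_zero fun t ht => ?_
  rw [edgeChain_mk, if_neg]
  rintro ⟨hab, ha, hb⟩
  exact h ⟨hab, t, hP ht, ha, hb⟩

theorem exists_mem_of_boundary_ne (hP : P ⊆ G.faces) (h : boundary P s(a, b) ≠ 0) :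
    ∃ c, G.IsTri a b c ∧ {a, b, c} ∈ P := by
  obtain ⟨t, ht, h⟩ := Finset.exists_ne_zero_of_sum_ne_zero h
  rw [edgeChain_mk] at h
  have h : a ≠ b ∧ a ∈ t ∧ b ∈ t := by
    by_contra hn
    exact h (if_neg hn)
  obtain ⟨c, rfl, hc⟩ := exists_eq_of_mem_face₂ (hP ht) h.2.1 h.2.2 h.1
  exact ⟨c, hc, ht⟩

theorem exists_ne_of_boundary_eq_zero (hP : P ⊆ G.faces) (h : boundary P s(a, b) = 0)
    (hc : G.IsTri a b c) (hcP : {a, b, c} ∈ P) : ∃ d, d ≠ c ∧ G.IsTri a b d ∧ {a, b, d} ∈ P := by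
  by_contra! hcon
  rw [boundary_mk hc.ne₁₂] at h
  have : {t ∈ P | a ∈ t ∧ b ∈ t} = {{a, b, c}} := by
    ext t
    simp only [Finset.mem_filter, Finset.mem_singleton]
    constructor
    · rintro ⟨ht, ha, hb⟩
      obtain ⟨d, rfl, hd⟩ := exists_eq_of_mem_face₂ (hP ht) ha hb hc.ne₁₂
      by_cases hdc : d = c
      · rw [hdc]
      · exact (hcon d hdc hd ht).elim
    · rintro rfl
      exact ⟨hcP, by simp, by simp⟩
  rw [this] at h
  simp at h

theorem IsTri.triple_inj (h : G.IsTri a b c) (h' : ({a, b, c} : Finset V) = {a, b, d}) : c = d := by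
  have : c ∈ ({a, b, d} : Finset V) := h' ▸ (by simp)
  simp only [Finset.mem_insert, Finset.mem_singleton] at this
  rcases this with h1 | h1 | h1
  · exact (h.ne₁₃ h1.symm).elim
  · exact (h.ne₂₃ h1.symm).elim
  · exact h1

theorem IsCombDisk.eq_of_boundary_ne (hG : G.IsCombDisk) (hP : P ⊆ G.faces)
    (h : boundary P s(a, b) ≠ 0) (hc : {a, b, c} ∈ P) (hd : {a, b, d} ∈ P) : c = d := by
  by_contra hne
  have hc' : G.IsTri a b c := hP hc
  have hd' : G.IsTri a b d := hP hd
  refine h ?_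
  rw [boundary_mk hc'.ne₁₂]
  have : {t ∈ P | a ∈ t ∧ b ∈ t} = {{a, b, c}, {a, b, d}} := by
    ext t
    simp only [Finset.mem_filter, Finset.mem_singleton, Finset.mem_insert]
    constructor
    · rintro ⟨ht, ha, hb⟩
      obtain ⟨e, rfl, he⟩ := exists_eq_of_mem_face₂ (hP ht) ha hb hc'.ne₁₂
      rcases hG.eq_or_eq hc' hd' hne he with rfl | rfl <;> simp
    · rintro (rfl | rfl)
      · exact ⟨hc, by simp, by simp⟩
      · exact ⟨hd, by simp, by simp⟩
  rw [this, Finset.card_pair fun h' => hne (hc'.triple_inj h')]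
  rfl

/-- Second homology vanishes because a nonempty set without boundary would be a closed subcomplex. A
set of triangles is therefore determined by its boundary. -/
theorem IsCombDisk.eq_empty_of_boundary_eq_zero (hG : G.IsCombDisk) (hP : P ⊆ G.faces)
    (h : ∀ a b, boundary P s(a, b) = 0) : P = ∅ := by
  by_contra hne
  obtain ⟨t, ht⟩ := Finset.nonempty_iff_ne_empty.mpr hne
  exact hG.false_of_closed (P := (· ∈ P))
    (fun a b c hc hcP => exists_ne_of_boundary_eq_zero hP (h a b) hc hcP) (hP ht) ht

theorem IsCombDisk.boundary_faces (hG : G.IsCombDisk) :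
    boundary G.faces s(a, b) ≠ 0 ↔ G.BoundaryEdge a b := by
  constructor
  · intro h
    obtain ⟨c, hc, hcm⟩ := exists_mem_of_boundary_ne subset_rfl h
    exact boundaryEdge_iff.mpr ⟨c, hc, fun d hd => hG.eq_of_boundary_ne subset_rfl h hd hcm⟩
  · intro h h0
    obtain ⟨c, hc, -⟩ := boundaryEdge_iff.mp h
    obtain ⟨d, hne, hd, -⟩ := exists_ne_of_boundary_eq_zero subset_rfl h0 hc hc
    exact hne (h.unique hd hc)

/-! ### Duality -/

/-- A functional that kills the boundaries of faces is a cocycle. Separating functionals thus turn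
vanishing cohomology into statements on chains. -/
theorem IsCombDisk.exists_potential (hG : G.IsCombDisk) (f : (Sym2 V → ZMod 2) →ₗ[ZMod 2] ZMod 2)
    (hf : ∀ t ∈ G.faces, f (edgeChain t) = 0) :
    ∃ g : V → ZMod 2, ∀ a b, G.graph.Adj a b → f (Pi.single s(a, b) 1) = g a + g b := by
  refine hG.h1 (fun a b => f (Pi.single s(a, b) 1)) (fun a b => by rw [Sym2.eq_swap]) ?_
  intro a b c h
  have := hf _ h
  rw [edgeChain_triple h.ne₁₂ h.ne₁₃ h.ne₂₃, map_add, map_add] at this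
  exact CharTwo.add_eq_zero.mp this

theorem mem_span_edgeChain {z : Sym2 V → ZMod 2}
    (h : z ∈ Submodule.span (ZMod 2) (edgeChain '' (G.faces : Set (Finset V)))) :
    ∃ P ⊆ G.faces, ∀ e, boundary P e = z e := by
  obtain ⟨c', hc⟩ := (Submodule.mem_span_image_finset_iff_exists_fun (ZMod 2)).mp h
  let c : Finset V → ZMod 2 := fun t => if ht : t ∈ G.faces then c' ⟨t, ht⟩ else 0
  have hc : ∑ t ∈ G.faces, c t • edgeChain t = z := by
    rw [← hc, ← Finset.sum_coe_sort]
    exact Finset.sum_congr rfl fun t _ => by simp [c]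
  refine ⟨{t ∈ G.faces | c t ≠ 0}, Finset.filter_subset _ _, fun e => ?_⟩
  rw [← hc, boundary, Finset.sum_filter, Finset.sum_apply]
  refine Finset.sum_congr rfl fun t _ => ?_
  have : ∀ s : ZMod 2, s = 0 ∨ s = 1 := by decide
  rcases this (c t) with h | h <;> simp [h]

/-- Every cycle is the boundary of a set of triangles. -/
theorem IsCombDisk.exists_boundary_eq (hG : G.IsCombDisk) (z : Sym2 V → ZMod 2)
    (hz : ∀ e, z e ≠ 0 → e ∈ G.edges) (hsum : ∀ x, ∑ e ∈ G.edges with x ∈ e, z e = 0) :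
    ∃ P ⊆ G.faces, ∀ e, boundary P e = z e := by
  refine mem_span_edgeChain ?_
  by_contra hn
  -- If `z` is not in the span, a functional separates it from the boundaries. Its potential `g`
  -- gives it the value `∑ g x * ∑ z e` with `e` running over the edges at `x`, which is zero on a
  -- cycle.
  obtain ⟨f, hfz, hf⟩ := Submodule.exists_le_ker_of_notMem hn
  obtain ⟨g, hg⟩ := hG.exists_potential f fun t ht =>
    hf (Submodule.subset_span (mem_image_of_mem _ ht))
  refine hfz ?_
  have hz' : z = ∑ e ∈ G.edges, z e • Pi.single e (1 : ZMod 2) := by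
    funext e
    simp only [Finset.sum_apply, Pi.smul_apply, Pi.single_apply, smul_eq_mul, mul_ite, mul_one,
      mul_zero, Finset.sum_ite_eq]
    by_cases h : e ∈ G.edges
    · simp [h]
    · rw [if_neg h]
      by_contra h0
      exact h (hz e h0)
  have hterm : ∀ e ∈ G.edges, f (Pi.single e (1 : ZMod 2)) =
      ∑ x ∈ G.faces.biUnion id with x ∈ e, g x := by
    intro e he
    induction e with | _ a b
    have hab := mem_edges.mp he
    rw [hg a b hab, ← Finset.sum_pair hab.1]
    refine Finset.sum_congr ?_ fun _ _ => rfl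
    ext x
    obtain ⟨-, t, ht, ha, hb⟩ := hab
    simp only [Finset.mem_insert, Finset.mem_singleton, Finset.mem_filter, Sym2.mem_iff,
      Finset.mem_biUnion, id]
    constructor
    · rintro (rfl | rfl)
      · exact ⟨⟨t, ht, ha⟩, Or.inl rfl⟩
      · exact ⟨⟨t, ht, hb⟩, Or.inr rfl⟩
    · exact And.right
  rw [hz', map_sum]
  calc ∑ e ∈ G.edges, f (z e • Pi.single e 1)
      = ∑ e ∈ G.edges, ∑ x ∈ G.faces.biUnion id with x ∈ e, z e * g x := by
        refine Finset.sum_congr rfl fun e he => ?_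
        rw [map_smul, hterm e he, smul_eq_mul, Finset.mul_sum]
    _ = ∑ x ∈ G.faces.biUnion id, ∑ e ∈ G.edges with x ∈ e, z e * g x := by
        simp only [Finset.sum_filter]
        exact Finset.sum_comm
    _ = 0 := by
        refine Finset.sum_eq_zero fun x _ => ?_
        rw [← Finset.sum_mul, hsum, zero_mul]

theorem IsCombDisk.exists_boundary_eq_edgeChain (hG : G.IsCombDisk) (h₁ : G.graph.Adj a b)
    (h₂ : G.graph.Adj a c) (h₃ : G.graph.Adj b c) :
    ∃ P ⊆ G.faces, ∀ e, boundary P e = edgeChain {a, b, c} e := by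
  refine hG.exists_boundary_eq _ (fun e he => ?_) (sum_edgeChain h₁ h₂ h₃)
  rw [edgeChain_triple h₁.1 h₂.1 h₃.1] at he
  by_contra hn
  refine he ?_
  have : ∀ p q, G.graph.Adj p q → e ≠ s(p, q) := by
    rintro p q h rfl
    exact hn (mem_edges.mpr h)
  simp [this _ _ h₁, this _ _ h₂, this _ _ h₃]

/-- The boundary is connected. -/
theorem IsCombDisk.mem_of_boundaryVertex (hG : G.IsCombDisk) {B : Set V} (hu : G.BoundaryVertex u)
    (hv : G.BoundaryVertex v) (huB : u ∈ B) (hB : ∀ a b, G.BoundaryEdge a b → a ∈ B → b ∈ B) :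
    v ∈ B := by
  classical
  -- `z` is the part of the boundary inside `B`. It is a cycle since `B` is a union of components of
  -- the boundary.
  let z : Sym2 V → ZMod 2 := fun e => if ∀ x ∈ e, x ∈ B then boundary G.faces e else 0
  have hzmk : ∀ a b, a ∈ B → b ∈ B → z s(a, b) = boundary G.faces s(a, b) := by
    intro a b ha hb
    exact if_pos (by simp [ha, hb])
  have hz₁ : ∀ e, z e ≠ 0 → e ∈ G.edges := by
    intro e he
    induction e with | _ a b
    by_contra hn
    refine he ?_
    have := boundary_eq_zero_of_not_adj (subset_refl G.faces) (mt mem_edges.mpr hn)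
    simp only [z, this, ite_self]
  have hz₂ : ∀ x, ∑ e ∈ G.edges with x ∈ e, z e = 0 := by
    intro x
    by_cases hx : x ∈ B
    · rw [← sum_boundary (subset_refl G.faces) x]
      refine Finset.sum_congr rfl fun e he => ?_
      have hxe := (Finset.mem_filter.mp he).2
      obtain ⟨y, rfl⟩ := Sym2.mem_iff_exists.mp hxe
      by_cases h : G.BoundaryEdge x y
      · exact hzmk x y hx (hB x y h hx)
      · have := not_not.mp (mt hG.boundary_faces.mp h)
        simp only [z, this, ite_self]
    · refine Finset.sum_eq_zero fun e he => if_neg fun h => hx (h x (Finset.mem_filter.mp he).2)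
  obtain ⟨P, hP, hPz⟩ := hG.exists_boundary_eq z hz₁ hz₂
  obtain ⟨y, hy⟩ := hu
  have hz : z s(u, y) ≠ 0 := by
    rw [hzmk u y huB (hB u y hy huB)]
    exact hG.boundary_faces.mpr hy
  rw [← hPz] at hz
  obtain ⟨c, hc, hcP⟩ := exists_mem_of_boundary_ne hP hz
  -- The set bounded by `z` continues across every inner edge, hence contains all faces; so `z` is
  -- the whole boundary.
  have hall : ∀ t ∈ G.faces, t ∈ P := by
    intro t ht
    refine hG.forall_face_of_exists (P := (· ∈ P)) ?_ hc hcP ht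
    intro a b c hc hcP
    by_cases hab : G.BoundaryEdge a b
    · exact Or.inl hab
    · refine Or.inr (exists_ne_of_boundary_eq_zero hP ?_ hc hcP)
      rw [hPz]
      have := not_not.mp (mt hG.boundary_faces.mp hab)
      simp only [z, this, ite_self]
  have hPe : P = G.faces := Finset.Subset.antisymm hP hall
  obtain ⟨w, hw⟩ := hv
  have := hG.boundary_faces.mpr hw
  rw [← hPe, hPz] at this
  by_contra hvB
  exact this (if_neg fun h => hvB (h v (by simp)))

/-- A chord cuts the complex: it is the inner part of the boundary of a set of triangles. -/
theorem IsCombDisk.exists_chord_region (hG : G.IsCombDisk) (huv : G.graph.Adj u v)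
    (hu : G.BoundaryVertex u) (hv : G.BoundaryVertex v) :
    ∃ P ⊆ G.faces, ∀ a b, ¬ G.BoundaryEdge a b → boundary P s(a, b) =
      (Pi.single s(u, v) 1 : Sym2 V → ZMod 2) s(a, b) := by
  let S₁ := Submodule.span (ZMod 2) (edgeChain '' (G.faces : Set (Finset V)))
  let S₂ := Submodule.span (ZMod 2)
    {z : Sym2 V → ZMod 2 | ∃ a b, G.BoundaryEdge a b ∧ z = Pi.single s(a, b) 1}
  -- Duality relative to the boundary: a functional that kills the boundaries of faces and the
  -- boundary edges has a potential that is constant along the connected boundary, so it kills the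
  -- chord too.
  have hmem : (Pi.single s(u, v) 1 : Sym2 V → ZMod 2) ∈ S₁ ⊔ S₂ := by
    by_contra hn
    obtain ⟨f, hfz, hf⟩ := Submodule.exists_le_ker_of_notMem hn
    obtain ⟨g, hg⟩ := hG.exists_potential f fun t ht =>
      hf (le_sup_left (a := S₁) (Submodule.subset_span (mem_image_of_mem _ ht)))
    refine hfz ?_
    rw [hg u v huv]
    have h : v ∈ {x | g u + g x = 0} := by
      refine hG.mem_of_boundaryVertex hu hv (CharTwo.add_self_eq_zero _) ?_
      intro a b hab ha
      have h1 : f (Pi.single s(a, b) 1) = 0 :=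
        hf (le_sup_right (a := S₁) (Submodule.subset_span ⟨a, b, hab, rfl⟩))
      rw [hg a b hab.adj] at h1
      simp only [Set.mem_ofPred_eq] at ha ⊢
      rw [CharTwo.add_eq_zero] at *
      exact ha.trans h1
    exact h
  obtain ⟨y, hy, z, hz, hyz⟩ := Submodule.mem_sup.mp hmem
  obtain ⟨P, hP, hPy⟩ := mem_span_edgeChain hy
  refine ⟨P, hP, fun a b hab => ?_⟩
  rw [hPy, ← hyz, Pi.add_apply]
  have : z s(a, b) = 0 := by
    clear hyz
    induction hz using Submodule.span_induction with
    | mem z h =>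
      obtain ⟨p, q, hpq, rfl⟩ := h
      refine Pi.single_eq_of_ne ?_ _
      intro h
      rcases Sym2.eq_iff.mp h with ⟨rfl, rfl⟩ | ⟨rfl, rfl⟩
      · exact hab hpq
      · exact hab hpq.symm
    | zero => rfl
    | add _ _ _ _ h1 h2 => rw [Pi.add_apply, h1, h2, add_zero]
    | smul c _ _ h => rw [Pi.smul_apply, h, smul_zero]
  rw [this, add_zero]

end TriComplex

/-! ### Smallest regions cut off by chords, and flags. -/

namespace TriComplex
variable {V : Type*} [DecidableEq V] {G : TriComplex V} {a b c d u v w x y z p q : V}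
  {P Q : Finset (Finset V)}

/-! ### Complexes with chords -/

theorem triple_rotate (a b c : V) : ({a, b, c} : Finset V) = {b, c, a} := by
  rw [Finset.insert_comm, Finset.pair_comm]

theorem eq_of_three_neighbors (hd : G.deg v = 3) (ha : G.graph.Adj v a) (hb : G.graph.Adj v b)
    (hc : G.graph.Adj v c) (hab : a ≠ b) (hac : a ≠ c) (hbc : b ≠ c) (hw : G.graph.Adj v w) :
    w = a ∨ w = b ∨ w = c := by
  have := mem_of_deg_le_card (s := {a, b, c}) ?_ ?_ hw
  · simpa using this
  · simp [ha, hb, hc]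
  · rw [hd, Finset.card_eq_three.mpr ⟨a, b, c, hab, hac, hbc, rfl⟩]

theorem eq_of_four_neighbors (hdeg : G.deg v ≤ 4) (ha : G.graph.Adj v a) (hb : G.graph.Adj v b)
    (hc : G.graph.Adj v c) (hd : G.graph.Adj v d) (hab : a ≠ b) (hac : a ≠ c) (had : a ≠ d)
    (hbc : b ≠ c) (hbd : b ≠ d) (hcd : c ≠ d) (hw : G.graph.Adj v w) :
    w = a ∨ w = b ∨ w = c ∨ w = d := by
  have := mem_of_deg_le_card (s := {a, b, c, d}) ?_ ?_ hw
  · simpa using this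
  · simp [ha, hb, hc, hd]
  · rw [Finset.card_insert_of_notMem, Finset.card_eq_three.mpr ⟨b, c, d, hbc, hbd, hcd, rfl⟩]
    · exact hdeg
    · simp [hab, hac, had]

/-- One boundary neighbour `a` forces the rest. `ua` is a boundary edge, so `x` is critical and has
degree 4; then `a` of degree 3 makes `ab` a boundary edge, and `b`, critical and now on the
boundary, closes the flag. -/
theorem IsReduced.isFlagAt (hG : G.IsReduced)
    (hfac : ∀ a b c, G.graph.Adj a b → G.graph.Adj a c → G.graph.Adj b c → G.IsTri a b c)
    (hnb : ¬ G.BoundaryEdge u v) (hbu : G.BoundaryVertex u)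
    (hx : G.IsTri u v x) (hw : G.IsTri u v w) (hwx : w ≠ x) (hxi : ¬ G.BoundaryVertex x)
    (t₁ : G.IsTri x u a) (hav : a ≠ v) (t₂ : G.IsTri x v b) (hbne : b ≠ u)
    (hbv : G.BoundaryVertex v) (hu : ¬ G.Critical u) (hv : ¬ G.Critical v)
    (ha : G.Critical a) (hb : G.Critical b) (hba : G.BoundaryVertex a)
    (hno : ∀ p q, G.IsTri x p q → G.BoundaryVertex p → G.BoundaryVertex q → s(p, q) ≠ s(u, v) →
      G.BoundaryEdge p q) : G.IsFlagAt x u a b v := by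
  have hF := hG.inFCirc4
  have hC := hF.isCombDisk
  have huv := hx.ne₁₂
  have hua : G.BoundaryEdge u a := by
    refine hno u a t₁ hbu hba fun h => ?_
    rcases Sym2.eq_iff.mp h with h | h
    · exact hav h.2
    · exact huv h.1
  have hx4 := (hG.critical_of_boundaryEdge t₁.rotate hua
    fun w h h' => hfac _ _ _ t₁.adj₂₃ h h').deg_of_inner hxi
  have ha3 := ha.deg_of_boundary hba
  obtain ⟨b', a', l1, t₃, l3, l4, l5, hNx⟩ := hF.exists_link₄ hxi hx4 hx.rotate.rotate
  obtain rfl := hC.eq_of_ne hx.swap₁₃ l1 t₂ l4 hbne.symm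
  obtain rfl := hC.eq_of_ne hx.rotate.rotate l3.swap₂₃ t₁ l5 hav.symm
  have hNa : ∀ {y}, G.graph.Adj a' y → y = u ∨ y = x ∨ y = b' :=
    fun h => eq_of_three_neighbors ha3 t₁.adj₂₃.symm t₁.adj₁₃.symm t₃.adj₂₃.symm t₁.ne₁₂.symm
      hbne.symm t₂.ne₁₃ h
  have hab : G.BoundaryEdge a' b' := by
    refine boundaryEdge_iff.mpr ⟨x, t₃.swap₁₃, fun d hd => ?_⟩
    rcases hNa hd.adj₁₃ with rfl | rfl | rfl
    · exact (t₂.ne₁₃ (hua.unique t₁.rotate hd.rotate.rotate)).elim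
    · rfl
    · exact (hd.ne₂₃ rfl).elim
  have hbb : G.BoundaryVertex b' := ⟨a', hab.symm⟩
  have hb3 := hb.deg_of_boundary hbb
  have hbv' : G.BoundaryEdge b' v := by
    refine hno b' v t₂.swap₂₃ hbb hbv fun h => ?_
    rcases Sym2.eq_iff.mp h with h | h
    · exact hbne h.1
    · exact huv h.2.symm
  have hNb : ∀ {y}, G.graph.Adj b' y → y = a' ∨ y = x ∨ y = v :=
    fun h => eq_of_three_neighbors hb3 t₃.adj₂₃ t₂.adj₁₃.symm t₂.adj₂₃.symm t₁.ne₁₃.symm hav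
      t₂.ne₁₂ h
  have hub : ¬ G.graph.Adj b' u := fun h => by
    rcases hNb h with h | h | h
    · exact t₁.ne₂₃ h
    · exact t₁.ne₁₂ h.symm
    · exact huv h
  have hva : ¬ G.graph.Adj a' v := fun h => by
    rcases hNa h with h | h | h
    · exact huv h.symm
    · exact hx.ne₂₃ h
    · exact t₂.ne₂₃ h
  have hwa : w ≠ a' := by
    rintro rfl
    exact hva hw.adj₂₃.symm
  have hwb : w ≠ b' := by
    rintro rfl
    exact hub hw.adj₁₃.symm
  have hwx' : ¬ G.graph.Adj x w := fun h => by
    rcases hNx w h with h | h | h | h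
    · exact hw.ne₁₃ h.symm
    · exact hw.ne₂₃ h.symm
    · exact hwb h
    · exact hwa h
  have hwa' : ¬ G.graph.Adj a' w := fun h => by
    rcases hNa h with h | h | h
    · exact hw.ne₁₃ h.symm
    · exact hwx h
    · exact hwb h
  have hwb' : ¬ G.graph.Adj b' w := fun h => by
    rcases hNb h with h | h | h
    · exact hwa h
    · exact hwx h
    · exact hw.ne₂₃ h.symm
  -- If `u` had degree 4, `uvw` would be the only face at `uw`. This boundary edge would make `v`
  -- critical.
  have hdeg : ∀ u v a, G.IsTri u v x → G.IsTri u v w → G.IsTri x u a → v ≠ a → w ≠ a →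
      ¬ G.graph.Adj a w → ¬ G.Critical v → G.deg u ≠ 4 := by
    intro u v a hx hw t hva hwa haw hv h
    refine hv (hG.critical_of_boundaryEdge hw.swap₂₃ (boundaryEdge_iff.mpr
      ⟨v, hw.swap₂₃, fun d hd => ?_⟩) fun w' h h' => hfac _ _ _ hw.adj₁₃ h h')
    rcases eq_of_four_neighbors h.le hx.adj₁₂ hx.adj₁₃ t.adj₂₃ hw.adj₁₃ hx.ne₂₃ hva hw.ne₂₃
      t.ne₁₃ hwx.symm hwa.symm hd.adj₁₃ with rfl | rfl | rfl | rfl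
    · rfl
    · exact (hwx' hd.adj₂₃.symm).elim
    · exact (haw hd.adj₂₃.symm).elim
    · exact (hd.ne₂₃ rfl).elim
  refine ⟨?_, hxi, hx4, ?_, t₁, t₃.swap₂₃, t₂.swap₂₃, hx.swap₁₃, hua, hab, hbv', hnb, ha3, hb3⟩
  · simp [t₁.ne₁₂, t₁.ne₁₃, t₂.ne₁₃, t₂.ne₁₂, t₁.ne₂₃, hbne.symm, huv, t₃.ne₂₃.symm, hav,
      t₂.ne₂₃.symm]
  · intro y hy
    rcases hNx y hy with rfl | rfl | rfl | rfl
    · exact hdeg y v a' hx hw t₁ hav.symm hwa hwa' hv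
    · exact hdeg y u b' hx.swap₁₂ hw.swap₁₂ t₂ hbne.symm hwb hwb' hu
    · omega
    · omega

theorem boundary_self (P : Finset (Finset V)) (a : V) : boundary P s(a, a) = 0 :=
  Finset.sum_eq_zero fun t _ => by simp [edgeChain_mk]

/-- An inner edge whose ends are boundary vertices. -/
structure IsChord (G : TriComplex V) (u v : V) : Prop where
  adj : G.graph.Adj u v
  not_boundary : ¬ G.BoundaryEdge u v
  left : G.BoundaryVertex u
  right : G.BoundaryVertex v

/-- A set of triangles whose boundary consists of the edge `uv` and of boundary edges. -/
structure IsCutOff (G : TriComplex V) (P : Finset (Finset V)) (u v : V) : Prop where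
  subset : P ⊆ G.faces
  boundary_eq : ∀ a b, ¬ G.BoundaryEdge a b → boundary P s(a, b) =
    (Pi.single s(u, v) 1 : Sym2 V → ZMod 2) s(a, b)

/-- Up to boundary edges the boundary of all faces is zero, so both sides of a chord have the same
boundary. -/
theorem IsCutOff.compl (hC : G.IsCombDisk) (h : G.IsCutOff P u v) :
    G.IsCutOff (G.faces \ P) u v := by
  refine ⟨Finset.sdiff_subset, fun a b hab => ?_⟩
  have h1 := boundary_add_boundary_sdiff h.subset (e := s(a, b))
  rw [not_not.mp (mt hC.boundary_faces.mp hab), CharTwo.add_eq_zero] at h1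
  rw [h1, h.boundary_eq a b hab]

theorem IsCutOff.mem_of_mem (hC : G.IsCombDisk) (h : G.IsCutOff P u v)
    (hab : ¬ G.BoundaryEdge a b) (hne : s(a, b) ≠ s(u, v)) (hc : {a, b, c} ∈ P)
    (hd : G.IsTri a b d) : {a, b, d} ∈ P := by
  have h0 := h.boundary_eq a b hab
  rw [Pi.single_eq_of_ne hne] at h0
  have hc' : G.IsTri a b c := h.subset hc
  obtain ⟨e, hne', he, heP⟩ := exists_ne_of_boundary_eq_zero h.subset h0 hc' hc
  rcases hC.eq_or_eq hc' he hne'.symm hd with rfl | rfl <;> assumption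

theorem IsCutOff.forall_mem (hC : G.IsCombDisk) (h : G.IsCutOff P u v) (hch : G.IsChord u v)
    (hx : ¬ G.BoundaryVertex x) (ha : {x, a, b} ∈ P) (hpq : G.IsTri x p q) : {x, p, q} ∈ P := by
  have hne : ∀ y, s(x, y) ≠ s(u, v) := by
    intro y hy
    rcases Sym2.eq_iff.mp hy with ⟨rfl, -⟩ | ⟨rfl, -⟩
    · exact hx hch.left
    · exact hx hch.right
  have hb : ∀ y, ¬ G.BoundaryEdge x y := fun y hy => hx ⟨y, hy⟩
  have ha' : G.IsTri x a b := h.subset ha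
  have : p ∈ {y | ∃ z, {x, y, z} ∈ P} := by
    refine hC.link (S := {y | ∃ z, {x, y, z} ∈ P}) ha'.adj₁₂ ⟨b, ha⟩ ?_ p hpq.adj₁₂
    rintro y z hyz ⟨z', hz'⟩
    refine ⟨y, ?_⟩
    rw [Finset.pair_comm]
    exact h.mem_of_mem hC (hb y) (hne y) hz' hyz
  obtain ⟨z, hz⟩ := this
  exact h.mem_of_mem hC (hb p) (hne p) hz hpq

theorem exists_minimal_cutOff (hC : G.IsCombDisk) (h : ∃ u v, G.IsChord u v) :
    ∃ u v P, G.IsChord u v ∧ G.IsCutOff P u v ∧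
      ∀ p q Q, G.IsChord p q → G.IsCutOff Q p q → P.card ≤ Q.card := by
  classical
  have hex : ∃ n, ∃ u v P, G.IsChord u v ∧ G.IsCutOff P u v ∧ P.card = n := by
    obtain ⟨u, v, huv⟩ := h
    obtain ⟨P, h1, h2⟩ := hC.exists_chord_region huv.adj huv.left huv.right
    exact ⟨_, u, v, P, huv, ⟨h1, h2⟩, rfl⟩
  obtain ⟨u, v, P, h1, h2, h3⟩ := Nat.find_spec hex
  refine ⟨u, v, P, h1, h2, fun p q Q h1 h2 => ?_⟩
  rw [h3]
  exact Nat.find_min' hex ⟨p, q, Q, h1, h2, rfl⟩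

/-- A minimal region contains no further chord, since the intersection with the appropriate side of
that chord would be smaller. -/
theorem IsCutOff.boundaryEdge_of_minimal (hC : G.IsCombDisk) (hch : G.IsChord u v)
    (h : G.IsCutOff P u v) (hmin : ∀ p q Q, G.IsChord p q → G.IsCutOff Q p q → P.card ≤ Q.card)
    (hc : {a, b, c} ∈ P) (ha : G.BoundaryVertex a) (hb : G.BoundaryVertex b)
    (hne : s(a, b) ≠ s(u, v)) : G.BoundaryEdge a b := by
  by_contra hab
  have hc' : G.IsTri a b c := h.subset hc
  have hch' : G.IsChord a b := ⟨hc'.adj₁₂, hab, ha, hb⟩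
  have h1 : boundary P s(u, v) ≠ 0 := by
    rw [h.boundary_eq u v hch.not_boundary, Pi.single_eq_same]
    exact one_ne_zero
  obtain ⟨x, hx, hxP⟩ := exists_mem_of_boundary_ne h.subset h1
  -- Of the two sides of the chord `ab`, the one that avoids the face of `P` at `uv`.
  obtain ⟨Q, hQ, hxQ⟩ : ∃ Q, G.IsCutOff Q a b ∧ {u, v, x} ∉ Q := by
    obtain ⟨Q, h1, h2⟩ := hC.exists_chord_region hch'.adj hch'.left hch'.right
    have hQ : G.IsCutOff Q a b := ⟨h1, h2⟩
    by_cases hm : {u, v, x} ∈ Q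
    · exact ⟨_, hQ.compl hC, fun h => (Finset.mem_sdiff.mp h).2 hm⟩
    · exact ⟨Q, hQ, hm⟩
  have hlt : (P ∩ Q).card < P.card := Finset.card_lt_card
    ⟨Finset.inter_subset_left, fun h => hxQ (Finset.mem_inter.mp (h hxP)).2⟩
  refine absurd (hmin a b (P ∩ Q) hch' ⟨Finset.inter_subset_left.trans h.subset, ?_⟩) (by omega)
  intro p q hpq
  by_cases hpq0 : p = q
  · subst hpq0
    rw [boundary_self, Pi.single_eq_of_ne]
    intro h
    rcases Sym2.eq_iff.mp h with ⟨h1, h2⟩ | ⟨h1, h2⟩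
    · exact hc'.ne₁₂ (h1.symm.trans h2)
    · exact hc'.ne₁₂ (h2.symm.trans h1)
  by_cases h2 : s(p, q) = s(u, v)
  · rw [h2, Pi.single_eq_of_ne hne.symm]
    rw [← boundary_empty (e := s(u, v))]
    refine boundary_congr fun t hu hv => ?_
    simp only [Finset.mem_inter, Finset.notMem_empty, iff_false, not_and]
    rintro - htQ
    obtain ⟨d, rfl, hd⟩ := exists_eq_of_mem_face₂ (hQ.subset htQ) hu hv hch.adj.1
    exact hxQ (hQ.mem_of_mem hC hch.not_boundary hne.symm htQ hx)
  · by_cases h3 : ∃ r, {p, q, r} ∈ P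
    · obtain ⟨r, hr⟩ := h3
      rw [← hQ.boundary_eq p q hpq]
      refine boundary_congr fun t hp hq => ?_
      simp only [Finset.mem_inter, and_iff_right_iff_imp]
      intro htQ
      have hr' : G.IsTri p q r := h.subset hr
      obtain ⟨d, rfl, hd⟩ := exists_eq_of_mem_face₂ (hQ.subset htQ) hp hq hr'.ne₁₂
      exact h.mem_of_mem hC hpq h2 hr hd
    · have hpq' : s(p, q) ≠ s(a, b) := by
        intro h4
        refine h3 ⟨c, ?_⟩
        rcases Sym2.eq_iff.mp h4 with ⟨rfl, rfl⟩ | ⟨rfl, rfl⟩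
        · exact hc
        · rwa [Finset.insert_comm]
      rw [Pi.single_eq_of_ne hpq', ← boundary_empty (e := s(p, q))]
      refine boundary_congr fun t hp hq => ?_
      simp only [Finset.mem_inter, Finset.notMem_empty, iff_false, not_and]
      intro htP
      obtain ⟨d, rfl, hd⟩ := exists_eq_of_mem_face₂ (h.subset htP) hp hq hpq0
      exact (h3 ⟨d, htP⟩).elim

/-- A reduced complex with a chord whose 3-cycles are faces contains a flag. -/
theorem IsReduced.exists_isFlagAt (hG : G.IsReduced)
    (hfac : ∀ a b c, G.graph.Adj a b → G.graph.Adj a c → G.graph.Adj b c → G.IsTri a b c)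
    (h : ∃ u v, G.IsChord u v) : ∃ x x₁ a b x₂, G.IsFlagAt x x₁ a b x₂ := by
  have hF := hG.inFCirc4
  have hC := hF.isCombDisk
  obtain ⟨u, v, P, hch, hP, hmin⟩ := exists_minimal_cutOff hC h
  have hno : ∀ {p q r}, {p, q, r} ∈ P → G.BoundaryVertex p → G.BoundaryVertex q →
      s(p, q) ≠ s(u, v) → G.BoundaryEdge p q :=
    fun h h1 h2 h3 => hP.boundaryEdge_of_minimal hC hch hmin h h1 h2 h3
  have hne := hch.adj.1
  have hbd : boundary P s(u, v) ≠ 0 := by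
    rw [hP.boundary_eq u v hch.not_boundary, Pi.single_eq_same]
    exact one_ne_zero
  obtain ⟨x, hx, hxP⟩ := exists_mem_of_boundary_ne hP.subset hbd
  have hxi : ¬ G.BoundaryVertex x := by
    intro hb
    have h1 : G.BoundaryEdge x u := by
      refine hno (r := v) ?_ hb hch.left fun h => ?_
      · rwa [triple_rotate]
      · rcases Sym2.eq_iff.mp h with h | h
        · exact hne h.2
        · exact hx.ne₂₃ h.1.symm
    have h2 : G.BoundaryEdge x v := by
      refine hno (r := u) ?_ hb hch.right fun h => ?_
      · rwa [triple_rotate, Finset.insert_comm]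
      · rcases Sym2.eq_iff.mp h with h | h
        · exact hx.ne₁₃ h.1.symm
        · exact hne h.2.symm
    exact hF.false_of_link₂ hx.rotate.rotate h1 h2
  have hPx : ∀ {p q}, G.IsTri x p q → {x, p, q} ∈ P := by
    intro p q h
    exact hP.forall_mem hC hch hxi (a := u) (b := v) (by rwa [triple_rotate]) h
  obtain ⟨w, hwx, hw⟩ := (not_boundaryEdge_iff hx).mp hch.not_boundary
  obtain ⟨a, hav, ta⟩ := exists_other hxi hx.rotate.rotate
  obtain ⟨b, hbu, tb⟩ := exists_other hxi hx.swap₁₃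
  have hnc : ∀ u v a, G.BoundaryVertex u → G.IsTri u v x → G.IsTri u v w → G.IsTri x u a → a ≠ v →
      ¬ G.Critical u := by
    intro u v a hu hx hw ta hav
    have hwa : w ≠ a := by
      rintro rfl
      exact hF.false_of_link₃ hx ta.swap₁₂ hw.swap₂₃
    exact not_critical_of_four_le hu (four_le_deg hx.adj₁₂ hx.adj₁₃ hw.adj₁₃ ta.adj₂₃ hx.ne₂₃
      hw.ne₂₃ hav.symm hwx.symm ta.ne₁₃ hwa)
  have hu := hnc u v a hch.left hx hw ta hav
  have hv := hnc v u b hch.right hx.swap₁₂ hw.swap₁₂ tb hbu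
  -- Both ends of the chord have faces on its two sides and degree at least 4, so they are not
  -- critical. Criticality passes to the other third vertices at `xu` and `xv`.
  have ha : G.Critical a := hG.critical_of_ne hx.rotate.rotate ta hav.symm
    (fun w h h' => hfac _ _ _ ta.adj₁₂ h h') (Or.inl hxi) hv
  have hb : G.Critical b := hG.critical_of_ne hx.swap₁₃ tb hbu.symm
    (fun w h h' => hfac _ _ _ tb.adj₁₂ h h') (Or.inl hxi) hu
  have hno' : ∀ p q, G.IsTri x p q → G.BoundaryVertex p → G.BoundaryVertex q →
      s(p, q) ≠ s(u, v) → G.BoundaryEdge p q := by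
    intro p q h
    refine hno (r := x) ?_
    rw [← triple_rotate]
    exact hPx h
  by_cases hab : G.BoundaryVertex a
  · exact ⟨_, _, _, _, _, hG.isFlagAt hfac hch.not_boundary hch.left hx hw hwx hxi ta hav tb hbu
      hch.right hu hv ha hb hab hno'⟩
  by_cases hbb : G.BoundaryVertex b
  · exact ⟨_, _, _, _, _, hG.isFlagAt hfac (fun h => hch.not_boundary h.symm) hch.right hx.swap₁₂
      hw.swap₁₂ hwx hxi tb hbu ta hav hch.left hv hu hb ha hbb
      (by rw [Sym2.eq_swap (a := v)]; exact hno')⟩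
  exfalso
  have ha4 := ha.deg_of_inner hab
  have hb4 := hb.deg_of_inner hbb
  -- With `a` and `b` inner of degree 4, a vertex `x` of degree 4 gives an apex `q` that forms a
  -- face with `u` and `v`. If `q` is on the boundary, `uq` is a boundary edge in two faces;
  -- otherwise `P` has a second face at `uv`.
  by_cases hx4 : G.deg x = 4
  · obtain ⟨b', a', l1, t, l3, l4, l5, hNx⟩ := hF.exists_link₄ hxi hx4 hx.rotate.rotate
    obtain rfl := hC.eq_of_ne hx.swap₁₃ l1 tb l4 hbu.symm
    obtain rfl := hC.eq_of_ne hx.rotate.rotate l3.swap₂₃ ta l5 hav.symm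
    obtain ⟨q, hqx, q1, q2, q3⟩ := hF.exists_apex tb t ta.swap₂₃ l4 l5 hbb hb4 hab ha4
    have huvq := hfac u v q hx.adj₁₂ q3.adj₂₃ q1.adj₂₃
    have hPa : {a', u, q} ∈ P := by
      refine hP.forall_mem hC hch hab (a := x) (b := u) ?_ q3
      rw [Finset.insert_comm, Finset.pair_comm]
      exact hPx ta
    by_cases hq : G.BoundaryVertex q
    · have hbe : G.BoundaryEdge u q := by
        refine hno (r := a') ?_ hch.left hq fun h => ?_
        · rwa [← triple_rotate]
        · rcases Sym2.eq_iff.mp h with h | h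
          · exact q1.ne₂₃ h.2.symm
          · exact hne h.1
      exact hav (hbe.unique q3.rotate huvq.swap₂₃)
    · refine hqx (hC.eq_of_boundary_ne hP.subset hbd ?_ hxP)
      rw [← triple_rotate]
      refine hP.forall_mem hC hch hq (a := a') (b := u) ?_ huvq.rotate.rotate
      rwa [triple_rotate]
  -- If `x` is not critical, criticality spreads around `a` to `c` and `d`. Their apex is adjacent
  -- to `u` and `x`, hence equals `v`, and this closes the link of `x` to a 4-cycle.
  · have hxc : ¬ G.Critical x := fun h => hx4 (h.deg_of_inner hxi)
    obtain ⟨c, d, l1, l2, l3, l4, l5, -⟩ := hF.exists_link₄ hab ha4 ta.rotate.rotate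
    have hc : G.Critical c := hG.critical_of_ne ta.swap₁₃ l1 l4
      (fun w h h' => hfac _ _ _ l1.adj₁₂ h h') (Or.inl hab) hxc
    have hd : G.Critical d := hG.critical_of_ne ta.swap₂₃ l3.swap₁₃.swap₂₃ l5
      (fun w h h' => hfac _ _ _ ta.adj₁₃ h h') (Or.inl hxi) hu
    have hdi : ¬ G.BoundaryVertex d := by
      intro hdb
      have hd3 := hd.deg_of_boundary hdb
      obtain ⟨e, hea, he⟩ := exists_other hxi l3.rotate.rotate.swap₂₃
      rcases eq_of_three_neighbors hd3 l3.adj₂₃ l3.adj₁₂.symm l2.adj₂₃.symm ta.ne₁₃ l4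
        l1.ne₁₃ he.adj₂₃ with rfl | rfl | rfl
      · exact he.ne₁₃ rfl
      · exact hea rfl
      · exact hF.false_of_link₃ l3.swap₁₂ he.swap₁₂ l2.swap₁₃
    have hci : ¬ G.BoundaryVertex c := by
      intro hcb
      have hc3 := hc.deg_of_boundary hcb
      obtain ⟨e, hea, he⟩ := exists_other hdi l2.swap₁₃
      rcases eq_of_three_neighbors hc3 l1.adj₂₃.symm l1.adj₁₃.symm l2.adj₂₃ ta.ne₂₃ l5
        l3.ne₁₂ he.adj₂₃ with rfl | rfl | rfl
      · exact hF.false_of_link₃ l1.swap₁₃ l2.swap₁₂ he.swap₁₂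
      · exact hea rfl
      · exact he.ne₁₃ rfl
    obtain ⟨q, hqa, q1, q2, q3⟩ := hF.exists_apex l1 l2 l3 l4 l5 hci (hc.deg_of_inner hci) hdi
      (hd.deg_of_inner hdi)
    have huxq := hfac u x q hx.adj₁₃ q1.adj₂₃ q3.adj₂₃
    rcases hC.eq_or_eq hx.swap₂₃ ta.swap₁₂ hav.symm huxq with rfl | rfl
    · rcases hC.eq_or_eq hx.swap₁₃ tb hbu.symm q3.rotate with rfl | rfl
      · exact l5 rfl
      · exact hx4 (hC.link₄ hx.rotate.rotate tb l3.swap₁₃ ta.swap₂₃ hbu.symm hav.symm).2.1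
    · exact hqa rfl

end TriComplex

/-! ### Smallest nonfacial 3-cycles, and octahedra. -/

namespace TriComplex
variable {V : Type*} [DecidableEq V] {G : TriComplex V} {a b c d u v w x y z p q : V}
  {P Q : Finset (Finset V)} {T T' : Finset V}

/-! ### Nonfacial 3-cycles -/

/-- A 3-cycle that is not a face. -/
structure IsNonfacial (G : TriComplex V) (T : Finset V) : Prop where
  card_eq : T.card = 3
  adj : ∀ x ∈ T, ∀ y ∈ T, x ≠ y → G.graph.Adj x y
  notMem : T ∉ G.faces

/-- A set of triangles whose boundary is a 3-cycle. -/
structure IsInside (G : TriComplex V) (P : Finset (Finset V)) (T : Finset V) : Prop where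
  subset : P ⊆ G.faces
  boundary_eq : ∀ e, boundary P e = edgeChain T e

theorem IsNonfacial.exists_isInside (hC : G.IsCombDisk) (hT : G.IsNonfacial T) :
    ∃ P, G.IsInside P T := by
  obtain ⟨a, b, c, hab, hac, hbc, rfl⟩ := Finset.card_eq_three.mp hT.card_eq
  obtain ⟨P, h1, h2⟩ := hC.exists_boundary_eq_edgeChain (hT.adj a (by simp) b (by simp) hab)
    (hT.adj a (by simp) c (by simp) hac) (hT.adj b (by simp) c (by simp) hbc)
  exact ⟨P, h1, h2⟩

theorem IsInside.boundary_eq_zero (h : G.IsInside P T) (hab : ¬ (a ∈ T ∧ b ∈ T)) :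
    boundary P s(a, b) = 0 := by
  rw [h.boundary_eq, edgeChain_mk, if_neg fun h => hab h.2]

theorem IsInside.boundary_ne_zero (h : G.IsInside P T) (ha : a ∈ T) (hb : b ∈ T) (hab : a ≠ b) :
    boundary P s(a, b) ≠ 0 := by
  rw [h.boundary_eq, edgeChain_mk, if_pos ⟨hab, ha, hb⟩]
  exact one_ne_zero

theorem IsInside.mem_of_mem (hC : G.IsCombDisk) (h : G.IsInside P T) (hab : ¬ (a ∈ T ∧ b ∈ T))
    (hc : {a, b, c} ∈ P) (hd : G.IsTri a b d) : {a, b, d} ∈ P := by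
  have hc' : G.IsTri a b c := h.subset hc
  obtain ⟨e, hne', he, heP⟩ := exists_ne_of_boundary_eq_zero h.subset
      (h.boundary_eq_zero hab) hc' hc
  rcases hC.eq_or_eq hc' he hne'.symm hd with rfl | rfl <;> assumption

theorem IsInside.forall_mem (hC : G.IsCombDisk) (h : G.IsInside P T) (hx : x ∉ T)
    (ha : {x, a, b} ∈ P) (hpq : G.IsTri x p q) : {x, p, q} ∈ P := by
  have ha' : G.IsTri x a b := h.subset ha
  have : p ∈ {y | ∃ z, {x, y, z} ∈ P} := by
    refine hC.link (S := {y | ∃ z, {x, y, z} ∈ P}) ha'.adj₁₂ ⟨b, ha⟩ ?_ p hpq.adj₁₂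
    rintro y z hyz ⟨z', hz'⟩
    refine ⟨y, ?_⟩
    rw [Finset.pair_comm]
    exact h.mem_of_mem hC (fun h => hx h.1) hz' hyz
  obtain ⟨z, hz⟩ := this
  exact h.mem_of_mem hC (fun h => hx h.1) hz hpq

/-- All faces at `x` lie in `P`, and the boundary of `P` has no edge at `x`, so each edge at `x` has
a second face. -/
theorem IsInside.not_boundaryVertex (hC : G.IsCombDisk) (h : G.IsInside P T) (hx : x ∉ T)
    (ha : {x, a, b} ∈ P) : ¬ G.BoundaryVertex x := by
  rintro ⟨y, hy⟩
  obtain ⟨z, hz⟩ := adj_iff.mp hy.adj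
  obtain ⟨d, hne, hd, -⟩ := exists_ne_of_boundary_eq_zero h.subset
    (h.boundary_eq_zero fun h => hx h.1) hz (h.forall_mem hC hx ha hz)
  exact hne (hy.unique hd hz)

theorem exists_minimal_isInside (hC : G.IsCombDisk) (h : ∃ T, G.IsNonfacial T) :
    ∃ T P, G.IsNonfacial T ∧ G.IsInside P T ∧
      ∀ T' Q, G.IsNonfacial T' → G.IsInside Q T' → P.card ≤ Q.card := by
  classical
  have hex : ∃ n, ∃ T P, G.IsNonfacial T ∧ G.IsInside P T ∧ P.card = n := by
    obtain ⟨T, hT⟩ := h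
    obtain ⟨P, hP⟩ := hT.exists_isInside hC
    exact ⟨_, T, P, hT, hP, rfl⟩
  obtain ⟨T, P, h1, h2, h3⟩ := Nat.find_spec hex
  refine ⟨T, P, h1, h2, fun T' Q h1 h2 => ?_⟩
  rw [h3]
  exact Nat.find_min' hex ⟨T', Q, h1, h2, rfl⟩

/-- A chain on a 3-cycle with boundary zero is constant. -/
theorem boundary_eq_of_support (hP : P ⊆ G.faces) (hab : a ≠ b) (hac : a ≠ c)
    (hbc : b ≠ c) (hadj : G.graph.Adj a b) (hadj' : G.graph.Adj a c)
    (h : ∀ y, y ≠ b → y ≠ c → boundary P s(a, y) = 0) :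
    boundary P s(a, b) = boundary P s(a, c) := by
  have h0 := sum_boundary hP a
  rw [← Finset.sum_subset (s₁ := {s(a, b), s(a, c)})] at h0
  · rw [Finset.sum_pair, CharTwo.add_eq_zero] at h0
    · exact h0
    · intro h
      rcases Sym2.eq_iff.mp h with h | h
      · exact hbc h.2
      · exact hac h.1
  · intro e he
    simp only [Finset.mem_insert, Finset.mem_singleton] at he
    rcases he with rfl | rfl
    · simp [mem_edges, hadj]
    · simp [mem_edges, hadj']
  · intro e he hne
    obtain ⟨y, rfl⟩ := Sym2.mem_iff_exists.mp (Finset.mem_filter.mp he).2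
    refine h y ?_ ?_
    · rintro rfl; exact hne (by simp)
    · rintro rfl; exact hne (by simp)

/-- Two crossing insides are compared by their chains: the part of `Q` outside `P` has its boundary
on the 3-cycle `T`, so this boundary is zero or all of `T`. The first contradicts minimality, the
second produces a closed surface. -/
theorem IsInside.false_of_minimal (hC : G.IsCombDisk) (hT : G.IsNonfacial T) (hP : G.IsInside P T)
    (hmin : ∀ T' Q, G.IsNonfacial T' → G.IsInside Q T' → P.card ≤ Q.card) (hx : x ∉ T)
    (hxP : {x, a, b} ∈ P) (hT' : G.IsNonfacial T') (hxT' : x ∈ T') : False := by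
  obtain ⟨Q, hQ⟩ := hT'.exists_isInside hC
  -- The vertices of `T'` are adjacent to `x` or equal to it. If they are off `T`, all their faces
  -- therefore lie in `P`.
  have hall : ∀ p ∈ T', p ∉ T → ∀ q r, G.IsTri p q r → {p, q, r} ∈ P := by
    intro p hp hpT q r h
    by_cases hpx : p = x
    · subst hpx
      exact hP.forall_mem hC hpT hxP h
    · obtain ⟨s, hs⟩ := adj_iff.mp (hT'.adj x hxT' p hp (Ne.symm hpx))
      refine hP.forall_mem hC hpT (a := s) (b := x) ?_ h
      rw [← triple_rotate]
      exact hP.forall_mem hC hx hxP hs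
  -- This difference is `Q \ P`, written so that its boundary and that of `P` add up to the boundary
  -- of `P ∪ Q`.
  have hR : (P ∪ Q) \ P ⊆ G.faces :=
    Finset.sdiff_subset.trans (Finset.union_subset hP.subset hQ.subset)
  have h0 : ∀ p q, ¬ (p ∈ T ∧ q ∈ T) → boundary ((P ∪ Q) \ P) s(p, q) = 0 := by
    intro p q hpq
    by_cases hpq0 : p = q
    · rw [hpq0, boundary_self]
    by_cases h : ∃ r, {p, q, r} ∈ P
    · obtain ⟨r, hr⟩ := h
      rw [← boundary_empty (e := s(p, q))]
      refine boundary_congr fun t hpt hqt => ?_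
      simp only [Finset.notMem_empty, iff_false]
      intro ht
      obtain ⟨s, rfl, hs⟩ := exists_eq_of_mem_face₂ (hR ht) hpt hqt hpq0
      exact (Finset.mem_sdiff.mp ht).2 (hP.mem_of_mem hC hpq hr hs)
    · have h1 : boundary ((P ∪ Q) \ P) s(p, q) = boundary Q s(p, q) := by
        refine boundary_congr fun t hpt hqt => ?_
        rw [Finset.mem_sdiff, Finset.mem_union]
        refine ⟨fun h => h.1.resolve_left h.2, fun ht => ⟨Or.inr ht, fun htP => ?_⟩⟩
        obtain ⟨s, rfl, hs⟩ := exists_eq_of_mem_face₂ (hP.subset htP) hpt hqt hpq0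
        exact h ⟨s, htP⟩
      rw [h1]
      refine hQ.boundary_eq_zero fun hpq' => h ?_
      obtain ⟨r, hr⟩ := adj_iff.mp (hT'.adj p hpq'.1 q hpq'.2 hpq0)
      by_cases hp : p ∈ T
      · have hq : q ∉ T := fun hq => hpq ⟨hp, hq⟩
        refine ⟨r, ?_⟩
        rw [Finset.insert_comm]
        exact hall q hpq'.2 hq p r hr.swap₁₂
      · exact ⟨r, hall p hpq'.1 hp q r hr⟩
  obtain ⟨a', b', c', hab, hac, hbc, rfl⟩ := Finset.card_eq_three.mp hT.card_eq
  have ma : a' ∈ ({a', b', c'} : Finset V) := by simp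
  have mb : b' ∈ ({a', b', c'} : Finset V) := by simp
  have mc : c' ∈ ({a', b', c'} : Finset V) := by simp
  have e1 := boundary_eq_of_support hR hab hac hbc (hT.adj _ ma _ mb hab) (hT.adj _ ma _ mc hac)
    fun y h1 h2 => by
      by_cases h3 : y = a'
      · rw [h3, boundary_self]
      · exact h0 _ _ fun h => by simp [h1, h2, h3] at h
  have e2 := boundary_eq_of_support hR hab.symm hbc hac (hT.adj _ mb _ ma hab.symm)
    (hT.adj _ mb _ mc hbc) fun y h1 h2 => by
      by_cases h3 : y = b'
      · rw [h3, boundary_self]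
      · exact h0 _ _ fun h => by simp [h1, h2, h3] at h
  have hval : ∀ p q, boundary ((P ∪ Q) \ P) s(p, q) =
      boundary ((P ∪ Q) \ P) s(a', b') * edgeChain {a', b', c'} s(p, q) := by
    intro p q
    by_cases hpq : p ≠ q ∧ p ∈ ({a', b', c'} : Finset V) ∧ q ∈ ({a', b', c'} : Finset V)
    · rw [edgeChain_mk, if_pos hpq, mul_one]
      obtain ⟨hne, hp, hq⟩ := hpq
      rw [Sym2.eq_swap] at e2
      simp only [Finset.mem_insert, Finset.mem_singleton] at hp hq
      rcases hp with rfl | rfl | rfl <;> rcases hq with rfl | rfl | rfl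
      · exact (hne rfl).elim
      · rfl
      · exact e1.symm
      · rw [Sym2.eq_swap]
      · exact (hne rfl).elim
      · exact e2.symm
      · rw [Sym2.eq_swap]; exact e1.symm
      · rw [Sym2.eq_swap]; exact e2.symm
      · exact (hne rfl).elim
    · rw [edgeChain_mk, if_neg hpq, mul_zero]
      by_cases hne : p = q
      · rw [hne, boundary_self]
      · exact h0 p q fun h => hpq ⟨hne, h⟩
  have h2 : ∀ r : ZMod 2, r = 0 ∨ r = 1 := by decide
  rcases h2 (boundary ((P ∪ Q) \ P) s(a', b')) with hε | hε
  · have hRe := hC.eq_empty_of_boundary_eq_zero hR fun p q => by rw [hval, hε, zero_mul]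
    have hQP : Q ⊆ P := by
      rw [Finset.sdiff_eq_empty_iff_subset] at hRe
      exact Finset.subset_union_right.trans hRe
    have := Finset.eq_of_subset_of_card_le hQP (hmin T' Q hT' hQ)
    subst this
    obtain ⟨y, hy, hyx⟩ : ∃ y ∈ T', y ≠ x := by
      have := hT'.card_eq
      obtain ⟨y, hy, hyx⟩ := Finset.exists_mem_ne (s := T') (by omega) x
      exact ⟨y, hy, hyx⟩
    exact hQ.boundary_ne_zero hxT' hy hyx.symm (hP.boundary_eq_zero fun h => hx h.1)
  · have hPQ := hC.eq_empty_of_boundary_eq_zero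
      (Finset.union_subset hP.subset hQ.subset) fun p q => by
      rw [← boundary_add_boundary_sdiff (Finset.subset_union_left (s₁ := P)), hval, hε, one_mul,
        hP.boundary_eq, CharTwo.add_self_eq_zero]
    have : ({x, a, b} : Finset V) ∈ P ∪ Q := Finset.mem_union_left _ hxP
    rw [hPQ] at this
    exact Finset.notMem_empty _ this

/-- The surface of an octahedron without the face `a₀a₁a₂` as a part of the complex. -/
structure IsOctahedronPart (G : TriComplex V) (v₀ v₁ v₂ a₀ a₁ a₂ : V) : Prop where
  center : G.IsTri v₀ v₁ v₂
  corner₀ : G.IsTri a₀ v₁ v₂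
  corner₁ : G.IsTri a₁ v₀ v₂
  corner₂ : G.IsTri a₂ v₀ v₁
  side₀ : G.IsTri v₀ a₁ a₂
  side₁ : G.IsTri v₁ a₀ a₂
  side₂ : G.IsTri v₂ a₀ a₁
  ne₀ : v₀ ≠ a₀
  ne₁ : v₁ ≠ a₁
  ne₂ : v₂ ≠ a₂
  not_isTri : ¬ G.IsTri a₀ a₁ a₂
  not_critical₀ : ¬ G.Critical a₀
  not_critical₁ : ¬ G.Critical a₁
  not_critical₂ : ¬ G.Critical a₂

/-- A reduced complex with a 3-cycle that is not a face contains an octahedron component. -/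
theorem IsReduced.exists_isOctahedronPart (hG : G.IsReduced) (h : ∃ T, G.IsNonfacial T) :
    ∃ v₀ v₁ v₂ a₀ a₁ a₂, G.IsOctahedronPart v₀ v₁ v₂ a₀ a₁ a₂ := by
  have hF := hG.inFCirc4
  have hC := hF.isCombDisk
  obtain ⟨T, P, hT, hP, hmin⟩ := exists_minimal_isInside hC h
  have hfac : ∀ {x p q}, x ∉ T → {x, p, q} ∈ P → ∀ y z, G.graph.Adj x y → G.graph.Adj x z →
      G.graph.Adj y z → G.IsTri x y z := by
    intro x p q hx hxP y z h1 h2 h3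
    by_contra hn
    refine hP.false_of_minimal hC hT hmin hx hxP (T' := {x, y, z}) ⟨?_, ?_, hn⟩ (by simp)
    · exact Finset.card_eq_three.mpr ⟨x, y, z, h1.1, h2.1, h3.1, rfl⟩
    · intro p hp q hq hpq
      simp only [Finset.mem_insert, Finset.mem_singleton] at hp hq
      rcases hp with rfl | rfl | rfl <;> rcases hq with rfl | rfl | rfl <;>
        first | exact (hpq rfl).elim | assumption | (apply SimpleGraph.Adj.symm; assumption)
  have hinn : ∀ {x p q}, x ∉ T → {x, p, q} ∈ P → ¬ G.BoundaryVertex x :=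
    fun hx h => hP.not_boundaryVertex hC hx h
  have hmem : ∀ {x p q y z}, x ∉ T → {x, p, q} ∈ P → G.IsTri x y z → {x, y, z} ∈ P :=
    fun hx h => hP.forall_mem hC hx h
  -- The third vertex is off `T` because `T` itself is not a face.
  have hface : ∀ a b, a ∈ T → b ∈ T → a ≠ b → ∃ x ∉ T, {x, a, b} ∈ P := by
    intro a b ha hb hab
    obtain ⟨x, hx, hxP⟩ := exists_mem_of_boundary_ne hP.subset (hP.boundary_ne_zero ha hb hab)
    refine ⟨x, fun hxT => hT.notMem ?_, by rwa [triple_rotate]⟩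
    rw [← Finset.eq_of_subset_of_card_le (s := {a, b, x}) (t := T)]
    · exact hx
    · intro y hy
      simp only [Finset.mem_insert, Finset.mem_singleton] at hy
      rcases hy with rfl | rfl | rfl <;> assumption
    · rw [hT.card_eq, G.card_eq _ hx]
  have htriple : ∀ a ∈ T, ∀ b ∈ T, a ≠ b → ∃ c, T = {a, b, c} := by
    intro a ha b hb hab
    obtain ⟨c, hc⟩ := Finset.card_eq_one.mp (show ((T.erase a).erase b).card = 1 by
      rw [Finset.card_erase_of_mem (Finset.mem_erase.mpr ⟨hab.symm, hb⟩),
        Finset.card_erase_of_mem ha,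
        hT.card_eq])
    exact ⟨c, by rw [← hc, Finset.insert_erase (Finset.mem_erase.mpr ⟨hab.symm, hb⟩),
      Finset.insert_erase ha]⟩
  -- A critical `a` has so few neighbours that `axc` would have to be a face, or `T` itself. In the
  -- first case `xbc` is a face too, and the link of `x` is a 3-cycle.
  have hnc : ∀ a ∈ T, ¬ G.Critical a := by
    intro a ha hcrit
    obtain ⟨b, hb, hba⟩ := Finset.exists_mem_ne (s := T) (by rw [hT.card_eq]; norm_num) a
    obtain ⟨c, hTabc⟩ := htriple a ha b hb hba.symm
    have hcT : c ∈ T := by rw [hTabc]; simp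
    have hcard := hT.card_eq
    have hac : a ≠ c := by
      rintro rfl
      rw [hTabc, Finset.insert_eq_of_mem (by simp)] at hcard
      have := Finset.card_le_two (a := b) (b := a)
      omega
    have hbc : b ≠ c := by
      rintro rfl
      rw [hTabc, Finset.pair_eq_singleton] at hcard
      have := Finset.card_le_two (a := a) (b := b)
      omega
    obtain ⟨x, hxT, hxP⟩ := hface a b ha hb hba.symm
    have hx : G.IsTri x a b := hP.subset hxP
    have hxc : x ≠ c := by
      rintro rfl
      exact hxT hcT
    have hfin : G.IsTri a x c → False := by
      intro h
      have h' := hfac hxT hxP b c hx.adj₁₃ h.adj₂₃ (hT.adj b hb c hcT hbc)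
      exact hF.false_of_link₃ hx h' h.rotate
    rcases hcrit with ⟨hai, ha4⟩ | ⟨hab, ha3⟩
    · obtain ⟨d, e, l1, l2, l3, l4, l5, hN⟩ := hF.exists_link₄ hai ha4 hx.swap₁₃.swap₁₂
      rcases hN c (hT.adj a ha c hcT hac) with h | h | h | h
      · exact hbc h.symm
      · exact hxc h.symm
      · exact hfin (h ▸ l1)
      · subst h
        refine hT.notMem ?_
        rw [hTabc, Finset.pair_comm]
        exact l3
    · obtain ⟨d, hdb, hd⟩ := exists_other (hinn hxT hxP) hx
      refine hfin ?_
      rcases eq_of_three_neighbors ha3 hx.adj₂₃ hx.adj₁₂.symm (hT.adj a ha c hcT hac) hx.ne₁₃.symm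
        hbc hxc hd.adj₂₃ with rfl | rfl | rfl
      · exact (hdb rfl).elim
      · exact (hd.ne₁₃ rfl).elim
      · exact hd.swap₁₂
  have hncT : ∀ {x}, G.Critical x → x ∉ T := fun h hx => hnc _ hx h
  obtain ⟨a, ha⟩ := Finset.card_pos.mp (show 0 < T.card by rw [hT.card_eq]; norm_num)
  obtain ⟨b, hb, hba⟩ := Finset.exists_mem_ne (s := T) (by rw [hT.card_eq]; norm_num) a
  obtain ⟨c, hTabc⟩ := htriple a ha b hb hba.symm
  obtain ⟨x, hxT, hxP⟩ := hface a b ha hb hba.symm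
  have hx : G.IsTri x a b := hP.subset hxP
  have hxi := hinn hxT hxP
  obtain ⟨y, hyb, ty⟩ := exists_other hxi hx
  obtain ⟨z, hza, tz⟩ := exists_other hxi hx.swap₂₃
  have hy : G.Critical y := hG.critical_of_ne hx ty hyb.symm
    (fun w h h' => hfac hxT hxP _ _ ty.adj₁₂ h h') (Or.inl hxi) (hnc b hb)
  have hz : G.Critical z := hG.critical_of_ne hx.swap₂₃ tz hza.symm
    (fun w h h' => hfac hxT hxP _ _ tz.adj₁₂ h h') (Or.inl hxi) (hnc a ha)
  have hyT := hncT hy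
  have hzT := hncT hz
  have hyP : {y, x, a} ∈ P := by
    rw [triple_rotate]
    exact hmem hxT hxP ty
  have hzP : {z, x, b} ∈ P := by
    rw [triple_rotate]
    exact hmem hxT hxP tz
  have hyi := hinn hyT hyP
  have hzi := hinn hzT hzP
  have hy4 := hy.deg_of_inner hyi
  have hz4 := hz.deg_of_inner hzi
  -- Here the apex `q` cannot be inside: it would give `P` a second face at `ab`. So it is the third
  -- vertex of `T`, and the octahedron is complete.
  by_cases hx4 : G.deg x = 4
  · obtain ⟨z', y', l1, t, l3, l4, l5, -⟩ := hF.exists_link₄ hxi hx4 hx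
    obtain rfl := hC.eq_of_ne hx.swap₂₃ l1 tz l4 hza.symm
    obtain rfl := hC.eq_of_ne hx l3.swap₂₃ ty l5 hyb.symm
    obtain ⟨q, hqx, q1, q2, q3⟩ := hF.exists_apex tz t l3 l4 l5 hzi hz4 hyi hy4
    have hqT : q ∈ T := by
      by_contra hqT
      have hqP : {q, y', a} ∈ P := by
        rw [triple_rotate]
        exact hmem hyT hyP q3
      have h1 := hfac hqT hqP a b q3.adj₂₃.symm q1.adj₂₃.symm hx.adj₂₃
      have h2 := hmem hqT hqP h1
      refine hqx (hC.eq_of_boundary_ne hP.subset (hP.boundary_ne_zero ha hb hba.symm) ?_ ?_)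
      · rwa [← triple_rotate]
      · rwa [← triple_rotate]
    have hqc : q = c := by
      rw [hTabc] at hqT
      simp only [Finset.mem_insert, Finset.mem_singleton] at hqT
      rcases hqT with h | h | h
      · exact (q3.ne₂₃ h.symm).elim
      · exact (q1.ne₂₃ h.symm).elim
      · exact h
    subst hqc
    refine ⟨x, y', z', q, b, a, ⟨t.swap₂₃, q2.rotate.rotate.swap₂₃, tz.swap₁₂, ty.swap₁₂, hx.swap₂₃,
      q3.swap₂₃, q1.swap₂₃, hqx.symm, l5.symm, l4.symm, ?_, hnc q hqT, hnc b hb, hnc a ha⟩⟩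
    intro h
    refine hT.notMem ?_
    rw [hTabc]
    exact h.swap₁₃
  -- As for chords: if `x` is not critical, criticality spreads around `y`, and the apex found there
  -- forces the link of `x` to be a 4-cycle after all.
  · exfalso
    have hxc : ¬ G.Critical x := fun h => hx4 (h.deg_of_inner hxi)
    obtain ⟨y', w, l1, l2, l3, l4, l5, -⟩ := hF.exists_link₄ hyi hy4 ty.rotate.rotate
    have hw : G.Critical w := hG.critical_of_ne ty.swap₂₃ l3.rotate.rotate l5
      (fun w h h' => hfac hxT hxP _ _ ty.adj₁₃ h h') (Or.inl hxi) (hnc a ha)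
    have hy' : G.Critical y' := hG.critical_of_ne ty.swap₁₃ l1 l4
      (fun w h h' => hfac hyT hyP _ _ l1.adj₁₂ h h') (Or.inl hyi) hxc
    have hwT := hncT hw
    have hwP : {w, x, y} ∈ P := by
      rw [triple_rotate]
      exact hmem hxT hxP l3.rotate.rotate
    have hyT' := hncT hy'
    have hyP' : {y', y, a} ∈ P := by
      rw [triple_rotate]
      exact hmem hyT hyP l1
    have hwi := hinn hwT hwP
    have hyi' := hinn hyT' hyP'
    obtain ⟨q, hqy, q1, q2, q3⟩ := hF.exists_apex l1 l2 l3 l4 l5 hyi' (hy'.deg_of_inner hyi') hwi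
      (hw.deg_of_inner hwi)
    have hxaq := hfac hxT hxP a q hx.adj₁₂ q3.adj₂₃ q1.adj₂₃
    rcases hC.eq_or_eq hx ty hyb.symm hxaq with rfl | rfl
    · rcases hC.eq_or_eq hx.swap₂₃ tz hza.symm q3.rotate with rfl | rfl
      · exact l5 rfl
      · exact hx4 (hC.link₄ hx tz l3.swap₁₃ ty.swap₂₃ hza.symm hyb.symm).2.1
    · exact hqy rfl

end TriComplex

/-! ### Removal of flags inside the class. -/

namespace TriComplex
variable {V : Type*} [DecidableEq V] {G G' : TriComplex V} {a b c d u v w x y z p q r : V}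

/-! ### Deletion of flags -/

theorem two_le_card_faces {s t : Finset V} (hs : s ∈ G.faces) (ht : t ∈ G.faces) (h : s ≠ t) :
    2 ≤ G.faces.card :=
  Finset.one_lt_card.mpr ⟨s, hs, t, ht, h⟩

theorem IsTri.two_le_card (h₁ : G.IsTri a b c) (h₂ : G.IsTri a b d) (h : c ≠ d) :
    2 ≤ G.faces.card :=
  two_le_card_faces h₁ h₂ fun h' => h (h₁.triple_inj h')

/-- Removal of a vertex whose link is a 3-cycle. -/
theorem IsDisk.contract_of_link₃ (hG : G.IsDisk) (h₁ : G.IsTri v p q) (h₂ : G.IsTri v q r)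
    (h₃ : G.IsTri v r p) : (G.contract p v).IsDisk ∧
      ∀ t, t ∈ (G.contract p v).faces ↔ (t ∈ G.faces ∧ v ∉ t) ∨ t = {p, q, r} := by
  have hC := hG.isCombDisk
  have hN : ∀ w, G.graph.Adj v w → w ∈ ({p, q, r} : Set V) := by
    refine hC.link h₁.adj₁₂ (by simp) ?_
    rintro x y hxy (rfl | rfl | rfl)
    · rcases hC.eq_or_eq h₁ h₃.swap₂₃ h₂.ne₂₃ hxy with rfl | rfl <;> simp
    · rcases hC.eq_or_eq h₁.swap₂₃ h₂ h₃.ne₂₃.symm hxy with rfl | rfl <;> simp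
    · rcases hC.eq_or_eq h₂.swap₂₃ h₃ h₁.ne₂₃.symm hxy with rfl | rfl <;> simp
  have hv : ¬ G.BoundaryVertex v := by
    rintro ⟨w, hw⟩
    rcases hN w hw.adj with rfl | rfl | rfl
    · exact not_boundaryEdge_of_ne h₁ h₃.swap₂₃ h₂.ne₂₃ hw
    · exact not_boundaryEdge_of_ne h₁.swap₂₃ h₂ h₃.ne₂₃.symm hw
    · exact not_boundaryEdge_of_ne h₂.swap₂₃ h₃ h₁.ne₂₃.symm hw
  refine ⟨hG.contract h₁.adj₁₂.symm ?_ (Or.inr (Or.inr hv))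
    (h₁.two_le_card h₃.swap₂₃ h₂.ne₂₃), fun t => ?_⟩
  · intro w hw hw'
    rcases hN w hw' with rfl | rfl | rfl
    · exact (hw.1 rfl).elim
    · exact h₁.swap₁₂
    · exact h₃.swap₂₃.swap₁₂
  · rw [mem_contract_iff h₁.ne₁₂.symm]
    refine or_congr Iff.rfl ⟨?_, ?_⟩
    · rintro ⟨x, y, rfl, hx, hy, hxy⟩
      rcases hN x hxy.adj₁₂ with rfl | rfl | rfl
      · exact (hx rfl).elim
      · rw [hC.eq_of_ne h₁.swap₂₃ hxy h₂ hy.symm h₃.ne₂₃.symm]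
      · rw [hC.eq_of_ne h₃ hxy h₂.swap₂₃ hy.symm h₁.ne₂₃, Finset.pair_comm]
    · rintro rfl
      exact ⟨q, r, rfl, h₁.ne₂₃.symm, h₃.ne₂₃, h₂⟩

/-- Contraction of an edge at a vertex whose link is a 4-cycle. -/
theorem IsDisk.contract_of_link₄ (hG : G.IsDisk) (h₁ : G.IsTri v u p) (h₂ : G.IsTri v p q)
    (h₃ : G.IsTri v q r) (h₄ : G.IsTri v r u) (huq : u ≠ q) (hpr : p ≠ r)
    (hadj : ¬ G.graph.Adj u q) : (G.contract u v).IsDisk ∧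
      ∀ t, t ∈ (G.contract u v).faces ↔
        (t ∈ G.faces ∧ v ∉ t) ∨ t = {u, p, q} ∨ t = {u, q, r} := by
  have hC := hG.isCombDisk
  obtain ⟨hv, -, hN⟩ := hC.link₄ h₁ h₂ h₃ h₄ huq hpr
  refine ⟨hG.contract h₁.adj₁₂.symm ?_ (Or.inr (Or.inr hv))
    (h₁.two_le_card h₄.swap₂₃ hpr), fun t => ?_⟩
  · intro w hw hw'
    rcases hN w hw' with rfl | rfl | rfl | rfl
    · exact (hw.1 rfl).elim
    · exact h₁.swap₁₂
    · exact (hadj hw).elim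
    · exact h₄.swap₂₃.swap₁₂
  · rw [mem_contract_iff h₁.ne₁₂.symm]
    refine or_congr Iff.rfl ⟨?_, ?_⟩
    · rintro ⟨x, y, rfl, hx, hy, hxy⟩
      rcases hC.isTri_of_link₄ h₁ h₂ h₃ h₄ huq hpr hxy with (h | h) | (h | h) | (h | h) |
        (h | h) <;>
        rcases h with ⟨rfl, rfl⟩
      · exact (hx rfl).elim
      · exact (hy rfl).elim
      · exact Or.inl rfl
      · exact Or.inl (by rw [Finset.pair_comm])
      · exact Or.inr rfl
      · exact Or.inr (by rw [Finset.pair_comm])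
      · exact (hy rfl).elim
      · exact (hx rfl).elim
    · rintro (rfl | rfl)
      · exact ⟨p, q, rfl, h₁.ne₂₃.symm, huq.symm, h₂⟩
      · exact ⟨q, r, rfl, huq.symm, h₄.ne₂₃, h₃⟩

/-- Contraction of a boundary edge at a boundary vertex of degree 3. -/
theorem IsDisk.contract_of_boundaryEdge (hG : G.IsDisk) (hb : G.BoundaryEdge u v)
    (h₁ : G.IsTri v u p) (h₂ : G.IsTri v p q) (hN : ∀ w, G.graph.Adj v w → w = u ∨ w = p ∨ w = q)
    (huq : u ≠ q) (hadj : ¬ G.graph.Adj u q) : (G.contract u v).IsDisk ∧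
      ∀ t, t ∈ (G.contract u v).faces ↔ (t ∈ G.faces ∧ v ∉ t) ∨ t = {u, p, q} := by
  refine ⟨hG.contract h₁.adj₁₂.symm ?_ (Or.inl hb)
    (h₁.swap₂₃.two_le_card h₂ huq), fun t => ?_⟩
  · intro w hw hw'
    rcases hN w hw' with rfl | rfl | rfl
    · exact (hw.1 rfl).elim
    · exact h₁.swap₁₂
    · exact (hadj hw).elim
  · rw [mem_contract_iff h₁.ne₁₂.symm]
    refine or_congr Iff.rfl ⟨?_, ?_⟩
    · rintro ⟨x, y, rfl, hx, hy, hxy⟩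
      rcases hN x hxy.adj₁₂ with rfl | rfl | rfl
      · exact (hx rfl).elim
      · rcases hN y hxy.adj₁₃ with rfl | rfl | rfl
        · exact (hy rfl).elim
        · exact (hxy.ne₂₃ rfl).elim
        · rfl
      · rcases hN y hxy.adj₁₃ with rfl | rfl | rfl
        · exact (hy rfl).elim
        · rw [Finset.pair_comm]
        · exact (hxy.ne₂₃ rfl).elim
    · rintro rfl
      exact ⟨p, q, rfl, h₁.ne₂₃.symm, huq.symm, h₂⟩

theorem deg_eq_of_star (h : ∀ y z, G'.IsTri w y z ↔ G.IsTri w y z) :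
    G'.deg w = G.deg w ∧ (G.BoundaryVertex w → G'.BoundaryVertex w) := by
  constructor
  · have : G'.graph.neighborSet w = G.graph.neighborSet w := by
      ext y
      simp only [SimpleGraph.mem_neighborSet, adj_iff, h]
    rw [deg, deg, this]
  · rintro ⟨y, hy⟩
    obtain ⟨z, hz⟩ := boundaryEdge_iff.mp hy
    exact ⟨y, boundaryEdge_iff.mpr ⟨z, by simpa only [h] using hz⟩⟩

theorem IsFlagAt.neighbors (h : G.IsFlagAt x u a b v) :
    (∀ {w}, G.graph.Adj x w → w = u ∨ w = a ∨ w = b ∨ w = v) ∧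
    (∀ {w}, G.graph.Adj a w → w = u ∨ w = x ∨ w = b) ∧
    (∀ {w}, G.graph.Adj b w → w = a ∨ w = x ∨ w = v) := by
  have t1 : G.IsTri x u a := h.link₁
  have t2 : G.IsTri x a b := h.link₂
  have t3 : G.IsTri x b v := h.link₃
  have hn := h.nodup
  simp only [List.nodup_cons, List.mem_cons, List.not_mem_nil, or_false, not_or] at hn
  refine ⟨fun hw => ?_, fun hw => ?_, fun hw => ?_⟩
  · exact eq_of_four_neighbors h.deg_eq.le t1.adj₁₂ t1.adj₁₃ t2.adj₁₃ t3.adj₁₃ (by tauto) (by tauto)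
      (by tauto) (by tauto) (by tauto) (by tauto) hw
  · exact eq_of_three_neighbors h.deg_a t1.adj₂₃.symm t1.adj₁₃.symm t2.adj₂₃ (by tauto) (by tauto)
      (by tauto) hw
  · exact eq_of_three_neighbors h.deg_b t2.adj₂₃.symm t2.adj₁₃.symm t3.adj₂₃ (by tauto) (by tauto)
      (by tauto) hw

/-- Deletion is composed of contractions: `a` is absorbed by `u`, then `x` has a 3-cycle as link and
is absorbed as well, then `b` is an ear. -/
theorem IsFlagAt.isDisk_deleteVertices (h : G.IsFlagAt x u a b v) (hG : G.IsDisk) :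
    (G.deleteVertices {a, b, x}).IsDisk := by
  obtain ⟨hNx, hNa, hNb⟩ := h.neighbors
  have t1 : G.IsTri x u a := h.link₁
  have t2 : G.IsTri x a b := h.link₂
  have t3 : G.IsTri x b v := h.link₃
  have t4 : G.IsTri x v u := h.link₄
  have hn := h.nodup
  simp only [List.nodup_cons, List.mem_cons, List.not_mem_nil, or_false, not_or] at hn
  obtain ⟨⟨n1, n2, n3, n4⟩, ⟨n5, n6, n7⟩, ⟨n8, n9⟩, n10, -⟩ := hn
  obtain ⟨w, hwx, hw⟩ := (not_boundaryEdge_iff t4.swap₁₃).mp h.not_boundary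
  have hub : ¬ G.graph.Adj u b := fun h => by
    rcases hNb h.symm with h | h | h
    · exact n5 h
    · exact n1 h.symm
    · exact n7 h
  have hwa : w ≠ a := by
    rintro rfl
    rcases hNa hw.adj₂₃.symm with h | h | h
    · exact n7 h.symm
    · exact n4 h.symm
    · exact n10 h.symm
  have hwb : w ≠ b := by
    rintro rfl
    exact hub hw.adj₁₃
  obtain ⟨d1, f1⟩ := hG.contract_of_boundaryEdge h.boundary₁ t1.swap₁₃ t2.swap₁₂
    (fun w h => hNa h) n6 hub
  obtain ⟨d2, f2⟩ := d1.contract_of_link₃ (v := x) (p := u) (q := b) (r := v)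
    ((f1 _).mpr (Or.inr (Finset.insert_comm _ _ _)))
    ((f1 _).mpr (Or.inl ⟨t3, by simp [Ne.symm n2, n8, n9]⟩))
    ((f1 _).mpr (Or.inl ⟨t4, by simp [Ne.symm n2, Ne.symm n5, n9]⟩))
  have tb : ((G.contract u a).contract u x).IsTri b u v :=
    (f2 _).mpr (Or.inr (Finset.insert_comm _ _ _))
  have tw : ((G.contract u a).contract u x).IsTri u v w :=
    (f2 _).mpr (Or.inl ⟨(f1 _).mpr (Or.inl ⟨hw, by simp [Ne.symm n5, n9, hwa.symm]⟩),
      by simp [n1, n4, hwx.symm]⟩)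
  have d3 := d2.deleteVertices_of_ear tb ?_ (tb.rotate.two_le_card tw hwb.symm)
  · convert d3 using 1
    ext t
    simp only [deleteVertices, Finset.mem_filter, Finset.disjoint_insert_right,
      Finset.disjoint_singleton_right, f1, f2]
    constructor
    · rintro ⟨h1, h2, h3, h4⟩
      exact ⟨Or.inl ⟨Or.inl ⟨h1, h2⟩, h4⟩, h3⟩
    · rintro ⟨(⟨(⟨h1, h2⟩ | rfl), h4⟩ | rfl), h3⟩
      · exact ⟨h1, h2, h3, h4⟩
      · simp at h4
      · simp at h3
  · intro t ht hbt
    rcases (f2 t).mp ht with ⟨ht, hxt⟩ | rfl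
    · rcases (f1 t).mp ht with ⟨ht, hat⟩ | rfl
      · obtain ⟨p, q, rfl, hpq⟩ := exists_eq_of_mem_face ht hbt
        simp only [Finset.mem_insert, Finset.mem_singleton, not_or] at hxt hat
        have h1 := ((hNb hpq.adj₁₂).resolve_left (Ne.symm hat.2.1)).resolve_left (Ne.symm hxt.2.1)
        have h2 := ((hNb hpq.adj₁₃).resolve_left (Ne.symm hat.2.2)).resolve_left (Ne.symm hxt.2.2)
        exact (hpq.ne₂₃ (h1.trans h2.symm)).elim
      · simp at hxt
    · exact Finset.insert_comm _ _ _

theorem isTri_deleteVertices {S : Finset V} : (G.deleteVertices S).IsTri p q r ↔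
    G.IsTri p q r ∧ p ∉ S ∧ q ∉ S ∧ r ∉ S := by
  simp only [IsTri, deleteVertices, Finset.mem_filter, Finset.disjoint_insert_left,
    Finset.disjoint_singleton_left]

theorem deg_le_add_card {S : Finset V} (h : ∀ y, G.graph.Adj w y → y ∉ S → G'.graph.Adj w y) :
    G.deg w ≤ G'.deg w + S.card := by
  obtain ⟨s, hs, hs'⟩ := exists_finset_neighbors G w
  have h1 : (s \ S).card ≤ G'.deg w := card_le_deg fun y hy => by
    rw [Finset.mem_sdiff, hs'] at hy
    exact h y hy.1 hy.2
  have h2 := Finset.le_card_sdiff S s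
  omega

theorem IsFlagAt.symm (h : G.IsFlagAt x u a b v) : G.IsFlagAt x v b a u := by
  have hn := h.nodup
  simp only [List.nodup_cons, List.mem_cons, List.not_mem_nil, or_false, not_or] at hn
  have t1 : G.IsTri x u a := h.link₁
  have t2 : G.IsTri x a b := h.link₂
  have t3 : G.IsTri x b v := h.link₃
  have t4 : G.IsTri x v u := h.link₄
  refine ⟨?_, h.inner, h.deg_eq, h.independent, t3.swap₂₃, t2.swap₂₃, t1.swap₂₃, t4.swap₂₃,
    h.boundary₃.symm, h.boundary₂.symm, h.boundary₁.symm, fun h' => h.not_boundary h'.symm,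
    h.deg_b, h.deg_a⟩
  simp only [List.nodup_cons, List.mem_cons, List.not_mem_nil, or_false, not_or]
  simp only [eq_comm (a := v), eq_comm (a := b) (b := a), eq_comm (a := b) (b := u),
    eq_comm (a := a) (b := u)]
  tauto

theorem IsFlagAt.deg_deleteVertices (h : G.IsFlagAt x u a b v) (hG : G.InFCirc4) :
    3 ≤ (G.deleteVertices {a, b, x}).deg u ∧ (G.deleteVertices {a, b, x}).BoundaryVertex u := by
  have hC := hG.isCombDisk
  obtain ⟨hNx, hNa, hNb⟩ := h.neighbors
  have t1 : G.IsTri x u a := h.link₁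
  have t4 : G.IsTri x v u := h.link₄
  have hn := h.nodup
  simp only [List.nodup_cons, List.mem_cons, List.not_mem_nil, or_false, not_or] at hn
  obtain ⟨⟨n1, n2, n3, n4⟩, ⟨n5, n6, n7⟩, ⟨n8, n9⟩, n10, -⟩ := hn
  obtain ⟨w, hwx, hw⟩ := (not_boundaryEdge_iff t4.swap₁₃).mp h.not_boundary
  have hub : ¬ G.graph.Adj u b := fun h => by
    rcases hNb h.symm with h | h | h
    · exact n5 h
    · exact n1 h.symm
    · exact n7 h
  have hwa : w ≠ a := by
    rintro rfl
    rcases hNa hw.adj₂₃.symm with h | h | h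
    · exact n7 h.symm
    · exact n4 h.symm
    · exact n10 h.symm
  have hwb : w ≠ b := by
    rintro rfl
    exact hub hw.adj₁₃
  have huS : u ∉ ({a, b, x} : Finset V) := by simp [n5, n6, Ne.symm n1]
  have hvS : v ∉ ({a, b, x} : Finset V) := by simp [Ne.symm n9, Ne.symm n10, Ne.symm n4]
  have hw' : (G.deleteVertices {a, b, x}).IsTri u v w :=
    isTri_deleteVertices.mpr ⟨hw, huS, hvS, by simp [hwa, hwb, hwx]⟩
  constructor
  · have h4 := four_le_deg hw.adj₁₂ t1.adj₁₂.symm t1.adj₂₃ hw.adj₁₃ t4.ne₁₂.symm (Ne.symm n9)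
      hw.ne₂₃ t1.ne₁₃ hwx.symm hwa.symm
    -- The reason for the independence condition: `u` has degree at least 4 and not 4, so three
    -- neighbours remain when `a` and `x` are lost.
    have h5 := h.independent u t1.adj₁₂
    have h6 := deg_le_add_card (G := G) (G' := G.deleteVertices {a, b, x}) (w := u) (S := {a, x}) ?_
    · have := Finset.card_le_two (a := a) (b := x)
      omega
    · intro y hy hyS
      simp only [Finset.mem_insert, Finset.mem_singleton, not_or] at hyS
      by_cases hyv : y = v
      · rw [hyv]; exact hw'.adj₁₂
      have hyb : y ≠ b := by
        rintro rfl
        exact hub hy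
      obtain ⟨z, hz⟩ := adj_iff.mp hy
      refine (isTri_deleteVertices.mpr ⟨hz, huS, by simp [hyS.1, hyS.2, hyb], ?_⟩).adj₁₂
      simp only [Finset.mem_insert, Finset.mem_singleton, not_or]
      refine ⟨?_, ?_, ?_⟩
      · rintro rfl
        rcases hNa hz.adj₂₃.symm with h | h | h
        · exact hz.ne₁₂ h.symm
        · exact hyS.2 h
        · exact hyb h
      · rintro rfl
        exact hub hz.adj₁₃
      · rintro rfl
        rcases hNx hz.adj₂₃.symm with h | h | h | h
        · exact hz.ne₁₂ h.symm
        · exact hyS.1 h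
        · exact hyb h
        · exact hyv h
  · refine ⟨v, boundaryEdge_iff.mpr ⟨w, hw', fun d hd => ?_⟩⟩
    obtain ⟨hd, -, -, hdS⟩ := isTri_deleteVertices.mp hd
    simp only [Finset.mem_insert, Finset.mem_singleton, not_or] at hdS
    exact (hC.eq_or_eq t4.swap₁₃ hw hwx.symm hd).resolve_left hdS.2.2

theorem IsFlagAt.step (h : G.IsFlagAt x u a b v) (hG : G.InFCirc4) :
    Step (G.deleteVertices {a, b, x}) G := by
  have hd := h.isDisk_deleteVertices hG.1
  obtain ⟨hNx, hNa, hNb⟩ := h.neighbors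
  refine ⟨⟨hd, fun w hw => ?_⟩, hG, Or.inr (Or.inl ⟨x, u, a, b, v, h, rfl⟩)⟩
  by_cases hwu : w = u
  · subst hwu
    have h' := h.deg_deleteVertices hG
    exact ⟨h'.1, fun hn => (hn h'.2).elim⟩
  by_cases hwv : w = v
  · subst hwv
    have h' := h.symm.deg_deleteVertices hG
    rw [Finset.insert_comm] at h'
    exact ⟨h'.1, fun hn => (hn h'.2).elim⟩
  obtain ⟨y, hy⟩ := isVertex_iff.mp hw
  obtain ⟨z, hz⟩ := adj_iff.mp hy
  obtain ⟨hz, hwS, -⟩ := isTri_deleteVertices.mp hz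
  have hS : ∀ p, G.graph.Adj w p → p ∉ ({a, b, x} : Finset V) := by
    intro p hp hpS
    simp only [Finset.mem_insert, Finset.mem_singleton, not_or] at hpS hwS
    rcases hpS with h | h | h <;> rw [h] at hp
    · rcases hNa hp.symm with h | h | h <;> tauto
    · rcases hNb hp.symm with h | h | h <;> tauto
    · rcases hNx hp.symm with h | h | h | h <;> tauto
  obtain ⟨h1, h2⟩ := deg_eq_of_star (G := G) (G' := G.deleteVertices {a, b, x}) (w := w)
    fun y z => isTri_deleteVertices.trans
      ⟨And.left, fun h => ⟨h, hwS, hS y h.adj₁₂, hS z h.adj₁₃⟩⟩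
  rw [h1]
  exact ⟨hG.three_le hz.adj₁₂, fun hn => hG.four_le hz.adj₁₂ fun h => hn (h2 h)⟩

end TriComplex

/-! ### Octahedra: filling and degree estimates. -/

namespace TriComplex
variable {V : Type*} [DecidableEq V] {G G' : TriComplex V}
  {a b c d u v w x y z p q r v₀ v₁ v₂ a₀ a₁ a₂ : V}

/-! ### Deletion of octahedra -/

namespace IsOctahedronPart

theorem rotate (h : G.IsOctahedronPart v₀ v₁ v₂ a₀ a₁ a₂) :
    G.IsOctahedronPart v₁ v₂ v₀ a₁ a₂ a₀ where
  center := h.center.rotate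
  corner₀ := h.corner₁.swap₂₃
  corner₁ := h.corner₂.swap₂₃
  corner₂ := h.corner₀
  side₀ := h.side₁.swap₂₃
  side₁ := h.side₂.swap₂₃
  side₂ := h.side₀
  ne₀ := h.ne₁
  ne₁ := h.ne₂
  ne₂ := h.ne₀
  not_isTri h' := h.not_isTri h'.rotate.rotate
  not_critical₀ := h.not_critical₁
  not_critical₁ := h.not_critical₂
  not_critical₂ := h.not_critical₀

theorem flip (h : G.IsOctahedronPart v₀ v₁ v₂ a₀ a₁ a₂) :
    G.IsOctahedronPart v₀ v₂ v₁ a₀ a₂ a₁ where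
  center := h.center.swap₂₃
  corner₀ := h.corner₀.swap₂₃
  corner₁ := h.corner₂
  corner₂ := h.corner₁
  side₀ := h.side₀.swap₂₃
  side₁ := h.side₂
  side₂ := h.side₁
  ne₀ := h.ne₀
  ne₁ := h.ne₂
  ne₂ := h.ne₁
  not_isTri h' := h.not_isTri h'.swap₂₃
  not_critical₀ := h.not_critical₀
  not_critical₁ := h.not_critical₂
  not_critical₂ := h.not_critical₁

theorem link (h : G.IsOctahedronPart v₀ v₁ v₂ a₀ a₁ a₂) (hC : G.IsCombDisk) :
    ¬ G.BoundaryVertex v₀ ∧ G.deg v₀ = 4 ∧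
      ∀ w, G.graph.Adj v₀ w → w = a₁ ∨ w = a₂ ∨ w = v₁ ∨ w = v₂ :=
  hC.link₄ h.side₀ h.corner₂.swap₁₂ h.center h.corner₁.rotate
    h.ne₁.symm h.ne₂.symm

theorem triple_eq (h : G.IsOctahedronPart v₀ v₁ v₂ a₀ a₁ a₂) (hC : G.IsCombDisk)
    (hpq : G.IsTri v₀ p q) : ({v₀, p, q} : Finset V) = {v₀, v₁, v₂} ∨
      ({v₀, p, q} : Finset V) = {v₀, v₁, a₂} ∨ ({v₀, p, q} : Finset V) = {v₀, a₁, v₂} ∨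
      ({v₀, p, q} : Finset V) = {v₀, a₁, a₂} := by
  rcases hC.isTri_of_link₄ h.side₀ h.corner₂.swap₁₂ h.center
    h.corner₁.rotate h.ne₁.symm h.ne₂.symm hpq with
    (h | h) | (h | h) | (h | h) | (h | h) <;> rcases h with ⟨rfl, rfl⟩ <;>
    simp [Finset.pair_comm]

theorem not_adj (h : G.IsOctahedronPart v₀ v₁ v₂ a₀ a₁ a₂) (hC : G.IsCombDisk) :
    ¬ G.graph.Adj v₀ a₀ := by
  intro h'
  rcases (h.link hC).2.2 _ h' with e | e | e | e
  · exact h.side₂.ne₂₃ e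
  · exact h.side₁.ne₂₃ e
  · exact h.corner₀.ne₁₂ e
  · exact h.corner₀.ne₁₃ e

theorem nodup (h : G.IsOctahedronPart v₀ v₁ v₂ a₀ a₁ a₂) :
    [v₀, v₁, v₂, a₀, a₁, a₂].Nodup := by
  simp [h.center.ne₁₂, h.center.ne₁₃, h.center.ne₂₃, h.ne₀, h.ne₁, h.ne₂, h.side₀.ne₁₂,
    h.side₀.ne₁₃, h.side₀.ne₂₃, h.side₁.ne₁₂, h.side₁.ne₁₃, h.side₁.ne₂₃, h.side₂.ne₁₂,
    h.side₂.ne₁₃, h.side₂.ne₂₃]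

/-- The neighbours of a center vertex belong to the octahedron. -/
theorem notMem_of_adj (h : G.IsOctahedronPart v₀ v₁ v₂ a₀ a₁ a₂) (hC : G.IsCombDisk)
    (h₀ : w ≠ a₀) (h₁ : w ≠ a₁) (h₂ : w ≠ a₂) (hv : w ∉ ({v₀, v₁, v₂} : Finset V))
    (hwy : G.graph.Adj w y) : y ∉ ({v₀, v₁, v₂} : Finset V) := by
  simp only [Finset.mem_insert, Finset.mem_singleton, not_or] at hv ⊢
  refine ⟨fun e => ?_, fun e => ?_, fun e => ?_⟩ <;> rw [e] at hwy
  · rcases (h.link hC).2.2 _ hwy.symm with e | e | e | e <;> tauto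
  · rcases (h.rotate.link hC).2.2 _ hwy.symm with e | e | e | e <;> tauto
  · rcases (h.rotate.rotate.link hC).2.2 _ hwy.symm with e | e | e | e <;> tauto

theorem isOctahedronAt (h : G.IsOctahedronPart v₀ v₁ v₂ a₀ a₁ a₂) (hC : G.IsCombDisk) :
    G.IsOctahedronAt ![v₀, v₁, v₂] ![a₀, a₁, a₂] ∧
      ∀ i, ¬ G.BoundaryVertex ((![v₀, v₁, v₂] : Fin 3 → V) i) := by
  have hn := h.nodup
  simp only [List.nodup_cons, List.mem_cons, List.not_mem_nil, or_false, not_or] at hn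
  have hi : ∀ i, ¬ G.BoundaryVertex ((![v₀, v₁, v₂] : Fin 3 → V) i) := by
    intro i
    fin_cases i
    · exact (h.link hC).1
    · exact (h.rotate.link hC).1
    · exact (h.rotate.rotate.link hC).1
  refine ⟨⟨?_, ?_, ?_, ?_, ?_, ?_, ?_, Or.inl hi⟩, hi⟩
  · intro i j
    fin_cases i <;> fin_cases j <;> simp <;> grind
  · intro i j
    fin_cases i <;> fin_cases j <;> simp <;> grind
  · intro i j
    fin_cases i <;> fin_cases j <;> simp <;> tauto
  · intro i
    fin_cases i
    · exact (h.link hC).2.1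
    · exact (h.rotate.link hC).2.1
    · exact (h.rotate.rotate.link hC).2.1
  · have := h.center.adj₁₂
    have := h.center.adj₁₃
    have := h.center.adj₂₃
    intro i j
    fin_cases i <;> fin_cases j <;> simp [*, SimpleGraph.adj_comm]
  · have h1 := h.corner₀.adj₁₂
    have h2 := h.corner₀.adj₁₃
    have h3 := h.corner₁.adj₁₂
    have h4 := h.corner₁.adj₁₃
    have h5 := h.corner₂.adj₁₂
    have h6 := h.corner₂.adj₁₃
    intro i j
    fin_cases i <;> fin_cases j <;> simp [*]
  · have h1 := h.side₀.adj₂₃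
    have h2 := h.side₁.adj₂₃
    have h3 := h.side₂.adj₂₃
    intro i j
    fin_cases i <;> fin_cases j <;> simp [*]
    all_goals exact SimpleGraph.Adj.symm ‹_›

/-- The center of an octahedron can be replaced by a face. -/
theorem exists_isDisk (h : G.IsOctahedronPart v₀ v₁ v₂ a₀ a₁ a₂) (hG : G.IsDisk) :
    ∃ G' : TriComplex V, G'.IsDisk ∧
      ∀ t, t ∈ G'.faces ↔ (t ∈ G.faces ∧ Disjoint t {v₀, v₁, v₂}) ∨ t = {a₀, a₁, a₂} := by
  have hC := hG.isCombDisk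
  have hn := h.nodup
  simp only [List.nodup_cons, List.mem_cons, List.not_mem_nil, or_false, not_or] at hn
  -- The center is removed by three contractions into `a₁`. The absorption of `v₀` reduces the link
  -- of `v₂` to a 3-cycle, and the absorption of `v₂` that of `v₁`.
  obtain ⟨d1, f1⟩ := hG.contract_of_link₄ h.side₀ h.corner₂.swap₁₂ h.center
    h.corner₁.rotate h.ne₁.symm h.ne₂.symm fun h' => h.rotate.not_adj hC h'.symm
  have k1 : (G.contract a₁ v₀).IsTri v₂ a₁ v₁ :=
    (f1 _).mpr (Or.inr (Or.inr (triple_rotate _ _ _)))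
  have k2 : (G.contract a₁ v₀).IsTri v₂ v₁ a₀ :=
    (f1 _).mpr (Or.inl ⟨h.corner₀.swap₁₃, by simp; tauto⟩)
  have k3 : (G.contract a₁ v₀).IsTri v₂ a₀ a₁ := (f1 _).mpr (Or.inl ⟨h.side₂, by simp; tauto⟩)
  obtain ⟨d2, f2⟩ := d1.contract_of_link₃ k1 k2 k3
  have l1 : ((G.contract a₁ v₀).contract a₁ v₂).IsTri v₁ a₁ a₂ := by
    refine (f2 _).mpr (Or.inl ⟨(f1 _).mpr (Or.inr (Or.inl (triple_rotate _ _ _))), by simp; tauto⟩)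
  have l2 : ((G.contract a₁ v₀).contract a₁ v₂).IsTri v₁ a₂ a₀ :=
    (f2 _).mpr (Or.inl ⟨(f1 _).mpr (Or.inl ⟨h.side₁.swap₂₃, by simp; tauto⟩), by simp; tauto⟩)
  have l3 : ((G.contract a₁ v₀).contract a₁ v₂).IsTri v₁ a₀ a₁ := by
    refine (f2 _).mpr (Or.inr (triple_rotate _ _ _).symm)
  obtain ⟨d3, f3⟩ := d2.contract_of_link₃ l1 l2 l3
  refine ⟨_, d3, fun t => ?_⟩
  rw [f3, f2, f1, triple_rotate a₀]
  simp only [Finset.disjoint_insert_right, Finset.disjoint_singleton_right]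
  constructor
  · rintro (⟨(⟨(h | rfl | rfl), h2⟩ | rfl), h3⟩ | rfl)
    · exact Or.inl ⟨h.1, h.2, h3, h2⟩
    all_goals simp at *
  · rintro (⟨h, h1, h2, h3⟩ | rfl)
    · exact Or.inl ⟨Or.inl ⟨Or.inl ⟨h, h1⟩, h3⟩, h2⟩
    · exact Or.inr rfl

theorem adj_corner (h : G.IsOctahedronPart v₀ v₁ v₂ a₀ a₁ a₂) :
    ∀ y ∈ ({a₁, a₂, v₁, v₂} : Finset V), G.graph.Adj a₀ y := by
  simp only [Finset.mem_insert, Finset.mem_singleton]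
  rintro y (rfl | rfl | rfl | rfl)
  · exact h.side₂.adj₂₃
  · exact h.side₁.adj₂₃
  · exact h.corner₀.adj₁₂
  · exact h.corner₀.adj₁₃

theorem card_corner (h : G.IsOctahedronPart v₀ v₁ v₂ a₀ a₁ a₂) :
    ({a₁, a₂, v₁, v₂} : Finset V).card = 4 := by
  rw [Finset.card_insert_of_notMem, Finset.card_insert_of_notMem,
    Finset.card_pair h.center.ne₂₃]
  · simp [h.side₁.ne₁₃.symm, h.ne₂.symm]
  · simp [h.side₀.ne₂₃, h.ne₁.symm, h.side₂.ne₁₃.symm]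

/-- The third vertex of another face at an edge of the outer 3-cycle. -/
theorem notMem_of_isTri (h : G.IsOctahedronPart v₀ v₁ v₂ a₀ a₁ a₂) (hC : G.IsCombDisk)
    (hw : G.IsTri a₁ a₂ w) (hwv : w ≠ v₀) : w ≠ a₀ ∧ w ∉ ({v₀, v₁, v₂} : Finset V) := by
  simp only [Finset.mem_insert, Finset.mem_singleton, not_or]
  refine ⟨?_, hwv, ?_, ?_⟩
  · rintro rfl
    exact h.not_isTri hw.rotate.rotate
  · rintro rfl
    exact h.rotate.not_adj hC hw.adj₁₃.symm
  · rintro rfl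
    exact h.rotate.rotate.not_adj hC hw.adj₂₃.symm

/-- With degree at most 5 there would be only one neighbour `w` outside the octahedron, and the
faces at `a₀w` would have the third vertices `a₁` and `a₂`. As these are not critical, the complex
would not be reduced. -/
theorem six_le_deg (h : G.IsOctahedronPart v₀ v₁ v₂ a₀ a₁ a₂) (hG : G.IsReduced)
    (ha : ¬ G.BoundaryVertex a₀) : 6 ≤ G.deg a₀ := by
  have hC := hG.inFCirc4.isCombDisk
  obtain ⟨w, hwv, hw⟩ := exists_other ha h.side₂.rotate
  obtain ⟨x, hxv, hx⟩ := exists_other ha h.side₁.rotate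
  obtain ⟨w1, w2⟩ := h.rotate.rotate.notMem_of_isTri hC hw hwv
  obtain ⟨x1, x2⟩ := h.rotate.notMem_of_isTri hC hx.swap₁₂ hxv
  simp only [Finset.mem_insert, Finset.mem_singleton, not_or] at w2 x2
  have hN := h.adj_corner
  have hcard := h.card_corner
  have hwN : w ∉ ({a₁, a₂, v₁, v₂} : Finset V) := by
    simp [hw.ne₂₃.symm, w1, w2]
  have hxN : x ∉ ({a₁, a₂, v₁, v₂} : Finset V) := by
    simp [hx.ne₂₃.symm, x1, x2]
  by_contra! hd
  have hN' : ∀ y ∈ insert w ({a₁, a₂, v₁, v₂} : Finset V), G.graph.Adj a₀ y := by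
    rw [Finset.forall_mem_insert]
    exact ⟨hw.adj₁₃, hN⟩
  have hcard' := Finset.card_insert_of_notMem hwN
  have hall : ∀ y, G.graph.Adj a₀ y → y ∈ insert w ({a₁, a₂, v₁, v₂} : Finset V) := fun y hy =>
    mem_of_deg_le_card hN' (by omega) hy
  obtain rfl : x = w := (Finset.mem_insert.mp (hall x hx.adj₁₃)).resolve_right hxN
  have hfac : ∀ y, G.graph.Adj a₀ y → G.graph.Adj x y → G.IsTri a₀ x y := by
    intro y hy hxy
    have hyv := h.notMem_of_adj hC hw.ne₁₃.symm hw.ne₂₃.symm hx.ne₂₃.symm (by simp [w2]) hxy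
    have := hall y hy
    simp only [Finset.mem_insert, Finset.mem_singleton, not_or] at hyv this
    rcases this with e | e | e | e | e
    · exact (hxy.ne e.symm).elim
    · rw [e]; exact hw.swap₂₃
    · rw [e]; exact hx.swap₂₃
    · exact (hyv.2.1 e).elim
    · exact (hyv.2.2 e).elim
  obtain ⟨y, hy, hyc⟩ := hG.exists_critical hw.adj₁₃ hfac (Or.inr (Or.inl ha))
  rcases hC.eq_or_eq hw.swap₂₃ hx.swap₂₃ h.side₀.ne₂₃ hy with rfl | rfl
  · exact h.not_critical₁ hyc
  · exact h.not_critical₂ hyc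

theorem boundaryEdge_of_deg (h : G.IsOctahedronPart v₀ v₁ v₂ a₀ a₁ a₂) (hC : G.IsCombDisk)
    (hd : G.deg a₀ ≤ 4) : G.BoundaryEdge a₀ a₁ := by
  by_contra hb
  obtain ⟨w, hwv, hw⟩ := (not_boundaryEdge_iff h.side₂.rotate).mp hb
  obtain ⟨w1, w2⟩ := h.rotate.rotate.notMem_of_isTri hC hw hwv
  have := mem_of_deg_le_card h.adj_corner (by rwa [h.card_corner]) hw.adj₁₃
  simp only [Finset.mem_insert, Finset.mem_singleton, not_or] at this w2
  rcases this with e | e | e | e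
  · exact hw.ne₂₃ e.symm
  · exact w1 e
  · exact w2.2.2 e
  · exact w2.1 e

/-- The faces that meet the center continue across every edge that is not on the outer 3-cycle, so
they are all faces. -/
theorem isOctahedron (h : G.IsOctahedronPart v₀ v₁ v₂ a₀ a₁ a₂) (hC : G.IsCombDisk)
    (h₁ : G.BoundaryEdge a₀ a₁) (h₂ : G.BoundaryEdge a₁ a₂) (h₀ : G.BoundaryEdge a₂ a₀) :
    G.IsOctahedron := by
  refine ⟨v₀, v₁, v₂, a₀, a₁, a₂, h.nodup, ?_⟩
  have hall : ∀ s ∈ G.faces, v₀ ∈ s ∨ v₁ ∈ s ∨ v₂ ∈ s := by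
    intro s hs
    refine hC.forall_face_of_exists (P := fun s => v₀ ∈ s ∨ v₁ ∈ s ∨ v₂ ∈ s) ?_ h.center
      (Or.inl (by simp)) hs
    intro a b c habc hP
    by_cases hv : ∃ v, (v = v₀ ∨ v = v₁ ∨ v = v₂) ∧ (v = a ∨ v = b)
    · obtain ⟨v, hv, hv'⟩ := hv
      have hvi : ¬ G.BoundaryVertex v := by
        rcases hv with rfl | rfl | rfl
        · exact (h.link hC).1
        · exact (h.rotate.link hC).1
        · exact (h.rotate.rotate.link hC).1
      have : ¬ G.BoundaryEdge a b := by
        intro hb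
        rcases hv' with rfl | rfl
        · exact hvi ⟨_, hb⟩
        · exact hvi ⟨_, hb.symm⟩
      obtain ⟨d, hd, hd'⟩ := (not_boundaryEdge_iff habc).mp this
      refine Or.inr ⟨d, hd, hd', ?_⟩
      simp only [Finset.mem_insert, Finset.mem_singleton]
      grind
    · left
      have hva : ∀ v, v = v₀ ∨ v = v₁ ∨ v = v₂ → v ≠ a ∧ v ≠ b := fun v h =>
        ⟨fun e => hv ⟨v, h, Or.inl e⟩, fun e => hv ⟨v, h, Or.inr e⟩⟩
      have k0 := hva v₀ (by simp)
      have k1 := hva v₁ (by simp)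
      have k2 := hva v₂ (by simp)
      clear hva hv
      have hab : a ∈ ({a₀, a₁, a₂} : Finset V) ∧ b ∈ ({a₀, a₁, a₂} : Finset V) := by
        simp only [Finset.mem_insert, Finset.mem_singleton] at hP ⊢
        have hc : c = v₀ ∨ c = v₁ ∨ c = v₂ := by grind
        rcases hc with rfl | rfl | rfl
        · have := (h.link hC).2.2 _ habc.adj₁₃.symm
          have := (h.link hC).2.2 _ habc.adj₂₃.symm
          grind
        · have := (h.rotate.link hC).2.2 _ habc.adj₁₃.symm
          have := (h.rotate.link hC).2.2 _ habc.adj₂₃.symm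
          grind
        · have := (h.rotate.rotate.link hC).2.2 _ habc.adj₁₃.symm
          have := (h.rotate.rotate.link hC).2.2 _ habc.adj₂₃.symm
          grind
      simp only [Finset.mem_insert, Finset.mem_singleton] at hab
      have := habc.ne₁₂
      obtain ⟨rfl | rfl | rfl, rfl | rfl | rfl⟩ := hab <;>
        first
        | exact (this rfl).elim
        | assumption
        | (apply BoundaryEdge.symm; assumption)
  ext t
  constructor
  · intro ht
    simp only [Finset.mem_insert, Finset.mem_singleton]
    rcases hall t ht with hv | hv | hv
    · obtain ⟨p, q, rfl, hpq⟩ := exists_eq_of_mem_face ht hv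
      have := h.triple_eq hC hpq
      tauto
    · obtain ⟨p, q, rfl, hpq⟩ := exists_eq_of_mem_face ht hv
      have := h.rotate.triple_eq hC hpq
      rw [← triple_rotate v₀, ← triple_rotate a₀, ← triple_rotate v₀, ← triple_rotate a₀] at this
      tauto
    · obtain ⟨p, q, rfl, hpq⟩ := exists_eq_of_mem_face ht hv
      have := h.rotate.rotate.triple_eq hC hpq
      rw [triple_rotate v₂ v₀ v₁, triple_rotate v₂ v₀ a₁, triple_rotate v₂ a₀ v₁,
        triple_rotate v₂ a₀ a₁] at this
      tauto
  · simp only [Finset.mem_insert, Finset.mem_singleton]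
    rintro (rfl | rfl | rfl | rfl | rfl | rfl | rfl)
    · exact h.center
    · exact h.corner₂.rotate
    · exact h.corner₁.swap₁₂
    · exact h.corner₀
    · exact h.side₀
    · exact h.side₁.swap₁₂
    · exact h.side₂.rotate

/-- With degree at most 5, the only common neighbour of `a₁` and `w` would be `a₂`. Then `a₁w` is a
boundary edge and `a₂` would be critical. -/
theorem six_le_deg_of_isTri (h : G.IsOctahedronPart v₀ v₁ v₂ a₀ a₁ a₂) (hG : G.IsReduced)
    (hd : G.deg a₀ ≤ 4) (hw : G.IsTri a₁ a₂ w) (hwv : w ≠ v₀) : 6 ≤ G.deg a₁ := by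
  have hC := hG.inFCirc4.isCombDisk
  obtain ⟨w0, wv⟩ := h.notMem_of_isTri hC hw hwv
  have hN := h.rotate.adj_corner
  have hcard := h.rotate.card_corner
  have wv' := wv
  simp only [Finset.mem_insert, Finset.mem_singleton, not_or] at wv'
  have hwN : w ∉ ({a₂, a₀, v₂, v₀} : Finset V) := by
    simp [hw.ne₂₃.symm, w0, wv']
  by_contra! hd5
  have hN' : ∀ y ∈ insert w ({a₂, a₀, v₂, v₀} : Finset V), G.graph.Adj a₁ y := by
    rw [Finset.forall_mem_insert]
    exact ⟨hw.adj₁₃, hN⟩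
  have hcard' := Finset.card_insert_of_notMem hwN
  have hcommon : ∀ y, G.graph.Adj a₁ y → G.graph.Adj w y → y = a₂ := by
    intro y hy hwy
    have hyv := h.notMem_of_adj hC w0 hw.ne₁₃.symm hw.ne₂₃.symm wv hwy
    have := mem_of_deg_le_card hN' (by omega) hy
    simp only [Finset.mem_insert, Finset.mem_singleton, not_or] at hyv this
    rcases this with e | e | e | e | e
    · exact (hwy.ne e.symm).elim
    · exact e
    · rw [e] at hwy
      have := mem_of_deg_le_card h.adj_corner (by rwa [h.card_corner]) hwy.symm
      simp only [Finset.mem_insert, Finset.mem_singleton] at this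
      have := hw.ne₁₃
      have := hw.ne₂₃
      grind
    · exact (hyv.2.2 e).elim
    · exact (hyv.1 e).elim
  have hb : G.BoundaryEdge a₁ w :=
    boundaryEdge_iff.mpr ⟨a₂, hw.swap₂₃, fun d hd => hcommon d hd.adj₁₃ hd.adj₂₃⟩
  refine h.not_critical₂ (hG.critical_of_boundaryEdge hw.swap₂₃ hb fun y hy hwy => ?_)
  rw [hcommon y hy hwy]
  exact hw.swap₂₃

end IsOctahedronPart

end TriComplex

/-! ### Removal of octahedra inside the class, and the descent. -/

namespace TriComplex
variable {V : Type*} [DecidableEq V] {G G' : TriComplex V}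
  {a b c d u v w x y z p q r v₀ v₁ v₂ a₀ a₁ a₂ : V}

/-! ### Octahedron additions -/

/-- `G'` is obtained from `G` by replacing the center of an octahedron by a face. -/
def IsFilling (G' G : TriComplex V) (v₀ v₁ v₂ a₀ a₁ a₂ : V) : Prop :=
  ∀ t, t ∈ G'.faces ↔ (t ∈ G.faces ∧ Disjoint t {v₀, v₁, v₂}) ∨ t = {a₀, a₁, a₂}

theorem card_faces_deleteVertices_lt {S t : Finset V} (ht : t ∈ G.faces) (h : ¬ Disjoint t S) :
    (G.deleteVertices S).faces.card < G.faces.card :=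
  Finset.card_lt_card (Finset.filter_ssubset.mpr ⟨t, ht, h⟩)

namespace IsFilling

theorem rotate (h : IsFilling G' G v₀ v₁ v₂ a₀ a₁ a₂) : IsFilling G' G v₁ v₂ v₀ a₁ a₂ a₀ := by
  intro t
  rw [h t, triple_rotate v₀, triple_rotate a₀]

theorem isTri_iff (h : IsFilling G' G v₀ v₁ v₂ a₀ a₁ a₂) : G'.IsTri p q r ↔
    (G.IsTri p q r ∧ p ∉ ({v₀, v₁, v₂} : Finset V) ∧ q ∉ ({v₀, v₁, v₂} : Finset V) ∧
      r ∉ ({v₀, v₁, v₂} : Finset V)) ∨ ({p, q, r} : Finset V) = {a₀, a₁, a₂} := by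
  rw [IsTri, h]
  simp only [Finset.disjoint_insert_left, Finset.disjoint_singleton_left, IsTri]

theorem isTri (h : IsFilling G' G v₀ v₁ v₂ a₀ a₁ a₂) : G'.IsTri a₀ a₁ a₂ :=
  h.isTri_iff.mpr (Or.inr rfl)

theorem star (h : IsFilling G' G v₀ v₁ v₂ a₀ a₁ a₂)
    (hO : G.IsOctahedronPart v₀ v₁ v₂ a₀ a₁ a₂) (hC : G.IsCombDisk) (h₀ : w ≠ a₀) (h₁ : w ≠ a₁)
    (h₂ : w ≠ a₂) (hv : w ∉ ({v₀, v₁, v₂} : Finset V)) (y z : V) :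
    G'.IsTri w y z ↔ G.IsTri w y z := by
  rw [h.isTri_iff]
  constructor
  · rintro (h | h)
    · exact h.1
    · have hw : w ∈ ({a₀, a₁, a₂} : Finset V) := h ▸ Finset.mem_insert_self _ _
      simp [h₀, h₁, h₂] at hw
  · exact fun h => Or.inl ⟨h, hv, hO.notMem_of_adj hC h₀ h₁ h₂ hv h.adj₁₂,
      hO.notMem_of_adj hC h₀ h₁ h₂ hv h.adj₁₃⟩

/-- The faces at a corner outside the octahedron. -/
theorem isTri_of_ne (h : IsFilling G' G v₀ v₁ v₂ a₀ a₁ a₂)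
    (hO : G.IsOctahedronPart v₀ v₁ v₂ a₀ a₁ a₂) (hC : G.IsCombDisk) (hz : G.IsTri a₀ y z)
    (h₁ : y ≠ a₁) (h₂ : y ≠ a₂) (hy : y ∉ ({v₀, v₁, v₂} : Finset V)) : G'.IsTri a₀ y z := by
  have := hO.nodup
  exact h.isTri_iff.mpr (Or.inl ⟨hz, by simp at this ⊢; grind, hy,
    hO.notMem_of_adj hC hz.ne₁₂.symm h₁ h₂ hy hz.adj₂₃⟩)

theorem deg_le (h : IsFilling G' G v₀ v₁ v₂ a₀ a₁ a₂)
    (hO : G.IsOctahedronPart v₀ v₁ v₂ a₀ a₁ a₂) (hC : G.IsCombDisk) :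
    G.deg a₀ ≤ G'.deg a₀ + 2 := by
  have := deg_le_add_card (G := G) (G' := G') (w := a₀) (S := {v₁, v₂}) ?_
  · have := Finset.card_le_two (a := v₁) (b := v₂)
    omega
  intro y hy hyS
  simp only [Finset.mem_insert, Finset.mem_singleton, not_or] at hyS
  by_cases h₁ : y = a₁
  · rw [h₁]; exact h.isTri.adj₁₂
  by_cases h₂ : y = a₂
  · rw [h₂]; exact h.isTri.adj₁₃
  obtain ⟨z, hz⟩ := adj_iff.mp hy
  have hy0 : y ≠ v₀ := by
    rintro rfl
    exact hO.not_adj hC hy.symm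
  exact (h.isTri_of_ne hO hC hz h₁ h₂ (by simp [hy0, hyS])).adj₁₂

theorem boundaryEdge (h : IsFilling G' G v₀ v₁ v₂ a₀ a₁ a₂)
    (hO : G.IsOctahedronPart v₀ v₁ v₂ a₀ a₁ a₂) (hb : G.BoundaryEdge a₁ a₂) :
    G'.BoundaryEdge a₁ a₂ := by
  refine boundaryEdge_iff.mpr ⟨a₀, h.isTri.rotate, fun d hd => ?_⟩
  rcases h.rotate.isTri_iff.mp hd with hd | hd
  · have := hb.unique hd.1 hO.side₀.rotate
    simp [this] at hd
  · exact h.rotate.isTri.triple_inj hd.symm ▸ rfl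

theorem boundaryVertex (h : IsFilling G' G v₀ v₁ v₂ a₀ a₁ a₂)
    (hO : G.IsOctahedronPart v₀ v₁ v₂ a₀ a₁ a₂) (hC : G.IsCombDisk)
    (hb : G.BoundaryVertex a₀) : G'.BoundaryVertex a₀ := by
  obtain ⟨y, hy⟩ := hb
  by_cases h₁ : y = a₁
  · rw [h₁] at hy
    exact ⟨a₁, h.rotate.rotate.boundaryEdge hO.rotate.rotate hy⟩
  by_cases h₂ : y = a₂
  · rw [h₂] at hy
    exact ⟨a₂, (h.rotate.boundaryEdge hO.rotate hy.symm).symm⟩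
  obtain ⟨z, hz, hz'⟩ := boundaryEdge_iff.mp hy
  refine ⟨y, boundaryEdge_iff.mpr ⟨z, h.isTri_of_ne hO hC hz h₁ h₂ ?_, fun d hd => ?_⟩⟩
  · simp only [Finset.mem_insert, Finset.mem_singleton, not_or]
    refine ⟨?_, ?_, ?_⟩ <;> rintro rfl
    · exact (hO.link hC).1 ⟨_, hy.symm⟩
    · exact (hO.rotate.link hC).1 ⟨_, hy.symm⟩
    · exact (hO.rotate.rotate.link hC).1 ⟨_, hy.symm⟩
  · rcases h.isTri_iff.mp hd with hd | hd
    · exact hz' d hd.1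
    · have : y ∈ ({a₀, a₁, a₂} : Finset V) := hd ▸ by simp
      simp [h₁, h₂, hy.adj.ne.symm] at this

end IsFilling

namespace IsOctahedronPart

/-- Deletion of an octahedron inside a face. -/
theorem exists_step_of_five_le (h : G.IsOctahedronPart v₀ v₁ v₂ a₀ a₁ a₂) (hG : G.IsReduced)
    (h₀ : G.BoundaryVertex a₀ → 5 ≤ G.deg a₀) (h₁ : G.BoundaryVertex a₁ → 5 ≤ G.deg a₁)
    (h₂ : G.BoundaryVertex a₂ → 5 ≤ G.deg a₂) :
    ∃ G', Step G' G ∧ G'.faces.card < G.faces.card := by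
  have hF := hG.inFCirc4
  have hC := hF.isCombDisk
  obtain ⟨G', hd, hfill⟩ := h.exists_isDisk hF.1
  have hfill : IsFilling G' G v₀ v₁ v₂ a₀ a₁ a₂ := hfill
  obtain ⟨hO, hi⟩ := h.isOctahedronAt hC
  have hfaces : G'.faces = insert {a₀, a₁, a₂} (G.deleteVertices {v₀, v₁, v₂}).faces := by
    ext t
    rw [hfill t, Finset.mem_insert, or_comm, deleteVertices, Finset.mem_filter]
  -- A corner loses at most two neighbours: a boundary corner keeps 3 of at least 5, an inner one 4
  -- of at least 6.
  have corner : ∀ {v₀ v₁ v₂ a₀ a₁ a₂}, G.IsOctahedronPart v₀ v₁ v₂ a₀ a₁ a₂ →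
      IsFilling G' G v₀ v₁ v₂ a₀ a₁ a₂ → (G.BoundaryVertex a₀ → 5 ≤ G.deg a₀) →
      3 ≤ G'.deg a₀ ∧ (¬ G'.BoundaryVertex a₀ → 4 ≤ G'.deg a₀) := by
    intro v₀ v₁ v₂ a₀ a₁ a₂ h hfill h₀
    have hdeg := hfill.deg_le h hC
    by_cases hb : G.BoundaryVertex a₀
    · exact ⟨by have := h₀ hb; omega, fun hn => (hn (hfill.boundaryVertex h hC hb)).elim⟩
    · have := h.six_le_deg hG hb
      exact ⟨by omega, fun _ => by omega⟩
  refine ⟨G', ⟨⟨hd, fun w hw => ?_⟩, hF, ?_⟩, ?_⟩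
  · by_cases hw₀ : w = a₀
    · rw [hw₀]; exact corner h hfill h₀
    by_cases hw₁ : w = a₁
    · rw [hw₁]; exact corner h.rotate hfill.rotate h₁
    by_cases hw₂ : w = a₂
    · rw [hw₂]; exact corner h.rotate.rotate hfill.rotate.rotate h₂
    obtain ⟨y, hy⟩ := isVertex_iff.mp hw
    obtain ⟨z, hz⟩ := adj_iff.mp hy
    rcases hfill.isTri_iff.mp hz with hz | hz
    · obtain ⟨e1, e2⟩ := deg_eq_of_star (hfill.star h hC hw₀ hw₁ hw₂ hz.2.1)
      rw [e1]
      exact ⟨hF.three_le hz.1.adj₁₂, fun hn => hF.four_le hz.1.adj₁₂ fun h => hn (e2 h)⟩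
    · have : w ∈ ({a₀, a₁, a₂} : Finset V) := hz ▸ Finset.mem_insert_self _ _
      simp [hw₀, hw₁, hw₂] at this
  · exact Or.inr (Or.inr (Or.inr (Or.inl ⟨_, _, hO, Or.inl ⟨hi, hfaces⟩⟩)))
  -- One face is added, so it suffices to exhibit two that disappear.
  · have hsub : insert {v₀, v₁, v₂} (insert {v₀, a₁, a₂} (G.deleteVertices {v₀, v₁, v₂}).faces) ⊆
        G.faces := by
      intro t ht
      simp only [Finset.mem_insert] at ht
      rcases ht with rfl | rfl | ht
      · exact h.center
      · exact h.side₀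
      · exact (Finset.mem_filter.mp ht).1
    have hn1 : ({v₀, a₁, a₂} : Finset V) ∉ (G.deleteVertices {v₀, v₁, v₂}).faces := by
      simp [deleteVertices]
    have hn2 : ({v₀, v₁, v₂} : Finset V) ∉
        insert {v₀, a₁, a₂} (G.deleteVertices {v₀, v₁, v₂}).faces := by
      simp only [Finset.mem_insert, not_or]
      refine ⟨fun e => ?_, by simp [deleteVertices]⟩
      have : v₁ ∈ ({v₀, a₁, a₂} : Finset V) := e ▸ by simp
      simp [h.center.ne₁₂.symm, h.ne₁, h.side₁.ne₁₃] at this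
    have := Finset.card_le_card hsub
    rw [Finset.card_insert_of_notMem hn2, Finset.card_insert_of_notMem hn1] at this
    have := Finset.card_insert_le {a₀, a₁, a₂} (G.deleteVertices {v₀, v₁, v₂}).faces
    rw [hfaces]
    omega

/-- Deletion of an octahedron along a boundary edge. -/
theorem step_of_deg_le (h : G.IsOctahedronPart v₀ v₁ v₂ a₀ a₁ a₂) (hG : G.IsReduced)
    (hd : G.deg a₀ ≤ 4) (hb : ¬ G.BoundaryEdge a₁ a₂) :
    Step (G.deleteVertices {a₀, v₀, v₁, v₂}) G := by
  have hF := hG.inFCirc4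
  have hC := hF.isCombDisk
  obtain ⟨w, hwv, hw⟩ := (not_boundaryEdge_iff h.side₀.rotate).mp hb
  obtain ⟨w0, wv⟩ := h.notMem_of_isTri hC hw hwv
  have hN : ∀ y, G.graph.Adj a₀ y → y = a₁ ∨ y = a₂ ∨ y = v₁ ∨ y = v₂ := fun y hy => by
    simpa using mem_of_deg_le_card h.adj_corner (by rwa [h.card_corner]) hy
  have hn := h.nodup
  simp only [List.nodup_cons, List.mem_cons, List.not_mem_nil, or_false, not_or] at hn
  obtain ⟨⟨n1, n2, n3, n4, n5⟩, ⟨n6, n7, n8, n9⟩, ⟨n10, n11, n12⟩, ⟨n13, n14⟩, n15, -⟩ := hn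
  -- After the center is filled, `a₀` is an ear with the face `a₀a₁a₂`.
  have hdisk : (G.deleteVertices {a₀, v₀, v₁, v₂}).IsDisk := by
    obtain ⟨G', hd', hfill⟩ := h.exists_isDisk hF.1
    have hfill : IsFilling G' G v₀ v₁ v₂ a₀ a₁ a₂ := hfill
    have hw' : G'.IsTri a₁ a₂ w := hfill.isTri_iff.mpr (Or.inl ⟨hw,
      by simp [Ne.symm n4, Ne.symm n8, Ne.symm n11], by simp [Ne.symm n5, Ne.symm n9, Ne.symm n12],
      wv⟩)
    have := hd'.deleteVertices_of_ear hfill.isTri ?_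
      (hw'.two_le_card hfill.isTri.rotate w0)
    · convert this using 1
      ext t
      simp only [deleteVertices, Finset.mem_filter, hfill t, Finset.disjoint_insert_right,
        Finset.disjoint_singleton_right]
      constructor
      · tauto
      · rintro ⟨h | rfl, h'⟩
        · tauto
        · simp at h'
    · intro t ht hat
      refine ((hfill t).mp ht).elim (fun ht' => ?_) id
      obtain ⟨p, q, rfl, hpq⟩ := exists_eq_of_mem_face ht'.1 hat
      have hdis := ht'.2
      simp only [Finset.disjoint_insert_left, Finset.disjoint_singleton_left, Finset.mem_insert,
        Finset.mem_singleton, not_or] at hdis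
      have := hN p hpq.adj₁₂
      have := hN q hpq.adj₁₃
      have := hpq.ne₂₃
      have hpq' : p = a₁ ∧ q = a₂ ∨ p = a₂ ∧ q = a₁ := by grind
      rcases hpq' with ⟨rfl, rfl⟩ | ⟨rfl, rfl⟩
      · rfl
      · rw [Finset.pair_comm]
  -- Only `a₀`, `v₀` and `v₂` are lost at `a₁`, and three of at least six neighbours remain. The
  -- labels are arbitrary so that `flip` yields the same at `a₂`.
  have hcorner : ∀ {v₁ v₂ a₁ a₂}, G.IsOctahedronPart v₀ v₁ v₂ a₀ a₁ a₂ → G.IsTri a₁ a₂ w →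
      3 ≤ (G.deleteVertices {a₀, v₀, v₁, v₂}).deg a₁ ∧
        (G.deleteVertices {a₀, v₀, v₁, v₂}).BoundaryVertex a₁ := by
    clear! v₁ v₂ a₁ a₂
    intro v₁ v₂ a₁ a₂ h hw
    obtain ⟨w0, wv⟩ := h.notMem_of_isTri hC hw hwv
    have hN : ∀ y, G.graph.Adj a₀ y → y = a₁ ∨ y = a₂ ∨ y = v₁ ∨ y = v₂ := fun y hy => by
      simpa using mem_of_deg_le_card h.adj_corner (by rwa [h.card_corner]) hy
    have hn := h.nodup
    simp only [List.nodup_cons, List.mem_cons, List.not_mem_nil, or_false, not_or] at hn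
    obtain ⟨⟨n1, n2, n3, n4, n5⟩, ⟨n6, n7, n8, n9⟩, ⟨n10, n11, n12⟩, ⟨n13, n14⟩, n15, -⟩ := hn
    have ha₁ : a₁ ∉ ({a₀, v₀, v₁, v₂} : Finset V) := by
      simp [Ne.symm n4, Ne.symm n8, Ne.symm n11, Ne.symm n13]
    have hw' : (G.deleteVertices {a₀, v₀, v₁, v₂}).IsTri a₁ a₂ w :=
      isTri_deleteVertices.mpr ⟨hw, ha₁, by simp [Ne.symm n5, Ne.symm n9, Ne.symm n12, Ne.symm n14],
        by rw [Finset.mem_insert, not_or]; exact ⟨w0, wv⟩⟩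
    constructor
    · have h6 := h.six_le_deg_of_isTri hG hd hw hwv
      have := deg_le_add_card (G := G) (G' := G.deleteVertices {a₀, v₀, v₁, v₂}) (w := a₁)
        (S := {a₀, v₀, v₂}) ?_
      · have := Finset.card_le_three (a := a₀) (b := v₀) (c := v₂)
        omega
      · intro y hy hyS
        by_cases hy₂ : y = a₂
        · rw [hy₂]; exact hw'.adj₁₂
        simp only [Finset.mem_insert, Finset.mem_singleton, not_or] at hyS
        have hy₁ : y ≠ v₁ := by
          rintro rfl
          exact h.rotate.not_adj hC hy.symm
        have hyv : y ∉ ({v₀, v₁, v₂} : Finset V) := by simp [hyS, hy₁]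
        obtain ⟨z, hz⟩ := adj_iff.mp hy
        refine (isTri_deleteVertices.mpr ⟨hz, ha₁, ?_, ?_⟩).adj₁₂
        · simp [hyS, hy₁]
        · rw [Finset.mem_insert, not_or]
          refine ⟨?_, h.notMem_of_adj hC hyS.1 hy.ne.symm hy₂ hyv hz.adj₂₃⟩
          rintro rfl
          rcases hN y hz.adj₂₃.symm with e | e | e | e
          · exact hy.ne e.symm
          · exact hy₂ e
          · exact hy₁ e
          · exact hyS.2.2 e
    · refine ⟨a₂, boundaryEdge_iff.mpr ⟨w, hw', fun d hd => ?_⟩⟩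
      obtain ⟨hd, -, -, hdS⟩ := isTri_deleteVertices.mp hd
      simp only [Finset.mem_insert, not_or] at hdS
      exact (hC.eq_or_eq h.side₀.rotate hw hwv.symm hd).resolve_left hdS.2.1
  obtain ⟨hO, hi⟩ := h.isOctahedronAt hC
  refine ⟨⟨hdisk, fun x hx => ?_⟩, hF, Or.inr (Or.inr (Or.inr (Or.inr ⟨_, _, 0, hO, ?_, rfl⟩)))⟩
  · by_cases hx₁ : x = a₁
    · rw [hx₁]
      have := hcorner h hw
      exact ⟨this.1, fun hn => (hn this.2).elim⟩
    by_cases hx₂ : x = a₂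
    · rw [hx₂]
      have := hcorner h.flip hw.swap₁₂
      rw [Finset.pair_comm v₂ v₁] at this
      exact ⟨this.1, fun hn => (hn this.2).elim⟩
    obtain ⟨y, hy⟩ := isVertex_iff.mp hx
    obtain ⟨z, hz⟩ := adj_iff.mp hy
    obtain ⟨hz, hxS, -⟩ := isTri_deleteVertices.mp hz
    have hx' := hxS
    rw [Finset.mem_insert, not_or] at hxS
    have hS : ∀ p, G.graph.Adj x p → p ∉ ({a₀, v₀, v₁, v₂} : Finset V) := by
      intro p hp
      rw [Finset.mem_insert, not_or]
      refine ⟨fun e => ?_, h.notMem_of_adj hC hxS.1 hx₁ hx₂ hxS.2 hp⟩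
      rw [e] at hp
      simp only [Finset.mem_insert, Finset.mem_singleton, not_or] at hxS
      have := hN x hp.symm
      tauto
    obtain ⟨e1, e2⟩ := deg_eq_of_star (G := G)
      (G' := G.deleteVertices {a₀, v₀, v₁, v₂}) (w := x)
      fun y z => isTri_deleteVertices.trans
        ⟨And.left, fun h => ⟨h, hx', hS y h.adj₁₂, hS z h.adj₁₃⟩⟩
    rw [e1]
    exact ⟨hF.three_le hz.adj₁₂, fun hn => hF.four_le hz.adj₁₂ fun h => hn (e2 h)⟩
  · have b1 := h.boundaryEdge_of_deg hC hd
    have b2 := h.flip.boundaryEdge_of_deg hC hd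
    intro i
    fin_cases i <;> simp [b1, b2]

theorem isOctahedron_or_exists_step_of_deg_le (h : G.IsOctahedronPart v₀ v₁ v₂ a₀ a₁ a₂)
    (hG : G.IsReduced) (hd : G.deg a₀ ≤ 4) :
    G.IsOctahedron ∨ ∃ G', Step G' G ∧ G'.faces.card < G.faces.card := by
  have hC := hG.inFCirc4.isCombDisk
  by_cases hb : G.BoundaryEdge a₁ a₂
  · exact Or.inl (h.isOctahedron hC (h.boundaryEdge_of_deg hC hd) hb
      (h.flip.boundaryEdge_of_deg hC hd).symm)
  · refine Or.inr ⟨_, h.step_of_deg_le hG hd hb, card_faces_deleteVertices_lt h.center ?_⟩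
    simp

/-- A corner of degree at most 4 has its two outer edges on the boundary, so the octahedron is
external or everything. Otherwise the octahedron can be replaced by a face. -/
theorem isOctahedron_or_exists_step (h : G.IsOctahedronPart v₀ v₁ v₂ a₀ a₁ a₂)
    (hG : G.IsReduced) :
    G.IsOctahedron ∨ ∃ G', Step G' G ∧ G'.faces.card < G.faces.card := by
  by_cases h₀ : G.deg a₀ ≤ 4
  · exact h.isOctahedron_or_exists_step_of_deg_le hG h₀
  by_cases h₁ : G.deg a₁ ≤ 4
  · exact h.rotate.isOctahedron_or_exists_step_of_deg_le hG h₁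
  by_cases h₂ : G.deg a₂ ≤ 4
  · exact h.rotate.rotate.isOctahedron_or_exists_step_of_deg_le hG h₂
  exact Or.inr (h.exists_step_of_five_le hG (fun _ => by omega) (fun _ => by omega)
    fun _ => by omega)

end IsOctahedronPart

/-! ### Generation -/

/-- A member of the class that is not one of the two initial complexes can be reduced. -/
theorem InFCirc4.exists_step (hG : G.InFCirc4) :
    (G.IsFlag ∨ G.IsOctahedron) ∨ ∃ G', Step G' G ∧ G'.faces.card < G.faces.card := by
  by_cases hred : ∃ u v, G.graph.Adj u v ∧
      (∀ w, G.graph.Adj u w → G.graph.Adj v w → G.IsTri u v w) ∧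
      (G.BoundaryEdge u v ∨ ¬ G.BoundaryVertex u ∨ ¬ G.BoundaryVertex v) ∧
      ∀ w, G.IsTri u v w → ¬ G.Critical w
  · obtain ⟨u, v, huv, hfac, hb, hnc⟩ := hred
    exact Or.inr ⟨_, hG.step_contract huv hfac hb hnc, card_faces_contract_lt huv⟩
  have hR : G.IsReduced := by
    refine ⟨hG, fun {u v} huv hfac hb => ?_⟩
    by_contra! hn
    exact hred ⟨u, v, huv, hfac, hb, hn⟩
  by_cases hT : ∃ T, G.IsNonfacial T
  · obtain ⟨v₀, v₁, v₂, a₀, a₁, a₂, h⟩ := hR.exists_isOctahedronPart hT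
    exact (h.isOctahedron_or_exists_step hR).imp_left Or.inr
  have hfac : ∀ a b c, G.graph.Adj a b → G.graph.Adj a c → G.graph.Adj b c → G.IsTri a b c := by
    intro a b c hab hac hbc
    by_contra hn
    refine hT ⟨{a, b, c}, Finset.card_eq_three.mpr ⟨a, b, c, hab.ne, hac.ne, hbc.ne, rfl⟩, ?_, hn⟩
    simp only [Finset.mem_insert, Finset.mem_singleton]
    rintro x (rfl | rfl | rfl) y (rfl | rfl | rfl) hxy <;>
      first
      | exact (hxy rfl).elim
      | assumption
      | (apply SimpleGraph.Adj.symm; assumption)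
  by_cases hch : ∃ u v, G.IsChord u v
  · obtain ⟨x, x₁, a, b, x₂, h⟩ := hR.exists_isFlagAt hfac hch
    refine Or.inr ⟨_, h.step hG, card_faces_deleteVertices_lt h.link₁ ?_⟩
    simp
  · refine Or.inl (Or.inl (hR.isFlag hfac fun a b hab ha hb => ?_))
    by_contra hn
    exact hch ⟨a, b, hab, hn, ha, hb⟩

/-- Strong induction on the number of faces; each step already contains the membership of the
smaller complex in the class. -/
theorem InFCirc4.exists_reflTransGen (hG : G.InFCirc4) :
    ∃ H : TriComplex V, (H.IsFlag ∨ H.IsOctahedron) ∧ Relation.ReflTransGen Step H G := by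
  induction hn : G.faces.card using Nat.strong_induction_on generalizing G with
  | _ n ih =>
    rcases hG.exists_step with h | ⟨G', h, hlt⟩
    · exact ⟨G, h, .refl⟩
    · obtain ⟨H, hH, hHG⟩ := ih _ (hn ▸ hlt) h.1 rfl
      exact ⟨H, hH, hHG.tail h⟩

end TriComplex

theorem theorem2 {V : Type*} [DecidableEq V] (G : TriComplex V) (hG : G.InFCirc4) :
    ∃ H : TriComplex V, (H.IsFlag ∨ H.IsOctahedron) ∧
      Relation.ReflTransGen TriComplex.Step H G :=
  hG.exists_reflTransGen
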